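/- Units with speed of light $1$ and charges $e_1=-1$, $e_2=1$; $m_1,m_2>0$. For $\sigma=\pm1$ ($+$ advanced, $-$ retarded), a particle at $\mathbf x$ with velocity $\mathbf v$, charge $e$, and a source at $\mathbf y$ in light-cone with $\mathbf x$, with velocity $\mathbf w$, acceleration $\mathbf b$, charge $e'$, put $r=|\mathbf x-\mathbf y|$, $\mathbf n=(\mathbf x-\mathbf y)/r$, $\kappa=1+\sigma\,\mathbf w\cdot\mathbf n$, $\mathbf u=\mathbf n+\sigma\mathbf w$, $\gamma_{\mathbf w}=(1-|\mathbf w|^2)^{-1/2}$ and $$\mathbf E^\sigma=\mathbf d+B\,\mathbf b,\quad \mathbf d=\frac{e'\,\mathbf u}{\gamma_{\mathbf w}^2\kappa^3r^2},\quad B=\frac{e'(\mathbf u\mathbf n^{\top}-\kappa \mathbf 1)}{\kappa^3 r},\qquad K^\sigma=\frac e2\big[(1+\sigma\,\mathbf v\cdot\mathbf n)\mathbf 1-\sigma(\mathbf n+\sigma\mathbf v)\mathbf v^{\top}\big].$$ The Wheeler–Feynman equation of a particle of mass $m$ is $m\gamma_{\mathbf v}\mathbf a=K^-\mathbf E^-+K^+\mathbf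 E^+$. A doubly circular (Schild) orbit $(\mathbf x_1^S,\mathbf x_2^S)$ is a pair of subluminal, diametrically opposite uniform circular motions about a common centre solving these equations; $r_{12}$ is its constant interparticle distance in light-cone. Boundary data of shortest-length type: an event $O_A=(t_{O_A},\mathbf x_{O_A})$, a $C^2$ segment $\mathbf x_2^h$ on $[t_{O^-},t_{O^+}]$ whose end events are in the past and future light-cones of $O_A$; an event $L_B=(t_{L_B},\mathbf x_{L_B})$, a $C^2$ segment $\mathbf x_1^h$ on $[t_{L^-},t_{L^+}]$ whose end events are in the past and future light-cones of $L_B$; and $L^-$ is in the future light-cone of $O^+$. They are $\delta$-near the orbit if $\mathbf x_2^h$, $\mathbf x_1^h$ are $\delta$-close in $C^2$ to $\mathbf x_2^S$, $\mathbf x_1^S$ on their intervals, $|\mathbf x_{O_A}-\mathbf x_1^S(t_{O_A})|<\delta$ and $|\mathbf x_{L_B}-\mathbf x_2^S(t_{L_B})|<\delta$. Reduced equations, for $t\in[t_{O_A},t_{L^-}]$: $\mathbf x_1,\mathbf v_1$ are taken at time $t$; $\mathbf x_2,\mathbf v_2$ at time $t_2=t+|\mathbf x_1-\mathbf x_2|$.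 With the past segment of particle 2 taken at the point in the past light-cone of $(t,\mathbf x_1)$ and the future segment of particle 1 at the point in the future light-cone of $(t_2,\mathbf x_2)$, let $\mathbf F_2$ be the right-hand side $K^-\mathbf E^-+K^+\mathbf E^+$ for particle 1 without the term in the acceleration of the running particle 2, $\mathbf F_1$ the one for particle 2 without the term in the acceleration of the running particle 1, $A_{12}=K^+B$ and $A_{21}=K^-B$ the matrices of these omitted terms, $M_i=m_i\gamma_i$, $\mathbf n=(\mathbf x_1-\mathbf x_2)/|\mathbf x_1-\mathbf x_2|$, $\lambda=\frac{1+\mathbf n\cdot\mathbf v_1}{1+\mathbf n\cdot\mathbf v_2}$. Then $$\dot{\mathbf v}_1=(M_1M_2\mathbf 1-A_{12}A_{21})^{-1}(A_{12}\mathbf F_1+M_2\mathbf F_2),\quad \dot{\mathbf v}_2=\lambda(M_1M_2\mathbf 1-A_{21}A_{12})^{-1}(A_{21}\mathbf F_2+M_1\mathbf F_1),\quad \dot{\mathbf x}_1=\mathbf v_1,\quad \dot{\mathbf x}_2=\lambda\mathbf v_2, \tag{ET3}$$ where along solutions $|\mathbf v_i|<1$, the interacting points are distinct and the two matrices are invertible.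 The boundary conditions are $$\mathbf x_1(t_{O_A})=\mathbf x_{O_A},\quad \mathbf x_2(t_{O_A})=\mathbf x_2^h(t_{O^+}),\quad \mathbf x_1(t_{L^-})=\mathbf x_1^h(t_{L^-}),\quad \mathbf x_2(t_{L^-})=\mathbf x_{L_B}, \tag{BC}$$ the argument being the time $t$ of particle 1. **Theorem.** Let $m_1,m_2>0$, $0<\varepsilon<1$, $0<c<\frac12$. There are $R,\rho>0$ such that for every doubly circular orbit with $r_{12}\ge R$ there is $\delta>0$ such that the following holds for all $C^2$ boundary data of shortest-length type that are $\delta$-near the orbit. Put $\Delta t=t_{L^-}-t_{O_A}$ and $V_0=(\dot{\mathbf x}_1^S(t_{O_A}),\dot{\mathbf x}_2^S(t_{O^+}))$. 1. The two-point boundary problem (ET3), (BC) has a solution with $|\mathbf v_1|,|\mathbf v_2|\le c$, and it is the only solution with this bound on the speeds. Its initial velocity $V_*=(\mathbf v_1,\mathbf v_2)(t_{O_A})$ lies in the open ball $U$ of radius $\rho$ about $V_0$. 2. (Shooting.) For every $V\in U$ the initial value problem (ET3) with initial positions $\mathbf x_{O_A},\mathbf x_2^h(t_{O^+})$ and initial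 velocities $V$ has a unique solution on $[t_{O_A},t_{L^-}]$ (the segments being continued in a fixed $C^2$ way beyond their ends for trajectories that overshoot). Its final position $X(V)=(\mathbf x_1,\mathbf x_2)(t_{L^-})$ is differentiable in $V\in U$, with invertible Jacobian $J(V)$ such that $\|J(V)-\Delta t\,\mathbf 1\|\le\varepsilon\,\Delta t$ and $\|J(V)\|\,\|J(V)^{-1}\|\le\frac{1+\varepsilon}{1-\varepsilon}$. The shooting iteration $V_{k+1}=V_k+J(V_k)^{-1}\big[(\mathbf x_1^h(t_{L^-}),\mathbf x_{L_B})-X(V_k)\big]$ started at $V_0$ stays in $U$ and converges to $V_*$. 3. (Continuous dependence.) The solution in 1, as a pair of trajectories (positions and velocities, uniformly in time after rescaling the time interval to $[0,1]$), depends continuously on the boundary data, in the topology given by the times and positions of the data and the $C^2$ norm of the segments; the solutions of the initial value problems in 2 depend in the same sense continuously on the boundary data and on the initial velocities $V$. -/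

import Mathlib

open Set Filter Topology Metric

noncomputable section

namespace WF

/-- Physical space with its Euclidean norm. -/
abbrev E : Type := EuclideanSpace ℝ (Fin 3)

/-! ### Liénard–Wiechert fields and the Wheeler–Feynman force

Units `c = 1`. The sign `σ = -1` is the retarded and `σ = 1` the advanced interaction.
`x, v` are the position and velocity of the particle acted upon, `y, w, b` the position, velocity
and acceleration of the source at the point in light-cone with `x`. -/

/-- The charge of particle 1 (the electron). -/
def e₁ : ℝ := -1

/-- The charge of particle 2. -/
def e₂ : ℝ := 1

/-- The Lorentz factor. -/
def gamma (v : E) : ℝ := (Real.sqrt (1 - ‖v‖ ^ 2))⁻¹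

/-- The unit vector from the source point `y` to `x`. -/
def nvec (x y : E) : E := ‖x - y‖⁻¹ • (x - y)

/-- `κ = 1 ± w · n`. -/
def kappa (σ : ℝ) (n w : E) : ℝ := 1 + σ * inner ℝ w n

/-- `u = n ± w`. -/
def uvec (σ : ℝ) (n w : E) : E := n + σ • w

/-- The part of the electric field that does not contain the acceleration of the source:
`e u / (γ² κ³ r²)`. -/
def nearField (e σ : ℝ) (x y w : E) : E :=
  (e / (gamma w ^ 2 * kappa σ (nvec x y) w ^ 3 * ‖x - y‖ ^ 2)) • uvec σ (nvec x y) w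

/-- The matrix `e (u nᵀ - κ 1) / (κ³ r)` that multiplies the acceleration of the source. -/
def radMatrix (e σ : ℝ) (x y w : E) : E →L[ℝ] E :=
  (e / (kappa σ (nvec x y) w ^ 3 * ‖x - y‖)) •
    ((innerSL ℝ (nvec x y)).smulRight (uvec σ (nvec x y) w) -
      kappa σ (nvec x y) w • ContinuousLinearMap.id ℝ E)

/-- The retarded or advanced Liénard–Wiechert electric field of a charge `e`. -/
def field (e σ : ℝ) (x y w b : E) : E := nearField e σ x y w + radMatrix e σ x y w b

/-- The linear map that turns the electric field `F` of the source into half of the (retarded or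
advanced) Lorentz force minus its power times the velocity:
`(e/2) [(1 ± v·n) F ∓ (v·F) (n ± v)]`. -/
def forceMatrix (e σ : ℝ) (x v y : E) : E →L[ℝ] E :=
  (e / 2) • (kappa σ (nvec x y) v • ContinuousLinearMap.id ℝ E -
    σ • (innerSL ℝ v).smulRight (uvec σ (nvec x y) v))

/-- The Wheeler–Feynman equation of motion `m γ a = K⁻ E⁻ + K⁺ E⁺` at time `t` of a particle of
mass `m`, charge `e` and trajectory `x` in the field of a charge `e'` of trajectory `y`; the
retarded and advanced times are `tm` and `tp`. -/
def WFEquation (m e e' : ℝ) (x y : ℝ → E) (t tm tp : ℝ) : Prop :=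
  (m * gamma (deriv x t)) • deriv (deriv x) t =
    forceMatrix e (-1) (x t) (deriv x t) (y tm)
      (field e' (-1) (x t) (y tm) (deriv y tm) (deriv (deriv y) tm)) +
    forceMatrix e 1 (x t) (deriv x t) (y tp)
      (field e' 1 (x t) (y tp) (deriv y tp) (deriv (deriv y) tp))

/-! ### Doubly circular orbits -/

/-- A doubly circular orbit: diametrically opposite uniform circular motions of the two charges
about a common center, which solve the Wheeler–Feynman equations. -/
structure SchildOrbit (m₁ m₂ : ℝ) where
  /-- the common center -/
  center : E
  /-- first axis of the plane of motion -/
  p : E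
  /-- second axis of the plane of motion -/
  q : E
  /-- the angular velocity -/
  ω : ℝ
  /-- the radius of the orbit of particle 1 -/
  rad₁ : ℝ
  /-- the radius of the orbit of particle 2 -/
  rad₂ : ℝ
  /-- the interparticle distance in light-cone -/
  r₁₂ : ℝ
  norm_p : ‖p‖ = 1
  norm_q : ‖q‖ = 1
  inner_pq : inner ℝ p q = 0
  ω_pos : 0 < ω
  rad₁_pos : 0 < rad₁
  rad₂_pos : 0 < rad₂
  r₁₂_pos : 0 < r₁₂
  subluminal₁ : ω * rad₁ < 1
  subluminal₂ : ω * rad₂ < 1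
  /-- the trajectory of particle 1 -/
  x₁ : ℝ → E
  /-- the trajectory of particle 2 -/
  x₂ : ℝ → E
  x₁_eq : ∀ t, x₁ t = center + rad₁ • (Real.cos (ω * t) • p + Real.sin (ω * t) • q)
  x₂_eq : ∀ t, x₂ t = center - rad₂ • (Real.cos (ω * t) • p + Real.sin (ω * t) • q)
  lightcone_retarded : ∀ t, ‖x₁ t - x₂ (t - r₁₂)‖ = r₁₂
  lightcone_advanced : ∀ t, ‖x₁ t - x₂ (t + r₁₂)‖ = r₁₂
  motion₁ : ∀ t, WFEquation m₁ e₁ e₂ x₁ x₂ t (t - r₁₂) (t + r₁₂)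
  motion₂ : ∀ t, WFEquation m₂ e₂ e₁ x₂ x₁ t (t - r₁₂) (t + r₁₂)

/-! ### The reduced equations -/

/-- The quantities entering the reduced equations at one instant: position and velocity of
particle 1 at its time `t₁`, of particle 2 at the time `t₂₊` at which it lies in the future
light-cone of particle 1, and position, velocity and acceleration on the two boundary segments. -/
structure Config where
  /-- position of particle 1 -/
  x₁ : E
  /-- velocity of particle 1 -/
  v₁ : E
  /-- position of particle 2 -/
  x₂ : E
  /-- velocity of particle 2 (with respect to its own time) -/
  v₂ : E
  /-- position on the past segment of particle 2, in the past light-cone of `x₁` -/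
  y₂ : E
  /-- velocity at `y₂` -/
  w₂ : E
  /-- acceleration at `y₂` -/
  b₂ : E
  /-- position on the future segment of particle 1, in the future light-cone of `x₂` -/
  y₁ : E
  /-- velocity at `y₁` -/
  w₁ : E
  /-- acceleration at `y₁` -/
  b₁ : E

namespace Config

/-- The matrix `A₁₂⁺ = K₊₁₂ B₁₂₊`. -/
def A₁₂ (c : Config) : E →L[ℝ] E :=
  (forceMatrix e₁ 1 c.x₁ c.v₁ c.x₂).comp (radMatrix e₂ 1 c.x₁ c.x₂ c.v₂)

/-- The matrix `A₂₁⁻ = K₋₂₁ B₂₁₋`. -/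
def A₂₁ (c : Config) : E →L[ℝ] E :=
  (forceMatrix e₂ (-1) c.x₂ c.v₂ c.x₁).comp (radMatrix e₁ (-1) c.x₂ c.x₁ c.v₁)

/-- The force on particle 1 without the contribution of the acceleration at `x₂`. -/
def F₂ (c : Config) : E :=
  forceMatrix e₁ (-1) c.x₁ c.v₁ c.y₂ (field e₂ (-1) c.x₁ c.y₂ c.w₂ c.b₂) +
    forceMatrix e₁ 1 c.x₁ c.v₁ c.x₂ (nearField e₂ 1 c.x₁ c.x₂ c.v₂)

/-- The force on particle 2 without the contribution of the acceleration at `x₁`. -/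
def F₁ (c : Config) : E :=
  forceMatrix e₂ 1 c.x₂ c.v₂ c.y₁ (field e₁ 1 c.x₂ c.y₁ c.w₁ c.b₁) +
    forceMatrix e₂ (-1) c.x₂ c.v₂ c.x₁ (nearField e₁ (-1) c.x₂ c.x₁ c.v₁)

/-- The matrix `G₁₂ = M₁ M₂ 1 - A₁₂⁺ A₂₁⁻`, where `M_i = m_i γ_i`. -/
def G₁₂ (m₁ m₂ : ℝ) (c : Config) : E →L[ℝ] E :=
  (m₁ * gamma c.v₁ * (m₂ * gamma c.v₂)) • (1 : E →L[ℝ] E) - c.A₁₂ * c.A₂₁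

/-- The matrix `G₂₁ = M₁ M₂ 1 - A₂₁⁻ A₁₂⁺`. -/
def G₂₁ (m₁ m₂ : ℝ) (c : Config) : E →L[ℝ] E :=
  (m₁ * gamma c.v₁ * (m₂ * gamma c.v₂)) • (1 : E →L[ℝ] E) - c.A₂₁ * c.A₁₂

/-- The acceleration of particle 1; `Ring.inverse` is the matrix inverse. -/
def H₁₂ (m₁ m₂ : ℝ) (c : Config) : E :=
  Ring.inverse (c.G₁₂ m₁ m₂) (c.A₁₂ c.F₁ + (m₂ * gamma c.v₂) • c.F₂)

/-- The acceleration of particle 2, with respect to its own time. -/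
def H₂₁ (m₁ m₂ : ℝ) (c : Config) : E :=
  Ring.inverse (c.G₂₁ m₁ m₂) (c.A₂₁ c.F₂ + (m₁ * gamma c.v₁) • c.F₁)

/-- The derivative `λ = dt₂₊ / dt₁`. -/
def lam (c : Config) : ℝ :=
  (1 + inner ℝ (nvec c.x₁ c.x₂) c.v₁) / (1 + inner ℝ (nvec c.x₁ c.x₂) c.v₂)

/-- The configurations at which the reduced equations make sense. -/
structure IsRegular (m₁ m₂ : ℝ) (c : Config) : Prop where
  subluminal₁ : ‖c.v₁‖ < 1
  subluminal₂ : ‖c.v₂‖ < 1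
  noncollision : c.x₁ ≠ c.x₂
  noncollision_past : c.x₁ ≠ c.y₂
  noncollision_future : c.x₂ ≠ c.y₁
  invertible₁₂ : IsUnit (c.G₁₂ m₁ m₂)
  invertible₂₁ : IsUnit (c.G₂₁ m₁ m₂)

end Config

/-! ### Boundary data -/

/-- Boundary data: the initial event `O_A` of trajectory 1, a segment of trajectory 2 between the
times of `O⁻` and `O⁺`, a segment of trajectory 1 between the times of `L⁻` and `L⁺`, and the final
event `L_B` of trajectory 2. Only the values of `seg₂` on `[tOm, tOp]` and of `seg₁` on
`[tLm, tLp]` are ever used. -/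
structure BoundaryData where
  /-- time of `O_A` -/
  tOA : ℝ
  /-- position of `O_A` -/
  xOA : E
  /-- time of `O⁻` -/
  tOm : ℝ
  /-- time of `O⁺` -/
  tOp : ℝ
  /-- past segment of trajectory 2 -/
  seg₂ : ℝ → E
  /-- time of `L⁻` -/
  tLm : ℝ
  /-- time of `L⁺` -/
  tLp : ℝ
  /-- future segment of trajectory 1 -/
  seg₁ : ℝ → E
  /-- time of `L_B` -/
  tLB : ℝ
  /-- position of `L_B` -/
  xLB : E

/-- The curve `g`, restricted to `[a, b]`, is closer than `η` to the curve `f` in the `C²` norm. -/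
def C2Close (f g : ℝ → E) (a b η : ℝ) : Prop :=
  ∀ n ≤ 2, ∀ t ∈ Icc a b, ‖iteratedDerivWithin n g (Icc a b) t - iteratedDeriv n f t‖ < η

/-- A fixed `C²` continuation to the whole line of a `C²` curve on `[a, b]`, with bounded velocity:
it has the value, the velocity and the acceleration of the curve at either end. It serves to
continue the trial trajectories of the shooting method that overshoot a boundary segment;
solutions of the boundary value problem use the segments only. -/
def c2Extend (f : ℝ → E) (a b t : ℝ) : E :=
  if t < a then
    f a + (t - a) • derivWithin f (Icc a b) a +
      (1 - Real.cos (t - a)) • iteratedDerivWithin 2 f (Icc a b) a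
  else if b < t then
    f b + (t - b) • derivWithin f (Icc a b) b +
      (1 - Real.cos (t - b)) • iteratedDerivWithin 2 f (Icc a b) b
  else f t

/-- On its interval the curve is not changed. -/
theorem c2Extend_of_mem (f : ℝ → E) {a b t : ℝ} (ht : t ∈ Icc a b) : c2Extend f a b t = f t := by
  unfold c2Extend
  rw [if_neg (not_lt.mpr ht.1), if_neg (not_lt.mpr ht.2)]

/-- A pair of trajectories, written as functions of the time `t` of particle 1: `x₂ t` and `v₂ t`
are the position and the velocity of particle 2 in the future light-cone of particle 1. -/
structure Trajectory where
  /-- position of particle 1 -/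
  x₁ : ℝ → E
  /-- velocity of particle 1 -/
  v₁ : ℝ → E
  /-- position of particle 2 -/
  x₂ : ℝ → E
  /-- velocity of particle 2, with respect to its own time -/
  v₂ : ℝ → E

namespace Trajectory

/-- The two pairs of trajectories agree on `s`. -/
def AgreeOn (y y' : Trajectory) (s : Set ℝ) : Prop :=
  EqOn y.x₁ y'.x₁ s ∧ EqOn y.v₁ y'.v₁ s ∧ EqOn y.x₂ y'.x₂ s ∧ EqOn y.v₂ y'.v₂ s

/-- The speeds do not exceed `c` on `s`. -/
def SpeedLE (y : Trajectory) (c : ℝ) (s : Set ℝ) : Prop :=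
  ∀ t ∈ s, ‖y.v₁ t‖ ≤ c ∧ ‖y.v₂ t‖ ≤ c

/-- The velocities of both particles at time `t` of particle 1. -/
def vel (y : Trajectory) (t : ℝ) : E × E := (y.v₁ t, y.v₂ t)

/-- The positions of both particles at time `t` of particle 1. -/
def pos (y : Trajectory) (t : ℝ) : E × E := (y.x₁ t, y.x₂ t)

end Trajectory

namespace BoundaryData

/-- `C²` boundary data of the shortest-length type: `O^±` and `L^±` are in light-cone with `O_A`
and with `L_B`, and `L⁻` is in the future light-cone of `O⁺`. -/
structure IsShortest (D : BoundaryData) : Prop where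
  contDiff₂ : ContDiffOn ℝ 2 D.seg₂ (Icc D.tOm D.tOp)
  contDiff₁ : ContDiffOn ℝ 2 D.seg₁ (Icc D.tLm D.tLp)
  lightcone_Om : D.tOA - D.tOm = ‖D.xOA - D.seg₂ D.tOm‖
  lightcone_Op : D.tOp - D.tOA = ‖D.xOA - D.seg₂ D.tOp‖
  lightcone_Lm : D.tLB - D.tLm = ‖D.xLB - D.seg₁ D.tLm‖
  lightcone_Lp : D.tLp - D.tLB = ‖D.xLB - D.seg₁ D.tLp‖
  shortest : D.tLm - D.tOp = ‖D.seg₁ D.tLm - D.seg₂ D.tOp‖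

/-- The boundary data lie in the `δ`-neighbourhood of a doubly circular orbit. -/
structure IsNear {m₁ m₂ : ℝ} (D : BoundaryData) (S : SchildOrbit m₁ m₂) (δ : ℝ) : Prop where
  near_OA : ‖D.xOA - S.x₁ D.tOA‖ < δ
  near_LB : ‖D.xLB - S.x₂ D.tLB‖ < δ
  near₂ : C2Close S.x₂ D.seg₂ D.tOm D.tOp δ
  near₁ : C2Close S.x₁ D.seg₁ D.tLm D.tLp δ

/-- The past segment of particle 2, continued. -/
def hist₂ (D : BoundaryData) : ℝ → E := c2Extend D.seg₂ D.tOm D.tOp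

/-- The future segment of particle 1, continued. -/
def hist₁ (D : BoundaryData) : ℝ → E := c2Extend D.seg₁ D.tLm D.tLp

/-- The boundary data `D'` are closer than `η` to `D`. -/
structure IsClose (D D' : BoundaryData) (η : ℝ) : Prop where
  tOA : |D'.tOA - D.tOA| < η
  tOm : |D'.tOm - D.tOm| < η
  tOp : |D'.tOp - D.tOp| < η
  tLm : |D'.tLm - D.tLm| < η
  tLp : |D'.tLp - D.tLp| < η
  tLB : |D'.tLB - D.tLB| < η
  xOA : ‖D'.xOA - D.xOA‖ < η
  xLB : ‖D'.xLB - D.xLB‖ < η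
  seg₂ : C2Close D.hist₂ D'.seg₂ D'.tOm D'.tOp η
  seg₁ : C2Close D.hist₁ D'.seg₁ D'.tLm D'.tLp η

/-- The time interval of particle 1, between `O_A` and `L⁻`. -/
def interval (D : BoundaryData) : Set ℝ := Icc D.tOA D.tLm

/-- The time span of the flight. -/
def span (D : BoundaryData) : ℝ := D.tLm - D.tOA

/-- The quantities in the reduced equations at time `t` along the trajectories `y`, where `s` and
`σ` are the delayed and the advanced time on the boundary segments. -/
def config (D : BoundaryData) (y : Trajectory) (t s σ : ℝ) : Config where
  x₁ := y.x₁ t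
  v₁ := y.v₁ t
  x₂ := y.x₂ t
  v₂ := y.v₂ t
  y₂ := D.hist₂ s
  w₂ := deriv D.hist₂ s
  b₂ := deriv (deriv D.hist₂) s
  y₁ := D.hist₁ σ
  w₁ := deriv D.hist₁ σ
  b₁ := deriv (deriv D.hist₁) σ

/-- The trajectories `y` solve the reduced differential equations, with delayed time `s t` and
advanced time `σ t`: particle 1 at time `t` has `hist₂ (s t)` in its past light-cone, and particle
2 at time `t₂ = t + |x₁ - x₂|` has `hist₁ (σ t)` in its future light-cone. -/
structure SolvesWith (m₁ m₂ : ℝ) (D : BoundaryData) (y : Trajectory) (s σ : ℝ → ℝ) : Prop where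
  lightcone_past : ∀ t ∈ D.interval, t - s t = ‖y.x₁ t - D.hist₂ (s t)‖
  lightcone_future : ∀ t ∈ D.interval,
    σ t - (t + ‖y.x₁ t - y.x₂ t‖) = ‖y.x₂ t - D.hist₁ (σ t)‖
  regular : ∀ t ∈ D.interval, (D.config y t (s t) (σ t)).IsRegular m₁ m₂
  ode_v₁ : ∀ t ∈ D.interval,
    HasDerivWithinAt y.v₁ ((D.config y t (s t) (σ t)).H₁₂ m₁ m₂) D.interval t
  ode_v₂ : ∀ t ∈ D.interval, HasDerivWithinAt y.v₂
    ((D.config y t (s t) (σ t)).lam • (D.config y t (s t) (σ t)).H₂₁ m₁ m₂) D.interval t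
  ode_x₁ : ∀ t ∈ D.interval, HasDerivWithinAt y.x₁ (y.v₁ t) D.interval t
  ode_x₂ : ∀ t ∈ D.interval,
    HasDerivWithinAt y.x₂ ((D.config y t (s t) (σ t)).lam • y.v₂ t) D.interval t

/-- The initial value problem of the shooting method: the trajectories solve the reduced equations,
start at the positions of `O_A` and `O⁺` and have the initial velocities `V`. -/
def IsTrial (m₁ m₂ : ℝ) (D : BoundaryData) (V : E × E) (y : Trajectory) : Prop :=
  (∃ s σ : ℝ → ℝ, D.SolvesWith m₁ m₂ y s σ) ∧
    y.pos D.tOA = (D.xOA, D.seg₂ D.tOp) ∧ y.vel D.tOA = V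

/-- The final positions prescribed by the boundary data: those of `L⁻` and `L_B`. -/
def target (D : BoundaryData) : E × E := (D.seg₁ D.tLm, D.xLB)

/-- The two-point boundary value problem: the trajectories solve the reduced equations, interact
with the boundary segments only, start at the positions of `O_A` and `O⁺` and end at those of
`L⁻` and `L_B`. -/
def IsSolution (m₁ m₂ : ℝ) (D : BoundaryData) (y : Trajectory) : Prop :=
  (∃ s σ : ℝ → ℝ, D.SolvesWith m₁ m₂ y s σ ∧
    (∀ t ∈ D.interval, s t ∈ Icc D.tOm D.tOp) ∧ (∀ t ∈ D.interval, σ t ∈ Icc D.tLm D.tLp)) ∧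
    y.pos D.tOA = (D.xOA, D.seg₂ D.tOp) ∧ y.pos D.tLm = D.target

/-- The velocities of the circular orbit at the events `O_A` and `O⁺`. -/
def circularVel {m₁ m₂ : ℝ} (D : BoundaryData) (S : SchildOrbit m₁ m₂) : E × E :=
  (deriv S.x₁ D.tOA, deriv S.x₂ D.tOp)

/-- The time interval of particle 1, parametrized by `[0, 1]`. -/
def time (D : BoundaryData) (u : ℝ) : ℝ := D.tOA + u * D.span

/-- The trajectories `y` for the data `D` and `y'` for the data `D'` are uniformly closer than
`η`, in position and velocity. -/
def TrajClose (D D' : BoundaryData) (y y' : Trajectory) (η : ℝ) : Prop :=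
  ∀ u ∈ Icc (0 : ℝ) 1, ‖y'.pos (D'.time u) - y.pos (D.time u)‖ < η ∧
    ‖y'.vel (D'.time u) - y.vel (D.time u)‖ < η

end BoundaryData

end WF

end

/-! # Boundary value problems near wide circular orbits of the electromagnetic two-body problem

On a doubly circular orbit the equations of motion bound the accelerations by a multiple of
`1 / r₁₂²`, so that for large `r₁₂` the speeds are small, too (`SchildOrbit.exists_isSlow`). In units
of `r = r₁₂` all distances in light-cone are about `1`, the time of flight `Δt` is about `2`, and
the force is proportional to the coupling `g = 1 / r`: the reduced equations are a small perturbation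
of free motion. The perturbation is treated on a compact set of the variables, `Vars.tube`, on which
the coefficients are `C¹`. The delayed and the advanced time are added to the unknowns; they satisfy
differential equations of their own, and the light-cone conditions become conserved quantities
(`IsFlow.lightcone_past`, `IsFlow.lightcone_future`). What results is an ordinary differential
equation, `IsFlow`.

As the segments are merely `C²`, the vector field of this equation is merely continuous: it contains
the accelerations `b₂ (s t)` and `b₁ (σ t)` on the segments. Existence comes from Peano's theorem. For
uniqueness, stability and differentiability one observes that `b₂ (s t)`, times the positive rate
`ds / dt`, is the derivative of `w₂ (s t)`. So the difference of two solutions, with the difference of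
the velocities corrected by the difference of `w₂` and `w₁` times a smooth matrix (`corrected`),
satisfies a differential inequality of Gronwall type, although the equation is not Lipschitz
(`flow_stability`). With one solution fixed, the same corrected difference satisfies a linear equation
up to small errors, which gives the differentiability in the initial velocities
(`flow_differentiable`).

Consequently the final positions `X V` are, as a function of the initial velocities, close to
`Δt • V` in the sense that `‖X V' - X V - Δt • (V' - V)‖ ≤ ε Δt ‖V' - V‖` (`Setting.approx`). For a map
of this kind existence and uniqueness of a zero, the conditioning of the Jacobian, and the convergence
of Newton's iteration are elementary (`exists_shooting`), and the continuous dependence on the data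
follows from the stability of the flow together with the Lipschitz inverse of `X`.

It remains to see that each solution of the boundary problem with speeds at most `c < 1 / 2` is among
the trial trajectories, that is, has small initial velocities. As its end points are close to each
other, no particle gets farther than about half the bound `c Δt` on its path, so that the particles
keep a distance of about `1 - 2 c`, in units of `r`, and the solution lies in the tube
(`Setting.mem_tube_of_speed_le`). There the accelerations are small, the velocities almost constant,
and since the displacements are small, so are the velocities. -/

noncomputable section

namespace WF

/-! ### Peano's theorem -/

section Peano

variable {W : Type*} [NormedAddCommGroup W] [NormedSpace ℝ W]

theorem eq_add_integral_of_hasDerivWithinAt [CompleteSpace W] {α : ℝ → W} {f : ℝ → W}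
    (hα : ∀ t ∈ Icc (0 : ℝ) 1, HasDerivWithinAt α (f t) (Icc 0 1) t)
    (hf : ContinuousOn f (Icc 0 1)) {t : ℝ} (ht : t ∈ Icc (0 : ℝ) 1) :
    α t = α 0 + ∫ τ in (0 : ℝ)..t, f τ := by
  have hsub : Icc 0 t ⊆ Icc (0 : ℝ) 1 := Icc_subset_Icc_right ht.2
  have h := intervalIntegral.integral_eq_sub_of_hasDeriv_right_of_le ht.1
    (f := α) (f' := f) (fun x hx => (hα x (hsub hx)).continuousWithinAt.mono hsub)
    (fun x hx => ((hα x (hsub ⟨hx.1.le, hx.2.le⟩)).hasDerivAt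
      (Icc_mem_nhds hx.1 (hx.2.trans_le ht.2))).hasDerivWithinAt)
    ((hf.mono hsub).intervalIntegrable_of_Icc ht.1)
  rw [h]; abel

/-- The Picard–Lindelöf theorem for a bounded `C¹` vector field, on all of `[0, 1]`. -/
theorem exists_solution_of_contDiff [FiniteDimensional ℝ W] {f : W → W} (hf : ContDiff ℝ 1 f)
    {M : ℝ} (hM₀ : 0 ≤ M) (hM : ∀ x, ‖f x‖ ≤ M) (x₀ : W) :
    ∃ α : ℝ → W, α 0 = x₀ ∧ ∀ t ∈ Icc (0 : ℝ) 1, HasDerivWithinAt α (f (α t)) (Icc 0 1) t := by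
  obtain ⟨K, hK⟩ := LocallyLipschitzOn.exists_lipschitzOnWith_of_compact (f := f)
    (isCompact_closedBall x₀ M) (hf.locallyLipschitz.locallyLipschitzOn (s := closedBall x₀ M))
  have hpl : IsPicardLindelof (fun _ : ℝ => f) (⟨0, by simp⟩ : Icc (0 : ℝ) 1) x₀ ⟨M, hM₀⟩ 0
      ⟨M, hM₀⟩ K :=
    { lipschitzOnWith := fun _ _ => hK
      continuousOn := fun _ _ => continuousOn_const
      norm_le := fun _ _ x _ => hM x
      mul_max_le := by simp }
  exact hpl.exists_eq_forall_mem_Icc_hasDerivWithinAt₀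

/-- **Peano's theorem** for a bounded continuous vector field: smooth vector fields that
approximate it have solutions, which are equicontinuous and accumulate at a solution. -/
theorem exists_solution_of_continuous [FiniteDimensional ℝ W] {f : W → W} (hf : Continuous f)
    {M : ℝ} (hM : ∀ x, ‖f x‖ ≤ M) (x₀ : W) :
    ∃ α : ℝ → W, α 0 = x₀ ∧ ∀ t ∈ Icc (0 : ℝ) 1, HasDerivWithinAt α (f (α t)) (Icc 0 1) t := by
  have hM₀ : 0 ≤ M := (norm_nonneg _).trans (hM x₀)
  have happ : ∀ n : ℕ, ∃ g : W → W, ContDiff ℝ 1 g ∧ ∀ x, dist (g x) (f x) < 1 / ((n : ℝ) + 1) := by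
    intro n
    obtain ⟨g, hg, hgf, -⟩ := hf.exists_contDiff_approx (ε := fun _ => 1 / ((n : ℝ) + 1)) 1
      continuous_const (fun _ => Nat.one_div_pos_of_nat)
    exact ⟨g, hg, hgf⟩
  choose g hg hgf using happ
  have hgM : ∀ n x, ‖g n x‖ ≤ M + 1 := by
    intro n x
    have h1 := hgf n x
    have h2 : 1 / ((n : ℝ) + 1) ≤ 1 := by
      rw [div_le_one (by positivity)]; linarith [(Nat.cast_nonneg n : (0 : ℝ) ≤ n)]
    have h3 := norm_le_norm_add_norm_sub' (g n x) (f x)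
    rw [dist_eq_norm] at h1
    linarith [hM x]
  choose α hα₀ hα using fun n => exists_solution_of_contDiff (hg n) (by linarith) (hgM n) x₀
  have hαL : ∀ n, ∀ t ∈ Icc (0 : ℝ) 1, ∀ t' ∈ Icc (0 : ℝ) 1,
      ‖α n t' - α n t‖ ≤ (M + 1) * ‖t' - t‖ := fun n t ht t' ht' =>
    (convex_Icc (0 : ℝ) 1).norm_image_sub_le_of_norm_hasDerivWithin_le (hα n)
      (fun x _ => hgM n _) ht ht'
  let a : ℕ → BoundedContinuousFunction (Icc (0 : ℝ) 1) W := fun n =>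
    BoundedContinuousFunction.mkOfCompact
      ⟨(Icc (0 : ℝ) 1).domRestrict (α n),
        ContinuousOn.domRestrict fun t ht => (hα n t ht).continuousWithinAt⟩
  let A : Set (BoundedContinuousFunction (Icc (0 : ℝ) 1) W) :=
    {β | (∀ t, β t ∈ closedBall x₀ (M + 1)) ∧
      ∀ t t', dist (β t) (β t') ≤ (M + 1) * dist t t'}
  have heval : ∀ t, Continuous fun β : BoundedContinuousFunction (Icc (0 : ℝ) 1) W => β t :=
    fun t => (BoundedContinuousFunction.lipschitz_eval_const t).continuous
  have hAc : IsClosed A := by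
    have e : A = (⋂ t, (fun β => β t) ⁻¹' closedBall x₀ (M + 1)) ∩
        ⋂ t, ⋂ t', {β | dist (β t) (β t') ≤ (M + 1) * dist t t'} := by
      ext β; simp only [A, mem_inter_iff, mem_iInter, mem_preimage]; rfl
    rw [e]
    exact (isClosed_iInter fun t => isClosed_closedBall.preimage (heval t)).inter
      (isClosed_iInter fun t => isClosed_iInter fun t' =>
        isClosed_le ((heval t).dist (heval t')) continuous_const)
  have hAK : IsCompact A := by
    refine BoundedContinuousFunction.arzela_ascoli₂ (closedBall x₀ (M + 1))
      (isCompact_closedBall _ _) A hAc (fun β t hβ => hβ.1 t) ?_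
    refine Metric.equicontinuous_of_continuity_modulus (fun d => (M + 1) * d) ?_ _ ?_
    · exact Continuous.tendsto' (by fun_prop) 0 0 (by simp)
    · intro t t' β
      exact β.2.2 t t'
  have haA : ∀ n, a n ∈ A := by
    intro n
    refine ⟨fun t => ?_, fun t t' => ?_⟩
    · have h := hαL n 0 (by simp) t t.2
      rw [hα₀] at h
      have ht : ‖(t : ℝ) - 0‖ ≤ 1 := by
        rw [sub_zero, Real.norm_eq_abs, abs_of_nonneg t.2.1]; exact t.2.2
      rw [mem_closedBall, dist_eq_norm]
      exact h.trans (by nlinarith)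
    · rw [dist_eq_norm, Subtype.dist_eq, dist_eq_norm]
      exact hαL n t' t'.2 t t.2
  obtain ⟨β, -, φ, hφ, hβ⟩ := hAK.tendsto_subseq haA
  let γ : ℝ → W := fun t => β (projIcc 0 1 zero_le_one t)
  have hγc : Continuous γ := β.continuous.comp continuous_projIcc
  have hlim : ∀ t ∈ Icc (0 : ℝ) 1, Tendsto (fun n => α (φ n) t) atTop (𝓝 (γ t)) := by
    intro t ht
    have h := (heval ⟨t, ht⟩).continuousAt.tendsto.comp hβ
    have e : γ t = β ⟨t, ht⟩ := by simp only [γ, projIcc_of_mem zero_le_one ht]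
    rw [e]; exact h
  have hint : ∀ t ∈ Icc (0 : ℝ) 1, γ t = x₀ + ∫ τ in (0 : ℝ)..t, f (γ τ) := by
    intro t ht
    have hs : uIoc 0 t ⊆ Icc (0 : ℝ) 1 := by
      rw [uIoc_of_le ht.1]
      exact fun x hx => ⟨hx.1.le, hx.2.trans ht.2⟩
    have hcont : ∀ n, ContinuousOn (fun τ => g n (α n τ)) (Icc 0 1) := fun n =>
      (hg n).continuous.comp_continuousOn fun t ht => (hα n t ht).continuousWithinAt
    have h1 : Tendsto (fun n => ∫ τ in (0 : ℝ)..t, g (φ n) (α (φ n) τ)) atTop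
        (𝓝 (∫ τ in (0 : ℝ)..t, f (γ τ))) := by
      refine intervalIntegral.tendsto_integral_filter_of_dominated_convergence
        (fun _ => M + 1) (Eventually.of_forall fun n => ?_)
        (Eventually.of_forall fun n => Eventually.of_forall fun τ _ => hgM _ _)
        intervalIntegrable_const (Eventually.of_forall fun τ hτ => ?_)
      · exact ((hcont (φ n)).mono hs).aestronglyMeasurable measurableSet_uIoc
      · have h2 := (hf.tendsto (γ τ)).comp (hlim τ (hs hτ))
        rw [tendsto_iff_dist_tendsto_zero] at h2 ⊢
        have h3 : Tendsto (fun n => 1 / ((φ n : ℝ) + 1)) atTop (𝓝 0) :=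
          (tendsto_one_div_add_atTop_nhds_zero_nat (𝕜 := ℝ)).comp hφ.tendsto_atTop
        have h4 := h3.add h2
        rw [add_zero] at h4
        refine squeeze_zero (fun _ => dist_nonneg) (fun n => ?_) h4
        exact (dist_triangle _ (f (α (φ n) τ)) _).trans
          (add_le_add (hgf _ _).le le_rfl)
    have h5 : ∀ n, α (φ n) t = x₀ + ∫ τ in (0 : ℝ)..t, g (φ n) (α (φ n) τ) := fun n => by
      have := eq_add_integral_of_hasDerivWithinAt (hα (φ n)) (hcont (φ n)) ht
      rwa [hα₀] at this
    exact tendsto_nhds_unique (hlim t ht) (by simpa only [h5] using h1.const_add x₀)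
  refine ⟨γ, by simpa using hint 0 (by simp), fun t ht => ?_⟩
  have h6 : HasDerivAt (fun t => x₀ + ∫ τ in (0 : ℝ)..t, f (γ τ)) (f (γ t)) t :=
    (intervalIntegral.integral_hasDerivAt_right ((hf.comp hγc).intervalIntegrable _ _)
      ((hf.comp hγc).stronglyMeasurableAtFilter _ _) (hf.comp hγc).continuousAt).const_add x₀
  exact h6.hasDerivWithinAt.congr hint (hint t ht)

end Peano

/-! ### Continuously differentiable maps on compact sets -/

section Compact

variable {Q Y : Type*} [NormedAddCommGroup Q] [NormedSpace ℝ Q] [NormedAddCommGroup Y]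
  [NormedSpace ℝ Y]

/-- A map that is `C¹` at the points of a compact set is bounded and Lipschitz there, with bounded
derivative. The set need not be convex. -/
theorem exists_bound_of_contDiffAt {Φ : Q → Y} {K : Set Q} (hK : IsCompact K)
    (hΦ : ∀ q ∈ K, ContDiffAt ℝ 1 Φ q) :
    ∃ C, 1 ≤ C ∧ ∀ q ∈ K, ‖Φ q‖ ≤ C ∧ ‖fderiv ℝ Φ q‖ ≤ C ∧
      ∀ q' ∈ K, ‖Φ q' - Φ q‖ ≤ C * ‖q' - q‖ := by
  have h1 : ContinuousOn Φ K := fun q hq => (hΦ q hq).continuousAt.continuousWithinAt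
  have h2 : ContinuousOn (fderiv ℝ Φ) K := fun q hq =>
    ((hΦ q hq).fderiv_right (m := 0) (by norm_num)).continuousAt.continuousWithinAt
  obtain ⟨C₁, hC₁⟩ := hK.exists_bound_of_continuousOn h1
  obtain ⟨C₂, hC₂⟩ := hK.exists_bound_of_continuousOn h2
  have h3 : LocallyLipschitzOn K Φ := by
    intro q hq
    obtain ⟨k, t, ht, hk⟩ := (hΦ q hq).exists_lipschitzOnWith
    exact ⟨k, t, mem_nhdsWithin_of_mem_nhds ht, hk⟩
  obtain ⟨C₃, hC₃⟩ := h3.exists_lipschitzOnWith_of_compact hK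
  refine ⟨max 1 (max C₁ (max C₂ C₃)), le_max_left _ _, fun q hq => ⟨?_, ?_, fun q' hq' => ?_⟩⟩
  · exact (hC₁ q hq).trans (by simp)
  · exact (hC₂ q hq).trans (by simp)
  · have := hC₃.dist_le_mul q' hq' q hq
    rw [dist_eq_norm, dist_eq_norm] at this
    exact this.trans (by gcongr; simp)

/-- A map that is `C¹` at the points of a compact set is uniformly differentiable there. -/
theorem uniform_differentiability {Φ : Q → Y} {K : Set Q} (hK : IsCompact K)
    (hΦ : ∀ q ∈ K, ContDiffAt ℝ 1 Φ q) {ε : ℝ} (hε : 0 < ε) :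
    ∃ δ > 0, ∀ q ∈ K, ∀ q', ‖q' - q‖ < δ →
      ‖Φ q' - Φ q - fderiv ℝ Φ q (q' - q)‖ ≤ ε * ‖q' - q‖ := by
  have hloc : ∀ q₀ : K, ∃ r > 0, ∀ a ∈ ball (q₀ : Q) r, ∀ b ∈ ball (q₀ : Q) r,
      ‖Φ b - Φ a - fderiv ℝ Φ a (b - a)‖ ≤ ε * ‖b - a‖ := by
    intro q₀
    have hs := (hΦ q₀ q₀.2).hasStrictFDerivAt one_ne_zero
    have h1 := hs.isLittleO.def (half_pos hε)
    have h2 : ∀ᶠ a in 𝓝 (q₀ : Q), ‖fderiv ℝ Φ a - fderiv ℝ Φ q₀‖ < ε / 2 := by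
      have hc := ((hΦ q₀ q₀.2).fderiv_right (m := 0) (by norm_num)).continuousAt
      have := Metric.tendsto_nhds.1 hc (ε / 2) (half_pos hε)
      simpa only [dist_eq_norm] using this
    rw [nhds_prod_eq] at h1
    obtain ⟨t, ht, h1⟩ := mem_prod_same_iff.1 h1
    obtain ⟨r, hr, hr'⟩ := Metric.mem_nhds_iff.1 (inter_mem ht h2)
    refine ⟨r, hr, fun a ha b hb => ?_⟩
    have e1 := h1 (mk_mem_prod (hr' hb).1 (hr' ha).1)
    have e2 : ‖(fderiv ℝ Φ a - fderiv ℝ Φ q₀) (b - a)‖ ≤ ε / 2 * ‖b - a‖ :=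
      ((fderiv ℝ Φ a - fderiv ℝ Φ q₀).le_opNorm _).trans (by gcongr; exact (hr' ha).2.le)
    calc ‖Φ b - Φ a - fderiv ℝ Φ a (b - a)‖
        = ‖(Φ b - Φ a - fderiv ℝ Φ q₀ (b - a)) - (fderiv ℝ Φ a - fderiv ℝ Φ q₀) (b - a)‖ := by
          congr 1; simp only [_root_.sub_apply]; abel
      _ ≤ ε / 2 * ‖b - a‖ + ε / 2 * ‖b - a‖ := (norm_sub_le _ _).trans (add_le_add e1 e2)
      _ = ε * ‖b - a‖ := by ring
  choose r hr hloc using hloc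
  obtain ⟨δ, hδ, hcov⟩ := lebesgue_number_lemma_of_metric hK
    (c := fun q₀ : K => ball (q₀ : Q) (r q₀)) (fun _ => isOpen_ball)
    (fun q hq => mem_iUnion.2 ⟨⟨q, hq⟩, mem_ball_self (hr _)⟩)
  refine ⟨δ, hδ, fun q hq q' hq' => ?_⟩
  obtain ⟨i, hi⟩ := hcov q hq
  exact hloc i q (hi (mem_ball_self hδ)) q' (hi (by rwa [mem_ball, dist_eq_norm]))

end Compact

/-! ### Gronwall on an interval -/

/-- Gronwall's inequality on `[0, a]`, `a ≤ 1`, with a crude constant. -/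
theorem norm_le_of_norm_deriv_le {W : Type*} [NormedAddCommGroup W] [NormedSpace ℝ W]
    {ζ ζ' : ℝ → W} {a C d e : ℝ} (ha : a ≤ 1) (hC : 0 ≤ C) (he : 0 ≤ e)
    (hζ : ∀ u ∈ Icc 0 a, HasDerivWithinAt ζ (ζ' u) (Icc 0 a) u) (h₀ : ‖ζ 0‖ ≤ d)
    (hb : ∀ u ∈ Icc 0 a, ‖ζ' u‖ ≤ C * ‖ζ u‖ + e) :
    ∀ u ∈ Icc 0 a, ‖ζ u‖ ≤ (d + e) * Real.exp (C + 1) := by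
  intro u hu
  have hd : 0 ≤ d := (norm_nonneg _).trans h₀
  have h := norm_le_gronwallBound_of_norm_deriv_right_le (f := ζ) (f' := ζ') (δ := d) (K := C + 1)
    (ε := e) (fun x hx => (hζ x hx).continuousWithinAt)
    (fun x hx => ((hζ x ⟨hx.1, hx.2.le⟩).mono_of_mem_nhdsWithin
      (Icc_mem_nhdsGE_of_mem hx))) h₀
    (fun x hx => (hb x ⟨hx.1, hx.2.le⟩).trans (by nlinarith [norm_nonneg (ζ x)])) u hu
  refine h.trans ?_
  rw [gronwallBound_of_K_ne_0 (by positivity), sub_zero]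
  have h1 : Real.exp ((C + 1) * u) ≤ Real.exp (C + 1) := by
    apply Real.exp_le_exp.2
    have := hu.2.trans ha
    nlinarith
  have h2 : e / (C + 1) ≤ e := div_le_self he (by linarith)
  have h3 : 0 ≤ e / (C + 1) := by positivity
  have h4 : 1 ≤ Real.exp ((C + 1) * u) := Real.one_le_exp (by have := hu.1; positivity)
  calc _ ≤ d * Real.exp (C + 1) + e * (Real.exp (C + 1)) := by
        refine add_le_add (by gcongr) ?_
        exact mul_le_mul h2 (by linarith) (by linarith) he
    _ = _ := by ring

/-! ### Differentiability from an approximately linear equation -/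

section ApproxLinear

variable {H W : Type*} [NormedAddCommGroup H] [NormedSpace ℝ H] [NormedAddCommGroup W]
  [NormedSpace ℝ W]

/-- If combinations `f (a h + b k) - a f h - b f k` are small compared to the arguments, then `f`
is differentiable at `0`: the derivative in direction `h` is the limit of `n f (h / n)`. -/
theorem hasFDerivAt_zero_of_approx_linear [FiniteDimensional ℝ H] [CompleteSpace W] {f : H → W}
    (hf : ∀ ε > 0, ∃ δ > 0, ∀ (h k : H) (a b : ℝ), ‖h‖ < δ → ‖k‖ < δ → ‖a • h + b • k‖ < δ →
      ‖f (a • h + b • k) - (a • f h + b • f k)‖ ≤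
        ε * (‖a • h + b • k‖ + |a| * ‖h‖ + |b| * ‖k‖)) :
    ∃ L : H →L[ℝ] W, HasFDerivAt f L 0 := by
  let c : ℕ → ℝ := fun n => (n : ℝ) + 1
  have hc : ∀ n, 0 < c n := fun n => by positivity
  have hsmall : ∀ (h : H) (δ : ℝ), 0 < δ → ∀ᶠ n in atTop, ‖(c n)⁻¹ • h‖ < δ := by
    intro h δ hδ
    have h1 : Tendsto (fun n => (c n)⁻¹ • h) atTop (𝓝 ((0 : ℝ) • h)) := by
      refine Tendsto.smul_const ?_ h
      simpa [c] using tendsto_one_div_add_atTop_nhds_zero_nat (𝕜 := ℝ)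
    rw [zero_smul] at h1
    simpa using Metric.tendsto_nhds.1 h1 δ hδ
  have hone : ∀ ε > 0, ∃ δ > 0, ∀ (h : H) (a : ℝ), ‖h‖ < δ → ‖a • h‖ < δ →
      ‖f (a • h) - a • f h‖ ≤ ε * (2 * (|a| * ‖h‖)) := by
    intro ε hε
    obtain ⟨δ, hδ, h1⟩ := hf ε hε
    refine ⟨δ, hδ, fun h a hh ha => ?_⟩
    have := h1 h 0 a 0 hh (by simpa using hδ) (by simpa using ha)
    simp only [zero_smul, add_zero, norm_zero, mul_zero, norm_smul, Real.norm_eq_abs] at this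
    linarith
  have hlim : ∀ h, ∃ l, Tendsto (fun n => c n • f ((c n)⁻¹ • h)) atTop (𝓝 l) := by
    intro h
    apply cauchySeq_tendsto_of_complete
    rw [Metric.cauchySeq_iff']
    intro ε hε
    obtain ⟨δ, hδ, h1⟩ := hone (ε / (4 * (‖h‖ + 1))) (by positivity)
    obtain ⟨N, hN⟩ := eventually_atTop.1 (hsmall h δ hδ)
    refine ⟨N, fun n hn => ?_⟩
    have e : (c n)⁻¹ • h = (c N * (c n)⁻¹) • (c N)⁻¹ • h := by
      rw [smul_smul]; congr 1; field_simp [(hc N).ne']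
    have h2 := h1 ((c N)⁻¹ • h) (c N * (c n)⁻¹) (hN N le_rfl) (by rw [← e]; exact hN n hn)
    rw [← e, norm_smul, norm_inv, Real.norm_eq_abs, abs_of_pos (hc N), abs_of_pos
      (mul_pos (hc N) (inv_pos.2 (hc n)))] at h2
    rw [dist_eq_norm]
    have e2 : c n • f ((c n)⁻¹ • h) - c N • f ((c N)⁻¹ • h) =
        c n • (f ((c n)⁻¹ • h) - (c N * (c n)⁻¹) • f ((c N)⁻¹ • h)) := by
      rw [smul_sub, smul_smul]; congr 2; field_simp [(hc n).ne']
    rw [e2, norm_smul, Real.norm_eq_abs, abs_of_pos (hc n)]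
    calc c n * ‖f ((c n)⁻¹ • h) - (c N * (c n)⁻¹) • f ((c N)⁻¹ • h)‖
        ≤ c n * (ε / (4 * (‖h‖ + 1)) * (2 * (c N * (c n)⁻¹ * ((c N)⁻¹ * ‖h‖)))) := by
          gcongr
      _ = ε / 2 * (‖h‖ / (‖h‖ + 1)) := by
          have := (hc n).ne'; have := (hc N).ne'
          field_simp; ring
      _ ≤ ε / 2 * 1 := by
          gcongr; rw [div_le_one (by positivity)]; linarith
      _ < ε := by linarith
  choose l hl using hlim
  have hlin : ∀ (a b : ℝ) (h k : H), l (a • h + b • k) = a • l h + b • l k := by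
    intro a b h k
    have h1 : Tendsto (fun n => c n • f ((c n)⁻¹ • (a • h + b • k)) -
        (a • (c n • f ((c n)⁻¹ • h)) + b • (c n • f ((c n)⁻¹ • k)))) atTop
        (𝓝 (l (a • h + b • k) - (a • l h + b • l k))) :=
      (hl _).sub (((hl h).const_smul a).add ((hl k).const_smul b))
    have h2 : Tendsto (fun n => c n • f ((c n)⁻¹ • (a • h + b • k)) -
        (a • (c n • f ((c n)⁻¹ • h)) + b • (c n • f ((c n)⁻¹ • k)))) atTop (𝓝 0) := by
      rw [Metric.tendsto_nhds]
      intro ε hε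
      set m := ‖a • h + b • k‖ + |a| * ‖h‖ + |b| * ‖k‖ with hm
      have hm0 : 0 ≤ m := by positivity
      obtain ⟨δ, hδ, h1⟩ := hf (ε / (2 * (m + 1))) (by positivity)
      filter_upwards [hsmall h δ hδ, hsmall k δ hδ, hsmall (a • h + b • k) δ hδ] with n hn1 hn2 hn3
      have e : (c n)⁻¹ • (a • h + b • k) = a • (c n)⁻¹ • h + b • (c n)⁻¹ • k := by
        rw [smul_add, smul_comm, smul_comm (c n)⁻¹ b]
      have h3 := h1 _ _ a b hn1 hn2 (by rwa [← e])
      rw [← e] at h3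
      rw [dist_zero_right]
      have e2 : c n • f ((c n)⁻¹ • (a • h + b • k)) -
        (a • (c n • f ((c n)⁻¹ • h)) + b • (c n • f ((c n)⁻¹ • k))) =
          c n • (f ((c n)⁻¹ • (a • h + b • k)) -
            (a • f ((c n)⁻¹ • h) + b • f ((c n)⁻¹ • k))) := by
        rw [smul_sub (c n), smul_add (c n) (a • _), smul_comm (c n) a (f _),
          smul_comm (c n) b (f _)]
      rw [e2, norm_smul, Real.norm_eq_abs, abs_of_pos (hc n)]
      simp only [norm_smul (c n)⁻¹, norm_inv, Real.norm_eq_abs, abs_of_pos (hc n)] at h3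
      calc _ ≤ c n * _ := mul_le_mul_of_nonneg_left h3 (hc n).le
        _ = ε / 2 * (m / (m + 1)) := by
          have := (hc n).ne'
          rw [hm]; field_simp
        _ ≤ ε / 2 * 1 := by
          gcongr; rw [div_le_one (by positivity)]; linarith
        _ < ε := by linarith
    exact sub_eq_zero.1 (tendsto_nhds_unique h1 h2)
  let L : H →ₗ[ℝ] W :=
    { toFun := l
      map_add' := fun h k => by simpa using hlin 1 1 h k
      map_smul' := fun a h => by simpa using hlin a 0 h 0 }
  have hf0 : f 0 = 0 := by
    obtain ⟨δ, hδ, h1⟩ := hone 1 one_pos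
    simpa using h1 0 0 (by simpa using hδ) (by simpa using hδ)
  refine ⟨LinearMap.toContinuousLinearMap L, ?_⟩
  rw [hasFDerivAt_iff_isLittleO_nhds_zero, Asymptotics.isLittleO_iff]
  intro ε hε
  obtain ⟨δ, hδ, h1⟩ := hone (ε / 2) (half_pos hε)
  filter_upwards [ball_mem_nhds (0 : H) hδ] with h hh
  rw [mem_ball_zero_iff] at hh
  simp only [zero_add, hf0, sub_zero]
  have h2 : Tendsto (fun n => ‖f h - c n • f ((c n)⁻¹ • h)‖) atTop (𝓝 ‖f h - l h‖) :=
    ((hl h).const_sub _).norm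
  refine le_of_tendsto h2 ?_
  filter_upwards [hsmall h δ hδ] with n hn
  have e : c n • (c n)⁻¹ • h = h := smul_inv_smul₀ (hc n).ne' h
  have h3 := h1 ((c n)⁻¹ • h) (c n) hn (by rwa [e])
  rw [e, norm_smul, norm_inv, Real.norm_eq_abs, abs_of_pos (hc n)] at h3
  refine h3.trans (le_of_eq ?_)
  have := (hc n).ne'
  field_simp

/-- A family of curves that start linearly in `h` and satisfy a linear differential equation
approximately is, at time `1`, differentiable in `h`. The linear equation need not be solved. -/
theorem hasFDerivAt_zero_of_approx_linear_ode [FiniteDimensional ℝ H] [CompleteSpace W]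
    {ζ : H → ℝ → W} {A : ℝ → W →L[ℝ] W} {C : ℝ} (hA : ∀ u ∈ Icc (0 : ℝ) 1, ‖A u‖ ≤ C)
    (ι : H →L[ℝ] W) {r : ℝ} (hr : 0 < r) (h₀ : ∀ h, ‖h‖ < r → ζ h 0 = ι h)
    (hζ : ∀ ε > 0, ∃ δ > 0, ∀ h, ‖h‖ < δ → ∀ u ∈ Icc (0 : ℝ) 1, ∃ ζ',
      HasDerivWithinAt (ζ h) ζ' (Icc 0 1) u ∧ ‖ζ' - A u (ζ h u)‖ ≤ ε * ‖h‖) :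
    ∃ L : H →L[ℝ] W, HasFDerivAt (fun h => ζ h 1) L 0 := by
  have hC : 0 ≤ C := (norm_nonneg _).trans (hA 0 (by simp))
  apply hasFDerivAt_zero_of_approx_linear
  intro ε hε
  obtain ⟨δ, hδ, h1⟩ := hζ (ε * Real.exp (-(C + 1))) (by positivity)
  refine ⟨min δ r, lt_min hδ hr, fun h k a b hh hk hhk => ?_⟩
  set ε' := ε * Real.exp (-(C + 1)) with hε'
  choose! d₁ hd₁ hd₁' using h1 h (hh.trans_le (min_le_left _ _))
  choose! d₂ hd₂ hd₂' using h1 k (hk.trans_le (min_le_left _ _))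
  choose! d₃ hd₃ hd₃' using h1 _ (hhk.trans_le (min_le_left _ _))
  have hmain := norm_le_of_norm_deriv_le (ζ := fun u => ζ (a • h + b • k) u -
      (a • ζ h u + b • ζ k u)) (ζ' := fun u => d₃ u - (a • d₁ u + b • d₂ u)) (a := 1) (C := C)
      (d := 0) (e := ε' * (‖a • h + b • k‖ + |a| * ‖h‖ + |b| * ‖k‖)) le_rfl hC (by positivity)
      (fun u hu => (hd₃ u hu).sub (((hd₁ u hu).const_smul a).add ((hd₂ u hu).const_smul b)))
      (by
        rw [h₀ h (hh.trans_le (min_le_right _ _)), h₀ k (hk.trans_le (min_le_right _ _)),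
          h₀ _ (hhk.trans_le (min_le_right _ _))]
        simp)
      (fun u hu => by
        have e : d₃ u - (a • d₁ u + b • d₂ u) =
            A u (ζ (a • h + b • k) u - (a • ζ h u + b • ζ k u)) +
            ((d₃ u - A u (ζ (a • h + b • k) u)) - (a • (d₁ u - A u (ζ h u)) +
              b • (d₂ u - A u (ζ k u)))) := by
          simp only [map_sub, map_add, map_smul, smul_sub]; abel
        rw [e]
        refine (norm_add_le _ _).trans (add_le_add ?_ ?_)
        · exact ((A u).le_opNorm _).trans (by gcongr; exact hA u hu)
        · refine (norm_sub_le _ _).trans ?_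
          refine (add_le_add le_rfl (norm_add_le _ _)).trans ?_
          rw [norm_smul, norm_smul, Real.norm_eq_abs, Real.norm_eq_abs]
          have e1 := hd₁' u hu
          have e2 := hd₂' u hu
          have e3 := hd₃' u hu
          nlinarith [mul_le_mul_of_nonneg_left e1 (abs_nonneg a),
            mul_le_mul_of_nonneg_left e2 (abs_nonneg b)]) 1 (by simp)
  refine hmain.trans (le_of_eq ?_)
  rw [hε', zero_add, mul_right_comm, mul_assoc ε, ← Real.exp_add, neg_add_cancel, Real.exp_zero,
    mul_one]

end ApproxLinear

/-! ### Newton's iteration for a map close to a multiple of the identity -/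

section Newton

variable {F : Type*} [NormedAddCommGroup F] [NormedSpace ℝ F]

/-- A map that is close to `Δ` times the identity is injective, with a Lipschitz inverse. -/
theorem injOn_of_approx {X : F → F} {B : Set F} {Δ ε : ℝ} (hΔ : 0 < Δ)
    (hX : ∀ V ∈ B, ∀ V' ∈ B, ‖X V' - X V - Δ • (V' - V)‖ ≤ ε * Δ * ‖V' - V‖)
    {V V' : F} (hV : V ∈ B) (hV' : V' ∈ B) :
    (1 - ε) * Δ * ‖V' - V‖ ≤ ‖X V' - X V‖ := by
  have h1 := hX V hV V' hV'
  have h2 : Δ * ‖V' - V‖ ≤ ‖X V' - X V‖ + ‖X V' - X V - Δ • (V' - V)‖ := by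
    have e : Δ • (V' - V) = (X V' - X V) - (X V' - X V - Δ • (V' - V)) := by abel
    have h3 : ‖Δ • (V' - V)‖ = Δ * ‖V' - V‖ := by
      rw [norm_smul, Real.norm_eq_abs, abs_of_pos hΔ]
    rw [← h3]
    nth_rewrite 1 [e]
    exact norm_sub_le _ _
  nlinarith

/-- A map that is close to `Δ` times the identity attains all values close to `X V₀`: the simplified
Newton map `V ↦ V - Δ⁻¹ (X V - Y)` is a contraction. -/
theorem exists_zero_of_approx [CompleteSpace F] {X : F → F} {V₀ Y : F} {ρ Δ ε : ℝ} (hρ : 0 < ρ)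
    (hΔ : 0 < Δ) (hε₀ : 0 ≤ ε) (hε : ε ≤ 1 / 8)
    (hX : ∀ V ∈ ball V₀ ρ, ∀ V' ∈ ball V₀ ρ, ‖X V' - X V - Δ • (V' - V)‖ ≤ ε * Δ * ‖V' - V‖)
    (hY : ‖Y - X V₀‖ ≤ ρ / 8 * Δ) :
    ∃ V ∈ closedBall V₀ (ρ / 4), X V = Y := by
  let N : F → F := fun V => V - Δ⁻¹ • (X V - Y)
  have hsub : closedBall V₀ (ρ / 4) ⊆ ball V₀ ρ := closedBall_subset_ball (by linarith)
  have hN : ∀ V ∈ ball V₀ ρ, ∀ V' ∈ ball V₀ ρ, ‖N V' - N V‖ ≤ ε * ‖V' - V‖ := by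
    intro V hV V' hV'
    have e : N V' - N V = -(Δ⁻¹ • (X V' - X V - Δ • (V' - V))) := by
      simp only [N, smul_sub, smul_smul, inv_mul_cancel₀ hΔ.ne', one_smul]; abel
    rw [e, norm_neg, norm_smul, norm_inv, Real.norm_eq_abs, abs_of_pos hΔ, inv_mul_le_iff₀ hΔ]
    exact (hX V hV V' hV').trans (le_of_eq (by ring))
  have h₀ : ‖N V₀ - V₀‖ ≤ ρ / 8 := by
    have e : N V₀ - V₀ = Δ⁻¹ • (Y - X V₀) := by simp only [N, smul_sub]; abel
    rw [e, norm_smul, norm_inv, Real.norm_eq_abs, abs_of_pos hΔ, inv_mul_le_iff₀ hΔ]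
    linarith
  have hmaps : MapsTo N (closedBall V₀ (ρ / 4)) (closedBall V₀ (ρ / 4)) := by
    intro V hV
    have h1 := hN V₀ (mem_ball_self hρ) V (hsub hV)
    rw [mem_closedBall, dist_eq_norm] at hV ⊢
    have h2 := norm_add_le (N V - N V₀) (N V₀ - V₀)
    rw [sub_add_sub_cancel] at h2
    nlinarith [norm_nonneg (V - V₀)]
  have hcontr : ContractingWith (1 / 8) (hmaps.restrict N _ _) := by
    refine ⟨?_, LipschitzWith.of_dist_le_mul fun V V' => ?_⟩
    · rw [← NNReal.coe_lt_coe]; norm_num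
    · rw [Subtype.dist_eq, Subtype.dist_eq, dist_eq_norm, dist_eq_norm]
      refine (hN V' (hsub V'.2) V (hsub V.2)).trans ?_
      have : ((1 / 8 : NNReal) : ℝ) = 1 / 8 := by norm_num
      rw [this]
      gcongr
  obtain ⟨V, hV, hfix, -⟩ := hcontr.exists_fixedPoint' isClosed_closedBall.isComplete hmaps
    (mem_closedBall_self (by positivity)) (edist_ne_top _ _)
  refine ⟨V, hV, ?_⟩
  have h3 : Δ⁻¹ • (X V - Y) = 0 := by
    have : V - Δ⁻¹ • (X V - Y) = V := hfix
    simpa using this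
  exact sub_eq_zero.1 ((smul_eq_zero.1 h3).resolve_left (inv_pos.2 hΔ).ne')

/-- A linear map close to `Δ` times the identity is invertible, by the Neumann series. -/
theorem exists_equiv_of_close [CompleteSpace F] {A : F →L[ℝ] F} {Δ ε : ℝ} (hΔ : 0 < Δ)
    (hε : ε < 1) (hA : ‖A - Δ • ContinuousLinearMap.id ℝ F‖ ≤ ε * Δ) :
    ∃ J : F ≃L[ℝ] F, (J : F →L[ℝ] F) = A ∧ ‖(J.symm : F →L[ℝ] F)‖ ≤ 1 / ((1 - ε) * Δ) := by
  have hlow : ∀ x, (1 - ε) * Δ * ‖x‖ ≤ ‖A x‖ := by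
    intro x
    have h1 := (A - Δ • ContinuousLinearMap.id ℝ F).le_opNorm x
    have h2 : ‖Δ • x‖ ≤ ‖A x‖ + ‖A x - Δ • x‖ := by
      have := norm_sub_le (A x) (A x - Δ • x)
      rwa [sub_sub_cancel] at this
    rw [norm_smul, Real.norm_eq_abs, abs_of_pos hΔ] at h2
    have h3 : ‖A x - Δ • x‖ ≤ ε * Δ * ‖x‖ := h1.trans (by gcongr)
    linarith
  have hT : ‖1 - Δ⁻¹ • A‖ < 1 := by
    have e : (1 : F →L[ℝ] F) - Δ⁻¹ • A = -(Δ⁻¹ • (A - Δ • ContinuousLinearMap.id ℝ F)) := by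
      rw [smul_sub, smul_smul, inv_mul_cancel₀ hΔ.ne', one_smul]
      exact (neg_sub _ _).symm
    rw [e, norm_neg, norm_smul, norm_inv, Real.norm_eq_abs, abs_of_pos hΔ, inv_mul_lt_iff₀ hΔ]
    nlinarith
  let T : (F →L[ℝ] F)ˣ := Units.oneSub _ hT
  have hTv : (T : F →L[ℝ] F) = Δ⁻¹ • A := by simp [T]
  let J := (ContinuousLinearEquiv.unitsEquiv ℝ F T).trans
    (ContinuousLinearEquiv.smulLeft (Units.mk0 Δ hΔ.ne'))
  have hJ : (J : F →L[ℝ] F) = A := by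
    ext x
    have : (T : F →L[ℝ] F) x = Δ⁻¹ • A x := by rw [hTv]; rfl
    change Δ • (T : F →L[ℝ] F) x = A x
    rw [this, smul_inv_smul₀ hΔ.ne']
  refine ⟨J, hJ, ContinuousLinearMap.opNorm_le_bound _ (by
    have : 0 < 1 - ε := by linarith
    positivity) fun x => ?_⟩
  have h4 := hlow (J.symm x)
  rw [← hJ] at h4
  have h5 : (J : F →L[ℝ] F) (J.symm x) = x := J.apply_symm_apply x
  rw [h5] at h4
  rw [one_div, ← div_eq_inv_mul, le_div_iff₀ (mul_pos (by linarith) hΔ)]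
  change ‖J.symm x‖ * _ ≤ _
  linarith

/-- Each step of Newton's iteration at least halves the distance to the zero: where the map is close
to `Δ` times the identity, so is its derivative, and no continuity of the derivative is needed. -/
theorem newton_iteration {X : F → F} {J : F → F ≃L[ℝ] F} {V₀ Vs : F} {ρ Δ ε : ℝ} (hρ : 0 < ρ)
    (hΔ : 0 < Δ) (hε : ε ≤ 1 / 8)
    (hX : ∀ V ∈ ball V₀ ρ, ∀ V' ∈ ball V₀ ρ, ‖X V' - X V - Δ • (V' - V)‖ ≤ ε * Δ * ‖V' - V‖)
    (hJ : ∀ V ∈ ball V₀ ρ, ‖(J V : F →L[ℝ] F) - Δ • ContinuousLinearMap.id ℝ F‖ ≤ ε * Δ)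
    (hJs : ∀ V ∈ ball V₀ ρ, ‖((J V).symm : F →L[ℝ] F)‖ ≤ 1 / ((1 - ε) * Δ))
    (hVs : Vs ∈ closedBall V₀ (ρ / 4)) {V : ℕ → F} (hV0 : V 0 = V₀)
    (hV : ∀ k, V (k + 1) = V k + (J (V k)).symm (X Vs - X (V k))) :
    (∀ k, V k ∈ ball V₀ ρ) ∧ Tendsto V atTop (𝓝 Vs) := by
  rw [mem_closedBall, dist_eq_norm] at hVs
  have hVsB : Vs ∈ ball V₀ ρ := by rw [mem_ball, dist_eq_norm]; linarith
  have hstep : ∀ W ∈ ball V₀ ρ, ‖W + (J W).symm (X Vs - X W) - Vs‖ ≤ 1 / 2 * ‖W - Vs‖ := by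
    intro W hW
    have e : W + (J W).symm (X Vs - X W) - Vs =
        (J W).symm ((X Vs - X W - Δ • (Vs - W)) -
          ((J W : F →L[ℝ] F) - Δ • ContinuousLinearMap.id ℝ F) (Vs - W)) := by
      have e1 : (X Vs - X W - Δ • (Vs - W)) -
          ((J W : F →L[ℝ] F) - Δ • ContinuousLinearMap.id ℝ F) (Vs - W) =
          (X Vs - X W) - (J W) (Vs - W) := by
        change (X Vs - X W - Δ • (Vs - W)) - ((J W) (Vs - W) - Δ • (Vs - W)) = _
        abel
      rw [e1, map_sub (J W).symm (X Vs - X W), (J W).symm_apply_apply]; abel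
    rw [e]
    have h1 := (((J W).symm : F →L[ℝ] F)).le_opNorm ((X Vs - X W - Δ • (Vs - W)) -
          ((J W : F →L[ℝ] F) - Δ • ContinuousLinearMap.id ℝ F) (Vs - W))
    have h2 := norm_sub_le (X Vs - X W - Δ • (Vs - W))
      (((J W : F →L[ℝ] F) - Δ • ContinuousLinearMap.id ℝ F) (Vs - W))
    have h3 := hX W hW Vs hVsB
    have h4 := (((J W : F →L[ℝ] F) - Δ • ContinuousLinearMap.id ℝ F)).le_of_opNorm_le
      (hJ W hW) (Vs - W)
    have hs : 0 < 1 - ε := by linarith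
    have h5 : ‖(X Vs - X W - Δ • (Vs - W)) -
        ((J W : F →L[ℝ] F) - Δ • ContinuousLinearMap.id ℝ F) (Vs - W)‖ ≤
        2 * (ε * Δ * ‖Vs - W‖) := by linarith
    refine h1.trans ((mul_le_mul (hJs W hW) h5 (norm_nonneg _) (by positivity)).trans ?_)
    rw [norm_sub_rev W Vs, one_div, inv_mul_le_iff₀ (by positivity)]
    nlinarith [mul_nonneg hΔ.le (norm_nonneg (Vs - W))]
  have hk : ∀ k, V k ∈ ball V₀ ρ ∧ ‖V k - Vs‖ ≤ (1 / 2) ^ k * ‖V₀ - Vs‖ := by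
    intro k
    induction k with
    | zero => simpa [hV0] using hρ
    | succ k ih =>
      have h1 := hstep (V k) ih.1
      rw [← hV] at h1
      have h2 : ‖V (k + 1) - Vs‖ ≤ (1 / 2) ^ (k + 1) * ‖V₀ - Vs‖ := by
        rw [pow_succ]; nlinarith [ih.2]
      refine ⟨?_, h2⟩
      have h3 : ((1 : ℝ) / 2) ^ (k + 1) ≤ 1 := pow_le_one₀ (by norm_num) (by norm_num)
      have h4 := norm_add_le (V (k + 1) - Vs) (Vs - V₀)
      rw [sub_add_sub_cancel] at h4
      rw [mem_ball, dist_eq_norm]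
      rw [norm_sub_rev V₀ Vs] at h2
      nlinarith [norm_nonneg (Vs - V₀)]
  refine ⟨fun k => (hk k).1, ?_⟩
  rw [tendsto_iff_norm_sub_tendsto_zero]
  have h5 : Tendsto (fun k => ((1 : ℝ) / 2) ^ k * ‖V₀ - Vs‖) atTop (𝓝 0) := by
    simpa using (tendsto_pow_atTop_nhds_zero_of_lt_one (by norm_num : (0 : ℝ) ≤ 1 / 2)
      (by norm_num)).mul_const ‖V₀ - Vs‖
  exact squeeze_zero (fun _ => norm_nonneg _) (fun k => (hk k).2) h5

end Newton

/-! ### Points in light-cone with a subluminal curve -/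

theorem hasFDerivAt_norm_of_ne {z : E} (hz : z ≠ 0) :
    HasFDerivAt (fun z : E => ‖z‖) (innerSL ℝ (‖z‖⁻¹ • z)) z := by
  have h1 := ((hasStrictFDerivAt_norm_sq z).hasFDerivAt).sqrt (by simpa using hz)
  have e : (fun y : E => Real.sqrt (‖y‖ ^ 2)) = fun y => ‖y‖ := by
    funext y; exact Real.sqrt_sq (norm_nonneg y)
  rw [e] at h1
  have e2 : innerSL ℝ (‖z‖⁻¹ • z) = (1 / (2 * Real.sqrt (‖z‖ ^ 2))) • 2 • innerSL ℝ z := by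
    have : ‖z‖ ≠ 0 := norm_ne_zero_iff.2 hz
    rw [Real.sqrt_sq (norm_nonneg z)]
    ext y
    simp only [innerSL_apply_apply, inner_smul_left, _root_.smul_apply, smul_eq_mul, nsmul_eq_mul,
      conj_trivial]
    push_cast
    field_simp
  rw [e2]
  exact h1

theorem norm_nvec {x y : E} (h : x ≠ y) : ‖nvec x y‖ = 1 := by
  rw [nvec, norm_smul, norm_inv, norm_norm, inv_mul_cancel₀ (norm_ne_zero_iff.2 (sub_ne_zero.2 h))]

theorem norm_nvec_le (x y : E) : ‖nvec x y‖ ≤ 1 := by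
  by_cases h : x = y
  · simp [nvec, h]
  · exact (norm_nvec h).le

theorem abs_inner_nvec_le (x y v : E) : |inner ℝ (nvec x y) v| ≤ ‖v‖ :=
  (abs_real_inner_le_norm _ _).trans (by nlinarith [norm_nvec_le x y, norm_nonneg v])

theorem hasDerivWithinAt_norm_sub {I : Set ℝ} {x y : ℝ → E} {x' y' : E} {t : ℝ}
    (hx : HasDerivWithinAt x x' I t) (hy : HasDerivWithinAt y y' I t) (hne : x t ≠ y t) :
    HasDerivWithinAt (fun t => ‖x t - y t‖) (inner ℝ (nvec (x t) (y t)) (x' - y')) I t :=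
  (hasFDerivAt_norm_of_ne (sub_ne_zero.2 hne)).comp_hasDerivWithinAt (f := fun t => x t - y t) t
    (hx.sub hy)

/-- The time `s` at which a subluminal curve `k` meets the half light-cone of the event `(θ, x)` is
a Lipschitz function of the event. The sign `sg` is `-1` for the past and `1` for the future. -/
theorem lightcone_lipschitz {k : ℝ → E} {ν sg θ θ' s s' : ℝ} {x x' : E} (hsg : |sg| = 1)
    (hk : ∀ a b, ‖k a - k b‖ ≤ ν * |a - b|)
    (h : sg * (s - θ) = ‖x - k s‖) (h' : sg * (s' - θ') = ‖x' - k s'‖) :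
    (1 - ν) * |s' - s| ≤ |θ' - θ| + ‖x' - x‖ := by
  have h1 : |s' - s| = |sg * (s' - s)| := by rw [abs_mul, hsg, one_mul]
  have h2 : sg * (s' - s) = sg * (θ' - θ) + (‖x' - k s'‖ - ‖x - k s‖) := by
    rw [← h, ← h']; ring
  have h3 : |‖x' - k s'‖ - ‖x - k s‖| ≤ ‖x' - x‖ + ν * |s' - s| := by
    refine (abs_norm_sub_norm_le _ _).trans ?_
    have e : x' - k s' - (x - k s) = (x' - x) - (k s' - k s) := by abel
    rw [e]
    exact (norm_sub_le _ _).trans (add_le_add le_rfl (hk _ _))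
  have h4 : |sg * (θ' - θ)| = |θ' - θ| := by rw [abs_mul, hsg, one_mul]
  have h5 := abs_add_le (sg * (θ' - θ)) (‖x' - k s'‖ - ‖x - k s‖)
  rw [← h2] at h5
  linarith

/-- A subluminal curve meets a half light-cone at most once. -/
theorem lightcone_unique {k : ℝ → E} {ν sg θ s s' : ℝ} {x : E} (hsg : |sg| = 1) (hν : ν < 1)
    (hk : ∀ a b, ‖k a - k b‖ ≤ ν * |a - b|)
    (h : sg * (s - θ) = ‖x - k s‖) (h' : sg * (s' - θ) = ‖x - k s'‖) : s = s' := by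
  have := lightcone_lipschitz hsg hk h h'
  simp only [sub_self, abs_zero, norm_zero, add_zero] at this
  have h2 : |s' - s| ≤ 0 := by nlinarith [abs_nonneg (s' - s)]
  have := abs_nonpos_iff.1 h2
  linarith

/-- The time at which a subluminal curve is in light-cone with a moving point is differentiable. -/
theorem hasDerivWithinAt_lightcone {I : Set ℝ} {x : ℝ → E} {θ s : ℝ → ℝ} {k w : ℝ → E}
    {ν sg θ' t : ℝ} {x' : E} (hsg : |sg| = 1) (hν : ν < 1)
    (hkL : ∀ a b, ‖k a - k b‖ ≤ ν * |a - b|) (hk : HasDerivAt k (w (s t)) (s t))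
    (hw : ‖w (s t)‖ ≤ ν)
    (h : ∀ t ∈ I, sg * (s t - θ t) = ‖x t - k (s t)‖) (ht : t ∈ I)
    (hθ : HasDerivWithinAt θ θ' I t) (hx : HasDerivWithinAt x x' I t) (hne : x t ≠ k (s t)) :
    HasDerivWithinAt s ((θ' + sg * inner ℝ (nvec (x t) (k (s t))) x') /
      (1 + sg * inner ℝ (nvec (x t) (k (s t))) (w (s t)))) I t := by
  set n := nvec (x t) (k (s t)) with hn
  have hsq : sg * sg = 1 := by rw [← abs_mul_abs_self, hsg, one_mul]
  have hden : 0 < 1 + sg * inner ℝ n (w (s t)) := by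
    have h1 : |sg * inner ℝ n (w (s t))| ≤ ν := by
      rw [abs_mul, hsg, one_mul]
      exact (abs_inner_nvec_le _ _ _).trans hw
    linarith [neg_abs_le (sg * inner ℝ n (w (s t)))]
  have hs : (fun τ => s τ - s t) =O[𝓝[I] t] fun τ => τ - t := by
    have h1 := (hθ.hasFDerivWithinAt.isBigO_sub.norm_left.add
      hx.hasFDerivWithinAt.isBigO_sub.norm_left)
    refine Asymptotics.IsBigO.trans ?_ h1
    refine Asymptotics.IsBigO.of_bound (1 / (1 - ν)) ?_
    filter_upwards [self_mem_nhdsWithin] with τ hτ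
    have h2 := lightcone_lipschitz hsg hkL (h t ht) (h τ hτ)
    rw [Real.norm_eq_abs, Real.norm_eq_abs, one_div, ← div_eq_inv_mul, le_div_iff₀ (by linarith),
      mul_comm]
    exact h2.trans (le_abs_self _)
  have hsc : Tendsto s (𝓝[I] t) (𝓝 (s t)) := by
    have h1 : Tendsto (fun τ : ℝ => τ - t) (𝓝[I] t) (𝓝 0) := by
      have : Tendsto (fun τ : ℝ => τ - t) (𝓝 t) (𝓝 (t - t)) := tendsto_id.sub_const t
      rw [sub_self] at this
      exact this.mono_left nhdsWithin_le_nhds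
    have h2 := (hs.trans_tendsto h1).add_const (s t)
    simpa using h2
  have hko : (fun τ => k (s τ) - k (s t) - (s τ - s t) • w (s t)) =o[𝓝[I] t] fun τ => τ - t :=
    ((hasDerivAt_iff_isLittleO.1 hk).comp_tendsto hsc).trans_isBigO hs
  have hxo := hasDerivWithinAt_iff_isLittleO.1 hx
  have hθo := hasDerivWithinAt_iff_isLittleO.1 hθ
  -- the vector from the curve to the moving point
  let z : ℝ → E := fun τ => x τ - k (s τ)
  have hzo : (fun τ => z τ - z t - ((τ - t) • x' - (s τ - s t) • w (s t))) =o[𝓝[I] t]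
      fun τ => τ - t := (hxo.sub hko).congr_left fun τ => by simp only [z]; abel
  have hzO : (fun τ => z τ - z t) =O[𝓝[I] t] fun τ => τ - t := by
    have h1 : (fun τ => (τ - t) • x' - (s τ - s t) • w (s t)) =O[𝓝[I] t] fun τ => τ - t := by
      refine Asymptotics.IsBigO.sub ?_ ?_
      · exact Asymptotics.IsBigO.of_bound ‖x'‖ (Eventually.of_forall fun τ => by
          rw [norm_smul, mul_comm])
      · refine Asymptotics.IsBigO.trans (Asymptotics.IsBigO.of_bound ‖w (s t)‖
          (Eventually.of_forall fun τ => by rw [norm_smul, mul_comm])) hs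
    exact (hzo.isBigO.add h1).congr_left fun τ => by abel
  have hzc : Tendsto z (𝓝[I] t) (𝓝 (z t)) :=
    hx.continuousWithinAt.tendsto.sub (hk.continuousAt.tendsto.comp hsc)
  have hno : (fun τ => ‖z τ‖ - ‖z t‖ - inner ℝ n (z τ - z t)) =o[𝓝[I] t] fun τ => τ - t := by
    have h1 := (hasFDerivAt_iff_isLittleO.1
      (hasFDerivAt_norm_of_ne (sub_ne_zero.2 hne))).comp_tendsto hzc
    exact h1.trans_isBigO hzO
  have hzi : (fun τ => inner ℝ n (z τ - z t - ((τ - t) • x' - (s τ - s t) • w (s t))))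
      =o[𝓝[I] t] fun τ => τ - t := by
    refine Asymptotics.IsBigO.trans_isLittleO ?_ hzo
    exact Asymptotics.IsBigO.of_bound ‖n‖ (Eventually.of_forall fun τ => norm_inner_le_norm _ _)
  have hfin := ((hno.add hzi).const_mul_left sg).add hθo
  rw [hasDerivWithinAt_iff_isLittleO]
  have hfin2 := hfin.const_mul_left ((1 + sg * inner ℝ n (w (s t)))⁻¹)
  refine hfin2.congr' ?_ EventuallyEq.rfl
  filter_upwards [self_mem_nhdsWithin] with τ hτ
  have e1 : ‖z τ‖ = sg * (s τ - θ τ) := (h τ hτ).symm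
  have e2 : ‖z t‖ = sg * (s t - θ t) := (h t ht).symm
  simp only [e1, e2, inner_sub_right, inner_smul_right, smul_eq_mul]
  field_simp
  linear_combination ((s τ - θ τ) - (s t - θ t)) * hsq

/-! ### The forces as functions of differences of positions -/

/-- The direction of `d`. -/
def nv (d : E) : E := ‖d‖⁻¹ • d

/-- `forceMatrix` as a function of `d = x - y`. -/
def forceKer (e sg : ℝ) (d v : E) : E →L[ℝ] E :=
  (e / 2) • (kappa sg (nv d) v • ContinuousLinearMap.id ℝ E -
    sg • (innerSL ℝ v).smulRight (uvec sg (nv d) v))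

/-- `radMatrix` as a function of `d = x - y`. -/
def radKer (e sg : ℝ) (d w : E) : E →L[ℝ] E :=
  (e / (kappa sg (nv d) w ^ 3 * ‖d‖)) •
    ((innerSL ℝ (nv d)).smulRight (uvec sg (nv d) w) -
      kappa sg (nv d) w • ContinuousLinearMap.id ℝ E)

/-- `nearField` as a function of `d = x - y`. -/
def nearKer (e sg : ℝ) (d w : E) : E :=
  (e / (gamma w ^ 2 * kappa sg (nv d) w ^ 3 * ‖d‖ ^ 2)) • uvec sg (nv d) w

theorem forceMatrix_eq (e sg : ℝ) (x v y : E) :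
    forceMatrix e sg x v y = forceKer e sg (x - y) v := rfl

theorem radMatrix_eq (e sg : ℝ) (x y w : E) : radMatrix e sg x y w = radKer e sg (x - y) w := rfl

theorem nearField_eq (e sg : ℝ) (x y w : E) : nearField e sg x y w = nearKer e sg (x - y) w := rfl

section Scaling

variable {r : ℝ}

theorem nv_smul (hr : 0 < r) (d : E) : nv (r • d) = nv d := by
  rw [nv, nv, norm_smul, smul_smul, Real.norm_eq_abs, abs_of_pos hr, mul_inv, mul_right_comm,
    inv_mul_cancel₀ hr.ne', one_mul]

theorem forceKer_smul (hr : 0 < r) (e sg : ℝ) (d v : E) : forceKer e sg (r • d) v = forceKer e sg d v := by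
  rw [forceKer, forceKer, nv_smul hr]

theorem radKer_smul (hr : 0 < r) (e sg : ℝ) (d w : E) : radKer e sg (r • d) w = r⁻¹ • radKer e sg d w := by
  rw [radKer, radKer, nv_smul hr, smul_smul, norm_smul, Real.norm_eq_abs, abs_of_pos hr]
  congr 1
  simp only [div_eq_mul_inv, mul_inv]
  ring

theorem nearKer_smul (hr : 0 < r) (e sg : ℝ) (d w : E) :
    nearKer e sg (r • d) w = (r⁻¹ * r⁻¹) • nearKer e sg d w := by
  rw [nearKer, nearKer, nv_smul hr, smul_smul, norm_smul, Real.norm_eq_abs, abs_of_pos hr]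
  congr 1
  field_simp

end Scaling

section Smooth

variable {X : Type*} [NormedAddCommGroup X] [NormedSpace ℝ X] {d v : X → E} {x : X}

theorem contDiffAt_nv (hd : ContDiffAt ℝ 1 d x) (h : d x ≠ 0) :
    ContDiffAt ℝ 1 (fun x => nv (d x)) x :=
  ((hd.norm ℝ h).inv (norm_ne_zero_iff.2 h)).smul hd

theorem contDiffAt_kappa {sg : ℝ} (hd : ContDiffAt ℝ 1 d x) (hv : ContDiffAt ℝ 1 v x) :
    ContDiffAt ℝ 1 (fun x => kappa sg (d x) (v x)) x :=
  contDiffAt_const.add (contDiffAt_const.mul (hv.inner ℝ hd))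

theorem contDiffAt_uvec {sg : ℝ} (hd : ContDiffAt ℝ 1 d x) (hv : ContDiffAt ℝ 1 v x) :
    ContDiffAt ℝ 1 (fun x => uvec sg (d x) (v x)) x := by
  unfold uvec
  fun_prop

theorem contDiffAt_gamma (hv : ContDiffAt ℝ 1 v x) (h : ‖v x‖ < 1) :
    ContDiffAt ℝ 1 (fun x => gamma (v x)) x := by
  have h1 : 0 < 1 - ‖v x‖ ^ 2 := by nlinarith [norm_nonneg (v x)]
  exact ((contDiffAt_const.sub (hv.norm_sq ℝ)).sqrt h1.ne').inv (Real.sqrt_ne_zero'.2 h1)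

theorem contDiffAt_smulRight {a b : X → E} (ha : ContDiffAt ℝ 1 a x) (hb : ContDiffAt ℝ 1 b x) :
    ContDiffAt ℝ 1 (fun x => (innerSL ℝ (a x)).smulRight (b x)) x := by
  have h1 : ContDiffAt ℝ 1 (fun x => innerSL ℝ (a x)) x :=
    (innerSL ℝ : E →L[ℝ] _).contDiff.contDiffAt.comp x ha
  exact h1.smulRight hb

theorem contDiffAt_forceKer {e sg : ℝ} (hd : ContDiffAt ℝ 1 d x) (hv : ContDiffAt ℝ 1 v x)
    (h : d x ≠ 0) : ContDiffAt ℝ 1 (fun x => forceKer e sg (d x) (v x)) x := by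
  have hn := contDiffAt_nv hd h
  have h1 := contDiffAt_kappa (sg := sg) hn hv
  have h2 := contDiffAt_smulRight hv (contDiffAt_uvec (sg := sg) hn hv)
  unfold forceKer
  fun_prop

theorem norm_nv_le (d : E) : ‖nv d‖ ≤ 1 := by
  have := norm_nvec_le d 0
  rwa [nvec, sub_zero] at this

theorem kappa_pos {sg : ℝ} (hsg : |sg| = 1) (d : E) {w : E} (hw : ‖w‖ < 1) :
    0 < kappa sg (nv d) w := by
  have h1 : |sg * inner ℝ w (nv d)| < 1 := by
    rw [abs_mul, hsg, one_mul]
    exact (abs_real_inner_le_norm _ _).trans_lt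
      (by nlinarith [norm_nv_le d, norm_nonneg w, norm_nonneg (nv d)])
  rw [kappa]
  linarith [neg_abs_le (sg * inner ℝ w (nv d))]

theorem gamma_pos {w : E} (hw : ‖w‖ < 1) : 0 < gamma w := by
  have h1 : 0 < 1 - ‖w‖ ^ 2 := by nlinarith [norm_nonneg w]
  exact inv_pos.2 (Real.sqrt_pos.2 h1)

theorem one_le_gamma {w : E} (hw : ‖w‖ < 1) : 1 ≤ gamma w := by
  have h1 : 0 < 1 - ‖w‖ ^ 2 := by nlinarith [norm_nonneg w]
  rw [gamma, one_le_inv₀ (Real.sqrt_pos.2 h1)]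
  exact Real.sqrt_le_one.2 (by nlinarith [norm_nonneg w])

theorem contDiffAt_radKer {e sg : ℝ} (hsg : |sg| = 1) (hd : ContDiffAt ℝ 1 d x)
    (hv : ContDiffAt ℝ 1 v x) (h : d x ≠ 0) (hv1 : ‖v x‖ < 1) :
    ContDiffAt ℝ 1 (fun x => radKer e sg (d x) (v x)) x := by
  have hn := contDiffAt_nv hd h
  have hk := contDiffAt_kappa (sg := sg) hn hv
  refine (contDiffAt_const.div ((hk.pow 3).mul (hd.norm ℝ h)) ?_).smul
    ((contDiffAt_smulRight hn (contDiffAt_uvec hn hv)).sub (hk.smul contDiffAt_const))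
  exact mul_ne_zero (pow_ne_zero _ (kappa_pos hsg _ hv1).ne') (norm_ne_zero_iff.2 h)

theorem contDiffAt_nearKer {e sg : ℝ} (hsg : |sg| = 1) (hd : ContDiffAt ℝ 1 d x)
    (hv : ContDiffAt ℝ 1 v x) (h : d x ≠ 0) (hv1 : ‖v x‖ < 1) :
    ContDiffAt ℝ 1 (fun x => nearKer e sg (d x) (v x)) x := by
  have hn := contDiffAt_nv hd h
  have hk := contDiffAt_kappa (sg := sg) hn hv
  refine (contDiffAt_const.div ((((contDiffAt_gamma hv hv1).pow 2).mul (hk.pow 3)).mul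
    ((hd.norm ℝ h).pow 2)) ?_).smul (contDiffAt_uvec hn hv)
  exact mul_ne_zero (mul_ne_zero (pow_ne_zero _ (gamma_pos hv1).ne')
    (pow_ne_zero _ (kappa_pos hsg _ hv1).ne')) (pow_ne_zero _ (norm_ne_zero_iff.2 h))

end Smooth

/-! ### The rescaled equations -/

/-- The variables on which the rescaled equations depend: the coupling `g = 1 / r`, the three
differences of positions of interacting points (both running particles, particle 1 and past
segment, particle 2 and future segment), the velocities of the running particles, and those on the
segments. -/
abbrev Vars : Type := ℝ × (E × E × E) × (E × E) × (E × E)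

namespace Vars

variable (m₁ m₂ : ℝ) (q : Vars)

/-- the coupling constant -/
abbrev g (q : Vars) : ℝ := q.1
/-- the difference of positions of the running particles -/
abbrev d (q : Vars) : E := q.2.1.1
/-- the difference of particle 1 and the past segment -/
abbrev d₂ (q : Vars) : E := q.2.1.2.1
/-- the difference of particle 2 and the future segment -/
abbrev d₁ (q : Vars) : E := q.2.1.2.2
/-- the velocity of particle 1 -/
abbrev v₁ (q : Vars) : E := q.2.2.1.1
/-- the velocity of particle 2 -/
abbrev v₂ (q : Vars) : E := q.2.2.1.2
/-- the velocity on the past segment -/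
abbrev w₂ (q : Vars) : E := q.2.2.2.1
/-- the velocity on the future segment -/
abbrev w₁ (q : Vars) : E := q.2.2.2.2

/-- The matrix `A₁₂`, rescaled. -/
def A₁₂ : E →L[ℝ] E := (forceKer e₁ 1 q.d q.v₁).comp (radKer e₂ 1 q.d q.v₂)

/-- The matrix `A₂₁`, rescaled. -/
def A₂₁ : E →L[ℝ] E := (forceKer e₂ (-1) (-q.d) q.v₂).comp (radKer e₁ (-1) (-q.d) q.v₁)

/-- The matrix that multiplies the acceleration on the past segment in the force on particle 1. -/
def D₂ : E →L[ℝ] E := (forceKer e₁ (-1) q.d₂ q.v₁).comp (radKer e₂ (-1) q.d₂ q.w₂)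

/-- The matrix that multiplies the acceleration on the future segment in the force on
particle 2. -/
def D₁ : E →L[ℝ] E := (forceKer e₂ 1 q.d₁ q.v₂).comp (radKer e₁ 1 q.d₁ q.w₁)

/-- The part of the force `F₂` without accelerations, rescaled. -/
def F₂ : E := forceKer e₁ (-1) q.d₂ q.v₁ (nearKer e₂ (-1) q.d₂ q.w₂) +
  forceKer e₁ 1 q.d q.v₁ (nearKer e₂ 1 q.d q.v₂)

/-- The part of the force `F₁` without accelerations, rescaled. -/
def F₁ : E := forceKer e₂ 1 q.d₁ q.v₂ (nearKer e₁ 1 q.d₁ q.w₁) +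
  forceKer e₂ (-1) (-q.d) q.v₂ (nearKer e₁ (-1) (-q.d) q.v₁)

/-- The matrix `M₁ M₂ 1 - A₁₂ A₂₁`, rescaled. -/
def G₁₂ : E →L[ℝ] E :=
  (m₁ * gamma q.v₁ * (m₂ * gamma q.v₂)) • (1 : E →L[ℝ] E) - (q.g * q.g) • (q.A₁₂ * q.A₂₁)

/-- The matrix `M₁ M₂ 1 - A₂₁ A₁₂`, rescaled. -/
def G₂₁ : E →L[ℝ] E :=
  (m₁ * gamma q.v₁ * (m₂ * gamma q.v₂)) • (1 : E →L[ℝ] E) - (q.g * q.g) • (q.A₂₁ * q.A₁₂)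

/-- The factor `λ = dt₂ / dt₁`. -/
def lam : ℝ := (1 + inner ℝ (nv q.d) q.v₁) / (1 + inner ℝ (nv q.d) q.v₂)

/-- The rates `ds / dt` and `dσ / dt` of the delayed and the advanced time. -/
def psi : ℝ × ℝ :=
  ((1 - inner ℝ (nv q.d₂) q.v₁) / (1 - inner ℝ (nv q.d₂) q.w₂),
    q.lam * (1 + inner ℝ (nv q.d₁) q.v₂) / (1 + inner ℝ (nv q.d₁) q.w₁))

/-- The rate of change of both positions. -/
def Lam : E × E := (q.v₁, q.lam • q.v₂)

/-- The part of the rate of change of the velocities, divided by `g`, that does not contain the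
accelerations on the segments. -/
def P : E × E :=
  (Ring.inverse (q.G₁₂ m₁ m₂) (q.g • q.A₁₂ q.F₁ + (m₂ * gamma q.v₂) • q.F₂),
    q.lam • Ring.inverse (q.G₂₁ m₁ m₂) (q.g • q.A₂₁ q.F₂ + (m₁ * gamma q.v₁) • q.F₁))

/-- The matrix that multiplies the acceleration on the past segment in the rate of change of the
velocities, divided by `g`. -/
def N₂ : E →L[ℝ] E × E :=
  (ContinuousLinearMap.inl ℝ E E).comp
      ((Ring.inverse (q.G₁₂ m₁ m₂)).comp ((m₂ * gamma q.v₂) • q.D₂)) +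
    (ContinuousLinearMap.inr ℝ E E).comp
      (q.lam • (Ring.inverse (q.G₂₁ m₁ m₂)).comp (q.g • q.A₂₁.comp q.D₂))

/-- The matrix that multiplies the acceleration on the future segment in the rate of change of the
velocities, divided by `g`. -/
def N₁ : E →L[ℝ] E × E :=
  (ContinuousLinearMap.inl ℝ E E).comp
      ((Ring.inverse (q.G₁₂ m₁ m₂)).comp (q.g • q.A₁₂.comp q.D₁)) +
    (ContinuousLinearMap.inr ℝ E E).comp
      (q.lam • (Ring.inverse (q.G₂₁ m₁ m₂)).comp ((m₁ * gamma q.v₁) • q.D₁))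

/-- The matrix that multiplies the time derivative of the pair `(w₂ (s t), w₁ (σ t))` of velocities
on the segments: a term in the acceleration `b₂ (s t)` is a term in `d/dt w₂ (s t) = b₂ ds/dt`. -/
def M : E × E →L[ℝ] E × E :=
  (q.psi.1)⁻¹ • (q.N₂ m₁ m₂).comp (ContinuousLinearMap.fst ℝ E E) +
    (q.psi.2)⁻¹ • (q.N₁ m₁ m₂).comp (ContinuousLinearMap.snd ℝ E E)

/-- All coefficients of the rescaled equations. They do not contain the accelerations on the
segments and are smooth. -/
def coeff : (E × E) × (E × E) × (E × E →L[ℝ] E × E) × (ℝ × ℝ) :=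
  (q.Lam, q.P m₁ m₂, q.M m₁ m₂, q.psi)

/-- The compact set of variables on which the coefficients are estimated: weak coupling, interacting
points neither too close nor too far, speeds at most `1 / 2`. -/
def tube (g₀ κ : ℝ) : Set Vars :=
  Icc 0 g₀ ×ˢ ((closedBall 0 4 \ ball 0 κ) ×ˢ (closedBall 0 4 \ ball 0 κ) ×ˢ
    (closedBall 0 4 \ ball 0 κ)) ×ˢ (closedBall 0 (1 / 2) ×ˢ closedBall 0 (1 / 2)) ×ˢ
    (closedBall 0 (1 / 2) ×ˢ closedBall 0 (1 / 2))

theorem isCompact_tube (g₀ κ : ℝ) : IsCompact (tube g₀ κ) := by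
  have h : IsCompact (closedBall (0 : E) 4 \ ball 0 κ) := (isCompact_closedBall _ _).diff isOpen_ball
  have h2 : IsCompact (closedBall (0 : E) (1 / 2)) := isCompact_closedBall _ _
  exact isCompact_Icc.prod ((h.prod (h.prod h)).prod ((h2.prod h2).prod (h2.prod h2)))

variable {q}

theorem mem_tube {g₀ κ : ℝ} : q ∈ tube g₀ κ ↔ (0 ≤ q.g ∧ q.g ≤ g₀) ∧
    ((‖q.d‖ ≤ 4 ∧ κ ≤ ‖q.d‖) ∧ (‖q.d₂‖ ≤ 4 ∧ κ ≤ ‖q.d₂‖) ∧ (‖q.d₁‖ ≤ 4 ∧ κ ≤ ‖q.d₁‖)) ∧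
    (‖q.v₁‖ ≤ 1 / 2 ∧ ‖q.v₂‖ ≤ 1 / 2) ∧ (‖q.w₂‖ ≤ 1 / 2 ∧ ‖q.w₁‖ ≤ 1 / 2) := by
  simp only [tube, mem_prod, Set.mem_sdiff, mem_Icc, mem_closedBall_zero_iff, mem_ball_zero_iff, not_lt]

variable {m₁ m₂}

theorem abs_inner_nv_le (d v : E) : |inner ℝ (nv d) v| ≤ ‖v‖ :=
  (abs_real_inner_le_norm _ _).trans (by nlinarith [norm_nv_le d, norm_nonneg v])

theorem lam_pos (h₁ : ‖q.v₁‖ < 1) (h₂ : ‖q.v₂‖ < 1) : 0 < q.lam := by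
  have e1 := abs_le.1 (abs_inner_nv_le q.d q.v₁)
  have e2 := abs_le.1 (abs_inner_nv_le q.d q.v₂)
  exact div_pos (by linarith) (by linarith)

theorem psi_pos (h₁ : ‖q.v₁‖ < 1) (h₂ : ‖q.v₂‖ < 1) (h₃ : ‖q.w₂‖ < 1) (h₄ : ‖q.w₁‖ < 1) :
    0 < q.psi.1 ∧ 0 < q.psi.2 := by
  have e1 := abs_le.1 (abs_inner_nv_le q.d₂ q.v₁)
  have e2 := abs_le.1 (abs_inner_nv_le q.d₂ q.w₂)
  have e3 := abs_le.1 (abs_inner_nv_le q.d₁ q.v₂)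
  have e4 := abs_le.1 (abs_inner_nv_le q.d₁ q.w₁)
  exact ⟨div_pos (by linarith) (by linarith),
    div_pos (mul_pos (lam_pos h₁ h₂) (by linarith)) (by linarith)⟩

/-- Variables at which the coefficients are smooth. -/
structure Regular (m₁ m₂ : ℝ) (q : Vars) : Prop where
  d : q.d ≠ 0
  d₂ : q.d₂ ≠ 0
  d₁ : q.d₁ ≠ 0
  v₁ : ‖q.v₁‖ < 1
  v₂ : ‖q.v₂‖ < 1
  w₂ : ‖q.w₂‖ < 1
  w₁ : ‖q.w₁‖ < 1
  G₁₂ : IsUnit (q.G₁₂ m₁ m₂)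
  G₂₁ : IsUnit (q.G₂₁ m₁ m₂)

section Smooth

theorem contDiffAt_A₁₂ (hd : q.d ≠ 0) (hv₂ : ‖q.v₂‖ < 1) : ContDiffAt ℝ 1 A₁₂ q := by
  have c₁ : ContDiffAt ℝ 1 (fun q : Vars => q.d) q := by fun_prop
  have c₂ : ContDiffAt ℝ 1 (fun q : Vars => q.v₁) q := by fun_prop
  have c₃ : ContDiffAt ℝ 1 (fun q : Vars => q.v₂) q := by fun_prop
  exact (contDiffAt_forceKer (e := e₁) (sg := 1) c₁ c₂ hd).clm_comp
    (contDiffAt_radKer (e := e₂) (sg := 1) (by simp) c₁ c₃ hd hv₂)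

theorem contDiffAt_A₂₁ (hd : q.d ≠ 0) (hv₁ : ‖q.v₁‖ < 1) : ContDiffAt ℝ 1 A₂₁ q := by
  have c₁ : ContDiffAt ℝ 1 (fun q : Vars => -q.d) q := by fun_prop
  have c₂ : ContDiffAt ℝ 1 (fun q : Vars => q.v₁) q := by fun_prop
  have c₃ : ContDiffAt ℝ 1 (fun q : Vars => q.v₂) q := by fun_prop
  have hd' : -q.d ≠ 0 := neg_ne_zero.2 hd
  exact (contDiffAt_forceKer (e := e₂) (sg := -1) c₁ c₃ hd').clm_comp
    (contDiffAt_radKer (e := e₁) (sg := -1) (by simp) c₁ c₂ hd' hv₁)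

theorem contDiffAt_lam (hd : q.d ≠ 0) (hv₂ : ‖q.v₂‖ < 1) : ContDiffAt ℝ 1 lam q := by
  have c₁ : ContDiffAt ℝ 1 (fun q : Vars => q.d) q := by fun_prop
  have c₄ : ContDiffAt ℝ 1 (fun q : Vars => q.v₁) q := by fun_prop
  have c₅ : ContDiffAt ℝ 1 (fun q : Vars => q.v₂) q := by fun_prop
  have n₀ := contDiffAt_nv c₁ hd
  have e1 := abs_le.1 (abs_inner_nv_le q.d q.v₂)
  exact (contDiffAt_const.add (n₀.inner ℝ c₄)).div (contDiffAt_const.add (n₀.inner ℝ c₅))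
    (by linarith)

end Smooth

theorem contDiffAt_coeff (hq : q.Regular m₁ m₂) : ContDiffAt ℝ 1 (coeff m₁ m₂) q := by
  have c₀ : ContDiffAt ℝ 1 (fun q : Vars => q.g) q := by fun_prop
  have c₁ : ContDiffAt ℝ 1 (fun q : Vars => q.d) q := by fun_prop
  have c₂ : ContDiffAt ℝ 1 (fun q : Vars => q.d₂) q := by fun_prop
  have c₃ : ContDiffAt ℝ 1 (fun q : Vars => q.d₁) q := by fun_prop
  have c₄ : ContDiffAt ℝ 1 (fun q : Vars => q.v₁) q := by fun_prop
  have c₅ : ContDiffAt ℝ 1 (fun q : Vars => q.v₂) q := by fun_prop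
  have c₆ : ContDiffAt ℝ 1 (fun q : Vars => q.w₂) q := by fun_prop
  have c₇ : ContDiffAt ℝ 1 (fun q : Vars => q.w₁) q := by fun_prop
  have c₈ : ContDiffAt ℝ 1 (fun q : Vars => -q.d) q := by fun_prop
  have hd : -q.d ≠ 0 := neg_ne_zero.2 hq.d
  have hA₁₂ := contDiffAt_A₁₂ hq.d hq.v₂
  have hA₂₁ := contDiffAt_A₂₁ hq.d hq.v₁
  have k₂ := contDiffAt_forceKer (e := e₁) (sg := -1) c₂ c₄ hq.d₂
  have k₁ := contDiffAt_forceKer (e := e₂) (sg := 1) c₃ c₅ hq.d₁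
  have hD₂ : ContDiffAt ℝ 1 D₂ q :=
    k₂.clm_comp (contDiffAt_radKer (e := e₂) (sg := -1) (by simp) c₂ c₆ hq.d₂ hq.w₂)
  have hD₁ : ContDiffAt ℝ 1 D₁ q :=
    k₁.clm_comp (contDiffAt_radKer (e := e₁) (sg := 1) (by simp) c₃ c₇ hq.d₁ hq.w₁)
  have hF₂ : ContDiffAt ℝ 1 F₂ q :=
    (k₂.clm_apply (contDiffAt_nearKer (e := e₂) (sg := -1) (by simp) c₂ c₆ hq.d₂ hq.w₂)).add
      ((contDiffAt_forceKer (e := e₁) (sg := 1) c₁ c₄ hq.d).clm_apply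
        (contDiffAt_nearKer (e := e₂) (sg := 1) (by simp) c₁ c₅ hq.d hq.v₂))
  have hF₁ : ContDiffAt ℝ 1 F₁ q :=
    (k₁.clm_apply (contDiffAt_nearKer (e := e₁) (sg := 1) (by simp) c₃ c₇ hq.d₁ hq.w₁)).add
      ((contDiffAt_forceKer (e := e₂) (sg := -1) c₈ c₅ hd).clm_apply
        (contDiffAt_nearKer (e := e₁) (sg := -1) (by simp) c₈ c₄ hd hq.v₁))
  have γ₁ := contDiffAt_gamma c₄ hq.v₁
  have γ₂ := contDiffAt_gamma c₅ hq.v₂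
  have μ₁ : ContDiffAt ℝ 1 (fun q : Vars => m₁ * gamma q.v₁) q := contDiffAt_const.mul γ₁
  have μ₂ : ContDiffAt ℝ 1 (fun q : Vars => m₂ * gamma q.v₂) q := contDiffAt_const.mul γ₂
  have hG₁₂ : ContDiffAt ℝ 1 (G₁₂ m₁ m₂) q :=
    ((μ₁.mul μ₂).smul contDiffAt_const).sub ((c₀.mul c₀).smul (hA₁₂.clm_comp hA₂₁))
  have hG₂₁ : ContDiffAt ℝ 1 (G₂₁ m₁ m₂) q :=
    ((μ₁.mul μ₂).smul contDiffAt_const).sub ((c₀.mul c₀).smul (hA₂₁.clm_comp hA₁₂))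
  have hR₁₂ : ContDiffAt ℝ 1 (fun q => Ring.inverse (G₁₂ m₁ m₂ q)) q := by
    obtain ⟨u, hu⟩ := hq.G₁₂
    have := contDiffAt_ringInverse ℝ (n := 1) u
    rw [hu] at this
    exact this.comp q hG₁₂
  have hR₂₁ : ContDiffAt ℝ 1 (fun q => Ring.inverse (G₂₁ m₁ m₂ q)) q := by
    obtain ⟨u, hu⟩ := hq.G₂₁
    have := contDiffAt_ringInverse ℝ (n := 1) u
    rw [hu] at this
    exact this.comp q hG₂₁
  have n₂ := contDiffAt_nv c₂ hq.d₂
  have n₁ := contDiffAt_nv c₃ hq.d₁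
  have e2 := abs_le.1 (abs_inner_nv_le q.d₂ q.w₂)
  have e3 := abs_le.1 (abs_inner_nv_le q.d₁ q.w₁)
  have h2 := hq.w₂
  have h3 := hq.w₁
  have hlam := contDiffAt_lam hq.d hq.v₂
  have hpsi₁ : ContDiffAt ℝ 1 (fun q : Vars => q.psi.1) q :=
    (contDiffAt_const.sub (n₂.inner ℝ c₄)).div (contDiffAt_const.sub (n₂.inner ℝ c₆))
      (by linarith)
  have hpsi₂ : ContDiffAt ℝ 1 (fun q : Vars => q.psi.2) q :=
    (hlam.mul (contDiffAt_const.add (n₁.inner ℝ c₅))).div (contDiffAt_const.add (n₁.inner ℝ c₇))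
      (by linarith)
  have hP : ContDiffAt ℝ 1 (P m₁ m₂) q :=
    (hR₁₂.clm_apply ((c₀.smul (hA₁₂.clm_apply hF₁)).add (μ₂.smul hF₂))).prodMk
      (hlam.smul (hR₂₁.clm_apply ((c₀.smul (hA₂₁.clm_apply hF₂)).add (μ₁.smul hF₁))))
  have hN₂ : ContDiffAt ℝ 1 (N₂ m₁ m₂) q :=
    (contDiffAt_const.clm_comp (hR₁₂.clm_comp (μ₂.smul hD₂))).add
      (contDiffAt_const.clm_comp (hlam.smul (hR₂₁.clm_comp (c₀.smul (hA₂₁.clm_comp hD₂)))))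
  have hN₁ : ContDiffAt ℝ 1 (N₁ m₁ m₂) q :=
    (contDiffAt_const.clm_comp (hR₁₂.clm_comp (c₀.smul (hA₁₂.clm_comp hD₁)))).add
      (contDiffAt_const.clm_comp (hlam.smul (hR₂₁.clm_comp (μ₁.smul hD₁))))
  obtain ⟨p1, p2⟩ := psi_pos hq.v₁ hq.v₂ hq.w₂ hq.w₁
  have hM : ContDiffAt ℝ 1 (M m₁ m₂) q :=
    ((hpsi₁.inv p1.ne').smul (hN₂.clm_comp contDiffAt_const)).add
      ((hpsi₂.inv p2.ne').smul (hN₁.clm_comp contDiffAt_const))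
  exact (c₄.prodMk (hlam.smul c₅)).prodMk (hP.prodMk (hM.prodMk (hpsi₁.prodMk hpsi₂)))

theorem isUnit_smul_one_sub {A : E →L[ℝ] E} {μ : ℝ} (h : ‖A‖ < μ) :
    IsUnit (μ • (1 : E →L[ℝ] E) - A) := by
  have hμ : 0 < μ := (norm_nonneg _).trans_lt h
  have h1 : ‖μ⁻¹ • A‖ < 1 := by
    rw [norm_smul, norm_inv, Real.norm_eq_abs, abs_of_pos hμ, inv_mul_lt_iff₀ hμ, mul_one]
    exact h
  have e : μ • (1 : E →L[ℝ] E) - A = algebraMap ℝ (E →L[ℝ] E) μ * (1 - μ⁻¹ • A) := by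
    rw [← Algebra.smul_def, smul_sub, smul_smul, mul_inv_cancel₀ hμ.ne', one_smul]
  rw [e]
  exact ((IsUnit.mk0 μ hμ.ne').map (algebraMap ℝ (E →L[ℝ] E))).mul
    (isUnit_one_sub_of_norm_lt_one h1)

/-- For weak coupling all variables of the tube are regular. -/
theorem exists_regular_tube (hm₁ : 0 < m₁) (hm₂ : 0 < m₂) {κ : ℝ} (hκ : 0 < κ) :
    ∃ g₀ > 0, g₀ ≤ 1 ∧ ∀ q ∈ tube g₀ κ, q.Regular m₁ m₂ := by
  have hne : ∀ q ∈ tube 1 κ, q.d ≠ 0 ∧ ‖q.v₁‖ < 1 ∧ ‖q.v₂‖ < 1 := by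
    intro q hq
    obtain ⟨-, ⟨⟨-, h1⟩, -⟩, ⟨h2, h3⟩, -⟩ := mem_tube.1 hq
    exact ⟨norm_pos_iff.1 (by linarith), by linarith, by linarith⟩
  have hc₁ : ContinuousOn (fun q : Vars => q.A₁₂ * q.A₂₁) (tube 1 κ) := fun q hq => by
    obtain ⟨h1, h2, h3⟩ := hne q hq
    exact ((contDiffAt_A₁₂ h1 h3).clm_comp
      (contDiffAt_A₂₁ h1 h2)).continuousAt.continuousWithinAt
  have hc₂ : ContinuousOn (fun q : Vars => q.A₂₁ * q.A₁₂) (tube 1 κ) := fun q hq => by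
    obtain ⟨h1, h2, h3⟩ := hne q hq
    exact ((contDiffAt_A₂₁ h1 h2).clm_comp
      (contDiffAt_A₁₂ h1 h3)).continuousAt.continuousWithinAt
  obtain ⟨C₁, hC₁⟩ := (isCompact_tube 1 κ).exists_bound_of_continuousOn hc₁
  obtain ⟨C₂, hC₂⟩ := (isCompact_tube 1 κ).exists_bound_of_continuousOn hc₂
  set C := max 1 (max C₁ C₂) with hC
  have hC1 : 1 ≤ C := le_max_left _ _
  have hmm : 0 < m₁ * m₂ := mul_pos hm₁ hm₂
  refine ⟨min 1 (m₁ * m₂ / (2 * C)), by positivity, min_le_left _ _, fun q hq => ?_⟩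
  set g₀ := min 1 (m₁ * m₂ / (2 * C)) with hg₀
  have hg₁ : g₀ ≤ 1 := min_le_left _ _
  have hg₂ : g₀ * (2 * C) ≤ m₁ * m₂ := (le_div_iff₀ (by positivity)).1 (min_le_right _ _)
  obtain ⟨⟨a1, a2⟩, ⟨⟨-, b1⟩, ⟨-, b2⟩, ⟨-, b3⟩⟩, ⟨c1, c2⟩, c3, c4⟩ := mem_tube.1 hq
  have hq1 : q ∈ tube 1 κ := by
    rw [mem_tube] at hq ⊢
    exact ⟨⟨hq.1.1, hq.1.2.trans hg₁⟩, hq.2⟩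
  have hμ : m₁ * m₂ ≤ m₁ * gamma q.v₁ * (m₂ * gamma q.v₂) := by
    have h1 := one_le_gamma (w := q.v₁) (by linarith)
    have h2 := one_le_gamma (w := q.v₂) (by linarith)
    calc m₁ * m₂ = (m₁ * 1) * (m₂ * 1) := by ring
      _ ≤ _ := by gcongr
  have hsmall : ∀ B : E →L[ℝ] E, ‖B‖ ≤ C →
      ‖(q.g * q.g) • B‖ < m₁ * gamma q.v₁ * (m₂ * gamma q.v₂) := by
    intro B hB
    rw [norm_smul, Real.norm_eq_abs, abs_of_nonneg (mul_nonneg a1 a1)]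
    have h1 : q.g * q.g ≤ g₀ * 1 := mul_le_mul a2 (a2.trans hg₁) a1 (a1.trans a2)
    have h2 : q.g * q.g * ‖B‖ ≤ g₀ * 1 * C := mul_le_mul h1 hB (norm_nonneg _) (by
      have := a1.trans a2; positivity)
    nlinarith
  exact ⟨norm_pos_iff.1 (by linarith), norm_pos_iff.1 (by linarith), norm_pos_iff.1 (by linarith),
    by linarith, by linarith, by linarith, by linarith,
    isUnit_smul_one_sub (hsmall _ ((hC₁ q hq1).trans (by simp [C]))),
    isUnit_smul_one_sub (hsmall _ ((hC₂ q hq1).trans (by simp [C])))⟩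

end Vars

/-! ### Stability of the rescaled flow -/

/-- The rescaled boundary segments, continued to the whole line: positions, velocities and
accelerations on the past segment of particle 2 and on the future segment of particle 1. -/
structure Hist where
  /-- positions on the past segment -/
  k₂ : ℝ → E
  /-- velocities on the past segment -/
  w₂ : ℝ → E
  /-- accelerations on the past segment -/
  b₂ : ℝ → E
  /-- positions on the future segment -/
  k₁ : ℝ → E
  /-- velocities on the future segment -/
  w₁ : ℝ → E
  /-- accelerations on the future segment -/
  b₁ : ℝ → E

section Components

variable {A B : Type*} [NormedAddCommGroup A] [NormedSpace ℝ A] [NormedAddCommGroup B]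
  [NormedSpace ℝ B] {f : ℝ → A × B} {f' : A × B} {I : Set ℝ} {u : ℝ}

theorem hasDerivWithinAt_fst (h : HasDerivWithinAt f f' I u) :
    HasDerivWithinAt (fun u => (f u).1) f'.1 I u :=
  (ContinuousLinearMap.fst ℝ A B).hasFDerivAt.comp_hasDerivWithinAt u h

theorem hasDerivWithinAt_snd (h : HasDerivWithinAt f f' I u) :
    HasDerivWithinAt (fun u => (f u).2) f'.2 I u :=
  (ContinuousLinearMap.snd ℝ A B).hasFDerivAt.comp_hasDerivWithinAt u h

end Components

namespace Hist

/-- The segments are `C²`, with velocities and accelerations bounded by `ν`. -/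
structure IsBounded (k : Hist) (ν : ℝ) : Prop where
  hk₂ : ∀ s, HasDerivAt k.k₂ (k.w₂ s) s
  hw₂ : ∀ s, HasDerivAt k.w₂ (k.b₂ s) s
  hb₂ : Continuous k.b₂
  hk₁ : ∀ s, HasDerivAt k.k₁ (k.w₁ s) s
  hw₁ : ∀ s, HasDerivAt k.w₁ (k.b₁ s) s
  hb₁ : Continuous k.b₁
  norm_w₂ : ∀ s, ‖k.w₂ s‖ ≤ ν
  norm_b₂ : ∀ s, ‖k.b₂ s‖ ≤ ν
  norm_w₁ : ∀ s, ‖k.w₁ s‖ ≤ ν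
  norm_b₁ : ∀ s, ‖k.b₁ s‖ ≤ ν

/-- The positions on both segments at the times `S`. -/
def pos (k : Hist) (S : ℝ × ℝ) : E × E := (k.k₂ S.1, k.k₁ S.2)

/-- The velocities on both segments at the times `S`. -/
def vel (k : Hist) (S : ℝ × ℝ) : E × E := (k.w₂ S.1, k.w₁ S.2)

/-- The derivative of `pos` at `S` in direction `τ`. -/
def dpos (k : Hist) (S τ : ℝ × ℝ) : E × E := (τ.1 • k.w₂ S.1, τ.2 • k.w₁ S.2)

/-- The derivative of `vel` at `S` in direction `τ`. -/
def dvel (k : Hist) (S τ : ℝ × ℝ) : E × E := (τ.1 • k.b₂ S.1, τ.2 • k.b₁ S.2)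

variable {k : Hist} {ν : ℝ}

theorem IsBounded.mono {ν' : ℝ} (hk : k.IsBounded ν) (h : ν ≤ ν') : k.IsBounded ν' :=
  { hk with
    norm_w₂ := fun s => (hk.norm_w₂ s).trans h
    norm_b₂ := fun s => (hk.norm_b₂ s).trans h
    norm_w₁ := fun s => (hk.norm_w₁ s).trans h
    norm_b₁ := fun s => (hk.norm_b₁ s).trans h }

theorem norm_sub_le_of_deriv {f f' : ℝ → E} (hf : ∀ s, HasDerivAt f (f' s) s)
    (hν : ∀ s, ‖f' s‖ ≤ ν) (s t : ℝ) : ‖f s - f t‖ ≤ ν * |s - t| :=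
  convex_univ.norm_image_sub_le_of_norm_hasDerivWithin_le
    (fun x _ => (hf x).hasDerivWithinAt) (fun x _ => hν x) (mem_univ t) (mem_univ s)

theorem IsBounded.norm_pos_sub (hk : k.IsBounded ν) (hν : 0 ≤ ν) (S S' : ℝ × ℝ) :
    ‖k.pos S - k.pos S'‖ ≤ ν * ‖S - S'‖ := by
  refine norm_prod_le_iff.2 ⟨?_, ?_⟩
  · exact (norm_sub_le_of_deriv hk.hk₂ hk.norm_w₂ _ _).trans
      (mul_le_mul_of_nonneg_left (norm_fst_le (S - S')) hν)
  · exact (norm_sub_le_of_deriv hk.hk₁ hk.norm_w₁ _ _).trans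
      (mul_le_mul_of_nonneg_left (norm_snd_le (S - S')) hν)

theorem IsBounded.norm_vel_sub (hk : k.IsBounded ν) (hν : 0 ≤ ν) (S S' : ℝ × ℝ) :
    ‖k.vel S - k.vel S'‖ ≤ ν * ‖S - S'‖ := by
  refine norm_prod_le_iff.2 ⟨?_, ?_⟩
  · exact (norm_sub_le_of_deriv hk.hw₂ hk.norm_b₂ _ _).trans
      (mul_le_mul_of_nonneg_left (norm_fst_le (S - S')) hν)
  · exact (norm_sub_le_of_deriv hk.hw₁ hk.norm_b₁ _ _).trans
      (mul_le_mul_of_nonneg_left (norm_snd_le (S - S')) hν)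

theorem IsBounded.norm_dpos_le (hk : k.IsBounded ν) (S τ : ℝ × ℝ) :
    ‖k.dpos S τ‖ ≤ ν * ‖τ‖ := by
  refine norm_prod_le_iff.2 ⟨?_, ?_⟩ <;> simp only [dpos, norm_smul, mul_comm ν]
  · exact mul_le_mul (norm_fst_le τ) (hk.norm_w₂ _) (norm_nonneg _) (norm_nonneg _)
  · exact mul_le_mul (norm_snd_le τ) (hk.norm_w₁ _) (norm_nonneg _) (norm_nonneg _)

theorem IsBounded.norm_dvel_le (hk : k.IsBounded ν) (S τ : ℝ × ℝ) :
    ‖k.dvel S τ‖ ≤ ν * ‖τ‖ := by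
  refine norm_prod_le_iff.2 ⟨?_, ?_⟩ <;> simp only [dvel, norm_smul, mul_comm ν]
  · exact mul_le_mul (norm_fst_le τ) (hk.norm_b₂ _) (norm_nonneg _) (norm_nonneg _)
  · exact mul_le_mul (norm_snd_le τ) (hk.norm_b₁ _) (norm_nonneg _) (norm_nonneg _)

theorem IsBounded.hasDerivWithinAt_pos (hk : k.IsBounded ν) {S : ℝ → ℝ × ℝ} {S' : ℝ × ℝ}
    {I : Set ℝ} {u : ℝ} (hS : HasDerivWithinAt S S' I u) :
    HasDerivWithinAt (fun u => k.pos (S u)) (k.dpos (S u) S') I u :=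
  ((hk.hk₂ _).scomp_hasDerivWithinAt u hS.fst).prodMk
    ((hk.hk₁ _).scomp_hasDerivWithinAt u hS.snd)

theorem IsBounded.hasDerivWithinAt_vel (hk : k.IsBounded ν) {S : ℝ → ℝ × ℝ} {S' : ℝ × ℝ}
    {I : Set ℝ} {u : ℝ} (hS : HasDerivWithinAt S S' I u) :
    HasDerivWithinAt (fun u => k.vel (S u)) (k.dvel (S u) S') I u :=
  ((hk.hw₂ _).scomp_hasDerivWithinAt u hS.fst).prodMk
    ((hk.hw₁ _).scomp_hasDerivWithinAt u hS.snd)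

end Hist

/-- Positions and velocities of both particles, and the delayed and advanced times. -/
abbrev State : Type := (E × E) × (E × E) × (ℝ × ℝ)

/-- The space of the coefficients `λ`-weighted velocities, accelerations without and with
accelerations of the segments, and rates of the delayed and advanced times. -/
abbrev Coeff : Type := (E × E) × (E × E) × (E × E →L[ℝ] E × E) × (ℝ × ℝ)

/-- The variables of the coefficients in the state `z`. -/
def vars (g : ℝ) (k : Hist) (z : State) : Vars :=
  (g, (z.1.1 - z.1.2, z.1.1 - (k.pos z.2.2).1, z.1.2 - (k.pos z.2.2).2), z.2.1, k.vel z.2.2)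

/-- The derivative of `vars` at `z` in the direction `y`. -/
def dvars (k : Hist) (z y : State) : Vars :=
  (0, (y.1.1 - y.1.2, y.1.1 - (k.dpos z.2.2 y.2.2).1, y.1.2 - (k.dpos z.2.2 y.2.2).2), y.2.1,
    k.dvel z.2.2 y.2.2)

/-- The vector field of the rescaled equations with coefficients `Φ`. -/
def vfield (Φ : Vars → Coeff) (g : ℝ) (k : Hist) (z : State) : State :=
  ((Φ (vars g k z)).1,
    g • ((Φ (vars g k z)).2.1 +
      (Φ (vars g k z)).2.2.1 (k.dvel z.2.2 (Φ (vars g k z)).2.2.2)),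
    (Φ (vars g k z)).2.2.2)

/-- `Z` solves the rescaled equations on `[0, a]`, with time measured in units of `T`. -/
def IsFlow (Φ : Vars → Coeff) (g T : ℝ) (k : Hist) (a : ℝ) (Z : ℝ → State) : Prop :=
  ∀ u ∈ Icc 0 a, HasDerivWithinAt Z (T • vfield Φ g k (Z u)) (Icc 0 a) u

/-- `C` bounds the coefficients and their derivatives on `K`. -/
structure IsCoeffBound (Φ : Vars → Coeff) (K : Set Vars) (C : ℝ) : Prop where
  one_le : 1 ≤ C
  contDiffAt : ∀ q ∈ K, ContDiffAt ℝ 1 Φ q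
  norm_le : ∀ q ∈ K, ‖Φ q‖ ≤ C
  norm_fderiv_le : ∀ q ∈ K, ‖fderiv ℝ Φ q‖ ≤ C
  norm_sub_le : ∀ q ∈ K, ∀ q' ∈ K, ‖Φ q' - Φ q‖ ≤ C * ‖q' - q‖

section Norms

theorem norm_coeff_le {y : Coeff} {C : ℝ} (h : ‖y‖ ≤ C) :
    ‖y.1‖ ≤ C ∧ ‖y.2.1‖ ≤ C ∧ ‖y.2.2.1‖ ≤ C ∧ ‖y.2.2.2‖ ≤ C := by
  simpa only [norm_prod_le_iff, and_assoc] using! h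

theorem norm_state_le {y : State} {C : ℝ} : ‖y‖ ≤ C ↔ ‖y.1‖ ≤ C ∧ ‖y.2.1‖ ≤ C ∧ ‖y.2.2‖ ≤ C := by
  rw [norm_prod_le_iff, norm_prod_le_iff (x := y.2)]

theorem norm_vars_le {q : Vars} {C : ℝ} : ‖q‖ ≤ C ↔ |q.1| ≤ C ∧
    (‖q.2.1.1‖ ≤ C ∧ ‖q.2.1.2.1‖ ≤ C ∧ ‖q.2.1.2.2‖ ≤ C) ∧ ‖q.2.2.1‖ ≤ C ∧ ‖q.2.2.2‖ ≤ C := by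
  rw [norm_prod_le_iff, norm_prod_le_iff (x := q.2), norm_prod_le_iff (x := q.2.1),
    norm_prod_le_iff (x := q.2.1.2), norm_prod_le_iff (x := q.2.2), Real.norm_eq_abs]

variable {g : ℝ} {k k' : Hist} {z z' : State}

theorem norm_vars_sub_le {e : ℝ} (he : 0 ≤ e) (hk : k.IsBounded 1)
    (h₁ : ‖k'.pos z'.2.2 - k.pos z'.2.2‖ ≤ e) (h₂ : ‖k'.vel z'.2.2 - k.vel z'.2.2‖ ≤ e) :
    ‖vars g k' z' - vars g k z‖ ≤ 2 * ‖z' - z‖ + e := by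
  obtain ⟨hX, hV, hS⟩ := norm_state_le.1 (le_refl ‖z' - z‖)
  obtain ⟨hX₁, hX₂⟩ := norm_prod_le_iff.1 hX
  have n := norm_nonneg (z' - z)
  have p : ‖k'.pos z'.2.2 - k.pos z.2.2‖ ≤ ‖z' - z‖ + e := by
    have h := hk.norm_pos_sub zero_le_one z'.2.2 z.2.2
    have h3 := norm_add_le (k'.pos z'.2.2 - k.pos z'.2.2) (k.pos z'.2.2 - k.pos z.2.2)
    rw [sub_add_sub_cancel] at h3
    have : ‖z'.2.2 - z.2.2‖ ≤ ‖z' - z‖ := hS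
    linarith
  have w : ‖k'.vel z'.2.2 - k.vel z.2.2‖ ≤ ‖z' - z‖ + e := by
    have h := hk.norm_vel_sub zero_le_one z'.2.2 z.2.2
    have h3 := norm_add_le (k'.vel z'.2.2 - k.vel z'.2.2) (k.vel z'.2.2 - k.vel z.2.2)
    rw [sub_add_sub_cancel] at h3
    have : ‖z'.2.2 - z.2.2‖ ≤ ‖z' - z‖ := hS
    linarith
  obtain ⟨p₁, p₂⟩ := norm_prod_le_iff.1 p
  refine norm_vars_le.2 ⟨?_, ⟨?_, ?_, ?_⟩, ?_, ?_⟩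
  · simp only [vars, Prod.fst_sub, sub_self, abs_zero]; linarith
  · have e1 : (vars g k' z' - vars g k z).2.1.1 = (z' - z).1.1 - (z' - z).1.2 := by
      simp only [vars, Prod.fst_sub, Prod.snd_sub]; abel
    rw [e1]
    exact (norm_sub_le _ _).trans (by linarith)
  · have e1 : (vars g k' z' - vars g k z).2.1.2.1 =
        (z' - z).1.1 - (k'.pos z'.2.2 - k.pos z.2.2).1 := by
      simp only [vars, Prod.fst_sub, Prod.snd_sub]; abel
    rw [e1]
    exact (norm_sub_le _ _).trans (by linarith)
  · have e1 : (vars g k' z' - vars g k z).2.1.2.2 =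
        (z' - z).1.2 - (k'.pos z'.2.2 - k.pos z.2.2).2 := by
      simp only [vars, Prod.fst_sub, Prod.snd_sub]; abel
    rw [e1]
    exact (norm_sub_le _ _).trans (by linarith)
  · exact hV.trans (by linarith)
  · exact w.trans (by linarith)

theorem norm_dvars_le (hk : k.IsBounded 1) (y : State) : ‖dvars k z y‖ ≤ 2 * ‖y‖ := by
  obtain ⟨hX, hV, hS⟩ := norm_state_le.1 (le_refl ‖y‖)
  obtain ⟨hX₁, hX₂⟩ := norm_prod_le_iff.1 hX
  have n := norm_nonneg y
  have p := hk.norm_dpos_le z.2.2 y.2.2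
  have w := hk.norm_dvel_le z.2.2 y.2.2
  rw [one_mul] at p w
  obtain ⟨p₁, p₂⟩ := norm_prod_le_iff.1 (p.trans hS)
  refine norm_vars_le.2 ⟨?_, ⟨?_, ?_, ?_⟩, ?_, ?_⟩
  · simp [dvars]
  · exact (norm_sub_le _ _).trans (by linarith)
  · exact (norm_sub_le _ _).trans (by linarith)
  · exact (norm_sub_le _ _).trans (by linarith)
  · exact hV.trans (by linarith)
  · exact (w.trans hS).trans (by linarith)

theorem hasDerivWithinAt_vars {Z : ℝ → State} {Z' : State} {I : Set ℝ} {u : ℝ} {ν : ℝ}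
    (hk : k.IsBounded ν) (hZ : HasDerivWithinAt Z Z' I u) :
    HasDerivWithinAt (fun u => vars g k (Z u)) (dvars k (Z u) Z') I u := by
  have hX := hasDerivWithinAt_fst hZ
  have hX₁ := hasDerivWithinAt_fst hX
  have hX₂ := hasDerivWithinAt_snd hX
  have hY := hasDerivWithinAt_snd hZ
  have hS := hasDerivWithinAt_snd hY
  have hp := hk.hasDerivWithinAt_pos hS
  exact (hasDerivWithinAt_const u I g).prodMk (HasDerivWithinAt.prodMk
    (HasDerivWithinAt.prodMk (hX₁.sub hX₂) (HasDerivWithinAt.prodMk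
      (hX₁.sub (hasDerivWithinAt_fst hp)) (hX₂.sub (hasDerivWithinAt_snd hp))))
    (HasDerivWithinAt.prodMk (hasDerivWithinAt_fst hY) (hk.hasDerivWithinAt_vel hS)))

variable {Φ : Vars → Coeff} {K : Set Vars} {C : ℝ}

theorem IsCoeffBound.norm_vfield_le (hC : IsCoeffBound Φ K C) (hg₀ : 0 ≤ g) (hg₁ : g ≤ 1)
    (hk : k.IsBounded 1) (hz : vars g k z ∈ K) : ‖vfield Φ g k z‖ ≤ 2 * C ^ 2 := by
  obtain ⟨h1, h2, h3, h4⟩ := norm_coeff_le (hC.norm_le _ hz)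
  have hC1 := hC.one_le
  refine norm_state_le.2 ⟨?_, ?_, ?_⟩
  · exact h1.trans (by nlinarith)
  · have h5 : ‖(Φ (vars g k z)).2.2.1 (k.dvel z.2.2 (Φ (vars g k z)).2.2.2)‖ ≤ C * C := by
      refine (ContinuousLinearMap.le_opNorm _ _).trans (mul_le_mul h3 ?_ (norm_nonneg _)
        (by linarith))
      have := hk.norm_dvel_le z.2.2 (Φ (vars g k z)).2.2.2
      linarith
    have h6 := norm_add_le (Φ (vars g k z)).2.1
      ((Φ (vars g k z)).2.2.1 (k.dvel z.2.2 (Φ (vars g k z)).2.2.2))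
    change ‖g • ((Φ (vars g k z)).2.1 +
      (Φ (vars g k z)).2.2.1 (k.dvel z.2.2 (Φ (vars g k z)).2.2.2))‖ ≤ _
    rw [norm_smul, Real.norm_eq_abs, abs_of_nonneg hg₀]
    calc g * _ ≤ 1 * (C + C * C) := mul_le_mul hg₁ (h6.trans (add_le_add h2 h5))
          (norm_nonneg _) zero_le_one
      _ ≤ _ := by nlinarith
  · exact h4.trans (by nlinarith)

end Norms

section Stability

variable {Φ : Vars → Coeff} {K : Set Vars} {C g T T' e : ℝ} {k k' : Hist}

/-- The difference `z' - z` of two states, with the difference of velocities corrected by the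
difference of the velocities on the segments. The accelerations on the segments, which are merely
continuous in the delayed and advanced times, drop out of the rate of change of this difference. -/
def corrected (Φ : Vars → Coeff) (g : ℝ) (k k' : Hist) (z z' : State) : State :=
  (z'.1 - z.1,
    z'.2.1 - z.2.1 - g • (Φ (vars g k z)).2.2.1 (k'.vel z'.2.2 - k.vel z.2.2), z'.2.2 - z.2.2)

/-- The rate of change of `corrected`. -/
def correctedDeriv (Φ : Vars → Coeff) (g T T' : ℝ) (k k' : Hist) (z z' : State) : State :=
  (T' • (Φ (vars g k' z')).1 - T • (Φ (vars g k z)).1,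
    g • ((T' • (Φ (vars g k' z')).2.1 - T • (Φ (vars g k z)).2.1) +
      ((Φ (vars g k' z')).2.2.1 - (Φ (vars g k z)).2.2.1)
        (k'.dvel z'.2.2 (T' • (Φ (vars g k' z')).2.2.2)) -
      (fderiv ℝ Φ (vars g k z) (dvars k z (T • vfield Φ g k z))).2.2.1
        (k'.vel z'.2.2 - k.vel z.2.2)),
    T' • (Φ (vars g k' z')).2.2.2 - T • (Φ (vars g k z)).2.2.2)

theorem Hist.dvel_smul (k : Hist) (S τ : ℝ × ℝ) (T : ℝ) : k.dvel S (T • τ) = T • k.dvel S τ := by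
  simp only [dvel, Prod.smul_fst, Prod.smul_snd, Prod.smul_mk, smul_smul, smul_eq_mul]

/-- The corrected difference has a rate of change in which the accelerations on the segments occur
only multiplied by differences: `b₂ ds/dt` is the derivative of `w₂ (s t)`, so that the leading term
is integrated by parts. -/
theorem hasDerivWithinAt_corrected (hC : IsCoeffBound Φ K C) {ν ν' : ℝ} (hk : k.IsBounded ν)
    (hk' : k'.IsBounded ν') {Z Z' : ℝ → State} {I : Set ℝ} {u : ℝ}
    (hZ : HasDerivWithinAt Z (T • vfield Φ g k (Z u)) I u)
    (hZ' : HasDerivWithinAt Z' (T' • vfield Φ g k' (Z' u)) I u) (hK : vars g k (Z u) ∈ K) :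
    HasDerivWithinAt (fun u => corrected Φ g k k' (Z u) (Z' u))
      (correctedDeriv Φ g T T' k k' (Z u) (Z' u)) I u := by
  have hq := hasDerivWithinAt_vars (g := g) hk hZ
  have hΦ := ((hC.contDiffAt _ hK).differentiableAt one_ne_zero).hasFDerivAt.comp_hasDerivWithinAt
    u hq
  have hM := hasDerivWithinAt_fst (hasDerivWithinAt_snd (hasDerivWithinAt_snd hΦ))
  have hY := hasDerivWithinAt_snd hZ
  have hY' := hasDerivWithinAt_snd hZ'
  have hS := hasDerivWithinAt_snd hY
  have hS' := hasDerivWithinAt_snd hY'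
  have hw := (hk'.hasDerivWithinAt_vel hS').sub (hk.hasDerivWithinAt_vel hS)
  have h1 := HasDerivWithinAt.prodMk ((hasDerivWithinAt_fst hZ').sub (hasDerivWithinAt_fst hZ))
    (HasDerivWithinAt.prodMk (((hasDerivWithinAt_fst hY').sub (hasDerivWithinAt_fst hY)).sub
      ((hM.clm_apply hw).const_smul g)) (hS'.sub hS))
  refine h1.congr_deriv ?_
  refine Prod.ext rfl (Prod.ext ?_ rfl)
  simp only [vfield, correctedDeriv, Prod.smul_mk, Hist.dvel_smul,
    map_sub, map_smul, _root_.sub_apply, smul_sub, smul_add, Function.comp_apply, Pi.sub_apply,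
    smul_comm T g, smul_comm T' g]
  abel

variable {z z' : State}

/-- The corrected and the true difference of two states bound each other. -/
theorem norm_corrected_le (hC : IsCoeffBound Φ K C) (hg₀ : 0 ≤ g) (hg₁ : g ≤ 1) (he : 0 ≤ e)
    (hk : k.IsBounded 1) (hq : vars g k z ∈ K) (h₂ : ‖k'.vel z'.2.2 - k.vel z'.2.2‖ ≤ e) :
    ‖k'.vel z'.2.2 - k.vel z.2.2‖ ≤ ‖z'.2.2 - z.2.2‖ + e ∧
    ‖g • (Φ (vars g k z)).2.2.1 (k'.vel z'.2.2 - k.vel z.2.2)‖ ≤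
      g * (C * (‖z'.2.2 - z.2.2‖ + e)) ∧
    ‖corrected Φ g k k' z z'‖ ≤ 2 * C * (‖z' - z‖ + e) ∧
    ‖z' - z‖ ≤ 2 * C * (‖corrected Φ g k k' z z'‖ + e) := by
  have hC1 := hC.one_le
  have hw : ‖k'.vel z'.2.2 - k.vel z.2.2‖ ≤ ‖z'.2.2 - z.2.2‖ + e := by
    have h := hk.norm_vel_sub zero_le_one z'.2.2 z.2.2
    have h3 := norm_add_le (k'.vel z'.2.2 - k.vel z'.2.2) (k.vel z'.2.2 - k.vel z.2.2)
    rw [sub_add_sub_cancel] at h3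
    linarith
  have hM : ‖(Φ (vars g k z)).2.2.1 (k'.vel z'.2.2 - k.vel z.2.2)‖ ≤
      C * (‖z'.2.2 - z.2.2‖ + e) :=
    (ContinuousLinearMap.le_opNorm _ _).trans
      (mul_le_mul (norm_coeff_le (hC.norm_le _ hq)).2.2.1 hw (norm_nonneg _) (by linarith))
  have hgM : ‖g • (Φ (vars g k z)).2.2.1 (k'.vel z'.2.2 - k.vel z.2.2)‖ ≤
      g * (C * (‖z'.2.2 - z.2.2‖ + e)) := by
    rw [norm_smul, Real.norm_eq_abs, abs_of_nonneg hg₀]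
    exact mul_le_mul_of_nonneg_left hM hg₀
  have hn : 0 ≤ C * (‖z'.2.2 - z.2.2‖ + e) := by positivity
  have hgM1 := hgM.trans (mul_le_mul_of_nonneg_right hg₁ hn)
  rw [one_mul] at hgM1
  refine ⟨hw, hgM, ?_, ?_⟩
  · obtain ⟨hX, hV, hS⟩ := norm_state_le.1 (le_refl ‖z' - z‖)
    have n := norm_nonneg (z' - z)
    have hS' : ‖z'.2.2 - z.2.2‖ ≤ ‖z' - z‖ := hS
    refine norm_state_le.2 ⟨?_, ?_, ?_⟩
    · exact hX.trans (by nlinarith)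
    · refine (norm_sub_le _ _).trans ?_
      have hV' : ‖z'.2.1 - z.2.1‖ ≤ ‖z' - z‖ := hV
      nlinarith
    · exact hS.trans (by nlinarith)
  · obtain ⟨hX, hV, hS⟩ := norm_state_le.1 (le_refl ‖corrected Φ g k k' z z'‖)
    have n := norm_nonneg (corrected Φ g k k' z z')
    have hS' : ‖z'.2.2 - z.2.2‖ ≤ ‖corrected Φ g k k' z z'‖ := hS
    refine norm_state_le.2 ⟨?_, ?_, ?_⟩
    · exact hX.trans (by nlinarith)
    · have h1 := norm_add_le (corrected Φ g k k' z z').2.1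
        (g • (Φ (vars g k z)).2.2.1 (k'.vel z'.2.2 - k.vel z.2.2))
      have e1 : (z' - z).2.1 = (corrected Φ g k k' z z').2.1 +
        g • (Φ (vars g k z)).2.2.1 (k'.vel z'.2.2 - k.vel z.2.2) := by
        simp only [corrected, Prod.snd_sub, Prod.fst_sub]; abel
      rw [← e1] at h1
      nlinarith
    · exact hS.trans (by nlinarith)

theorem norm_smul_sub_smul_le {F : Type*} [NormedAddCommGroup F] [NormedSpace ℝ F] {a a' : F}
    {c B : ℝ} (hT : 0 ≤ T) (hT' : T ≤ 3) (h₁ : ‖a'‖ ≤ c) (h₂ : ‖a' - a‖ ≤ B) :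
    ‖T' • a' - T • a‖ ≤ |T' - T| * c + 3 * B := by
  have e1 : T' • a' - T • a = (T' - T) • a' + T • (a' - a) := by
    rw [sub_smul, smul_sub]; abel
  rw [e1]
  refine (norm_add_le _ _).trans (add_le_add ?_ ?_) <;> rw [norm_smul, Real.norm_eq_abs]
  · exact mul_le_mul_of_nonneg_left h₁ (abs_nonneg _)
  · rw [abs_of_nonneg hT]
    exact mul_le_mul hT' h₂ (norm_nonneg _) (by norm_num)

theorem norm_correctedDeriv_le (hC : IsCoeffBound Φ K C) (hg₀ : 0 ≤ g) (hg₁ : g ≤ 1)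
    (hT : 0 ≤ T) (hT3 : T ≤ 3) (hT' : 0 ≤ T') (hT3' : T' ≤ 3) (he : 0 ≤ e)
    (hk : k.IsBounded 1) (hk' : k'.IsBounded 1) (hq : vars g k z ∈ K) (hq' : vars g k' z' ∈ K)
    (h₁ : ‖k'.pos z'.2.2 - k.pos z'.2.2‖ ≤ e) (h₂ : ‖k'.vel z'.2.2 - k.vel z'.2.2‖ ≤ e) :
    ‖correctedDeriv Φ g T T' k k' z z'‖ ≤
      50 * C ^ 3 * (‖corrected Φ g k k' z z'‖ + (e + |T' - T|)) ∧
    ‖(correctedDeriv Φ g T T' k k' z z').2.1‖ ≤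
      g * (50 * C ^ 3 * (‖corrected Φ g k k' z z'‖ + (e + |T' - T|))) := by
  have hC1 := hC.one_le
  obtain ⟨hw, -, -, hz⟩ := norm_corrected_le (k' := k') (z' := z') hC hg₀ hg₁ he hk hq h₂
  have hB := norm_vars_sub_le (g := g) (z := z) he hk h₁ h₂
  set ζ := corrected Φ g k k' z z' with hζ
  set τ := |T' - T| with hτ
  have hτ0 : 0 ≤ τ := abs_nonneg _
  set x := ‖ζ‖ + e with hx
  have hx0 : 0 ≤ x := by positivity
  have hex : e ≤ x := by rw [hx]; linarith [norm_nonneg ζ]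
  have hS : ‖z'.2.2 - z.2.2‖ ≤ ‖ζ‖ := (norm_state_le.1 (le_refl ‖ζ‖)).2.2
  have hB5 : ‖vars g k' z' - vars g k z‖ ≤ 5 * C * x := by nlinarith
  have hΔ : ‖Φ (vars g k' z') - Φ (vars g k z)‖ ≤ C * (5 * C * x) :=
    (hC.norm_sub_le _ hq _ hq').trans (mul_le_mul_of_nonneg_left hB5 (by linarith))
  obtain ⟨d1, d2, d3, d4⟩ := norm_coeff_le hΔ
  obtain ⟨a1, a2, a3, a4⟩ := norm_coeff_le (hC.norm_le _ hq')
  have b1 := norm_smul_sub_smul_le (T' := T') hT hT3 a1 d1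
  have b2 := norm_smul_sub_smul_le (T' := T') hT hT3 a2 d2
  have b4 := norm_smul_sub_smul_le (T' := T') hT hT3 a4 d4
  have hω : ‖k'.dvel z'.2.2 (T' • (Φ (vars g k' z')).2.2.2)‖ ≤ 3 * C := by
    have := hk'.norm_dvel_le z'.2.2 (T' • (Φ (vars g k' z')).2.2.2)
    rw [norm_smul, Real.norm_eq_abs, abs_of_nonneg hT'] at this
    have h5 : T' * ‖(Φ (vars g k' z')).2.2.2‖ ≤ 3 * C :=
      mul_le_mul hT3' a4 (norm_nonneg _) (by norm_num)
    linarith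
  have c2 : ‖((Φ (vars g k' z')).2.2.1 - (Φ (vars g k z)).2.2.1)
      (k'.dvel z'.2.2 (T' • (Φ (vars g k' z')).2.2.2))‖ ≤ C * (5 * C * x) * (3 * C) :=
    (ContinuousLinearMap.le_opNorm _ _).trans
      (mul_le_mul d3 hω (norm_nonneg _) (by positivity))
  have hdv : ‖dvars k z (T • vfield Φ g k z)‖ ≤ 12 * C ^ 2 := by
    refine (norm_dvars_le hk _).trans ?_
    have := hC.norm_vfield_le hg₀ hg₁ hk hq
    rw [norm_smul, Real.norm_eq_abs, abs_of_nonneg hT]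
    have h5 : T * ‖vfield Φ g k z‖ ≤ 3 * (2 * C ^ 2) :=
      mul_le_mul hT3 this (norm_nonneg _) (by norm_num)
    linarith
  have hfd : ‖fderiv ℝ Φ (vars g k z) (dvars k z (T • vfield Φ g k z))‖ ≤ C * (12 * C ^ 2) :=
    (ContinuousLinearMap.le_opNorm _ _).trans
      (mul_le_mul (hC.norm_fderiv_le _ hq) hdv (norm_nonneg _) (by linarith))
  have c3 : ‖(fderiv ℝ Φ (vars g k z) (dvars k z (T • vfield Φ g k z))).2.2.1
        (k'.vel z'.2.2 - k.vel z.2.2)‖ ≤ C * (12 * C ^ 2) * x :=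
    (ContinuousLinearMap.le_opNorm _ _).trans
      (mul_le_mul (norm_coeff_le hfd).2.2.1 (hw.trans (by linarith)) (norm_nonneg _)
        (by positivity))
  have p2 : C ≤ C ^ 2 := by nlinarith
  have p3 : C ^ 2 ≤ C ^ 3 := by nlinarith [sq_nonneg C]
  have hsmall : τ * C + 3 * (C * (5 * C * x)) ≤ 50 * C ^ 3 * (x + τ) := by
    have h6 : τ * C ≤ τ * C ^ 3 := by gcongr; linarith
    have h7 : C ^ 2 * x ≤ C ^ 3 * x := by gcongr
    have h8 : 0 ≤ τ * C ^ 3 := by positivity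
    have h9 : 0 ≤ C ^ 3 * x := by positivity
    calc τ * C + 3 * (C * (5 * C * x)) = τ * C + 15 * (C ^ 2 * x) := by ring
      _ ≤ 50 * (C ^ 3 * x) + 50 * (τ * C ^ 3) := by linarith
      _ = _ := by ring
  have hxe : x + τ = ‖ζ‖ + (e + τ) := by rw [hx]; ring
  have hmid : ‖(correctedDeriv Φ g T T' k k' z z').2.1‖ ≤
      g * (50 * C ^ 3 * (x + τ)) := by
    change ‖g • _‖ ≤ _
    rw [norm_smul, Real.norm_eq_abs, abs_of_nonneg hg₀]
    refine mul_le_mul_of_nonneg_left ?_ hg₀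
    refine (norm_sub_le _ _).trans ((add_le_add ((norm_add_le _ _).trans (add_le_add b2 c2))
      c3).trans ?_)
    have h6 : τ * C ≤ τ * C ^ 3 := by gcongr; linarith
    have h7 : C ^ 2 * x ≤ C ^ 3 * x := by gcongr
    have h8 : 0 ≤ τ * C ^ 3 := by positivity
    have h9 : 0 ≤ C ^ 3 * x := by positivity
    calc τ * C + 3 * (C * (5 * C * x)) + C * (5 * C * x) * (3 * C) + C * (12 * C ^ 2) * x
        = τ * C + 15 * (C ^ 2 * x) + 27 * (C ^ 3 * x) := by ring
      _ ≤ 50 * (C ^ 3 * x) + 50 * (τ * C ^ 3) := by linarith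
      _ = _ := by ring
  rw [hxe] at hmid hsmall
  refine ⟨norm_state_le.2 ⟨b1.trans hsmall, hmid.trans ?_, b4.trans hsmall⟩, hmid⟩
  have h8 : 0 ≤ 50 * C ^ 3 * (‖ζ‖ + (e + τ)) := by positivity
  exact mul_le_of_le_one_left h8 hg₁

/-- The growth factor in Gronwall's inequality for `corrected`. -/
def growthConst (C : ℝ) : ℝ := 104 * C ^ 3 * Real.exp (50 * C ^ 3 + 1)

/-- The constant of the stability estimates. -/
def stabConst (C : ℝ) : ℝ := 50 * C ^ 3 * (growthConst C + 2) + 4 * C * (growthConst C + 1)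

theorem stabConst_pos {C : ℝ} (hC : 1 ≤ C) : 1 ≤ stabConst C := by
  have h : 0 ≤ growthConst C := by rw [growthConst]; positivity
  have h2 : 0 ≤ 50 * C ^ 3 * (growthConst C + 2) := by positivity
  rw [stabConst]
  nlinarith

/-- Two solutions of the rescaled equations, for segments that are close in `C¹`, differ at most by
a multiple of the difference of the data. The change of the difference of the velocities is small
of the order of the coupling. -/
theorem flow_stability (hC : IsCoeffBound Φ K C) {a d : ℝ} {Z Z' : ℝ → State} (hg₀ : 0 ≤ g)
    (hg₁ : g ≤ 1) (hT : 0 ≤ T) (hT3 : T ≤ 3) (hT' : 0 ≤ T') (hT3' : T' ≤ 3)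
    (ha₀ : 0 ≤ a) (ha : a ≤ 1)
    (hk : k.IsBounded 1) (hk' : k'.IsBounded 1)
    (hZ : IsFlow Φ g T k a Z) (hZ' : IsFlow Φ g T' k' a Z')
    (hK : ∀ u ∈ Icc 0 a, vars g k (Z u) ∈ K) (hK' : ∀ u ∈ Icc 0 a, vars g k' (Z' u) ∈ K)
    (h₁ : ∀ u ∈ Icc 0 a, ‖k'.pos (Z' u).2.2 - k.pos (Z' u).2.2‖ ≤ d)
    (h₂ : ∀ u ∈ Icc 0 a, ‖k'.vel (Z' u).2.2 - k.vel (Z' u).2.2‖ ≤ d)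
    (h₃ : |T' - T| ≤ d) (h₄ : ‖Z' 0 - Z 0‖ ≤ d) :
    ∀ u ∈ Icc 0 a, ‖Z' u - Z u‖ ≤ stabConst C * d ∧
      ‖((Z' u).2.1 - (Z u).2.1) - ((Z' 0).2.1 - (Z 0).2.1)‖ ≤
        g * (stabConst C * d) := by
  have hC1 := hC.one_le
  have hd : 0 ≤ d := (norm_nonneg _).trans h₄
  have hC3 : 1 ≤ C ^ 3 := one_le_pow₀ hC1
  have h0 : (0 : ℝ) ∈ Icc 0 a := ⟨le_rfl, ha₀⟩
  let ζ : ℝ → State := fun u => corrected Φ g k k' (Z u) (Z' u)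
  let ζ' : ℝ → State := fun u => correctedDeriv Φ g T T' k k' (Z u) (Z' u)
  have hder : ∀ u ∈ Icc 0 a, HasDerivWithinAt ζ (ζ' u) (Icc 0 a) u := fun u hu =>
    hasDerivWithinAt_corrected hC hk hk' (hZ u hu) (hZ' u hu) (hK u hu)
  have hbd := fun u hu => norm_correctedDeriv_le hC hg₀ hg₁ hT hT3 hT' hT3' hd hk hk'
    (hK u hu) (hK' u hu) (h₁ u hu) (h₂ u hu)
  have hnc := fun u hu => norm_corrected_le (k' := k') (z' := Z' u) hC hg₀ hg₁ hd hk
    (hK u hu) (h₂ u hu)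
  have hζ0 : ‖ζ 0‖ ≤ 4 * C * d := (hnc 0 h0).2.2.1.trans (by nlinarith)
  -- Gronwall's inequality, with the data on both segments in the inhomogeneous term
  have hG := norm_le_of_norm_deriv_le (C := 50 * C ^ 3) (d := 4 * C * d) (e := 100 * C ^ 3 * d)
    ha (by positivity) (by positivity) hder hζ0 (fun u hu => (hbd u hu).1.trans (by
      have : 50 * C ^ 3 * (d + |T' - T|) ≤ 50 * C ^ 3 * (d + d) := by gcongr
      linarith))
  have hG' : ∀ u ∈ Icc 0 a, ‖ζ u‖ ≤ growthConst C * d := by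
    intro u hu
    refine (hG u hu).trans ?_
    have h5 : C ≤ C ^ 3 := le_self_pow₀ hC1 (by norm_num)
    have h6 : 4 * C * d + 100 * C ^ 3 * d ≤ 104 * C ^ 3 * d := by nlinarith
    refine (mul_le_mul_of_nonneg_right h6 (Real.exp_pos _).le).trans (le_of_eq ?_)
    rw [growthConst]; ring
  have hg' : 0 ≤ growthConst C := by rw [growthConst]; positivity
  set G := growthConst C with hGdef
  have hrate : ∀ u ∈ Icc 0 a, 50 * C ^ 3 * (‖ζ u‖ + (d + |T' - T|)) ≤
      50 * C ^ 3 * (G + 2) * d := by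
    intro u hu
    rw [mul_assoc (50 * C ^ 3) (G + 2) d]
    refine mul_le_mul_of_nonneg_left ?_ (by positivity)
    linarith [hG' u hu]
  have hcorr : ∀ u ∈ Icc 0 a, C * (‖(Z' u).2.2 - (Z u).2.2‖ + d) ≤ C * (G + 1) * d := by
    intro u hu
    rw [mul_assoc C (G + 1) d]
    refine mul_le_mul_of_nonneg_left ?_ (by linarith)
    have : ‖(Z' u).2.2 - (Z u).2.2‖ ≤ ‖ζ u‖ := (norm_state_le.1 (le_refl ‖ζ u‖)).2.2
    linarith [hG' u hu]
  have hp1 : 0 ≤ 50 * C ^ 3 * (G + 2) * d := by positivity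
  have hp2 : 0 ≤ C * (G + 1) * d := by positivity
  have hsc : stabConst C * d = 50 * C ^ 3 * (G + 2) * d + 4 * (C * (G + 1) * d) := by
    rw [stabConst]; ring
  intro u hu
  constructor
  · refine (hnc u hu).2.2.2.trans ?_
    have h6 : 2 * C * (‖ζ u‖ + d) ≤ 2 * C * ((G + 1) * d) := by
      refine mul_le_mul_of_nonneg_left ?_ (by linarith)
      linarith [hG' u hu]
    refine h6.trans ?_
    rw [hsc]
    linarith
  · have hP : ∀ u ∈ Icc 0 a, HasDerivWithinAt (fun u => (ζ u).2.1) (ζ' u).2.1 (Icc 0 a) u :=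
      fun u hu => hasDerivWithinAt_fst (hasDerivWithinAt_snd (hder u hu))
    have hP' := (convex_Icc 0 a).norm_image_sub_le_of_norm_hasDerivWithin_le hP
      (C := g * (50 * C ^ 3 * (G + 2) * d)) (fun u hu => (hbd u hu).2.trans
        (mul_le_mul_of_nonneg_left (hrate u hu) hg₀)) h0 hu
    have hu1 : ‖u - 0‖ ≤ 1 := by
      rw [sub_zero, Real.norm_eq_abs, abs_of_nonneg hu.1]; exact hu.2.trans ha
    have hP2 : ‖(ζ u).2.1 - (ζ 0).2.1‖ ≤ g * (50 * C ^ 3 * (G + 2) * d) :=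
      hP'.trans (mul_le_of_le_one_right (mul_nonneg hg₀ hp1) hu1)
    have c1 := (hnc u hu).2.1.trans (mul_le_mul_of_nonneg_left (hcorr u hu) hg₀)
    have c2 := (hnc 0 h0).2.1.trans (mul_le_mul_of_nonneg_left (hcorr 0 h0) hg₀)
    have e1 : ((Z' u).2.1 - (Z u).2.1) - ((Z' 0).2.1 - (Z 0).2.1) =
        ((ζ u).2.1 - (ζ 0).2.1) +
        (g • (Φ (vars g k (Z u))).2.2.1 (k'.vel (Z' u).2.2 - k.vel (Z u).2.2) -
        g • (Φ (vars g k (Z 0))).2.2.1 (k'.vel (Z' 0).2.2 - k.vel (Z 0).2.2)) := by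
      simp only [ζ, corrected]; abel
    rw [e1, hsc]
    refine (norm_add_le _ _).trans ((add_le_add hP2 ((norm_sub_le _ _).trans
      (add_le_add c1 c2))).trans ?_)
    nlinarith [mul_nonneg hg₀ hp2]

end Stability

/-! ### Differentiability with respect to the initial velocities -/

section Uniform

theorem uniform_hasDerivAt {f f' : ℝ → E} (hf : ∀ s, HasDerivAt f (f' s) s) (hf' : Continuous f')
    {J : Set ℝ} (hJ : IsCompact J) {ε : ℝ} (hε : 0 < ε) :
    ∃ δ > 0, ∀ s ∈ J, ∀ s', |s' - s| < δ → ‖f s' - f s - (s' - s) • f' s‖ ≤ ε * |s' - s| := by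
  have hd : deriv f = f' := funext fun s => (hf s).deriv
  have h1 : ContDiff ℝ 1 f :=
    contDiff_one_iff_deriv.2 ⟨fun s => (hf s).differentiableAt, by rwa [hd]⟩
  obtain ⟨δ, hδ, h2⟩ := uniform_differentiability hJ (fun s _ => h1.contDiffAt) hε
  refine ⟨δ, hδ, fun s hs s' hs' => ?_⟩
  have := h2 s hs s' hs'
  rwa [(hf s).hasFDerivAt.fderiv, ContinuousLinearMap.toSpanSingleton_apply] at this

theorem uniform_continuousAt {f : ℝ → E} (hf : Continuous f) {J : Set ℝ} (hJ : IsCompact J)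
    {ε : ℝ} (hε : 0 < ε) :
    ∃ δ > 0, ∀ s ∈ J, ∀ s', |s' - s| < δ → ‖f s' - f s‖ ≤ ε := by
  have h1 := hJ.uniformContinuousAt_of_continuousAt f (fun s _ => hf.continuousAt)
    (Metric.dist_mem_uniformity hε)
  obtain ⟨δ, hδ, h2⟩ := Metric.mem_uniformity_dist.1 h1
  refine ⟨δ, hδ, fun s hs s' hs' => ?_⟩
  have h3 := @h2 s s' (by rwa [Real.dist_eq, abs_sub_comm]) hs
  rw [← dist_eq_norm, dist_comm]
  exact le_of_lt h3

/-- The segments are uniformly differentiable on compact sets of times, and their accelerations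
uniformly continuous. -/
theorem Hist.IsBounded.uniform {k : Hist} {ν : ℝ} (hk : k.IsBounded ν) {J : Set (ℝ × ℝ)}
    (hJ : IsCompact J) {ε : ℝ} (hε : 0 < ε) :
    ∃ δ > 0, ∀ S ∈ J, ∀ S', ‖S' - S‖ < δ →
      ‖k.pos S' - k.pos S - k.dpos S (S' - S)‖ ≤ ε * ‖S' - S‖ ∧
      ‖k.vel S' - k.vel S - k.dvel S (S' - S)‖ ≤ ε * ‖S' - S‖ ∧
      ‖k.b₂ S'.1 - k.b₂ S.1‖ ≤ ε ∧ ‖k.b₁ S'.2 - k.b₁ S.2‖ ≤ ε := by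
  have hJ₁ := hJ.image continuous_fst
  have hJ₂ := hJ.image continuous_snd
  have hw₂ : Continuous k.w₂ := continuous_iff_continuousAt.2 fun s => (hk.hw₂ s).continuousAt
  have hw₁ : Continuous k.w₁ := continuous_iff_continuousAt.2 fun s => (hk.hw₁ s).continuousAt
  obtain ⟨δ₁, hδ₁, h₁⟩ := uniform_hasDerivAt hk.hk₂ hw₂ hJ₁ hε
  obtain ⟨δ₂, hδ₂, h₂⟩ := uniform_hasDerivAt hk.hk₁ hw₁ hJ₂ hε
  obtain ⟨δ₃, hδ₃, h₃⟩ := uniform_hasDerivAt hk.hw₂ hk.hb₂ hJ₁ hε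
  obtain ⟨δ₄, hδ₄, h₄⟩ := uniform_hasDerivAt hk.hw₁ hk.hb₁ hJ₂ hε
  obtain ⟨δ₅, hδ₅, h₅⟩ := uniform_continuousAt hk.hb₂ hJ₁ hε
  obtain ⟨δ₆, hδ₆, h₆⟩ := uniform_continuousAt hk.hb₁ hJ₂ hε
  refine ⟨min (min δ₁ δ₂) (min (min δ₃ δ₄) (min δ₅ δ₆)), by positivity, fun S hS S' hS' => ?_⟩
  simp only [lt_min_iff] at hS'
  obtain ⟨⟨g₁, g₂⟩, ⟨g₃, g₄⟩, g₅, g₆⟩ := hS'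
  have i₁ : S.1 ∈ Prod.fst '' J := mem_image_of_mem _ hS
  have i₂ : S.2 ∈ Prod.snd '' J := mem_image_of_mem _ hS
  have n₁ : |S'.1 - S.1| ≤ ‖S' - S‖ := norm_fst_le (S' - S)
  have n₂ : |S'.2 - S.2| ≤ ‖S' - S‖ := norm_snd_le (S' - S)
  refine ⟨norm_prod_le_iff.2 ⟨?_, ?_⟩, norm_prod_le_iff.2 ⟨?_, ?_⟩, ?_, ?_⟩
  · exact (h₁ _ i₁ _ (n₁.trans_lt g₁)).trans (mul_le_mul_of_nonneg_left n₁ hε.le)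
  · exact (h₂ _ i₂ _ (n₂.trans_lt g₂)).trans (mul_le_mul_of_nonneg_left n₂ hε.le)
  · exact (h₃ _ i₁ _ (n₁.trans_lt g₃)).trans (mul_le_mul_of_nonneg_left n₁ hε.le)
  · exact (h₄ _ i₂ _ (n₂.trans_lt g₄)).trans (mul_le_mul_of_nonneg_left n₂ hε.le)
  · exact h₅ _ i₁ _ (n₁.trans_lt g₅)
  · exact h₆ _ i₂ _ (n₂.trans_lt g₆)

end Uniform

section Linearized

/-- `dpos` as a linear map. -/
def Hist.dposL (k : Hist) (S : ℝ × ℝ) : ℝ × ℝ →L[ℝ] E × E :=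
  ((ContinuousLinearMap.fst ℝ ℝ ℝ).smulRight (k.w₂ S.1)).prod
    ((ContinuousLinearMap.snd ℝ ℝ ℝ).smulRight (k.w₁ S.2))

/-- `dvel` as a linear map. -/
def Hist.dvelL (k : Hist) (S : ℝ × ℝ) : ℝ × ℝ →L[ℝ] E × E :=
  ((ContinuousLinearMap.fst ℝ ℝ ℝ).smulRight (k.b₂ S.1)).prod
    ((ContinuousLinearMap.snd ℝ ℝ ℝ).smulRight (k.b₁ S.2))

/-- The positions in a state. -/
abbrev posL : State →L[ℝ] E × E := ContinuousLinearMap.fst ℝ _ _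

/-- The velocities in a state. -/
abbrev velL : State →L[ℝ] E × E :=
  (ContinuousLinearMap.fst ℝ _ _).comp (ContinuousLinearMap.snd ℝ _ _)

/-- The delayed and advanced times in a state. -/
abbrev timesL : State →L[ℝ] ℝ × ℝ :=
  (ContinuousLinearMap.snd ℝ _ _).comp (ContinuousLinearMap.snd ℝ _ _)

/-- `dvars` as a linear map. -/
def dvarsL (k : Hist) (z : State) : State →L[ℝ] Vars :=
  let x₁ : State →L[ℝ] E := (ContinuousLinearMap.fst ℝ _ _).comp posL
  let x₂ : State →L[ℝ] E := (ContinuousLinearMap.snd ℝ _ _).comp posL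
  let p := (k.dposL z.2.2).comp timesL
  (0 : State →L[ℝ] ℝ).prod (((x₁ - x₂).prod
    ((x₁ - (ContinuousLinearMap.fst ℝ _ _).comp p).prod
      (x₂ - (ContinuousLinearMap.snd ℝ _ _).comp p))).prod
    (velL.prod ((k.dvelL z.2.2).comp timesL)))

theorem dvarsL_apply (k : Hist) (z y : State) : dvarsL k z y = dvars k z y := rfl

variable (Φ : Vars → Coeff) (g T : ℝ) (k : Hist) (z : State)

/-- The variation of the state that belongs to a given variation of `corrected`. -/
def uncorrectL : State →L[ℝ] State :=
  posL.prod ((velL + g • (Φ (vars g k z)).2.2.1.comp ((k.dvelL z.2.2).comp timesL)).prod timesL)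

/-- The variation of the coefficients that belongs to a given variation of `corrected`. -/
def dcoeffL : State →L[ℝ] Coeff :=
  (fderiv ℝ Φ (vars g k z)).comp ((dvarsL k z).comp (uncorrectL Φ g k z))

/-- The linearization of `correctedDeriv` at the state `z`. -/
def linearized : State →L[ℝ] State :=
  let dΦ := dcoeffL Φ g k z
  let dM : State →L[ℝ] E × E →L[ℝ] E × E := (ContinuousLinearMap.fst ℝ _ _).comp
    ((ContinuousLinearMap.snd ℝ _ _).comp ((ContinuousLinearMap.snd ℝ _ _).comp dΦ))
  (T • (ContinuousLinearMap.fst ℝ _ _).comp dΦ).prod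
    ((g • (T • (ContinuousLinearMap.fst ℝ _ _).comp ((ContinuousLinearMap.snd ℝ _ _).comp dΦ) +
      (ContinuousLinearMap.apply ℝ (E × E) (k.dvel z.2.2 (T • (Φ (vars g k z)).2.2.2))).comp dM -
      (fderiv ℝ Φ (vars g k z) (dvars k z (T • vfield Φ g k z))).2.2.1.comp
        ((k.dvelL z.2.2).comp timesL))).prod
      (T • (ContinuousLinearMap.snd ℝ _ _).comp ((ContinuousLinearMap.snd ℝ _ _).comp
        ((ContinuousLinearMap.snd ℝ _ _).comp dΦ))))

theorem uncorrectL_apply (y : State) : uncorrectL Φ g k z y =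
    (y.1, y.2.1 + g • (Φ (vars g k z)).2.2.1 (k.dvel z.2.2 y.2.2), y.2.2) := rfl

theorem dcoeffL_apply (y : State) : dcoeffL Φ g k z y =
    fderiv ℝ Φ (vars g k z) (dvars k z (uncorrectL Φ g k z y)) := rfl

theorem linearized_apply (y : State) : linearized Φ g T k z y =
    (T • (dcoeffL Φ g k z y).1,
      g • (T • (dcoeffL Φ g k z y).2.1 +
        (dcoeffL Φ g k z y).2.2.1 (k.dvel z.2.2 (T • (Φ (vars g k z)).2.2.2)) -
        (fderiv ℝ Φ (vars g k z) (dvars k z (T • vfield Φ g k z))).2.2.1 (k.dvel z.2.2 y.2.2)),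
      T • (dcoeffL Φ g k z y).2.2.2) := rfl

variable {Φ g T k z} {K : Set Vars} {C : ℝ}

theorem norm_rate_fderiv_le (hC : IsCoeffBound Φ K C) (hg₀ : 0 ≤ g) (hg₁ : g ≤ 1) (hT : 0 ≤ T)
    (hT3 : T ≤ 3) (hk : k.IsBounded 1) (hq : vars g k z ∈ K) :
    ‖(fderiv ℝ Φ (vars g k z) (dvars k z (T • vfield Φ g k z))).2.2.1‖ ≤ 12 * C ^ 3 := by
  have hdv : ‖dvars k z (T • vfield Φ g k z)‖ ≤ 12 * C ^ 2 := by
    refine (norm_dvars_le hk _).trans ?_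
    have := hC.norm_vfield_le hg₀ hg₁ hk hq
    rw [norm_smul, Real.norm_eq_abs, abs_of_nonneg hT]
    have h5 : T * ‖vfield Φ g k z‖ ≤ 3 * (2 * C ^ 2) :=
      mul_le_mul hT3 this (norm_nonneg _) (by norm_num)
    linarith
  have hfd : ‖fderiv ℝ Φ (vars g k z) (dvars k z (T • vfield Φ g k z))‖ ≤ C * (12 * C ^ 2) :=
    (ContinuousLinearMap.le_opNorm _ _).trans
      (mul_le_mul (hC.norm_fderiv_le _ hq) hdv (norm_nonneg _) (by linarith [hC.one_le]))
  exact (norm_coeff_le hfd).2.2.1.trans (le_of_eq (by ring))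

theorem norm_uncorrectL_le (hC : IsCoeffBound Φ K C) (hg₀ : 0 ≤ g) (hg₁ : g ≤ 1)
    (hk : k.IsBounded 1) (hq : vars g k z ∈ K) (y : State) :
    ‖uncorrectL Φ g k z y‖ ≤ 2 * C * ‖y‖ := by
  have hC1 := hC.one_le
  obtain ⟨hX, hV, hS⟩ := norm_state_le.1 (le_refl ‖y‖)
  have n := norm_nonneg y
  have h1 : ‖(Φ (vars g k z)).2.2.1 (k.dvel z.2.2 y.2.2)‖ ≤ C * ‖y‖ := by
    refine (ContinuousLinearMap.le_opNorm _ _).trans (mul_le_mul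
      (norm_coeff_le (hC.norm_le _ hq)).2.2.1 ?_ (norm_nonneg _) (by linarith))
    have := hk.norm_dvel_le z.2.2 y.2.2
    linarith
  rw [uncorrectL_apply]
  refine norm_state_le.2 ⟨hX.trans (by nlinarith), ?_, hS.trans (by nlinarith)⟩
  refine (norm_add_le _ _).trans ?_
  rw [norm_smul, Real.norm_eq_abs, abs_of_nonneg hg₀]
  have h2 : g * ‖(Φ (vars g k z)).2.2.1 (k.dvel z.2.2 y.2.2)‖ ≤ 1 * (C * ‖y‖) :=
    mul_le_mul hg₁ h1 (norm_nonneg _) zero_le_one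
  nlinarith

theorem norm_dcoeffL_le (hC : IsCoeffBound Φ K C) (hk : k.IsBounded 1) (hq : vars g k z ∈ K)
    (y : State) : ‖dcoeffL Φ g k z y‖ ≤ 2 * C * ‖uncorrectL Φ g k z y‖ := by
  have hC1 := hC.one_le
  rw [dcoeffL_apply]
  refine (ContinuousLinearMap.le_opNorm _ _).trans ?_
  have := mul_le_mul (hC.norm_fderiv_le _ hq) (norm_dvars_le (z := z) hk (uncorrectL Φ g k z y))
    (norm_nonneg _) (by linarith)
  linarith

theorem norm_linearized_le (hC : IsCoeffBound Φ K C) (hg₀ : 0 ≤ g) (hg₁ : g ≤ 1) (hT : 0 ≤ T)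
    (hT3 : T ≤ 3) (hk : k.IsBounded 1) (hq : vars g k z ∈ K) :
    ‖linearized Φ g T k z‖ ≤ 40 * C ^ 3 := by
  have hC1 := hC.one_le
  have p2 : C ≤ C ^ 2 := by nlinarith
  have p3 : C ^ 2 ≤ C ^ 3 := by nlinarith [sq_nonneg C]
  refine ContinuousLinearMap.opNorm_le_bound _ (by positivity) fun y => ?_
  have n := norm_nonneg y
  have h1 : ‖dcoeffL Φ g k z y‖ ≤ 4 * C ^ 2 * ‖y‖ := by
    refine (norm_dcoeffL_le hC hk hq y).trans ?_
    have h2 := mul_le_mul_of_nonneg_left (norm_uncorrectL_le hC hg₀ hg₁ hk hq y)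
      (by linarith : 0 ≤ 2 * C)
    linarith
  obtain ⟨d1, d2, d3, d4⟩ := norm_coeff_le h1
  have hsm : ∀ {F : Type} [NormedAddCommGroup F] [NormedSpace ℝ F] (x : F),
      ‖x‖ ≤ 4 * C ^ 2 * ‖y‖ → ‖T • x‖ ≤ 12 * C ^ 2 * ‖y‖ := by
    intro F _ _ x hx
    rw [norm_smul, Real.norm_eq_abs, abs_of_nonneg hT]
    have := mul_le_mul hT3 hx (norm_nonneg _) (by norm_num)
    linarith
  have p4 : C ^ 2 * ‖y‖ ≤ C ^ 3 * ‖y‖ := mul_le_mul_of_nonneg_right p3 n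
  have hω : ‖k.dvel z.2.2 (T • (Φ (vars g k z)).2.2.2)‖ ≤ 3 * C := by
    have h5 := hk.norm_dvel_le z.2.2 (T • (Φ (vars g k z)).2.2.2)
    rw [norm_smul, Real.norm_eq_abs, abs_of_nonneg hT, one_mul] at h5
    exact h5.trans (mul_le_mul hT3 (norm_coeff_le (hC.norm_le _ hq)).2.2.2 (norm_nonneg _)
      (by norm_num))
  have c2 : ‖(dcoeffL Φ g k z y).2.2.1 (k.dvel z.2.2 (T • (Φ (vars g k z)).2.2.2))‖ ≤
      4 * C ^ 2 * ‖y‖ * (3 * C) :=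
    (ContinuousLinearMap.le_opNorm _ _).trans (mul_le_mul d3 hω (norm_nonneg _) (by positivity))
  have c3 : ‖(fderiv ℝ Φ (vars g k z) (dvars k z (T • vfield Φ g k z))).2.2.1
      (k.dvel z.2.2 y.2.2)‖ ≤ 12 * C ^ 3 * ‖y‖ := by
    refine (ContinuousLinearMap.le_opNorm _ _).trans (mul_le_mul
      (norm_rate_fderiv_le hC hg₀ hg₁ hT hT3 hk hq) ?_ (norm_nonneg _) (by positivity))
    have h6 := hk.norm_dvel_le z.2.2 y.2.2
    rw [one_mul] at h6
    exact h6.trans (norm_state_le.1 (le_refl ‖y‖)).2.2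
  have p5 : 0 ≤ C ^ 3 * ‖y‖ := by positivity
  rw [linearized_apply]
  refine norm_state_le.2 ⟨(hsm _ d1).trans (by linarith), ?_, (hsm _ d4).trans (by linarith)⟩
  rw [norm_smul, Real.norm_eq_abs, abs_of_nonneg hg₀]
  have h7 : ‖T • (dcoeffL Φ g k z y).2.1 +
        (dcoeffL Φ g k z y).2.2.1 (k.dvel z.2.2 (T • (Φ (vars g k z)).2.2.2)) -
        (fderiv ℝ Φ (vars g k z) (dvars k z (T • vfield Φ g k z))).2.2.1 (k.dvel z.2.2 y.2.2)‖ ≤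
      40 * C ^ 3 * ‖y‖ := by
    refine (norm_sub_le _ _).trans ((add_le_add ((norm_add_le _ _).trans
      (add_le_add (hsm _ d2) c2)) c3).trans ?_)
    have e : 4 * C ^ 2 * ‖y‖ * (3 * C) = 12 * (C ^ 3 * ‖y‖) := by ring
    rw [e]
    linarith
  exact (mul_le_mul hg₁ h7 (norm_nonneg _) zero_le_one).trans (by linarith)

/-- `correctedDeriv` is differentiable at the state `z`, with derivative `linearized`. -/
theorem norm_correctedDeriv_sub_linearized_le (hC : IsCoeffBound Φ K C) (hg₀ : 0 ≤ g)
    (hg₁ : g ≤ 1) (hT : 0 ≤ T) (hT3 : T ≤ 3) (hk : k.IsBounded 1) {z' : State}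
    (hq : vars g k z ∈ K) (hq' : vars g k z' ∈ K) {ε : ℝ} (hε : 0 ≤ ε) (hε1 : ε ≤ 1)
    (hz : ‖z' - z‖ ≤ ε)
    (hp : ‖k.pos z'.2.2 - k.pos z.2.2 - k.dpos z.2.2 (z'.2.2 - z.2.2)‖ ≤ ε * ‖z'.2.2 - z.2.2‖)
    (hw : ‖k.vel z'.2.2 - k.vel z.2.2 - k.dvel z.2.2 (z'.2.2 - z.2.2)‖ ≤ ε * ‖z'.2.2 - z.2.2‖)
    (hb₂ : ‖k.b₂ z'.2.2.1 - k.b₂ z.2.2.1‖ ≤ ε) (hb₁ : ‖k.b₁ z'.2.2.2 - k.b₁ z.2.2.2‖ ≤ ε)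
    (hΦ : ‖Φ (vars g k z') - Φ (vars g k z) -
      fderiv ℝ Φ (vars g k z) (vars g k z' - vars g k z)‖ ≤ ε * ‖vars g k z' - vars g k z‖) :
    ‖correctedDeriv Φ g T T k k z z' - linearized Φ g T k z (corrected Φ g k k z z')‖ ≤
      100 * C ^ 3 * ε * ‖z' - z‖ := by
  have hC1 := hC.one_le
  have p2 : C ≤ C ^ 2 := by nlinarith
  have p3 : C ^ 2 ≤ C ^ 3 := by nlinarith [sq_nonneg C]
  have n := norm_nonneg (z' - z)
  have hΔS : ‖z'.2.2 - z.2.2‖ ≤ ‖z' - z‖ := (norm_state_le.1 (le_refl ‖z' - z‖)).2.2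
  set x := ‖z' - z‖ with hx
  have hεx : 0 ≤ ε * x := mul_nonneg hε n
  have hp' := hp.trans (mul_le_mul_of_nonneg_left hΔS hε)
  have hw' := hw.trans (mul_le_mul_of_nonneg_left hΔS hε)
  set y := uncorrectL Φ g k z (corrected Φ g k k z z') with hy
  set rw := k.vel z'.2.2 - k.vel z.2.2 - k.dvel z.2.2 (z'.2.2 - z.2.2) with hrw
  set m := (Φ (vars g k z)).2.2.1 with hm
  -- the error of `y` as an approximation of the variation of the state
  have hzy : z' - z - y = (0, g • m rw, 0) := by
    rw [hy, uncorrectL_apply, corrected]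
    refine Prod.ext ?_ (Prod.ext ?_ ?_)
    · simp
    · simp only [Prod.snd_sub, Prod.fst_sub, hrw, hm, map_sub, smul_sub]; abel
    · simp
  have hgm : ‖g • m rw‖ ≤ C * (ε * x) := by
    rw [norm_smul, Real.norm_eq_abs, abs_of_nonneg hg₀]
    have h1 : ‖m rw‖ ≤ C * (ε * x) := (ContinuousLinearMap.le_opNorm _ _).trans
      (mul_le_mul (norm_coeff_le (hC.norm_le _ hq)).2.2.1 hw' (norm_nonneg _) (by linarith))
    exact (mul_le_of_le_one_left (norm_nonneg _) hg₁).trans h1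
  have hzy' : ‖z' - z - y‖ ≤ C * (ε * x) := by
    rw [hzy]
    exact norm_state_le.2 ⟨by simpa using by positivity, hgm, by simpa using by positivity⟩
  have hyn : ‖y‖ ≤ 2 * C * x := by
    have h1 := norm_sub_le (z' - z) (z' - z - y)
    rw [sub_sub_cancel] at h1
    have h2 : ε * x ≤ x := mul_le_of_le_one_left n hε1
    have h3 : C * (ε * x) ≤ C * x := mul_le_mul_of_nonneg_left h2 (by linarith)
    nlinarith
  -- the error of the variation of the variables of the coefficients
  have hq1 : ‖vars g k z' - vars g k z - dvars k z (z' - z)‖ ≤ ε * x := by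
    obtain ⟨p₁, p₂⟩ := norm_prod_le_iff.1 hp'
    refine norm_vars_le.2 ⟨?_, ⟨?_, ?_, ?_⟩, ?_, hw'⟩
    · simpa [vars, dvars] using hεx
    · have e : (vars g k z' - vars g k z - dvars k z (z' - z)).2.1.1 = 0 := by
        simp only [vars, dvars, Prod.fst_sub, Prod.snd_sub]; abel
      rw [e, norm_zero]; exact hεx
    · have e : (vars g k z' - vars g k z - dvars k z (z' - z)).2.1.2.1 =
          -(k.pos z'.2.2 - k.pos z.2.2 - k.dpos z.2.2 (z'.2.2 - z.2.2)).1 := by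
        simp only [vars, dvars, Prod.fst_sub, Prod.snd_sub]; abel
      rw [e, norm_neg]; exact p₁
    · have e : (vars g k z' - vars g k z - dvars k z (z' - z)).2.1.2.2 =
          -(k.pos z'.2.2 - k.pos z.2.2 - k.dpos z.2.2 (z'.2.2 - z.2.2)).2 := by
        simp only [vars, dvars, Prod.fst_sub, Prod.snd_sub]; abel
      rw [e, norm_neg]; exact p₂
    · have e : (vars g k z' - vars g k z - dvars k z (z' - z)).2.2.1 = 0 := by
        simp only [vars, dvars, Prod.fst_sub, Prod.snd_sub]; abel
      rw [e, norm_zero]; exact hεx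
  have hq2 : ‖vars g k z' - vars g k z - dvars k z y‖ ≤ 3 * C * (ε * x) := by
    have e : vars g k z' - vars g k z - dvars k z y =
        (vars g k z' - vars g k z - dvars k z (z' - z)) + dvars k z (z' - z - y) := by
      rw [← dvarsL_apply, ← dvarsL_apply, ← dvarsL_apply, map_sub (dvarsL k z) (z' - z)]; abel
    rw [e]
    refine (norm_add_le _ _).trans ?_
    have := norm_dvars_le (z := z) hk (z' - z - y)
    nlinarith
  have hB : ‖vars g k z' - vars g k z‖ ≤ 2 * x := by
    have := norm_vars_sub_le (g := g) (k := k) (k' := k) (z := z) (z' := z') le_rfl hk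
      (by simp) (by simp)
    linarith
  have hr : ‖Φ (vars g k z') - Φ (vars g k z) - dcoeffL Φ g k z (corrected Φ g k k z z')‖ ≤
      5 * C ^ 2 * (ε * x) := by
    have e : Φ (vars g k z') - Φ (vars g k z) - dcoeffL Φ g k z (corrected Φ g k k z z') =
        (Φ (vars g k z') - Φ (vars g k z) -
          fderiv ℝ Φ (vars g k z) (vars g k z' - vars g k z)) +
        fderiv ℝ Φ (vars g k z) (vars g k z' - vars g k z - dvars k z y) := by
      rw [dcoeffL_apply, map_sub (fderiv ℝ Φ (vars g k z)) (vars g k z' - vars g k z)]; abel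
    rw [e]
    refine (norm_add_le _ _).trans ?_
    have h1 : ‖fderiv ℝ Φ (vars g k z) (vars g k z' - vars g k z - dvars k z y)‖ ≤
        C * (3 * C * (ε * x)) := (ContinuousLinearMap.le_opNorm _ _).trans
      (mul_le_mul (hC.norm_fderiv_le _ hq) hq2 (norm_nonneg _) (by linarith))
    have h2 := hΦ.trans (mul_le_mul_of_nonneg_left hB hε)
    have h3 : ε * x ≤ C ^ 2 * (ε * x) := le_mul_of_one_le_left hεx (one_le_pow₀ hC1)
    linarith
  set dΦ := dcoeffL Φ g k z (corrected Φ g k k z z') with hdΦ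
  obtain ⟨r1, r2, r3, r4⟩ := norm_coeff_le hr
  have hsm : ∀ {F : Type} [NormedAddCommGroup F] [NormedSpace ℝ F] (v : F),
      ‖v‖ ≤ 5 * C ^ 2 * (ε * x) → ‖T • v‖ ≤ 15 * C ^ 2 * (ε * x) := by
    intro F _ _ v hv
    rw [norm_smul, Real.norm_eq_abs, abs_of_nonneg hT]
    have := mul_le_mul hT3 hv (norm_nonneg _) (by norm_num)
    linarith
  have p4 : C ^ 2 * (ε * x) ≤ C ^ 3 * (ε * x) := mul_le_mul_of_nonneg_right p3 hεx
  have p5 : 0 ≤ C ^ 3 * (ε * x) := by positivity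
  have hωs : ∀ w : State, vars g k w ∈ K → ‖T • (Φ (vars g k w)).2.2.2‖ ≤ 3 * C := by
    intro w hw
    rw [norm_smul, Real.norm_eq_abs, abs_of_nonneg hT]
    exact mul_le_mul hT3 (norm_coeff_le (hC.norm_le _ hw)).2.2.2 (norm_nonneg _) (by norm_num)
  -- the rates of change of the velocities on the segments
  have hω : ‖k.dvel z'.2.2 (T • (Φ (vars g k z')).2.2.2)‖ ≤ 3 * C := by
    have h5 := hk.norm_dvel_le z'.2.2 (T • (Φ (vars g k z')).2.2.2)
    rw [one_mul] at h5
    exact h5.trans (hωs z' hq')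
  have hωω : ‖k.dvel z'.2.2 (T • (Φ (vars g k z')).2.2.2) -
      k.dvel z.2.2 (T • (Φ (vars g k z)).2.2.2)‖ ≤ 9 * C * ε := by
    set τ' := T • (Φ (vars g k z')).2.2.2
    set τ := T • (Φ (vars g k z)).2.2.2
    have e : k.dvel z'.2.2 τ' - k.dvel z.2.2 τ =
        (τ'.1 • (k.b₂ z'.2.2.1 - k.b₂ z.2.2.1), τ'.2 • (k.b₁ z'.2.2.2 - k.b₁ z.2.2.2)) +
        k.dvelL z.2.2 (τ' - τ) := by
      have e1 : k.dvelL z.2.2 (τ' - τ) = k.dvel z.2.2 (τ' - τ) := rfl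
      rw [e1]
      refine Prod.ext ?_ ?_ <;>
      simp only [Hist.dvel, Prod.fst_sub, Prod.snd_sub, Prod.fst_add, Prod.snd_add, smul_sub,
        sub_smul] <;> abel
    have h6 : ‖τ'‖ ≤ 3 * C := hωs z' hq'
    have h7 : ‖τ' - τ‖ ≤ 6 * C * ε := by
      have e2 : τ' - τ = T • ((Φ (vars g k z')).2.2.2 - (Φ (vars g k z)).2.2.2) := by
        rw [smul_sub]
      rw [e2, norm_smul, Real.norm_eq_abs, abs_of_nonneg hT]
      have h8 := (hC.norm_sub_le _ hq _ hq').trans (mul_le_mul_of_nonneg_left hB (by linarith))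
      have h9 : ‖(Φ (vars g k z')).2.2.2 - (Φ (vars g k z)).2.2.2‖ ≤ C * (2 * ε) :=
        (norm_coeff_le h8).2.2.2.trans (by gcongr)
      have := mul_le_mul hT3 h9 (norm_nonneg _) (by norm_num)
      linarith
    have h8 : ‖k.dvelL z.2.2 (τ' - τ)‖ ≤ 6 * C * ε := by
      have h9 := hk.norm_dvel_le z.2.2 (τ' - τ)
      rw [one_mul] at h9
      exact h9.trans h7
    have h9 : ‖((τ'.1 • (k.b₂ z'.2.2.1 - k.b₂ z.2.2.1),
        τ'.2 • (k.b₁ z'.2.2.2 - k.b₁ z.2.2.2)) : E × E)‖ ≤ 3 * C * ε := by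
      refine norm_prod_le_iff.2 ⟨?_, ?_⟩ <;> rw [norm_smul]
      · exact mul_le_mul ((norm_fst_le τ').trans h6) hb₂ (norm_nonneg _) (by positivity)
      · exact mul_le_mul ((norm_snd_le τ').trans h6) hb₁ (norm_nonneg _) (by positivity)
    rw [e]
    exact (norm_add_le _ _).trans (by linarith)
  have hdM : ‖dΦ.2.2.1‖ ≤ 4 * C ^ 2 * x := by
    have h6 := norm_dcoeffL_le (g := g) hC hk hq (corrected Φ g k k z z')
    have h7 := mul_le_mul_of_nonneg_left hyn (by linarith : 0 ≤ 2 * C)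
    exact (norm_coeff_le (h6.trans h7)).2.2.1.trans (le_of_eq (by ring))
  set Mq := (fderiv ℝ Φ (vars g k z) (dvars k z (T • vfield Φ g k z))).2.2.1 with hMq
  have hMqn : ‖Mq‖ ≤ 12 * C ^ 3 := norm_rate_fderiv_le hC hg₀ hg₁ hT hT3 hk hq
  rw [linearized_apply]
  refine norm_state_le.2 ⟨?_, ?_, ?_⟩
  · have e : (correctedDeriv Φ g T T k k z z').1 - T • dΦ.1 =
        T • (Φ (vars g k z') - Φ (vars g k z) - dΦ).1 := by
      simp only [correctedDeriv, Prod.fst_sub, smul_sub]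
    refine (le_of_eq (congrArg _ e)).trans ((hsm _ r1).trans (by linarith))
  · have e : (correctedDeriv Φ g T T k k z z').2.1 - g • (T • dΦ.2.1 +
        dΦ.2.2.1 (k.dvel z.2.2 (T • (Φ (vars g k z)).2.2.2)) -
        Mq (k.dvel z.2.2 (corrected Φ g k k z z').2.2)) =
        g • (T • (Φ (vars g k z') - Φ (vars g k z) - dΦ).2.1 +
          (Φ (vars g k z') - Φ (vars g k z) - dΦ).2.2.1
            (k.dvel z'.2.2 (T • (Φ (vars g k z')).2.2.2)) +
          dΦ.2.2.1 (k.dvel z'.2.2 (T • (Φ (vars g k z')).2.2.2) -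
            k.dvel z.2.2 (T • (Φ (vars g k z)).2.2.2)) - Mq rw) := by
      simp only [correctedDeriv, corrected, ← hMq, hrw, Prod.fst_sub, Prod.snd_sub, smul_sub,
        smul_add, map_sub, _root_.sub_apply]
      abel
    refine (le_of_eq (congrArg _ e)).trans ?_
    rw [norm_smul, Real.norm_eq_abs, abs_of_nonneg hg₀]
    refine (mul_le_of_le_one_left (norm_nonneg _) hg₁).trans ?_
    have t2 : ‖(Φ (vars g k z') - Φ (vars g k z) - dΦ).2.2.1
        (k.dvel z'.2.2 (T • (Φ (vars g k z')).2.2.2))‖ ≤ 5 * C ^ 2 * (ε * x) * (3 * C) :=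
      (ContinuousLinearMap.le_opNorm _ _).trans (mul_le_mul r3 hω (norm_nonneg _) (by positivity))
    have t3 : ‖dΦ.2.2.1 (k.dvel z'.2.2 (T • (Φ (vars g k z')).2.2.2) -
        k.dvel z.2.2 (T • (Φ (vars g k z)).2.2.2))‖ ≤ 4 * C ^ 2 * x * (9 * C * ε) :=
      (ContinuousLinearMap.le_opNorm _ _).trans
        (mul_le_mul hdM hωω (norm_nonneg _) (by positivity))
    have t4 : ‖Mq rw‖ ≤ 12 * C ^ 3 * (ε * x) :=
      (ContinuousLinearMap.le_opNorm _ _).trans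
        (mul_le_mul hMqn hw' (norm_nonneg _) (by positivity))
    refine (norm_sub_le _ _).trans ((add_le_add ((norm_add_le _ _).trans
      (add_le_add ((norm_add_le _ _).trans (add_le_add (hsm _ r2) t2)) t3)) t4).trans ?_)
    calc 15 * C ^ 2 * (ε * x) + 5 * C ^ 2 * (ε * x) * (3 * C) + 4 * C ^ 2 * x * (9 * C * ε) +
          12 * C ^ 3 * (ε * x) = 15 * (C ^ 2 * (ε * x)) + 63 * (C ^ 3 * (ε * x)) := by ring
      _ ≤ 100 * (C ^ 3 * (ε * x)) := by linarith
      _ = _ := by ring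
  · have e : (correctedDeriv Φ g T T k k z z').2.2 - T • dΦ.2.2.2 =
        T • (Φ (vars g k z') - Φ (vars g k z) - dΦ).2.2.2 := by
      simp only [correctedDeriv, Prod.snd_sub, smul_sub]
    refine (le_of_eq (congrArg _ e)).trans ((hsm _ r4).trans (by linarith))

end Linearized

/-- The positions at time `1` are differentiable in the initial velocities. -/
theorem flow_differentiable {Φ : Vars → Coeff} {K : Set Vars} {C g T : ℝ} {k : Hist}
    (hC : IsCoeffBound Φ K C) (hKc : IsCompact K) (hg₀ : 0 ≤ g) (hg₁ : g ≤ 1) (hT : 0 ≤ T)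
    (hT3 : T ≤ 3) (hk : k.IsBounded 1) {Z : ℝ → State} (hZ : IsFlow Φ g T k 1 Z)
    (hK : ∀ u ∈ Icc (0 : ℝ) 1, vars g k (Z u) ∈ K) {Zh : E × E → ℝ → State} {r : ℝ} (hr : 0 < r)
    (hZh : ∀ h, ‖h‖ < r → IsFlow Φ g T k 1 (Zh h))
    (hKh : ∀ h, ‖h‖ < r → ∀ u ∈ Icc (0 : ℝ) 1, vars g k (Zh h u) ∈ K)
    (h₀ : ∀ h, ‖h‖ < r → Zh h 0 = Z 0 + (0, h, 0)) :
    ∃ L : E × E →L[ℝ] E × E, HasFDerivAt (fun h => (Zh h 1).1) L 0 := by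
  have hC1 := hC.one_le
  have hs1 := stabConst_pos hC1
  have hstab : ∀ h, ‖h‖ < r → ∀ u ∈ Icc (0 : ℝ) 1, ‖Zh h u - Z u‖ ≤ stabConst C * ‖h‖ := by
    intro h hh u hu
    refine (flow_stability hC hg₀ hg₁ hT hT3 hT hT3 zero_le_one le_rfl hk hk hZ (hZh h hh) hK
      (hKh h hh) (d := ‖h‖) (by simp) (by simp) (by simp) ?_ u hu).1
    rw [h₀ h hh, add_sub_cancel_left]
    simp
  let ι : E × E →L[ℝ] State :=
    (ContinuousLinearMap.inr ℝ (E × E) ((E × E) × (ℝ × ℝ))).comp (ContinuousLinearMap.inl ℝ _ _)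
  have hmain := hasFDerivAt_zero_of_approx_linear_ode
    (ζ := fun h u => corrected Φ g k k (Z u) (Zh h u)) (A := fun u => linearized Φ g T k (Z u))
    (C := 40 * C ^ 3)
    (fun u hu => norm_linearized_le hC hg₀ hg₁ hT hT3 hk (hK u hu)) ι hr
    (fun h hh => by
      rw [h₀ h hh]
      simp [corrected, ι])
    (by
      intro ε hε
      set ε₁ := min 1 (ε / (100 * C ^ 3 * stabConst C)) with hε₁
      have hε₁0 : 0 < ε₁ := by positivity
      have hZc : ContinuousOn (fun u => (Z u).2.2) (Icc 0 1) := fun u hu =>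
        ((hZ u hu).continuousWithinAt).snd.snd
      obtain ⟨δ₁, hδ₁, h1⟩ := hk.uniform (isCompact_Icc.image_of_continuousOn hZc) hε₁0
      obtain ⟨δ₂, hδ₂, h2⟩ := uniform_differentiability hKc hC.contDiffAt hε₁0
      set δ := min (min δ₁ (δ₂ / 2)) ε₁ / stabConst C with hδ
      refine ⟨min r δ, by positivity, fun h hh u hu => ?_⟩
      obtain ⟨hhr, hhδ⟩ := lt_min_iff.1 hh
      have hst := hstab h hhr u hu
      have hlt : ‖Zh h u - Z u‖ < min (min δ₁ (δ₂ / 2)) ε₁ := by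
        refine hst.trans_lt ?_
        rw [hδ, lt_div_iff₀ (by linarith)] at hhδ
        linarith
      obtain ⟨hlt12, hlt3⟩ := lt_min_iff.1 hlt
      obtain ⟨hlt1, hlt2⟩ := lt_min_iff.1 hlt12
      have hS : ‖(Zh h u).2.2 - (Z u).2.2‖ ≤ ‖Zh h u - Z u‖ :=
        (norm_state_le.1 (le_refl ‖Zh h u - Z u‖)).2.2
      obtain ⟨a1, a2, a3, a4⟩ := h1 _ (mem_image_of_mem _ hu) (Zh h u).2.2 (hS.trans_lt hlt1)
      have hB : ‖vars g k (Zh h u) - vars g k (Z u)‖ ≤ 2 * ‖Zh h u - Z u‖ := by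
        have := norm_vars_sub_le (g := g) (k := k) (k' := k) (z := Z u) (z' := Zh h u) le_rfl hk
          (by simp) (by simp)
        linarith
      refine ⟨_, hasDerivWithinAt_corrected hC hk hk (hZ u hu) (hZh h hhr u hu) (hK u hu), ?_⟩
      refine (norm_correctedDeriv_sub_linearized_le hC hg₀ hg₁ hT hT3 hk (hK u hu)
        (hKh h hhr u hu) hε₁0.le (min_le_left _ _) hlt3.le a1 a2 a3 a4
        (h2 _ (hK u hu) _ (by linarith))).trans ?_
      have h5 : ε₁ * (100 * C ^ 3 * stabConst C) ≤ ε :=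
        (le_div_iff₀ (by positivity)).1 (min_le_right _ _)
      calc 100 * C ^ 3 * ε₁ * ‖Zh h u - Z u‖ ≤ 100 * C ^ 3 * ε₁ * (stabConst C * ‖h‖) := by gcongr
        _ = ε₁ * (100 * C ^ 3 * stabConst C) * ‖h‖ := by ring
        _ ≤ ε * ‖h‖ := by gcongr)
  obtain ⟨L, hL⟩ := hmain
  refine ⟨(ContinuousLinearMap.fst ℝ _ _).comp L, ?_⟩
  have h6 := ((ContinuousLinearMap.fst ℝ (E × E) ((E × E) × (ℝ × ℝ))).hasFDerivAt.comp 0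
    hL).const_add (Z 1).1
  refine h6.congr_of_eventuallyEq (Eventually.of_forall fun h => ?_)
  simp [corrected]

/-! ### Existence, uniqueness and shooting estimates for the rescaled flow -/

/-- A continuous quantity that starts below `1`, and that is below `1` whenever it has been at most
`1` so far, stays below `1`. -/
theorem lt_one_of_bootstrap {N : ℝ → ℝ} {b : ℝ} (hN : ContinuousOn N (Icc 0 b))
    (h : ∀ a ∈ Icc 0 b, (∀ u ∈ Icc 0 a, u ≠ a → N u < 1) → N a < 1) :
    ∀ u ∈ Icc 0 b, N u < 1 := by
  by_contra! hne
  obtain ⟨u₀, hu₀, h₀⟩ := hne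
  let s : Set ℝ := Icc 0 b ∩ N ⁻¹' Ici 1
  have hs : IsCompact s := isCompact_Icc.of_isClosed_subset
    (hN.preimage_isClosed_of_isClosed isClosed_Icc isClosed_Ici) inter_subset_left
  obtain ⟨a, ha, hmin⟩ := hs.exists_isLeast ⟨u₀, hu₀, h₀⟩
  refine absurd (h a ha.1 fun u hu hua => ?_) (not_lt.2 ha.2)
  by_contra! hu1
  exact hua (le_antisymm hu.2 (hmin ⟨⟨hu.1, hu.2.trans ha.1.2⟩, hu1⟩))

/-- The radial retraction to the closed ball of radius `a` about the origin. -/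
def retract {W : Type*} [NormedAddCommGroup W] [NormedSpace ℝ W] (a : ℝ) (z : W) : W :=
  (max 1 (‖z‖ / a))⁻¹ • z

section Retract

variable {W : Type*} [NormedAddCommGroup W] [NormedSpace ℝ W] {a : ℝ}

theorem continuous_retract : Continuous (retract a : W → W) := by
  refine Continuous.smul (Continuous.inv₀ (by fun_prop) fun z => ?_) continuous_id
  exact (lt_max_of_lt_left one_pos).ne'

theorem norm_retract_le (ha : 0 < a) (z : W) : ‖retract a z‖ ≤ a := by
  have h : 0 < max 1 (‖z‖ / a) := lt_max_of_lt_left one_pos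
  rw [retract, norm_smul, norm_inv, Real.norm_eq_abs, abs_of_pos h, inv_mul_le_iff₀ h]
  exact (div_le_iff₀ ha).1 (le_max_right _ _)

theorem retract_of_le (ha : 0 < a) {z : W} (hz : ‖z‖ ≤ a) : retract a z = z := by
  rw [retract, max_eq_left ((div_le_one ha).2 hz), inv_one, one_smul]

end Retract

/-- Constants for which the rescaled equations are a small perturbation of free motion: on the tube
the coefficients are smooth and bounded by `C`, and `μ`, which bounds the coupling, the speeds and
the accelerations, is small in terms of `C` and of the accuracy `ε`. -/
structure Setting (m₁ m₂ κ g₀ C μ ε : ℝ) : Prop where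
  coeffBound : IsCoeffBound (Vars.coeff m₁ m₂) (Vars.tube g₀ κ) C
  regular : ∀ q ∈ Vars.tube g₀ κ, q.Regular m₁ m₂
  lam_sub_le : ∀ q ∈ Vars.tube g₀ κ, ∀ q' ∈ Vars.tube g₀ κ, |q'.lam - q.lam| ≤ C * ‖q' - q‖
  κ_pos : 0 < κ
  κ_le : κ ≤ 1 / 2
  g₀_le : g₀ ≤ 1
  μ_pos : 0 < μ
  μ_le : μ ≤ g₀
  ε_le : ε ≤ 1 / 8
  small : 1000 * (C ^ 3 * stabConst C) * μ ≤ ε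

/-- What the boundary data prescribe for the rescaled equations: the coupling, the time span, the
boundary segments, the initial positions, and the initial delayed and advanced times. -/
structure Frame where
  /-- the coupling, the inverse of the unit of length -/
  g : ℝ
  /-- the time span -/
  T : ℝ
  /-- the boundary segments -/
  k : Hist
  /-- the initial positions -/
  X : E × E
  /-- the initial delayed and advanced times -/
  S : ℝ × ℝ

namespace Frame

/-- The initial state with velocities `V`. -/
def start (f : Frame) (V : E × E) : State := (f.X, V, f.S)

/-- The initially interacting points have distance about `1`, and the coupling, the velocities and
the accelerations on the segments are small. -/
structure IsGood (f : Frame) (μ : ℝ) : Prop where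
  g_nonneg : 0 ≤ f.g
  g_le : f.g ≤ μ
  one_le_T : 1 ≤ f.T
  T_le : f.T ≤ 3
  hk : f.k.IsBounded μ
  d : |‖f.X.1 - f.X.2‖ - 1| ≤ μ
  d₂ : |‖f.X.1 - f.k.k₂ f.S.1‖ - 1| ≤ μ
  d₁ : |‖f.X.2 - f.k.k₁ f.S.2‖ - 1| ≤ μ

/-- The states that can be reached in the given time. -/
structure Near (f : Frame) (C μ : ℝ) (z : State) : Prop where
  X : ‖z.1 - f.X‖ ≤ 1 / 8
  V : ‖z.2.1‖ ≤ 8 * C ^ 2 * μ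
  S : ‖z.2.2 - f.S‖ ≤ 4 * C

/-- `Z` solves the rescaled initial value problem. -/
def Solves (m₁ m₂ : ℝ) (f : Frame) (V : E × E) (Z : ℝ → State) : Prop :=
  Z 0 = f.start V ∧ IsFlow (Vars.coeff m₁ m₂) f.g f.T f.k 1 Z

end Frame

namespace Setting

variable {m₁ m₂ κ g₀ C μ ε : ℝ} {f : Frame}

theorem one_le (G : Setting m₁ m₂ κ g₀ C μ ε) : 1 ≤ C := G.coeffBound.one_le

theorem small_stab (G : Setting m₁ m₂ κ g₀ C μ ε) : 1000 * (stabConst C * μ) ≤ ε := by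
  have h1 : 1 ≤ C ^ 3 := one_le_pow₀ G.one_le
  have h2 := stabConst_pos G.one_le
  have h3 := G.μ_pos
  calc 1000 * (stabConst C * μ) ≤ 1000 * (stabConst C * μ) * C ^ 3 :=
        le_mul_of_one_le_right (by positivity) h1
    _ = 1000 * (C ^ 3 * stabConst C) * μ := by ring
    _ ≤ ε := G.small

theorem small_sq (G : Setting m₁ m₂ κ g₀ C μ ε) : 1000 * (C ^ 2 * μ) ≤ ε := by
  have hC := G.one_le
  have h2 := stabConst_pos G.one_le
  have h3 := G.μ_pos
  have h4 : C ^ 2 ≤ C ^ 3 * stabConst C := by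
    calc C ^ 2 ≤ C ^ 3 := pow_le_pow_right₀ hC (by norm_num)
      _ ≤ _ := le_mul_of_one_le_right (by positivity) h2
  have h5 : C ^ 2 * μ ≤ C ^ 3 * stabConst C * μ := mul_le_mul_of_nonneg_right h4 h3.le
  linarith [G.small]

theorem small_C (G : Setting m₁ m₂ κ g₀ C μ ε) : 1000 * (C * μ) ≤ ε := by
  have hC := G.one_le
  have h : C * μ ≤ C ^ 2 * μ := mul_le_mul_of_nonneg_right (by nlinarith) G.μ_pos.le
  linarith [G.small_sq]

theorem small_μ (G : Setting m₁ m₂ κ g₀ C μ ε) : 1000 * μ ≤ ε := by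
  have h : μ ≤ C * μ := le_mul_of_one_le_left G.μ_pos.le G.one_le
  linarith [G.small_C]

theorem bounded_one (G : Setting m₁ m₂ κ g₀ C μ ε) (hf : f.IsGood μ) : f.k.IsBounded 1 :=
  hf.hk.mono (by linarith [G.small_μ, G.ε_le])

theorem g_le_one (G : Setting m₁ m₂ κ g₀ C μ ε) (hf : f.IsGood μ) : f.g ≤ 1 :=
  hf.g_le.trans (by linarith [G.small_μ, G.ε_le])

/-- Near states lie in the tube. -/
theorem mem_tube (G : Setting m₁ m₂ κ g₀ C μ ε) (hf : f.IsGood μ) {z : State}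
    (hz : f.Near C μ z) : vars f.g f.k z ∈ Vars.tube g₀ κ := by
  have s1 := G.small_sq
  have s2 := G.small_C
  have s3 := G.small_μ
  have hε := G.ε_le
  have hκ := G.κ_le
  have hμ := G.μ_pos
  have hp : ‖f.k.pos z.2.2 - f.k.pos f.S‖ ≤ 4 * (C * μ) :=
    (hf.hk.norm_pos_sub hμ.le _ _).trans (by nlinarith [hz.S])
  obtain ⟨p₁, p₂⟩ := norm_prod_le_iff.1 hp
  obtain ⟨x₁, x₂⟩ := norm_prod_le_iff.1 hz.X
  have hV := hz.V
  obtain ⟨v₁, v₂⟩ := norm_prod_le_iff.1 hV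
  have hd : ∀ {a b a' b' : E}, ‖a' - a‖ ≤ 1 / 8 → ‖b' - b‖ ≤ 1 / 8 → |‖a - b‖ - 1| ≤ μ →
      ‖a' - b'‖ ≤ 4 ∧ κ ≤ ‖a' - b'‖ := by
    intro a b a' b' h1 h2 h3
    have h4 := abs_le.1 h3
    have e : a' - b' - (a - b) = (a' - a) - (b' - b) := by abel
    have h5 : |‖a' - b'‖ - ‖a - b‖| ≤ 1 / 4 := by
      refine (abs_norm_sub_norm_le _ _).trans ?_
      rw [e]
      exact (norm_sub_le _ _).trans (by linarith)
    have h6 := abs_le.1 h5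
    constructor <;> linarith
  refine Vars.mem_tube.2 ⟨⟨hf.g_nonneg, hf.g_le.trans G.μ_le⟩, ⟨?_, ?_, ?_⟩, ⟨?_, ?_⟩, ?_, ?_⟩
  · exact hd x₁ x₂ hf.d
  · exact hd x₁ (p₁.trans (by linarith)) hf.d₂
  · exact hd x₂ (p₂.trans (by linarith)) hf.d₁
  · exact v₁.trans (by linarith)
  · exact v₂.trans (by linarith)
  · exact (hf.hk.norm_w₂ _).trans (by linarith)
  · exact (hf.hk.norm_w₁ _).trans (by linarith)

theorem abs_lam_sub_one_le {q : Vars} (h₂ : ‖q.v₂‖ ≤ 1 / 2) :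
    |q.lam - 1| ≤ 2 * (‖q.v₁‖ + ‖q.v₂‖) := by
  have e1 := abs_le.1 (Vars.abs_inner_nv_le q.d q.v₁)
  have e2 := abs_le.1 (Vars.abs_inner_nv_le q.d q.v₂)
  have hp : 0 < 1 + inner ℝ (nv q.d) q.v₂ := by linarith
  have e : q.lam - 1 = (inner ℝ (nv q.d) q.v₁ - inner ℝ (nv q.d) q.v₂) /
      (1 + inner ℝ (nv q.d) q.v₂) := by
    rw [Vars.lam]; field_simp; ring
  rw [e, abs_div, abs_of_pos hp, div_le_iff₀ hp]
  have h3 : |inner ℝ (nv q.d) q.v₁ - inner ℝ (nv q.d) q.v₂| ≤ ‖q.v₁‖ + ‖q.v₂‖ :=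
    abs_le.2 ⟨by linarith, by linarith⟩
  have h4 : (1 : ℝ) / 2 ≤ 1 + inner ℝ (nv q.d) q.v₂ := by linarith
  nlinarith [norm_nonneg q.v₁, norm_nonneg q.v₂]

theorem norm_Lam_le {q : Vars} {a : ℝ} (ha : a ≤ 1 / 2) (h : ‖q.2.2.1‖ ≤ a) :
    ‖q.Lam‖ ≤ 3 * a := by
  obtain ⟨h₁, h₂⟩ := norm_prod_le_iff.1 h
  have h₀ : 0 ≤ a := (norm_nonneg _).trans h
  have h3 := abs_lam_sub_one_le (q := q) (h₂.trans ha)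
  have h4 : |q.lam| ≤ 3 := by
    have h5 := abs_sub_abs_le_abs_sub q.lam 1
    rw [abs_one] at h5
    have h6 : ‖q.v₁‖ ≤ a := h₁
    have h7 : ‖q.v₂‖ ≤ a := h₂
    linarith
  refine norm_prod_le_iff.2 ⟨h₁.trans (by linarith), ?_⟩
  change ‖q.lam • q.v₂‖ ≤ _
  rw [norm_smul]
  exact mul_le_mul h4 h₂ (norm_nonneg _) (by norm_num)

/-- The rate of change of the velocities is of the order of the coupling. -/
theorem norm_vfield_velocity_le {Φ : Vars → Coeff} {K : Set Vars} {g : ℝ} {k : Hist} {z : State}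
    (hC : IsCoeffBound Φ K C) (hg₀ : 0 ≤ g) (hk : k.IsBounded 1) (hz : vars g k z ∈ K) :
    ‖(vfield Φ g k z).2.1‖ ≤ g * (2 * C ^ 2) := by
  obtain ⟨-, h2, h3, h4⟩ := norm_coeff_le (hC.norm_le _ hz)
  have hC1 := hC.one_le
  have h5 : ‖(Φ (vars g k z)).2.2.1 (k.dvel z.2.2 (Φ (vars g k z)).2.2.2)‖ ≤ C * C := by
    refine (ContinuousLinearMap.le_opNorm _ _).trans (mul_le_mul h3 ?_ (norm_nonneg _)
      (by linarith))
    have := hk.norm_dvel_le z.2.2 (Φ (vars g k z)).2.2.2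
    linarith
  have h6 := norm_add_le (Φ (vars g k z)).2.1
    ((Φ (vars g k z)).2.2.1 (k.dvel z.2.2 (Φ (vars g k z)).2.2.2))
  change ‖g • ((Φ (vars g k z)).2.1 +
    (Φ (vars g k z)).2.2.1 (k.dvel z.2.2 (Φ (vars g k z)).2.2.2))‖ ≤ _
  rw [norm_smul, Real.norm_eq_abs, abs_of_nonneg hg₀]
  exact mul_le_mul_of_nonneg_left (by nlinarith) hg₀

/-- Rates given by the vector field at near states lead to states that are near, with room to
spare. -/
theorem near_of_rate (G : Setting m₁ m₂ κ g₀ C μ ε) (hf : f.IsGood μ) {a : ℝ} (ha₀ : 0 ≤ a)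
    (ha₁ : a ≤ 1) {Z y : ℝ → State} {V : E × E} (hV : ‖V‖ ≤ μ) (h0 : Z 0 = f.start V)
    (hZc : ContinuousOn Z (Icc 0 a))
    (hZ : ∀ u ∈ Ico 0 a, HasDerivWithinAt Z (f.T • vfield (Vars.coeff m₁ m₂) f.g f.k (y u))
      (Ici u) u)
    (hy : ∀ u ∈ Ico 0 a, f.Near C μ (y u)) :
    ‖(Z a).1 - f.X‖ ≤ 72 * C ^ 2 * μ ∧ ‖(Z a).2.1‖ ≤ 7 * C ^ 2 * μ ∧ ‖(Z a).2.2 - f.S‖ ≤ 3 * C := by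
  have s1 := G.small_sq
  have hε := G.ε_le
  have hμ := G.μ_pos
  have hC := G.one_le
  have hT0 : 0 ≤ f.T := by linarith [hf.one_le_T]
  have hT3 := hf.T_le
  have ha : a ∈ Icc 0 a := ⟨ha₀, le_rfl⟩
  have mvt : ∀ {A : Type} [NormedAddCommGroup A] [NormedSpace ℝ A] {φ φ' : ℝ → A} {c : ℝ},
      0 ≤ c → ContinuousOn φ (Icc 0 a) →
      (∀ u ∈ Ico 0 a, HasDerivWithinAt φ (f.T • φ' u) (Ici u) u) → (∀ u ∈ Ico 0 a, ‖φ' u‖ ≤ c) →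
      ‖φ a - φ 0‖ ≤ 3 * c := by
    intro A _ _ φ φ' c hc hφ hd hb
    have h := norm_image_sub_le_of_norm_deriv_right_le_segment (C := 3 * c) hφ hd (fun u hu => by
      rw [norm_smul, Real.norm_eq_abs, abs_of_nonneg hT0]
      exact mul_le_mul hT3 (hb u hu) (norm_nonneg _) (by norm_num)) a ha
    refine h.trans (mul_le_of_le_one_right (by positivity) (by linarith))
  have hCμ : 8 * C ^ 2 * μ ≤ 1 / 2 := by linarith
  refine ⟨?_, ?_, ?_⟩
  · have h := mvt (φ := fun u => (Z u).1) (c := 3 * (8 * C ^ 2 * μ)) (by positivity)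
      (continuous_fst.comp_continuousOn hZc) (fun u hu => hasDerivWithinAt_fst (hZ u hu))
      (fun u hu => norm_Lam_le (q := vars f.g f.k (y u)) hCμ (hy u hu).V)
    simp only [h0, Frame.start] at h
    linarith
  · have h := mvt (φ := fun u => (Z u).2.1) (c := f.g * (2 * C ^ 2))
      (mul_nonneg hf.g_nonneg (by positivity))
      (continuous_fst.comp_continuousOn (continuous_snd.comp_continuousOn hZc))
      (fun u hu => hasDerivWithinAt_fst (hasDerivWithinAt_snd (hZ u hu)))
      (fun u hu => norm_vfield_velocity_le G.coeffBound hf.g_nonneg (G.bounded_one hf)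
        (G.mem_tube hf (hy u hu)))
    simp only [h0, Frame.start] at h
    have h2 := norm_add_le ((Z a).2.1 - V) V
    rw [sub_add_cancel] at h2
    have h3 : f.g * (2 * C ^ 2) ≤ μ * (2 * C ^ 2) := mul_le_mul_of_nonneg_right hf.g_le
      (by positivity)
    have h4 : μ ≤ C ^ 2 * μ := le_mul_of_one_le_left hμ.le (one_le_pow₀ hC)
    linarith
  · have h := mvt (φ := fun u => (Z u).2.2) (c := C) (by linarith)
      (continuous_snd.comp_continuousOn (continuous_snd.comp_continuousOn hZc))
      (fun u hu => hasDerivWithinAt_snd (hasDerivWithinAt_snd (hZ u hu)))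
      (fun u hu => (norm_coeff_le (G.coeffBound.norm_le _ (G.mem_tube hf (hy u hu)))).2.2.2)
    simpa only [h0, Frame.start] using h

theorem near_of_strong (G : Setting m₁ m₂ κ g₀ C μ ε) {z : State}
    (h : ‖z.1 - f.X‖ ≤ 72 * C ^ 2 * μ ∧ ‖z.2.1‖ ≤ 7 * C ^ 2 * μ ∧ ‖z.2.2 - f.S‖ ≤ 3 * C) :
    f.Near C μ z := by
  have h1 : 0 ≤ C ^ 2 * μ := mul_nonneg (sq_nonneg C) G.μ_pos.le
  exact ⟨h.1.trans (by linarith [G.small_sq, G.ε_le]), h.2.1.trans (by linarith), h.2.2.trans (by linarith [G.one_le])⟩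

theorem hasDerivWithinAt_Ici {W : Type*} [NormedAddCommGroup W] [NormedSpace ℝ W] {Z : ℝ → W}
    {Z' : W} {a u : ℝ} (h : HasDerivWithinAt Z Z' (Icc 0 a) u) (hu : u ∈ Ico 0 a) :
    HasDerivWithinAt Z Z' (Ici u) u :=
  h.mono_of_mem_nhdsWithin (mem_of_superset (Icc_mem_nhdsGE hu.2) (Icc_subset_Icc_left hu.1))

/-- Every solution stays near. -/
theorem near_of_solves (G : Setting m₁ m₂ κ g₀ C μ ε) (hf : f.IsGood μ) {Z : ℝ → State}
    {V : E × E} (hV : ‖V‖ ≤ μ) (hZ : f.Solves m₁ m₂ V Z) :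
    ∀ u ∈ Icc (0 : ℝ) 1, f.Near C μ (Z u) := by
  have hC := G.one_le
  have hμ := G.μ_pos
  have hb : 0 < 8 * C ^ 2 * μ := by positivity
  have hc : 0 < 4 * C := by positivity
  have hZc : ContinuousOn Z (Icc 0 1) := fun u hu => (hZ.2 u hu).continuousWithinAt
  have key := lt_one_of_bootstrap (b := 1) (N := fun u => max (‖(Z u).1 - f.X‖ / (1 / 8))
    (max (‖(Z u).2.1‖ / (8 * C ^ 2 * μ)) (‖(Z u).2.2 - f.S‖ / (4 * C)))) (by fun_prop)
    (fun a ha h => by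
      have := G.near_of_rate hf ha.1 ha.2 (y := Z) hV hZ.1 (hZc.mono (Icc_subset_Icc_right ha.2))
        (fun u hu => hasDerivWithinAt_Ici (hZ.2 u ⟨hu.1, hu.2.le.trans ha.2⟩)
          ⟨hu.1, hu.2.trans_le ha.2⟩)
        (fun u hu => by
          have h1 := h u ⟨hu.1, hu.2.le⟩ hu.2.ne
          simp only [max_lt_iff, div_lt_one hb, div_lt_one hc, div_lt_iff₀ (show (0 : ℝ) < 1 / 8 by
            norm_num)] at h1
          exact ⟨by linarith [h1.1], h1.2.1.le, h1.2.2.le⟩)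
      simp only [max_lt_iff, div_lt_one hb, div_lt_one hc, div_lt_iff₀ (show (0 : ℝ) < 1 / 8 by
            norm_num)]
      have h1 : 0 < C ^ 2 * μ := by positivity
      exact ⟨by linarith [this.1, G.small_sq, G.ε_le], by linarith [this.2.1], by linarith [this.2.2]⟩)
  intro u hu
  have h1 := key u hu
  simp only [max_lt_iff, div_lt_one hb, div_lt_one hc, div_lt_iff₀ (show (0 : ℝ) < 1 / 8 by
            norm_num)] at h1
  exact ⟨by linarith [h1.1], h1.2.1.le, h1.2.2.le⟩

/-- The displacement in the given time is small. -/
theorem displacement_le (G : Setting m₁ m₂ κ g₀ C μ ε) (hf : f.IsGood μ) {Z : ℝ → State}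
    {V : E × E} (hV : ‖V‖ ≤ μ) (hZ : f.Solves m₁ m₂ V Z) : ‖(Z 1).1 - f.X‖ ≤ 72 * C ^ 2 * μ :=
  (G.near_of_rate hf zero_le_one le_rfl (y := Z) hV hZ.1
    (fun u hu => (hZ.2 u hu).continuousWithinAt)
    (fun u hu => hasDerivWithinAt_Ici (hZ.2 u ⟨hu.1, hu.2.le⟩) hu)
    (fun u hu => G.near_of_solves hf hV hZ u ⟨hu.1, hu.2.le⟩)).1

/-- Existence follows from Peano's theorem: the vector field is merely continuous, since the segments
are merely `C²`. Solutions of the field cut off outside the near states stay near. -/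
theorem exists_solves (G : Setting m₁ m₂ κ g₀ C μ ε) (hf : f.IsGood μ) {V : E × E}
    (hV : ‖V‖ ≤ μ) : ∃ Z, f.Solves m₁ m₂ V Z := by
  have hC := G.one_le
  have hμ := G.μ_pos
  have hb : 0 < 8 * C ^ 2 * μ := by positivity
  have hc : 0 < 4 * C := by positivity
  -- the vector field is evaluated at the retraction of the state to the region of near states
  let y : State → State := fun z => (f.X + retract (1 / 8) (z.1 - f.X),
    retract (8 * C ^ 2 * μ) z.2.1, f.S + retract (4 * C) (z.2.2 - f.S))
  have hyc : Continuous y := by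
    refine Continuous.prodMk ?_ (Continuous.prodMk ?_ ?_)
    · exact continuous_const.add (continuous_retract.comp (by fun_prop))
    · exact continuous_retract.comp (by fun_prop)
    · exact continuous_const.add (continuous_retract.comp (by fun_prop))
  have hyn : ∀ z, f.Near C μ (y z) := fun z =>
    ⟨by simpa only [y, add_sub_cancel_left] using norm_retract_le (by norm_num) _,
      norm_retract_le hb _,
      by simpa only [y, add_sub_cancel_left] using norm_retract_le hc _⟩
  have hyt := fun z => G.mem_tube hf (hyn z)
  have hk := hf.hk
  have hk₂ : Continuous f.k.k₂ := continuous_iff_continuousAt.2 fun s => (hk.hk₂ s).continuousAt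
  have hk₁ : Continuous f.k.k₁ := continuous_iff_continuousAt.2 fun s => (hk.hk₁ s).continuousAt
  have hw₂ : Continuous f.k.w₂ := continuous_iff_continuousAt.2 fun s => (hk.hw₂ s).continuousAt
  have hw₁ : Continuous f.k.w₁ := continuous_iff_continuousAt.2 fun s => (hk.hw₁ s).continuousAt
  have hb₂ := hk.hb₂
  have hb₁ := hk.hb₁
  have hvc : Continuous fun z => vars f.g f.k (y z) := by
    have : Continuous (vars f.g f.k) := by
      unfold vars Hist.pos Hist.vel
      fun_prop
    exact this.comp hyc
  have hΦ : Continuous fun z => Vars.coeff m₁ m₂ (vars f.g f.k (y z)) :=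
    continuous_iff_continuousAt.2 fun z =>
      ((G.coeffBound.contDiffAt _ (hyt z)).continuousAt.comp (f := fun z => vars f.g f.k (y z))
        hvc.continuousAt)
  have hF : Continuous fun z => f.T • vfield (Vars.coeff m₁ m₂) f.g f.k (y z) := by
    obtain ⟨Q, hQ⟩ : ∃ Q : State → Coeff, ∀ z, Vars.coeff m₁ m₂ (vars f.g f.k (y z)) = Q z :=
      ⟨_, fun _ => rfl⟩
    simp only [hQ] at hΦ
    have h3 : Continuous fun z => f.k.dvel (y z).2.2 (Q z).2.2.2 := by
      unfold Hist.dvel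
      fun_prop
    have h4 : Continuous fun z => (Q z).2.2.1 (f.k.dvel (y z).2.2 (Q z).2.2.2) :=
      Continuous.clm_apply (by fun_prop) h3
    simp only [vfield, hQ]
    fun_prop
  have hT0 : 0 ≤ f.T := by linarith [hf.one_le_T]
  obtain ⟨Z, h0, hZ⟩ := exists_solution_of_continuous hF (M := 3 * (2 * C ^ 2)) (fun z => by
    rw [norm_smul, Real.norm_eq_abs, abs_of_nonneg hT0]
    exact mul_le_mul hf.T_le (G.coeffBound.norm_vfield_le hf.g_nonneg (G.g_le_one hf)
      (G.bounded_one hf) (hyt z)) (norm_nonneg _) (by norm_num)) (f.start V)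
  have hZc : ContinuousOn Z (Icc 0 1) := fun u hu => (hZ u hu).continuousWithinAt
  refine ⟨Z, h0, fun u hu => ?_⟩
  have hn := G.near_of_strong (G.near_of_rate hf hu.1 hu.2 (y := fun u => y (Z u)) hV h0
    (hZc.mono (Icc_subset_Icc_right hu.2))
    (fun w hw => hasDerivWithinAt_Ici (hZ w ⟨hw.1, hw.2.le.trans hu.2⟩)
      ⟨hw.1, hw.2.trans_le hu.2⟩) (fun w _ => hyn (Z w)))
  have hy : y (Z u) = Z u := by
    refine Prod.ext ?_ (Prod.ext ?_ ?_)
    · simp only [y, retract_of_le (show (0 : ℝ) < 1 / 8 by norm_num) hn.X, add_sub_cancel]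
    · simp only [y, retract_of_le hb hn.V]
    · simp only [y, retract_of_le hc hn.S, add_sub_cancel]
  have h := hZ u hu
  rwa [hy] at h

/-- Stability, and in particular uniqueness, of solutions for different initial velocities. -/
theorem stability (G : Setting m₁ m₂ κ g₀ C μ ε) (hf : f.IsGood μ) {V V' : E × E}
    {Z Z' : ℝ → State} (hV : ‖V‖ ≤ μ) (hV' : ‖V'‖ ≤ μ) (hZ : f.Solves m₁ m₂ V Z)
    (hZ' : f.Solves m₁ m₂ V' Z') : ∀ u ∈ Icc (0 : ℝ) 1, ‖Z' u - Z u‖ ≤ stabConst C * ‖V' - V‖ ∧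
      ‖((Z' u).2.1 - (Z u).2.1) - (V' - V)‖ ≤ f.g * (stabConst C * ‖V' - V‖) := by
  have hT0 : 0 ≤ f.T := by linarith [hf.one_le_T]
  have h := flow_stability (d := ‖V' - V‖) G.coeffBound hf.g_nonneg (G.g_le_one hf) hT0 hf.T_le hT0
    hf.T_le zero_le_one le_rfl (G.bounded_one hf) (G.bounded_one hf) hZ.2 hZ'.2
    (fun u hu => G.mem_tube hf (G.near_of_solves hf hV hZ u hu))
    (fun u hu => G.mem_tube hf (G.near_of_solves hf hV' hZ' u hu))
    (by simp) (by simp) (by simp) (by simp [hZ.1, hZ'.1, Frame.start])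
  simpa only [hZ.1, hZ'.1, Frame.start] using h

theorem solves_unique (G : Setting m₁ m₂ κ g₀ C μ ε) (hf : f.IsGood μ) {V : E × E}
    {Z Z' : ℝ → State} (hV : ‖V‖ ≤ μ) (hZ : f.Solves m₁ m₂ V Z) (hZ' : f.Solves m₁ m₂ V Z') :
    EqOn Z' Z (Icc 0 1) := fun u hu => by
  have h := (G.stability hf hV hV hZ hZ' u hu).1
  rw [sub_self, norm_zero, mul_zero] at h
  exact sub_eq_zero.1 (norm_le_zero_iff.1 h)

/-- The difference of the final positions is that of free motion, up to a small relative error. -/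
theorem approx (G : Setting m₁ m₂ κ g₀ C μ ε) (hf : f.IsGood μ) {V V' : E × E}
    {Z Z' : ℝ → State} (hV : ‖V‖ ≤ μ) (hV' : ‖V'‖ ≤ μ) (hZ : f.Solves m₁ m₂ V Z)
    (hZ' : f.Solves m₁ m₂ V' Z') :
    ‖(Z' 1).1 - (Z 1).1 - f.T • (V' - V)‖ ≤ ε * f.T * ‖V' - V‖ := by
  have hC := G.one_le
  have hμ := G.μ_pos
  have hs := stabConst_pos hC
  have hT0 : 0 ≤ f.T := by linarith [hf.one_le_T]
  set h := V' - V with hh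
  set σ := stabConst C with hσ
  have hst := G.stability hf hV hV' hZ hZ'
  have hder : ∀ u ∈ Icc (0 : ℝ) 1, HasDerivWithinAt
      (fun u => (Z' u).1 - (Z u).1 - (u * f.T) • h)
      (f.T • ((vars f.g f.k (Z' u)).Lam - (vars f.g f.k (Z u)).Lam - h)) (Icc 0 1) u := by
    intro u hu
    have h1 := (hasDerivWithinAt_fst (hZ'.2 u hu)).sub (hasDerivWithinAt_fst (hZ.2 u hu))
    have h2 : HasDerivWithinAt (fun u => (u * f.T) • h) ((1 * f.T) • h) (Icc 0 1) u :=
      ((hasDerivWithinAt_id u _).mul_const f.T).smul_const h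
    refine (h1.sub h2).congr_deriv ?_
    have e : ∀ a b c : E × E, f.T • a - f.T • b - f.T • c = f.T • (a - b - c) := fun a b c => by
      rw [smul_sub, smul_sub]
    rw [one_mul]
    exact e _ _ _
  have hb : ∀ u ∈ Icc (0 : ℝ) 1,
      ‖(vars f.g f.k (Z' u)).Lam - (vars f.g f.k (Z u)).Lam - h‖ ≤ ε * ‖h‖ := by
    intro u hu
    have n := G.near_of_solves hf hV hZ u hu
    have n' := G.near_of_solves hf hV' hZ' u hu
    have t := G.mem_tube hf n
    have t' := G.mem_tube hf n'
    set q := vars f.g f.k (Z u) with hq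
    set q' := vars f.g f.k (Z' u) with hq'
    obtain ⟨s1, s2⟩ := hst u hu
    have hqq : ‖q' - q‖ ≤ 2 * (σ * ‖h‖) := by
      have h1 := norm_vars_sub_le (g := f.g) (z := Z u) (z' := Z' u) (le_refl (0 : ℝ))
        (G.bounded_one hf) (k' := f.k) (by simp) (by simp)
      linarith
    have hlam := (G.lam_sub_le q t q' t').trans (mul_le_mul_of_nonneg_left hqq (by linarith))
    obtain ⟨-, -, ⟨-, b2⟩, -⟩ := Vars.mem_tube.1 t
    have hl1 := abs_lam_sub_one_le b2
    obtain ⟨v1, v2⟩ := norm_prod_le_iff.1 n.V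
    obtain ⟨v1', v2'⟩ := norm_prod_le_iff.1 n'.V
    have hg : f.g * (σ * ‖h‖) ≤ μ * (σ * ‖h‖) := mul_le_mul_of_nonneg_right hf.g_le (by positivity)
    obtain ⟨d1, d2⟩ := norm_prod_le_iff.1 (s2.trans hg)
    have sm := mul_le_mul_of_nonneg_right G.small (norm_nonneg h)
    have sm1 := mul_le_mul_of_nonneg_right G.small_stab (norm_nonneg h)
    have hμ0 : 0 ≤ μ * (σ * ‖h‖) := by positivity
    refine norm_prod_le_iff.2 ⟨?_, ?_⟩
    · exact d1.trans (by linarith)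
    · have e : (q'.Lam - q.Lam - h).2 = (((Z' u).2.1 - (Z u).2.1) - h).2 +
          ((q.lam - 1) • ((Z' u).2.1 - (Z u).2.1).2 + (q'.lam - q.lam) • (Z' u).2.1.2) := by
        change q'.lam • (Z' u).2.1.2 - q.lam • (Z u).2.1.2 - h.2 =
          ((Z' u).2.1.2 - (Z u).2.1.2 - h.2) +
          ((q.lam - 1) • ((Z' u).2.1.2 - (Z u).2.1.2) + (q'.lam - q.lam) • (Z' u).2.1.2)
        module
      rw [e]
      have hΔ : ‖((Z' u).2.1 - (Z u).2.1).2‖ ≤ σ * ‖h‖ :=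
        ((norm_snd_le _).trans (norm_state_le.1 s1).2.1)
      have a1 : ‖(q.lam - 1) • ((Z' u).2.1 - (Z u).2.1).2‖ ≤ (32 * (C ^ 2 * μ)) * (σ * ‖h‖) := by
        rw [norm_smul, Real.norm_eq_abs]
        refine mul_le_mul (hl1.trans ?_) hΔ (norm_nonneg _) (by positivity)
        have v1 : ‖q.v₁‖ ≤ 8 * C ^ 2 * μ := v1
        have v2 : ‖q.v₂‖ ≤ 8 * C ^ 2 * μ := v2
        linarith
      have a2 : ‖(q'.lam - q.lam) • (Z' u).2.1.2‖ ≤ (C * (2 * (σ * ‖h‖))) * (8 * C ^ 2 * μ) := by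
        rw [norm_smul, Real.norm_eq_abs]
        exact mul_le_mul hlam v2' (norm_nonneg _) (by positivity)
      have a3 : C ^ 2 * μ * (σ * ‖h‖) ≤ C ^ 3 * μ * (σ * ‖h‖) := by
        have : C ^ 2 ≤ C ^ 3 := pow_le_pow_right₀ hC (by norm_num)
        gcongr
      have a4 : 1000 * (C ^ 3 * μ * (σ * ‖h‖)) ≤ ε * ‖h‖ := by linarith
      refine (norm_add_le _ _).trans ?_
      refine (add_le_add d2 ((norm_add_le _ _).trans (add_le_add a1 a2))).trans ?_
      linarith
  have hfin := (convex_Icc (0 : ℝ) 1).norm_image_sub_le_of_norm_hasDerivWithin_le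
    (C := f.T * (ε * ‖h‖)) hder
    (fun u hu => by
      rw [norm_smul, Real.norm_eq_abs, abs_of_nonneg hT0]
      exact mul_le_mul_of_nonneg_left (hb u hu) hT0)
    (left_mem_Icc.2 zero_le_one) (right_mem_Icc.2 zero_le_one)
  simp only [hZ.1, hZ'.1, Frame.start, sub_self, zero_mul, zero_smul, sub_zero, one_mul, norm_one,
    mul_one] at hfin
  linarith

end Setting

/-! ### Continuation of the boundary segments -/

/-- The velocity of `c2Extend f a b`. -/
def c2ExtendVel (f : ℝ → E) (a b t : ℝ) : E :=
  if t < a then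
    derivWithin f (Icc a b) a + Real.sin (t - a) • iteratedDerivWithin 2 f (Icc a b) a
  else if b < t then
    derivWithin f (Icc a b) b + Real.sin (t - b) • iteratedDerivWithin 2 f (Icc a b) b
  else derivWithin f (Icc a b) t

/-- The acceleration of `c2Extend f a b`. -/
def c2ExtendAcc (f : ℝ → E) (a b t : ℝ) : E :=
  if t < a then Real.cos (t - a) • iteratedDerivWithin 2 f (Icc a b) a
  else if b < t then Real.cos (t - b) • iteratedDerivWithin 2 f (Icc a b) b
  else iteratedDerivWithin 2 f (Icc a b) t

/-- The point of `[a, b]` closest to `t`. -/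
def clamp (a b t : ℝ) : ℝ := max a (min t b)

section

variable {f : ℝ → E} {a b t : ℝ}

theorem clamp_mem (hab : a ≤ b) : clamp a b t ∈ Icc a b :=
  ⟨le_max_left _ _, max_le hab (min_le_right _ _)⟩

theorem clamp_of_mem (ht : t ∈ Icc a b) : clamp a b t = t := by
  rw [clamp, min_eq_left ht.2, max_eq_right ht.1]

theorem clamp_cases (hab : a ≤ b) : (t < a ∧ clamp a b t = a) ∨
    (¬ t < a ∧ b < t ∧ clamp a b t = b) ∨ (¬ t < a ∧ ¬ b < t ∧ clamp a b t = t) := by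
  rcases lt_or_ge t a with h | h
  · exact Or.inl ⟨h, max_eq_left ((min_le_left _ _).trans h.le)⟩
  rcases lt_or_ge b t with h' | h'
  · refine Or.inr (Or.inl ⟨h.not_gt, h', ?_⟩)
    rw [clamp, min_eq_right h'.le, max_eq_right hab]
  · exact Or.inr (Or.inr ⟨h.not_gt, h'.not_gt, clamp_of_mem ⟨h, h'⟩⟩)

theorem c2Extend_eq (hab : a ≤ b) : c2Extend f a b t = f (clamp a b t) +
    (t - clamp a b t) • derivWithin f (Icc a b) (clamp a b t) +
    (1 - Real.cos (t - clamp a b t)) • iteratedDerivWithin 2 f (Icc a b) (clamp a b t) := by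
  rcases clamp_cases (t := t) hab with ⟨h, e⟩ | ⟨h, h', e⟩ | ⟨h, h', e⟩ <;>
    simp [c2Extend, h, e] <;> simp [h']

theorem c2ExtendVel_eq (hab : a ≤ b) : c2ExtendVel f a b t =
    derivWithin f (Icc a b) (clamp a b t) +
    Real.sin (t - clamp a b t) • iteratedDerivWithin 2 f (Icc a b) (clamp a b t) := by
  rcases clamp_cases (t := t) hab with ⟨h, e⟩ | ⟨h, h', e⟩ | ⟨h, h', e⟩ <;>
    simp [c2ExtendVel, h, e] <;> simp [h']

theorem c2ExtendAcc_eq (hab : a ≤ b) : c2ExtendAcc f a b t =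
    Real.cos (t - clamp a b t) • iteratedDerivWithin 2 f (Icc a b) (clamp a b t) := by
  rcases clamp_cases (t := t) hab with ⟨h, e⟩ | ⟨h, h', e⟩ | ⟨h, h', e⟩ <;>
    simp [c2ExtendAcc, h, e] <;> simp [h']

theorem hasDerivAt_of_pieces {F F' : ℝ → E} (hab : a ≤ b)
    (h₁ : ∀ t ∈ Iic a, HasDerivWithinAt F (F' t) (Iic a) t)
    (h₂ : ∀ t ∈ Icc a b, HasDerivWithinAt F (F' t) (Icc a b) t)
    (h₃ : ∀ t ∈ Ici b, HasDerivWithinAt F (F' t) (Ici b) t) (t : ℝ) :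
    HasDerivAt F (F' t) t := by
  have key : ∀ {s : Set ℝ}, IsClosed s → (∀ t ∈ s, HasDerivWithinAt F (F' t) s t) →
      HasDerivWithinAt F (F' t) s t := by
    intro s hs h
    by_cases ht : t ∈ s
    · exact h t ht
    · exact HasFDerivWithinAt.of_notMem_closure (hs.closure_eq.symm ▸ ht)
  have h := ((key isClosed_Iic h₁).union (key isClosed_Icc h₂)).union (key isClosed_Ici h₃)
  rwa [Iic_union_Icc_eq_Iic hab, Iic_union_Ici, hasDerivWithinAt_univ] at h

theorem hasDerivAt_c2Extend (hab : a < b) (hf : ContDiffOn ℝ 2 f (Icc a b)) (t : ℝ) :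
    HasDerivAt (c2Extend f a b) (c2ExtendVel f a b t) t := by
  have out : ∀ (p v w : E) (τ t : ℝ) (s : Set ℝ), HasDerivWithinAt
      (fun t => p + (t - τ) • v + (1 - Real.cos (t - τ)) • w) (v + Real.sin (t - τ) • w) s t := by
    intro p v w τ t s
    have h1 := ((hasDerivAt_id t).sub_const τ).smul_const v
    have h2 := (((Real.hasDerivAt_cos (t - τ)).comp t ((hasDerivAt_id t).sub_const τ)).const_sub
      1).smul_const w
    refine (((h1.const_add p).add h2).congr_deriv ?_).hasDerivWithinAt
    simp
  refine hasDerivAt_of_pieces hab.le (fun t ht => ?_) (fun t ht => ?_) (fun t ht => ?_) t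
  · have e : ∀ τ ∈ Iic a, c2Extend f a b τ = f a + (τ - a) • derivWithin f (Icc a b) a +
        (1 - Real.cos (τ - a)) • iteratedDerivWithin 2 f (Icc a b) a := fun τ hτ => by
      rw [c2Extend_eq hab.le, clamp, min_eq_left (hτ.out.trans hab.le), max_eq_left hτ.out]
    rw [c2ExtendVel_eq hab.le, clamp, min_eq_left (ht.out.trans hab.le), max_eq_left ht.out]
    exact (out _ _ _ _ _ _).congr e (e t ht)
  · have e : ∀ τ ∈ Icc a b, c2Extend f a b τ = f τ := fun τ hτ => c2Extend_of_mem f hτ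
    have e1 : c2ExtendVel f a b t = derivWithin f (Icc a b) t := by
      rw [c2ExtendVel_eq hab.le, clamp_of_mem ht]; simp
    rw [e1]
    exact ((hf.differentiableOn (by norm_num) t ht).hasDerivWithinAt).congr e (e t ht)
  · have e : ∀ τ ∈ Ici b, c2Extend f a b τ = f b + (τ - b) • derivWithin f (Icc a b) b +
        (1 - Real.cos (τ - b)) • iteratedDerivWithin 2 f (Icc a b) b := fun τ hτ => by
      rw [c2Extend_eq hab.le, clamp, min_eq_right hτ.out, max_eq_right hab.le]
    rw [c2ExtendVel_eq hab.le, clamp, min_eq_right ht.out, max_eq_right hab.le]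
    exact (out _ _ _ _ _ _).congr e (e t ht)

theorem hasDerivAt_c2ExtendVel (hab : a < b) (hf : ContDiffOn ℝ 2 f (Icc a b)) (t : ℝ) :
    HasDerivAt (c2ExtendVel f a b) (c2ExtendAcc f a b t) t := by
  have out : ∀ (v w : E) (τ t : ℝ) (s : Set ℝ), HasDerivWithinAt
      (fun t => v + Real.sin (t - τ) • w) (Real.cos (t - τ) • w) s t := by
    intro v w τ t s
    have h2 := (((Real.hasDerivAt_sin (t - τ)).comp t ((hasDerivAt_id t).sub_const τ))).smul_const w
    refine ((h2.const_add v).congr_deriv ?_).hasDerivWithinAt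
    simp
  refine hasDerivAt_of_pieces hab.le (fun t ht => ?_) (fun t ht => ?_) (fun t ht => ?_) t
  · have e : ∀ τ ∈ Iic a, c2ExtendVel f a b τ = derivWithin f (Icc a b) a +
        Real.sin (τ - a) • iteratedDerivWithin 2 f (Icc a b) a := fun τ hτ => by
      rw [c2ExtendVel_eq hab.le, clamp, min_eq_left (hτ.out.trans hab.le), max_eq_left hτ.out]
    rw [c2ExtendAcc_eq hab.le, clamp, min_eq_left (ht.out.trans hab.le), max_eq_left ht.out]
    exact (out _ _ _ _ _).congr e (e t ht)
  · have e : ∀ τ ∈ Icc a b, c2ExtendVel f a b τ = derivWithin f (Icc a b) τ := fun τ hτ => by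
      rw [c2ExtendVel_eq hab.le, clamp_of_mem hτ]; simp
    have e1 : c2ExtendAcc f a b t = derivWithin (derivWithin f (Icc a b)) (Icc a b) t := by
      rw [c2ExtendAcc_eq hab.le, clamp_of_mem ht, iteratedDerivWithin_succ]
      simp only [sub_self, Real.cos_zero, one_smul]
      exact derivWithin_congr (fun τ hτ => congrFun iteratedDerivWithin_one τ)
        (congrFun iteratedDerivWithin_one t)
    rw [e1]
    exact (((hf.derivWithin (uniqueDiffOn_Icc hab) (m := 1) (by norm_num)).differentiableOn
      (by norm_num) t ht).hasDerivWithinAt).congr e (e t ht)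
  · have e : ∀ τ ∈ Ici b, c2ExtendVel f a b τ = derivWithin f (Icc a b) b +
        Real.sin (τ - b) • iteratedDerivWithin 2 f (Icc a b) b := fun τ hτ => by
      rw [c2ExtendVel_eq hab.le, clamp, min_eq_right hτ.out, max_eq_right hab.le]
    rw [c2ExtendAcc_eq hab.le, clamp, min_eq_right ht.out, max_eq_right hab.le]
    exact (out _ _ _ _ _).congr e (e t ht)

theorem continuous_c2ExtendAcc (hab : a < b) (hf : ContDiffOn ℝ 2 f (Icc a b)) :
    Continuous (c2ExtendAcc f a b) := by
  have h1 := hf.continuousOn_iteratedDerivWithin (m := 2) (by norm_num) (uniqueDiffOn_Icc hab)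
  have h2 : Continuous (clamp a b) := by unfold clamp; fun_prop
  have h3 : Continuous fun t => iteratedDerivWithin 2 f (Icc a b) (clamp a b t) :=
    h1.comp_continuous h2 fun t => clamp_mem hab.le
  have e : c2ExtendAcc f a b = fun t =>
      Real.cos (t - clamp a b t) • iteratedDerivWithin 2 f (Icc a b) (clamp a b t) :=
    funext fun t => c2ExtendAcc_eq hab.le
  rw [e]
  fun_prop

theorem norm_c2ExtendVel_le (hab : a ≤ b) {A B : ℝ}
    (hA : ∀ t ∈ Icc a b, ‖derivWithin f (Icc a b) t‖ ≤ A)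
    (hB : ∀ t ∈ Icc a b, ‖iteratedDerivWithin 2 f (Icc a b) t‖ ≤ B) (t : ℝ) :
    ‖c2ExtendVel f a b t‖ ≤ A + B := by
  rw [c2ExtendVel_eq hab]
  refine (norm_add_le _ _).trans (add_le_add (hA _ (clamp_mem hab)) ?_)
  rw [norm_smul, Real.norm_eq_abs]
  have h := hB _ (clamp_mem hab (t := t))
  exact (mul_le_of_le_one_left (norm_nonneg _) (Real.abs_sin_le_one _)).trans h

theorem norm_c2ExtendAcc_le (hab : a ≤ b) {B : ℝ}
    (hB : ∀ t ∈ Icc a b, ‖iteratedDerivWithin 2 f (Icc a b) t‖ ≤ B) (t : ℝ) :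
    ‖c2ExtendAcc f a b t‖ ≤ B := by
  rw [c2ExtendAcc_eq hab, norm_smul, Real.norm_eq_abs]
  have h := hB _ (clamp_mem hab (t := t))
  exact (mul_le_of_le_one_left (norm_nonneg _) (Real.abs_cos_le_one _)).trans h

/-- The continuation depends continuously in `C¹`, locally uniformly, on the segment in `C²` and on
its end points. -/
theorem exists_c2Extend_close (hab : a < b) (hf : ContDiffOn ℝ 2 f (Icc a b)) {K : Set ℝ}
    (hK : IsCompact K) {ε : ℝ} (hε : 0 < ε) : ∃ η > 0, ∀ (f' : ℝ → E) (a' b' : ℝ), a' ≤ b' →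
      |a' - a| < η → |b' - b| < η → (∀ t ∈ Icc a' b', ‖f' t - c2Extend f a b t‖ ≤ η ∧
        ‖derivWithin f' (Icc a' b') t - c2ExtendVel f a b t‖ ≤ η ∧
        ‖iteratedDerivWithin 2 f' (Icc a' b') t - c2ExtendAcc f a b t‖ ≤ η) →
      ∀ t ∈ K, ‖c2Extend f' a' b' t - c2Extend f a b t‖ ≤ ε ∧
        ‖c2ExtendVel f' a' b' t - c2ExtendVel f a b t‖ ≤ ε := by
  set h := c2Extend f a b with hh
  set h₁ := c2ExtendVel f a b with hh₁
  set h₂ := c2ExtendAcc f a b with hh₂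
  have c₀ : Continuous h := continuous_iff_continuousAt.2 fun t =>
    (hasDerivAt_c2Extend hab hf t).continuousAt
  have c₁ : Continuous h₁ := continuous_iff_continuousAt.2 fun t =>
    (hasDerivAt_c2ExtendVel hab hf t).continuousAt
  have c₂ : Continuous h₂ := continuous_c2ExtendAcc hab hf
  -- the continuation that starts from the end points `a'`, `b'` instead of `a`, `b`
  let J : ℝ × ℝ → ℝ → E := fun p t => h (clamp p.1 p.2 t) +
    (t - clamp p.1 p.2 t) • h₁ (clamp p.1 p.2 t) +
    (1 - Real.cos (t - clamp p.1 p.2 t)) • h₂ (clamp p.1 p.2 t)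
  let J₁ : ℝ × ℝ → ℝ → E := fun p t => h₁ (clamp p.1 p.2 t) +
    Real.sin (t - clamp p.1 p.2 t) • h₂ (clamp p.1 p.2 t)
  have hcl : Continuous fun z : (ℝ × ℝ) × ℝ => clamp z.1.1 z.1.2 z.2 := by unfold clamp; fun_prop
  have hJ : Continuous fun z : (ℝ × ℝ) × ℝ => J z.1 z.2 := by
    simp only [J]; fun_prop
  have hJ₁ : Continuous fun z : (ℝ × ℝ) × ℝ => J₁ z.1 z.2 := by
    simp only [J₁]; fun_prop
  have hend : ∀ t ∈ Icc a b, h t = f t ∧ h₁ t = derivWithin f (Icc a b) t ∧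
      h₂ t = iteratedDerivWithin 2 f (Icc a b) t := fun t ht =>
    ⟨c2Extend_of_mem f ht, by rw [hh₁, c2ExtendVel_eq hab.le, clamp_of_mem ht]; simp,
      by rw [hh₂, c2ExtendAcc_eq hab.le, clamp_of_mem ht]; simp⟩
  have hJe : ∀ t, J (a, b) t = h t := fun t => by
    obtain ⟨e0, e1, e2⟩ := hend _ (clamp_mem hab.le (t := t))
    simp only [J, e0, e1, e2]
    exact (c2Extend_eq hab.le).symm
  have hJ₁e : ∀ t, J₁ (a, b) t = h₁ t := fun t => by
    obtain ⟨e0, e1, e2⟩ := hend _ (clamp_mem hab.le (t := t))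
    simp only [J₁, e1, e2]
    exact (c2ExtendVel_eq hab.le).symm
  have hev : ∀ᶠ p in 𝓝 (a, b), ∀ t ∈ K, ‖J p t - J (a, b) t‖ < ε / 2 ∧
      ‖J₁ p t - J₁ (a, b) t‖ < ε / 2 := by
    refine hK.eventually_forall_of_forall_eventually fun t _ => ?_
    have cJ : Continuous fun z : (ℝ × ℝ) × ℝ => ‖J z.1 z.2 - J (a, b) z.2‖ :=
      (hJ.sub (hJ.comp (continuous_const.prodMk continuous_snd))).norm
    have cJ₁ : Continuous fun z : (ℝ × ℝ) × ℝ => ‖J₁ z.1 z.2 - J₁ (a, b) z.2‖ :=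
      (hJ₁.sub (hJ₁.comp (continuous_const.prodMk continuous_snd))).norm
    exact (cJ.continuousAt.eventually_lt continuousAt_const (by simpa using half_pos hε)).and
      (cJ₁.continuousAt.eventually_lt continuousAt_const (by simpa using half_pos hε))
  obtain ⟨δ, hδ, hball⟩ := Metric.eventually_nhds_iff.1 hev
  obtain ⟨L, hL⟩ := hK.isBounded.exists_norm_le
  set Λ := |L| + |a| + |b| + 10 with hΛ
  have hΛ0 : 0 < Λ := by positivity
  refine ⟨min (min δ 1) (ε / (2 * Λ)), by positivity, fun f' a' b' hab' ha hb hf' t ht => ?_⟩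
  set η := min (min δ 1) (ε / (2 * Λ)) with hη
  have hη0 : 0 < η := by positivity
  have hη1 : η ≤ 1 := (min_le_left _ _).trans (min_le_right _ _)
  have hηδ : η ≤ δ := (min_le_left _ _).trans (min_le_left _ _)
  have hηε : η * (2 * Λ) ≤ ε := (le_div_iff₀ (by positivity)).1 (min_le_right _ _)
  obtain ⟨i0, i1⟩ := hball (y := (a', b')) (by
    rw [Prod.dist_eq, Real.dist_eq, Real.dist_eq]
    exact max_lt (ha.trans_le hηδ) (hb.trans_le hηδ)) t ht
  rw [hJe] at i0
  rw [hJ₁e] at i1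
  have hm := clamp_mem hab' (t := t)
  obtain ⟨j0, j1, j2⟩ := hf' _ hm
  set τ := clamp a' b' t with hτ
  have htL : |t| ≤ L := hL t ht
  have hLL := le_abs_self L
  have hτb : |t - τ| ≤ Λ - 6 := by
    have := abs_le.1 htL
    have := abs_lt.1 ha
    have := abs_lt.1 hb
    have := abs_le.1 (le_refl |a|)
    have := abs_le.1 (le_refl |b|)
    have := hm.1
    have := hm.2
    rw [abs_le]
    constructor <;> linarith [abs_nonneg a, abs_nonneg b]
  constructor
  · have e : c2Extend f' a' b' t - J (a', b') t = (f' τ - h τ) +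
        (t - τ) • (derivWithin f' (Icc a' b') τ - h₁ τ) +
        (1 - Real.cos (t - τ)) • (iteratedDerivWithin 2 f' (Icc a' b') τ - h₂ τ) := by
      rw [c2Extend_eq hab']
      simp only [J, ← hτ]
      module
    have h3 : ‖c2Extend f' a' b' t - J (a', b') t‖ ≤ η * Λ := by
      rw [e]
      refine (norm_add₃_le).trans ?_
      rw [norm_smul, norm_smul, Real.norm_eq_abs, Real.norm_eq_abs]
      have k1 : |t - τ| * ‖derivWithin f' (Icc a' b') τ - h₁ τ‖ ≤ (Λ - 6) * η :=
        mul_le_mul hτb j1 (norm_nonneg _) (by linarith [abs_nonneg (t - τ)])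
      have k2 : |1 - Real.cos (t - τ)| ≤ 2 := by
        have := Real.cos_le_one (t - τ)
        have := Real.neg_one_le_cos (t - τ)
        rw [abs_le]; constructor <;> linarith
      have k3 := mul_le_mul k2 j2 (norm_nonneg _) (by norm_num)
      linarith
    have := norm_add_le (c2Extend f' a' b' t - J (a', b') t) (J (a', b') t - h t)
    rw [sub_add_sub_cancel] at this
    linarith
  · have e : c2ExtendVel f' a' b' t - J₁ (a', b') t =
        (derivWithin f' (Icc a' b') τ - h₁ τ) +
        Real.sin (t - τ) • (iteratedDerivWithin 2 f' (Icc a' b') τ - h₂ τ) := by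
      rw [c2ExtendVel_eq hab']
      simp only [J₁, ← hτ]
      module
    have h3 : ‖c2ExtendVel f' a' b' t - J₁ (a', b') t‖ ≤ η * Λ := by
      rw [e]
      refine (norm_add_le _ _).trans ?_
      rw [norm_smul, Real.norm_eq_abs]
      have k3 := mul_le_mul (Real.abs_sin_le_one (t - τ)) j2 (norm_nonneg _) (by norm_num)
      have k4 : η * 2 ≤ η * Λ := mul_le_mul_of_nonneg_left (by
        rw [hΛ]; linarith [abs_nonneg L, abs_nonneg a, abs_nonneg b]) hη0.le
      linarith
    have := norm_add_le (c2ExtendVel f' a' b' t - J₁ (a', b') t) (J₁ (a', b') t - h₁ t)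
    rw [sub_add_sub_cancel] at this
    linarith

end

/-! ### Wide doubly circular orbits are slow -/

/-- Uniform circular motion. -/
def circ (x₀ p q : E) (a ω t : ℝ) : E := x₀ + a • (Real.cos (ω * t) • p + Real.sin (ω * t) • q)

/-- The velocity of `circ`. -/
def circVel (p q : E) (a ω t : ℝ) : E :=
  (ω * a) • (-Real.sin (ω * t) • p + Real.cos (ω * t) • q)

section Circ

variable {x₀ p q : E} {a b ω r t s : ℝ}

theorem hasDerivAt_circ : HasDerivAt (circ x₀ p q a ω) (circVel p q a ω t) t := by
  have h0 : HasDerivAt (fun t : ℝ => ω * t) ω t := by simpa using (hasDerivAt_id t).const_mul ω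
  have h1 := ((h0.cos.smul_const p).add (h0.sin.smul_const q)).const_smul a
  refine (h1.const_add x₀).congr_deriv ?_
  rw [circVel]
  module

theorem deriv_circ : deriv (circ x₀ p q a ω) = circVel p q a ω :=
  funext fun _ => hasDerivAt_circ.deriv

theorem hasDerivAt_circVel : HasDerivAt (circVel p q a ω)
    (-(ω * (ω * a)) • (Real.cos (ω * t) • p + Real.sin (ω * t) • q)) t := by
  have h0 : HasDerivAt (fun t : ℝ => ω * t) ω t := by simpa using (hasDerivAt_id t).const_mul ω
  have h1 := ((h0.sin.neg.smul_const p).add (h0.cos.smul_const q)).const_smul (ω * a)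
  refine h1.congr_deriv ?_
  module

theorem deriv_circVel : deriv (circVel p q a ω) = fun t =>
    -(ω * (ω * a)) • (Real.cos (ω * t) • p + Real.sin (ω * t) • q) :=
  funext fun _ => hasDerivAt_circVel.deriv

theorem inner_combination (hp : ‖p‖ = 1) (hq : ‖q‖ = 1) (hpq : inner ℝ p q = 0) (α β γ δ : ℝ) :
    inner ℝ (α • p + β • q) (γ • p + δ • q) = α * γ + β * δ := by
  have hqp : inner ℝ q p = 0 := by rw [real_inner_comm, hpq]
  simp only [inner_add_left, inner_add_right, real_inner_smul_left, real_inner_smul_right, hpq, hqp,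
    real_inner_self_eq_norm_sq, hp, hq]
  ring

theorem norm_combination (hp : ‖p‖ = 1) (hq : ‖q‖ = 1) (hpq : inner ℝ p q = 0) (α β : ℝ)
    (h : α ^ 2 + β ^ 2 = 1) : ‖α • p + β • q‖ = 1 := by
  have h1 := inner_combination hp hq hpq α β α β
  rw [real_inner_self_eq_norm_sq] at h1
  nlinarith [norm_nonneg (α • p + β • q)]

theorem norm_circVel (hp : ‖p‖ = 1) (hq : ‖q‖ = 1) (hpq : inner ℝ p q = 0) :
    ‖circVel p q a ω t‖ = |ω * a| := by
  rw [circVel, norm_smul, norm_combination hp hq hpq _ _ (by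
    rw [neg_sq]; exact Real.sin_sq_add_cos_sq _), mul_one, Real.norm_eq_abs]

theorem norm_deriv_circVel (hp : ‖p‖ = 1) (hq : ‖q‖ = 1) (hpq : inner ℝ p q = 0) :
    ‖deriv (circVel p q a ω) t‖ = |ω * (ω * a)| := by
  rw [deriv_circVel]
  simp only
  rw [norm_smul, norm_combination hp hq hpq _ _ (Real.cos_sq_add_sin_sq _), mul_one,
    Real.norm_eq_abs, abs_neg]

theorem norm_circ_sub_sq (hp : ‖p‖ = 1) (hq : ‖q‖ = 1) (hpq : inner ℝ p q = 0) :
    ‖circ x₀ p q a ω t - circ x₀ p q b ω s‖ ^ 2 =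
      a ^ 2 + b ^ 2 - 2 * (a * b) * Real.cos (ω * t - ω * s) := by
  have e : circ x₀ p q a ω t - circ x₀ p q b ω s =
      (a * Real.cos (ω * t) - b * Real.cos (ω * s)) • p +
      (a * Real.sin (ω * t) - b * Real.sin (ω * s)) • q := by
    rw [circ, circ]; module
  rw [e, ← real_inner_self_eq_norm_sq, inner_combination hp hq hpq, Real.cos_sub]
  linear_combination a ^ 2 * Real.sin_sq_add_cos_sq (ω * t) +
    b ^ 2 * Real.sin_sq_add_cos_sq (ω * s)

/-- On a doubly circular orbit the denominators of the Liénard–Wiechert fields are at least `1`. -/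
theorem kappa_circ (hp : ‖p‖ = 1) (hq : ‖q‖ = 1) (hpq : inner ℝ p q = 0) {sg : ℝ} (hsg : |sg| = 1)
    (hr : 0 < r) (hω : 0 < ω) (hθ : ω * r ≤ Real.pi) (hab : a * b ≤ 0)
    (hd : ‖circ x₀ p q a ω t - circ x₀ p q b ω (t + sg * r)‖ = r) :
    1 ≤ kappa sg (nvec (circ x₀ p q a ω t) (circ x₀ p q b ω (t + sg * r)))
      (circVel p q b ω (t + sg * r)) := by
  have e : circ x₀ p q a ω t - circ x₀ p q b ω (t + sg * r) =
      (a * Real.cos (ω * t) - b * Real.cos (ω * (t + sg * r))) • p +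
      (a * Real.sin (ω * t) - b * Real.sin (ω * (t + sg * r))) • q := by
    rw [circ, circ]; module
  have e2 : inner ℝ (circVel p q b ω (t + sg * r))
      (circ x₀ p q a ω t - circ x₀ p q b ω (t + sg * r)) =
      ω * (a * b) * Real.sin (ω * t - ω * (t + sg * r)) := by
    rw [e, circVel, real_inner_smul_left, inner_combination hp hq hpq, Real.sin_sub]
    ring
  have hs : 0 ≤ Real.sin (ω * r) := Real.sin_nonneg_of_nonneg_of_le_pi (by positivity) hθ
  have e3 : sg * Real.sin (ω * t - ω * (t + sg * r)) = -Real.sin (ω * r) := by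
    have e4 : ω * t - ω * (t + sg * r) = -(sg * (ω * r)) := by ring
    rw [e4, Real.sin_neg]
    rcases (abs_eq zero_le_one).1 hsg with h | h <;> simp [h]
  have e5 : kappa sg (nvec (circ x₀ p q a ω t) (circ x₀ p q b ω (t + sg * r)))
      (circVel p q b ω (t + sg * r)) = 1 + r⁻¹ * (ω * (-(a * b)) * Real.sin (ω * r)) := by
    rw [kappa, nvec, hd, real_inner_smul_right, e2]
    linear_combination r⁻¹ * (ω * (a * b)) * e3
  rw [e5]
  have : 0 ≤ -(a * b) := by linarith
  have : 0 ≤ r⁻¹ * (ω * (-(a * b)) * Real.sin (ω * r)) := by positivity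
  linarith

end Circ

section Bounds

variable {e sg : ℝ} {x v y w b : E}

theorem abs_kappa_le (hsg : |sg| = 1) (hw : ‖w‖ ≤ 1) : |kappa sg (nvec x y) w| ≤ 2 := by
  rw [kappa]
  refine (abs_add_le _ _).trans ?_
  rw [abs_mul, hsg, one_mul, abs_one, real_inner_comm]
  linarith [abs_inner_nvec_le x y w]

theorem norm_uvec_le (hsg : |sg| = 1) (hw : ‖w‖ ≤ 1) : ‖uvec sg (nvec x y) w‖ ≤ 2 := by
  refine (norm_add_le _ _).trans ?_
  rw [norm_smul, Real.norm_eq_abs, hsg, one_mul]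
  linarith [norm_nvec_le x y]

theorem norm_forceMatrix_le (he : |e| = 1) (hsg : |sg| = 1) (hv : ‖v‖ ≤ 1) :
    ‖forceMatrix e sg x v y‖ ≤ 2 := by
  have h1 : ‖kappa sg (nvec x y) v • ContinuousLinearMap.id ℝ E‖ ≤ 2 * 1 := by
    rw [norm_smul, Real.norm_eq_abs]
    exact mul_le_mul (abs_kappa_le hsg hv) ContinuousLinearMap.norm_id_le (norm_nonneg _)
      (by norm_num)
  have h2 : ‖sg • (innerSL ℝ v).smulRight (uvec sg (nvec x y) v)‖ ≤ 1 * 2 := by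
    rw [norm_smul, Real.norm_eq_abs, hsg, one_mul, ContinuousLinearMap.norm_smulRight_apply,
      innerSL_apply_norm]
    exact mul_le_mul hv (norm_uvec_le hsg hv) (norm_nonneg _) zero_le_one
  rw [forceMatrix, norm_smul, Real.norm_eq_abs, abs_div, he, abs_of_pos (by norm_num : (0 : ℝ) < 2)]
  have := norm_sub_le (kappa sg (nvec x y) v • ContinuousLinearMap.id ℝ E)
    (sg • (innerSL ℝ v).smulRight (uvec sg (nvec x y) v))
  linarith

/-- The Liénard–Wiechert field decays like `1 / r²`, its radiation part like `1 / r`. -/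
theorem norm_field_le (he : |e| = 1) (hsg : |sg| = 1) (hw : ‖w‖ < 1) {r : ℝ} (hr : 0 < r)
    (hxy : ‖x - y‖ = r) (hκ : 1 ≤ kappa sg (nvec x y) w) :
    ‖field e sg x y w b‖ ≤ 2 / r ^ 2 + 4 / r * ‖b‖ := by
  have hg := one_le_gamma hw
  have hκ3 : 1 ≤ kappa sg (nvec x y) w ^ 3 := one_le_pow₀ hκ
  have hu := norm_uvec_le (x := x) (y := y) hsg hw.le
  have hκ2 := abs_kappa_le (x := x) (y := y) hsg hw.le
  refine (norm_add_le _ _).trans (add_le_add ?_ ?_)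
  · rw [nearField, norm_smul, Real.norm_eq_abs, abs_div, he, hxy, abs_of_nonneg (by positivity)]
    have h1 : r ^ 2 ≤ gamma w ^ 2 * kappa sg (nvec x y) w ^ 3 * r ^ 2 := by
      have h2 : 1 ≤ gamma w ^ 2 := one_le_pow₀ hg
      exact le_mul_of_one_le_left (by positivity) (one_le_mul_of_one_le_of_one_le h2 hκ3)
    calc _ ≤ 1 / r ^ 2 * 2 := mul_le_mul (one_div_le_one_div_of_le (by positivity) h1) hu
          (norm_nonneg _) (by positivity)
      _ = 2 / r ^ 2 := by ring
  · refine ContinuousLinearMap.le_of_opNorm_le _ ?_ b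
    rw [radMatrix, norm_smul, Real.norm_eq_abs, abs_div, he, hxy, abs_of_nonneg (by positivity)]
    have h1 : r ≤ kappa sg (nvec x y) w ^ 3 * r := le_mul_of_one_le_left hr.le hκ3
    have h2 : ‖(innerSL ℝ (nvec x y)).smulRight (uvec sg (nvec x y) w)‖ ≤ 1 * 2 := by
      rw [ContinuousLinearMap.norm_smulRight_apply, innerSL_apply_norm]
      exact mul_le_mul (norm_nvec_le x y) hu (norm_nonneg _) zero_le_one
    have h3 : ‖kappa sg (nvec x y) w • ContinuousLinearMap.id ℝ E‖ ≤ 2 * 1 := by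
      rw [norm_smul, Real.norm_eq_abs]
      exact mul_le_mul hκ2 ContinuousLinearMap.norm_id_le (norm_nonneg _) (by norm_num)
    calc _ ≤ 1 / r * 4 := mul_le_mul (one_div_le_one_div_of_le hr h1)
          ((norm_sub_le _ _).trans (by linarith)) (norm_nonneg _) (by positivity)
      _ = 4 / r := by ring

end Bounds

/-- The equation of motion bounds the acceleration on a doubly circular orbit. -/
theorem acceleration_le_of_circular {x₀ p q : E} {m e e' a b ω r t : ℝ} (hm : 0 < m) (he : |e| = 1)
    (he' : |e'| = 1) (hp : ‖p‖ = 1) (hq : ‖q‖ = 1) (hpq : inner ℝ p q = 0) (hr : 0 < r)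
    (hω : 0 < ω) (hab : a * b ≤ 0) (ha₁ : |ω * a| < 1) (hb₁ : |ω * b| < 1)
    (hθ : ω * r ≤ 2)
    (hd : ∀ t, ‖circ x₀ p q a ω t - circ x₀ p q b ω (t - r)‖ = r)
    (hd' : ∀ t, ‖circ x₀ p q a ω t - circ x₀ p q b ω (t + r)‖ = r)
    (hmot : WFEquation m e e' (circ x₀ p q a ω) (circ x₀ p q b ω) t (t - r) (t + r)) :
    m * (ω * |ω * a|) ≤ 40 / r ^ 2 := by
  have hπ : ω * r ≤ Real.pi := by linarith [Real.pi_gt_three]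
  have e1 : t - r = t + -1 * r := by ring
  have e2 : t + r = t + 1 * r := by ring
  unfold WFEquation at hmot
  simp only [deriv_circ] at hmot
  have va : ∀ t, ‖circVel p q a ω t‖ = |ω * a| := fun t => norm_circVel hp hq hpq
  have vb : ∀ t, ‖circVel p q b ω t‖ = |ω * b| := fun t => norm_circVel hp hq hpq
  have hb2 : ∀ t, ‖deriv (circVel p q b ω) t‖ ≤ 2 / r := fun t => by
    rw [norm_deriv_circVel hp hq hpq, abs_mul, abs_of_pos hω, le_div_iff₀ hr]
    nlinarith [mul_pos hω hr, abs_nonneg (ω * b)]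
  have hfield : ∀ sg : ℝ, |sg| = 1 →
      ‖circ x₀ p q a ω t - circ x₀ p q b ω (t + sg * r)‖ = r →
      ‖forceMatrix e sg (circ x₀ p q a ω t) (circVel p q a ω t) (circ x₀ p q b ω (t + sg * r))
        (field e' sg (circ x₀ p q a ω t) (circ x₀ p q b ω (t + sg * r))
          (circVel p q b ω (t + sg * r)) (deriv (circVel p q b ω) (t + sg * r)))‖ ≤
        20 / r ^ 2 := by
    intro sg hsg hdd
    have k1 := norm_field_le (b := deriv (circVel p q b ω) (t + sg * r)) he' hsg
      (by rw [vb]; exact hb₁) hr hdd (kappa_circ hp hq hpq hsg hr hω hπ hab hdd)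
    have k2 := norm_forceMatrix_le (x := circ x₀ p q a ω t) (y := circ x₀ p q b ω (t + sg * r)) he
      hsg (v := circVel p q a ω t) (by rw [va]; exact ha₁.le)
    have k3 : 4 / r * ‖deriv (circVel p q b ω) (t + sg * r)‖ ≤ 4 / r * (2 / r) :=
      mul_le_mul_of_nonneg_left (hb2 _) (by positivity)
    refine (ContinuousLinearMap.le_opNorm _ _).trans ((mul_le_mul k2 (k1.trans
      (add_le_add le_rfl k3)) (norm_nonneg _) (by norm_num)).trans (le_of_eq ?_))
    field_simp
    norm_num
  have f1 := hfield (-1) (by simp) (by rw [← e1]; exact hd t)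
  have f2 := hfield 1 (by simp) (by rw [← e2]; exact hd' t)
  rw [← e1] at f1
  rw [← e2] at f2
  have h1 := congrArg norm hmot
  have hγ := one_le_gamma (w := circVel p q a ω t) (by rw [va]; exact ha₁)
  rw [norm_smul, norm_deriv_circVel hp hq hpq, Real.norm_eq_abs, abs_of_pos (by positivity),
    abs_mul ω, abs_of_pos hω] at h1
  calc m * (ω * |ω * a|) ≤ m * gamma (circVel p q a ω t) * (ω * |ω * a|) := by
        gcongr
        exact le_mul_of_one_le_right hm.le hγ
    _ ≤ 20 / r ^ 2 + 20 / r ^ 2 := h1.le.trans ((norm_add_le _ _).trans (add_le_add f1 f2))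
    _ = 40 / r ^ 2 := by ring

/-- Small accelerations in units of `1 / r` imply small speeds: the angle `θ = ω r` is at most the sum
of the speeds, so that `θ²` is at most the sum of the accelerations times `r`; then `cos θ ≥ 0`, and
the radii are at most `r`. -/
theorem slow_of_bounds {r ω ρ₁ ρ₂ ν τ : ℝ} (hr : 0 < r) (hω : 0 < ω) (h₁ : 0 < ρ₁) (h₂ : 0 < ρ₂)
    (hcos : r ^ 2 = ρ₁ ^ 2 + ρ₂ ^ 2 + 2 * (ρ₁ * ρ₂) * Real.cos (ω * r))
    (hθv : ω * r ≤ ω * ρ₁ + ω * ρ₂) (hν : 0 < ν) (t1 : τ ≤ 1) (t2 : τ ≤ ν) (t3 : τ ≤ ν ^ 2)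
    (b₁ : r * (ω * (ω * ρ₁)) ≤ τ / 2) (b₂ : r * (ω * (ω * ρ₂)) ≤ τ / 2) :
    ω * ρ₁ ≤ ν ∧ ω * ρ₂ ≤ ν ∧ r * (ω * (ω * ρ₁)) ≤ ν ∧ r * (ω * (ω * ρ₂)) ≤ ν := by
  have hθ0 : 0 < ω * r := mul_pos hω hr
  have hθ2 : (ω * r) ^ 2 ≤ τ := by
    have : ω * r * (ω * r) ≤ ω * r * (ω * ρ₁ + ω * ρ₂) := mul_le_mul_of_nonneg_left hθv hθ0.le
    linarith
  have hθ1 : ω * r ≤ 1 := by nlinarith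
  have hθν : ω * r ≤ ν := (pow_le_pow_iff_left₀ hθ0.le hν.le two_ne_zero).1 (hθ2.trans t3)
  have hc : 0 ≤ Real.cos (ω * r) := Real.cos_nonneg_of_neg_pi_div_two_le_of_le
    (by linarith [Real.pi_gt_three]) (by linarith [Real.pi_gt_three])
  have hc2 : 0 ≤ 2 * (ρ₁ * ρ₂) * Real.cos (ω * r) := by positivity
  have r₁ : ρ₁ ≤ r := (pow_le_pow_iff_left₀ h₁.le hr.le two_ne_zero).1 (by
    linarith [sq_nonneg ρ₂])
  have r₂ : ρ₂ ≤ r := (pow_le_pow_iff_left₀ h₂.le hr.le two_ne_zero).1 (by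
    linarith [sq_nonneg ρ₁])
  have hτ : 0 < r * (ω * (ω * ρ₁)) := by positivity
  exact ⟨(mul_le_mul_of_nonneg_left r₁ hω.le).trans hθν,
    (mul_le_mul_of_nonneg_left r₂ hω.le).trans hθν, by linarith, by linarith⟩

namespace SchildOrbit

variable {m₁ m₂ : ℝ} (S : SchildOrbit m₁ m₂)

theorem x₁_eq_circ : S.x₁ = circ S.center S.p S.q S.rad₁ S.ω := funext S.x₁_eq

theorem x₂_eq_circ : S.x₂ = circ S.center S.p S.q (-S.rad₂) S.ω := funext fun t => by
  rw [S.x₂_eq, circ, neg_smul, sub_eq_add_neg]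

/-- Speeds, and accelerations in units of the inverse distance, are at most `ν`. -/
structure IsSlow (ν : ℝ) : Prop where
  speed₁ : S.ω * S.rad₁ ≤ ν
  speed₂ : S.ω * S.rad₂ ≤ ν
  acc₁ : S.r₁₂ * (S.ω * (S.ω * S.rad₁)) ≤ ν
  acc₂ : S.r₁₂ * (S.ω * (S.ω * S.rad₂)) ≤ ν

/-- Wide doubly circular orbits are slow, since by the equations of motion the acceleration is of the
order of `1 / r²`. -/
theorem exists_isSlow (hm₁ : 0 < m₁) (hm₂ : 0 < m₂) {ν : ℝ} (hν : 0 < ν) :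
    ∃ R > 0, ∀ S : SchildOrbit m₁ m₂, R ≤ S.r₁₂ → S.IsSlow ν := by
  set m := min m₁ m₂ with hm
  have hm0 : 0 < m := lt_min hm₁ hm₂
  refine ⟨80 / m * (1 + ν⁻¹ + (ν ^ 2)⁻¹), by positivity, fun S hR => ?_⟩
  have hr := S.r₁₂_pos
  have hω := S.ω_pos
  have h₁ := S.rad₁_pos
  have h₂ := S.rad₂_pos
  set r := S.r₁₂ with hrdef
  set ω := S.ω with hωdef
  -- the bounds on `80 / (m r)`
  set τ := 80 / (m * r) with hτ
  have hτ0 : 0 < τ := by positivity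
  have hτr : τ * r = 80 / m := by rw [hτ]; field_simp
  have hR' : τ * (1 + ν⁻¹ + (ν ^ 2)⁻¹) ≤ 1 := by
    have h : τ * r * (1 + ν⁻¹ + (ν ^ 2)⁻¹) ≤ r := by rw [hτr]; exact hR
    have h2 : r * (τ * (1 + ν⁻¹ + (ν ^ 2)⁻¹)) ≤ r * 1 := by linarith
    exact le_of_mul_le_mul_left h2 hr
  have p1 : 0 < τ * ν⁻¹ := by positivity
  have p2 : 0 < τ * (ν ^ 2)⁻¹ := by positivity
  have t1 : τ ≤ 1 := by linarith
  have t2 : τ ≤ ν := by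
    have : τ * ν⁻¹ ≤ 1 := by linarith
    rwa [← div_eq_mul_inv, div_le_one hν] at this
  have t3 : τ ≤ ν ^ 2 := by
    have : τ * (ν ^ 2)⁻¹ ≤ 1 := by linarith
    rwa [← div_eq_mul_inv, div_le_one (by positivity)] at this
  -- the distance in terms of the radii and the angle `θ`
  have hp := S.norm_p
  have hq := S.norm_q
  have hpq := S.inner_pq
  have lr : ∀ t, ‖circ S.center S.p S.q S.rad₁ ω t - circ S.center S.p S.q (-S.rad₂) ω (t - r)‖ =
      r := fun t => by
    have := S.lightcone_retarded t
    rwa [S.x₁_eq_circ, S.x₂_eq_circ] at this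
  have la : ∀ t, ‖circ S.center S.p S.q S.rad₁ ω t - circ S.center S.p S.q (-S.rad₂) ω (t + r)‖ =
      r := fun t => by
    have := S.lightcone_advanced t
    rwa [S.x₁_eq_circ, S.x₂_eq_circ] at this
  have hcos : r ^ 2 = S.rad₁ ^ 2 + S.rad₂ ^ 2 + 2 * (S.rad₁ * S.rad₂) * Real.cos (ω * r) := by
    have h := norm_circ_sub_sq (x₀ := S.center) (a := S.rad₁) (b := -S.rad₂) (ω := ω) (t := 0)
      (s := 0 - r) hp hq hpq
    rw [lr 0] at h
    have e : ω * 0 - ω * (0 - r) = ω * r := by ring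
    rw [e] at h
    linarith
  have hsum : r ≤ S.rad₁ + S.rad₂ := by
    have h1 := Real.cos_le_one (ω * r)
    have h2 : 0 < S.rad₁ * S.rad₂ := mul_pos h₁ h₂
    have h3 : r ^ 2 ≤ (S.rad₁ + S.rad₂) ^ 2 := by nlinarith
    exact (pow_le_pow_iff_left₀ hr.le (by positivity) two_ne_zero).1 h3
  have s₁ := S.subluminal₁
  have s₂ := S.subluminal₂
  have hθv : ω * r ≤ ω * S.rad₁ + ω * S.rad₂ := by nlinarith
  have hab : S.rad₁ * -S.rad₂ ≤ 0 := by nlinarith [mul_pos h₁ h₂]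
  have v₁ : |ω * S.rad₁| = ω * S.rad₁ := abs_of_pos (by positivity)
  have v₂ : |ω * -S.rad₂| = ω * S.rad₂ := by rw [mul_neg, abs_neg, abs_of_pos (by positivity)]
  have a₁ : m₁ * (ω * (ω * S.rad₁)) ≤ 40 / r ^ 2 := by
    have h := S.motion₁ 0
    rw [S.x₁_eq_circ, S.x₂_eq_circ] at h
    have := acceleration_le_of_circular hm₁ (by simp [e₁]) (by simp [e₂]) hp hq hpq hr hω hab
      (by rw [v₁]; exact s₁) (by rw [v₂]; exact s₂) (by linarith) lr la h
    rwa [v₁] at this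
  have a₂ : m₂ * (ω * (ω * S.rad₂)) ≤ 40 / r ^ 2 := by
    have h := S.motion₂ 0
    rw [S.x₁_eq_circ, S.x₂_eq_circ] at h
    have := acceleration_le_of_circular hm₂ (by simp [e₂]) (by simp [e₁]) hp hq hpq hr hω
      (by linarith) (by rw [v₂]; exact s₂) (by rw [v₁]; exact s₁) (by linarith)
      (fun t => by
        have := la (t - r)
        rwa [sub_add_cancel, norm_sub_rev] at this)
      (fun t => by
        have := lr (t + r)
        rwa [add_sub_cancel_right, norm_sub_rev] at this) h
    rwa [v₂] at this
  have conv : ∀ {m' x : ℝ}, m ≤ m' → 0 < x → m' * x ≤ 40 / r ^ 2 → r * x ≤ τ / 2 := by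
    intro m' x hm' hx h
    have h1 : m * x ≤ 40 / r ^ 2 := (mul_le_mul_of_nonneg_right hm' hx.le).trans h
    rw [le_div_iff₀ (by positivity)] at h1
    have h2 : τ / 2 = 40 / (m * r) := by rw [hτ]; ring
    rw [h2, le_div_iff₀ (by positivity)]
    linarith
  have b₁ := conv (min_le_left _ _) (by positivity) a₁
  have b₂ := conv (min_le_right _ _) (by positivity) a₂
  obtain ⟨i, j, k, l⟩ := slow_of_bounds hr hω h₁ h₂ hcos hθv hν t1 t2 t3 b₁ b₂
  exact ⟨i, j, k, l⟩

end SchildOrbit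

/-! ### Boundary data near a wide doubly circular orbit -/

namespace BoundaryData

/-- Boundary data whose light-cone distances are about `r`, with displacements, speeds and
accelerations that are small, of the order of `ν`, in units of `r`. -/
structure IsTame (D : BoundaryData) (r ν : ℝ) : Prop where
  one_le_r : 1 ≤ r
  Om : |D.tOA - D.tOm - r| ≤ ν * r
  Op : |D.tOp - D.tOA - r| ≤ ν * r
  Lm : |D.tLm - D.tOp - r| ≤ ν * r
  LB : |D.tLB - D.tLm - r| ≤ ν * r
  Lp : |D.tLp - D.tLB - r| ≤ ν * r
  move₁ : ‖D.seg₁ D.tLm - D.xOA‖ ≤ ν * r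
  move₂ : ‖D.xLB - D.seg₂ D.tOp‖ ≤ ν * r
  vel₂ : ∀ t, ‖c2ExtendVel D.seg₂ D.tOm D.tOp t‖ ≤ ν
  acc₂ : ∀ t, r * ‖c2ExtendAcc D.seg₂ D.tOm D.tOp t‖ ≤ ν
  vel₁ : ∀ t, ‖c2ExtendVel D.seg₁ D.tLm D.tLp t‖ ≤ ν
  acc₁ : ∀ t, r * ‖c2ExtendAcc D.seg₁ D.tLm D.tLp t‖ ≤ ν

end BoundaryData

/-- The light-cone distance between points near two subluminal curves differs little from that
between the curves. -/
theorem abs_lightcone_sub_le {θ s sg ν δ r : ℝ} {x y A : E} {k : ℝ → E} (hsg : |sg| = 1)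
    (hν : ν ≤ 1 / 2) (hk : ∀ a b, ‖k a - k b‖ ≤ ν * |a - b|) (h : sg * (s - θ) = ‖x - y‖)
    (hx : ‖x - A‖ ≤ δ) (hy : ‖y - k s‖ ≤ δ) (hA : ‖A - k (θ + sg * r)‖ = r) :
    |‖x - y‖ - r| ≤ 4 * δ := by
  have h1 : |s - (θ + sg * r)| = |‖x - y‖ - r| := by
    have hsq : sg * sg = 1 := by rw [← abs_mul_abs_self, hsg, one_mul]
    have e : ‖x - y‖ - r = sg * (s - (θ + sg * r)) := by
      rw [← h]; linear_combination r * hsq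
    rw [e, abs_mul, hsg, one_mul]
  have h2 : |‖x - y‖ - ‖A - k (θ + sg * r)‖| ≤ δ + (δ + ν * |s - (θ + sg * r)|) := by
    refine (abs_norm_sub_norm_le _ _).trans ?_
    have e : x - y - (A - k (θ + sg * r)) = (x - A) - ((y - k s) + (k s - k (θ + sg * r))) := by
      abel
    rw [e]
    exact (norm_sub_le _ _).trans (add_le_add hx ((norm_add_le _ _).trans
      (add_le_add hy (hk _ _))))
  rw [hA, h1] at h2
  nlinarith [abs_nonneg (‖x - y‖ - r)]

theorem c2Close_apply {f g : ℝ → E} {a b η t : ℝ} (h : C2Close f g a b η) (ht : t ∈ Icc a b) :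
    ‖g t - f t‖ < η ∧ ‖derivWithin g (Icc a b) t - deriv f t‖ < η ∧
      ‖iteratedDerivWithin 2 g (Icc a b) t - deriv (deriv f) t‖ < η := by
  refine ⟨?_, ?_, ?_⟩
  · simpa only [iteratedDerivWithin_zero, iteratedDeriv_zero] using h 0 (by norm_num) t ht
  · simpa only [iteratedDerivWithin_one, iteratedDeriv_one] using h 1 (by norm_num) t ht
  · simpa only [iteratedDeriv_succ, iteratedDeriv_zero] using h 2 le_rfl t ht

namespace SchildOrbit

variable {m₁ m₂ : ℝ} {S : SchildOrbit m₁ m₂} {ν : ℝ}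

theorem IsSlow.norm_deriv₁ (h : S.IsSlow ν) (t : ℝ) : ‖deriv S.x₁ t‖ ≤ ν := by
  rw [S.x₁_eq_circ, deriv_circ, norm_circVel S.norm_p S.norm_q S.inner_pq,
    abs_of_pos (mul_pos S.ω_pos S.rad₁_pos)]
  exact h.speed₁

theorem IsSlow.norm_deriv₂ (h : S.IsSlow ν) (t : ℝ) : ‖deriv S.x₂ t‖ ≤ ν := by
  rw [S.x₂_eq_circ, deriv_circ, norm_circVel S.norm_p S.norm_q S.inner_pq, mul_neg, abs_neg,
    abs_of_pos (mul_pos S.ω_pos S.rad₂_pos)]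
  exact h.speed₂

theorem IsSlow.norm_deriv_deriv₁ (h : S.IsSlow ν) (t : ℝ) :
    S.r₁₂ * ‖deriv (deriv S.x₁) t‖ ≤ ν := by
  rw [S.x₁_eq_circ, deriv_circ, norm_deriv_circVel S.norm_p S.norm_q S.inner_pq,
    abs_of_pos (mul_pos S.ω_pos (mul_pos S.ω_pos S.rad₁_pos))]
  exact h.acc₁

theorem IsSlow.norm_deriv_deriv₂ (h : S.IsSlow ν) (t : ℝ) :
    S.r₁₂ * ‖deriv (deriv S.x₂) t‖ ≤ ν := by
  rw [S.x₂_eq_circ, deriv_circ, norm_deriv_circVel S.norm_p S.norm_q S.inner_pq, mul_neg, mul_neg,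
    abs_neg, abs_of_pos (mul_pos S.ω_pos (mul_pos S.ω_pos S.rad₂_pos))]
  exact h.acc₂

theorem IsSlow.lipschitz₁ (h : S.IsSlow ν) (a b : ℝ) : ‖S.x₁ a - S.x₁ b‖ ≤ ν * |a - b| :=
  Hist.norm_sub_le_of_deriv (f' := deriv S.x₁) (fun s => by
    rw [S.x₁_eq_circ]; exact hasDerivAt_circ.differentiableAt.hasDerivAt) h.norm_deriv₁ a b

theorem IsSlow.lipschitz₂ (h : S.IsSlow ν) (a b : ℝ) : ‖S.x₂ a - S.x₂ b‖ ≤ ν * |a - b| :=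
  Hist.norm_sub_le_of_deriv (f' := deriv S.x₂) (fun s => by
    rw [S.x₂_eq_circ]; exact hasDerivAt_circ.differentiableAt.hasDerivAt) h.norm_deriv₂ a b

theorem norm_circularVel_le (h : S.IsSlow ν) (D : BoundaryData) : ‖D.circularVel S‖ ≤ ν :=
  norm_prod_le_iff.2 ⟨h.norm_deriv₁ _, h.norm_deriv₂ _⟩

/-- Boundary data near a wide doubly circular orbit are tame. -/
theorem exists_isTame (h : S.IsSlow ν) (hν : 0 < ν) (hν₁ : ν ≤ 1 / 8) (hr : 1 ≤ S.r₁₂) :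
    ∃ δ > 0, ∀ D : BoundaryData, D.IsShortest → D.IsNear S δ → D.IsTame S.r₁₂ (8 * ν) := by
  set r := S.r₁₂ with hrdef
  have hr0 : 0 < r := by linarith
  refine ⟨ν / (8 * r), by positivity, fun D hD hn => ?_⟩
  set δ := ν / (8 * r) with hδ
  have hδ0 : 0 < δ := by positivity
  have hδr : 8 * (δ * r) = ν := by rw [hδ]; field_simp
  have hδ1 : δ ≤ δ * r := le_mul_of_one_le_right hδ0.le hr
  have hνr : ν ≤ ν * r := le_mul_of_one_le_right hν.le hr
  have hν2 : ν ≤ 1 / 2 := by linarith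
  have n1 := norm_nonneg (D.xOA - D.seg₂ D.tOm)
  have n2 := norm_nonneg (D.xOA - D.seg₂ D.tOp)
  have n3 := norm_nonneg (D.xLB - D.seg₁ D.tLm)
  have n4 := norm_nonneg (D.xLB - D.seg₁ D.tLp)
  have c1 := hD.lightcone_Om
  have c2 := hD.lightcone_Op
  have c3 := hD.lightcone_Lm
  have c4 := hD.lightcone_Lp
  have c5 := hD.shortest
  have i2 : D.tOm ≤ D.tOp := by linarith
  have i1 : D.tLm ≤ D.tLp := by linarith
  have hOm := c2Close_apply hn.near₂ (left_mem_Icc.2 i2)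
  have hOp := c2Close_apply hn.near₂ (right_mem_Icc.2 i2)
  have hLm := c2Close_apply hn.near₁ (left_mem_Icc.2 i1)
  have hLp := c2Close_apply hn.near₁ (right_mem_Icc.2 i1)
  have q1 := abs_lightcone_sub_le (sg := -1) (θ := D.tOA) (s := D.tOm) (by simp) hν2 h.lipschitz₂
    (by rw [← c1]; ring) hn.near_OA.le hOm.1.le
    (by rw [show D.tOA + -1 * r = D.tOA - r by ring]; exact S.lightcone_retarded _)
  have q2 := abs_lightcone_sub_le (sg := 1) (θ := D.tOA) (s := D.tOp) (by simp) hν2 h.lipschitz₂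
    (by rw [← c2]; ring) hn.near_OA.le hOp.1.le
    (by rw [show D.tOA + 1 * r = D.tOA + r by ring]; exact S.lightcone_advanced _)
  have q3 := abs_lightcone_sub_le (sg := -1) (θ := D.tLB) (s := D.tLm) (by simp) hν2 h.lipschitz₁
    (by rw [← c3]; ring) hn.near_LB.le hLm.1.le
    (by
      have := S.lightcone_advanced (D.tLB - r)
      rw [sub_add_cancel, norm_sub_rev] at this
      rw [show D.tLB + -1 * r = D.tLB - r by ring]; exact this)
  have q4 := abs_lightcone_sub_le (sg := 1) (θ := D.tLB) (s := D.tLp) (by simp) hν2 h.lipschitz₁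
    (by rw [← c4]; ring) hn.near_LB.le hLp.1.le
    (by
      have := S.lightcone_retarded (D.tLB + r)
      rw [add_sub_cancel_right, norm_sub_rev] at this
      rw [show D.tLB + 1 * r = D.tLB + r by ring]; exact this)
  have q5 := abs_lightcone_sub_le (sg := 1) (θ := D.tOp) (s := D.tLm) (x := D.seg₂ D.tOp)
    (y := D.seg₁ D.tLm) (by simp) hν2 h.lipschitz₁
    (by rw [norm_sub_rev, ← c5]; ring) hOp.1.le hLm.1.le
    (by
      have := S.lightcone_retarded (D.tOp + r)
      rw [add_sub_cancel_right, norm_sub_rev] at this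
      rw [show D.tOp + 1 * r = D.tOp + r by ring]; exact this)
  rw [← c1] at q1
  rw [← c2] at q2
  rw [← c3] at q3
  rw [← c4] at q4
  rw [norm_sub_rev, ← c5] at q5
  have hq : 4 * δ ≤ 8 * ν * r := by linarith
  have b2 := abs_le.1 q2
  have b3 := abs_le.1 q3
  have b5 := abs_le.1 q5
  have hνr8 : ν * r ≤ 1 / 8 * r := mul_le_mul_of_nonneg_right hν₁ hr0.le
  have hvel : ∀ {s f : ℝ → E} {a b : ℝ}, a ≤ b → C2Close f s a b δ → (∀ t, ‖deriv f t‖ ≤ ν) →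
      (∀ t, r * ‖deriv (deriv f) t‖ ≤ ν) →
      (∀ t, ‖c2ExtendVel s a b t‖ ≤ 8 * ν) ∧ ∀ t, r * ‖c2ExtendAcc s a b t‖ ≤ 8 * ν := by
    intro s f a b hab hc hv ha
    have d1 : ∀ t ∈ Icc a b, ‖derivWithin s (Icc a b) t‖ ≤ ν + δ := fun t ht => by
      have h1 := (c2Close_apply hc ht).2.1
      have h2 := norm_add_le (derivWithin s (Icc a b) t - deriv f t) (deriv f t)
      rw [sub_add_cancel] at h2
      linarith [hv t]
    have d2 : ∀ t ∈ Icc a b, ‖iteratedDerivWithin 2 s (Icc a b) t‖ ≤ ν / r + δ := fun t ht => by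
      have h1 := (c2Close_apply hc ht).2.2
      have h2 := norm_add_le (iteratedDerivWithin 2 s (Icc a b) t - deriv (deriv f) t)
        (deriv (deriv f) t)
      rw [sub_add_cancel] at h2
      have h3 : ‖deriv (deriv f) t‖ ≤ ν / r := by
        rw [le_div_iff₀ hr0, mul_comm]; exact ha t
      linarith
    refine ⟨fun t => ?_, fun t => ?_⟩
    · have h1 := norm_c2ExtendVel_le hab d1 d2 t
      have h2 : ν / r ≤ ν := div_le_self hν.le hr
      linarith
    · have h1 := mul_le_mul_of_nonneg_left (norm_c2ExtendAcc_le hab d2 t) hr0.le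
      have h2 : r * (ν / r + δ) = ν + δ * r := by field_simp
      linarith
  obtain ⟨v2, a2⟩ := hvel i2 hn.near₂ h.norm_deriv₂ h.norm_deriv_deriv₂
  obtain ⟨v1, a1⟩ := hvel i1 hn.near₁ h.norm_deriv₁ h.norm_deriv_deriv₁
  refine ⟨hr, q1.trans hq, q2.trans hq, q5.trans hq, q3.trans hq, q4.trans hq, ?_, ?_, v2, a2, v1,
    a1⟩
  · have e : D.seg₁ D.tLm - D.xOA = (D.seg₁ D.tLm - S.x₁ D.tLm) +
        ((S.x₁ D.tLm - S.x₁ D.tOA) - (D.xOA - S.x₁ D.tOA)) := by abel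
    rw [e]
    have l1 := h.lipschitz₁ D.tLm D.tOA
    rw [abs_of_nonneg (by linarith)] at l1
    have l2 : ν * (D.tLm - D.tOA) ≤ ν * (3 * r) :=
      mul_le_mul_of_nonneg_left (by linarith) hν.le
    have m1 := norm_add_le (D.seg₁ D.tLm - S.x₁ D.tLm)
        ((S.x₁ D.tLm - S.x₁ D.tOA) - (D.xOA - S.x₁ D.tOA))
    have m2 := norm_sub_le (S.x₁ D.tLm - S.x₁ D.tOA) (D.xOA - S.x₁ D.tOA)
    have m3 := hn.near_OA
    have m4 := hLm.1
    linarith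
  · have e : D.xLB - D.seg₂ D.tOp = (D.xLB - S.x₂ D.tLB) +
        ((S.x₂ D.tLB - S.x₂ D.tOp) - (D.seg₂ D.tOp - S.x₂ D.tOp)) := by abel
    rw [e]
    have l1 := h.lipschitz₂ D.tLB D.tOp
    rw [abs_of_nonneg (by linarith)] at l1
    have l2 : ν * (D.tLB - D.tOp) ≤ ν * (3 * r) :=
      mul_le_mul_of_nonneg_left (by linarith) hν.le
    have m1 := norm_add_le (D.xLB - S.x₂ D.tLB)
        ((S.x₂ D.tLB - S.x₂ D.tOp) - (D.seg₂ D.tOp - S.x₂ D.tOp))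
    have m2 := norm_sub_le (S.x₂ D.tLB - S.x₂ D.tOp) (D.seg₂ D.tOp - S.x₂ D.tOp)
    have m3 := hn.near_LB
    have m4 := hOp.1
    linarith

end SchildOrbit

/-! ### Rescaling of the reduced equations -/

theorem clm_smul_mul_smul (a : ℝ) (A B : E →L[ℝ] E) : (a • A) * (a • B) = (a * a) • (A * B) :=
  ContinuousLinearMap.ext fun x => by
    change a • A (a • B x) = (a * a) • A (B x)
    rw [map_smul, smul_smul]

/-- The variables `q` are those of the configuration `c`, with `r` as the unit of length. -/
structure Config.Matches (c : Config) (r : ℝ) (q : Vars) : Prop where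
  g : q.g = r⁻¹
  d : r • q.d = c.x₁ - c.x₂
  d₂ : r • q.d₂ = c.x₁ - c.y₂
  d₁ : r • q.d₁ = c.x₂ - c.y₁
  v₁ : q.v₁ = c.v₁
  v₂ : q.v₂ = c.v₂
  w₂ : q.w₂ = c.w₂
  w₁ : q.w₁ = c.w₁

namespace Config.Matches

variable {c : Config} {r : ℝ} {q : Vars} {m₁ m₂ : ℝ}

theorem neg_d (h : c.Matches r q) : r • -q.d = c.x₂ - c.x₁ := by
  rw [smul_neg, h.d, neg_sub]

theorem A₁₂ (h : c.Matches r q) (hr : 0 < r) : c.A₁₂ = q.g • q.A₁₂ := by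
  rw [Config.A₁₂, Vars.A₁₂, forceMatrix_eq, radMatrix_eq, ← h.d, ← h.v₁, ← h.v₂, forceKer_smul hr,
    radKer_smul hr, h.g, ContinuousLinearMap.comp_smul]

theorem A₂₁ (h : c.Matches r q) (hr : 0 < r) : c.A₂₁ = q.g • q.A₂₁ := by
  rw [Config.A₂₁, Vars.A₂₁, forceMatrix_eq, radMatrix_eq, ← h.neg_d, ← h.v₁, ← h.v₂,
    forceKer_smul hr, radKer_smul hr, h.g, ContinuousLinearMap.comp_smul]

theorem F₂ (h : c.Matches r q) (hr : 0 < r) : c.F₂ = (q.g * q.g) • (q.F₂ + q.D₂ (r • c.b₂)) := by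
  rw [Config.F₂, Vars.F₂, Vars.D₂, field, forceMatrix_eq, forceMatrix_eq, radMatrix_eq,
    nearField_eq, nearField_eq, ← h.d, ← h.d₂, ← h.v₁, ← h.v₂, ← h.w₂, forceKer_smul hr,
    forceKer_smul hr, radKer_smul hr, nearKer_smul hr, nearKer_smul hr, h.g]
  simp only [map_add, map_smul, _root_.smul_apply, ContinuousLinearMap.comp_apply, smul_add,
    smul_smul]
  rw [mul_assoc r⁻¹ r⁻¹ r, inv_mul_cancel₀ hr.ne', mul_one]
  abel

theorem F₁ (h : c.Matches r q) (hr : 0 < r) : c.F₁ = (q.g * q.g) • (q.F₁ + q.D₁ (r • c.b₁)) := by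
  rw [Config.F₁, Vars.F₁, Vars.D₁, field, forceMatrix_eq, forceMatrix_eq, radMatrix_eq,
    nearField_eq, nearField_eq, ← h.neg_d, ← h.d₁, ← h.v₁, ← h.v₂, ← h.w₁, forceKer_smul hr,
    forceKer_smul hr, radKer_smul hr, nearKer_smul hr, nearKer_smul hr, h.g]
  simp only [map_add, map_smul, _root_.smul_apply, ContinuousLinearMap.comp_apply, smul_add,
    smul_smul]
  rw [mul_assoc r⁻¹ r⁻¹ r, inv_mul_cancel₀ hr.ne', mul_one]
  abel

theorem G₁₂ (h : c.Matches r q) (hr : 0 < r) : c.G₁₂ m₁ m₂ = q.G₁₂ m₁ m₂ := by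
  rw [Config.G₁₂, Vars.G₁₂, h.A₁₂ hr, h.A₂₁ hr, h.v₁, h.v₂, clm_smul_mul_smul]

theorem G₂₁ (h : c.Matches r q) (hr : 0 < r) : c.G₂₁ m₁ m₂ = q.G₂₁ m₁ m₂ := by
  rw [Config.G₂₁, Vars.G₂₁, h.A₁₂ hr, h.A₂₁ hr, h.v₁, h.v₂, clm_smul_mul_smul]

theorem nvec_eq (h : c.Matches r q) (hr : 0 < r) : nvec c.x₁ c.x₂ = nv q.d := by
  change nv (c.x₁ - c.x₂) = _
  rw [← h.d, nv_smul hr]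

theorem nvec_eq₂ (h : c.Matches r q) (hr : 0 < r) : nvec c.x₁ c.y₂ = nv q.d₂ := by
  change nv (c.x₁ - c.y₂) = _
  rw [← h.d₂, nv_smul hr]

theorem nvec_eq₁ (h : c.Matches r q) (hr : 0 < r) : nvec c.x₂ c.y₁ = nv q.d₁ := by
  change nv (c.x₂ - c.y₁) = _
  rw [← h.d₁, nv_smul hr]

theorem lam (h : c.Matches r q) (hr : 0 < r) : c.lam = q.lam := by
  rw [Config.lam, Vars.lam, h.nvec_eq hr, h.v₁, h.v₂]

/-- The accelerations of the reduced equations in terms of the rescaled coefficients. -/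
theorem accelerations (h : c.Matches r q) (hr : 0 < r) (h₁ : q.psi.1 ≠ 0) (h₂ : q.psi.2 ≠ 0) :
    q.g • (q.P m₁ m₂ + q.M m₁ m₂ (q.psi.1 • r • c.b₂, q.psi.2 • r • c.b₁)) =
      r • (c.H₁₂ m₁ m₂, c.lam • c.H₂₁ m₁ m₂) := by
  have hrg : r * (q.g * q.g) = q.g := by rw [h.g]; field_simp
  have hM : q.M m₁ m₂ (q.psi.1 • r • c.b₂, q.psi.2 • r • c.b₁) =
      q.N₂ m₁ m₂ (r • c.b₂) + q.N₁ m₁ m₂ (r • c.b₁) := by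
    simp only [Vars.M, _root_.add_apply, _root_.smul_apply,
      ContinuousLinearMap.comp_apply, ContinuousLinearMap.coe_fst', ContinuousLinearMap.coe_snd']
    rw [map_smul (q.N₂ m₁ m₂) q.psi.1, map_smul (q.N₁ m₁ m₂) q.psi.2, smul_smul, smul_smul,
      inv_mul_cancel₀ h₁, inv_mul_cancel₀ h₂, one_smul, one_smul]
  rw [hM, Config.H₁₂, Config.H₂₁, h.G₁₂ hr, h.G₂₁ hr, h.lam hr, h.A₁₂ hr, h.A₂₁ hr, h.F₁ hr,
    h.F₂ hr, ← h.v₁, ← h.v₂]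
  generalize r • c.b₂ = β₂
  generalize r • c.b₁ = β₁
  refine Prod.ext ?_ ?_
  · have e : r • Ring.inverse (q.G₁₂ m₁ m₂) ((q.g • q.A₁₂) ((q.g * q.g) • (q.F₁ + q.D₁ β₁)) +
        (m₂ * gamma q.v₂) • (q.g * q.g) • (q.F₂ + q.D₂ β₂)) =
        (r * (q.g * q.g)) • Ring.inverse (q.G₁₂ m₁ m₂) (q.g • q.A₁₂ (q.F₁ + q.D₁ β₁) +
        (m₂ * gamma q.v₂) • (q.F₂ + q.D₂ β₂)) := by
      simp only [_root_.smul_apply, map_add, map_smul]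
      module
    change _ = r • Ring.inverse (q.G₁₂ m₁ m₂) _
    rw [e, hrg]
    simp only [Vars.P, Vars.N₂, Vars.N₁, Prod.smul_fst, Prod.fst_add, _root_.add_apply,
      _root_.smul_apply, ContinuousLinearMap.comp_apply, ContinuousLinearMap.inl_apply,
      ContinuousLinearMap.inr_apply, map_add, smul_add, map_smul, smul_zero]
    abel
  · have e : r • Ring.inverse (q.G₂₁ m₁ m₂) ((q.g • q.A₂₁) ((q.g * q.g) • (q.F₂ + q.D₂ β₂)) +
        (m₁ * gamma q.v₁) • (q.g * q.g) • (q.F₁ + q.D₁ β₁)) =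
        (r * (q.g * q.g)) • Ring.inverse (q.G₂₁ m₁ m₂) (q.g • q.A₂₁ (q.F₂ + q.D₂ β₂) +
        (m₁ * gamma q.v₁) • (q.F₁ + q.D₁ β₁)) := by
      simp only [_root_.smul_apply, map_add, map_smul]
      module
    change _ = r • q.lam • Ring.inverse (q.G₂₁ m₁ m₂) _
    rw [smul_comm r q.lam, e, hrg]
    simp only [Vars.P, Vars.N₂, Vars.N₁, Prod.smul_snd, Prod.snd_add, _root_.add_apply,
      _root_.smul_apply, ContinuousLinearMap.comp_apply, ContinuousLinearMap.inl_apply,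
      ContinuousLinearMap.inr_apply, map_add, smul_add, map_smul, smul_comm q.lam q.g,
      smul_zero]
    abel

theorem isRegular (h : c.Matches r q) (hr : 0 < r) (hq : q.Regular m₁ m₂) : c.IsRegular m₁ m₂ where
  subluminal₁ := h.v₁ ▸ hq.v₁
  subluminal₂ := h.v₂ ▸ hq.v₂
  noncollision := sub_ne_zero.1 (h.d ▸ smul_ne_zero hr.ne' hq.d)
  noncollision_past := sub_ne_zero.1 (h.d₂ ▸ smul_ne_zero hr.ne' hq.d₂)
  noncollision_future := sub_ne_zero.1 (h.d₁ ▸ smul_ne_zero hr.ne' hq.d₁)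
  invertible₁₂ := h.G₁₂ hr (m₁ := m₁) ▸ hq.G₁₂
  invertible₂₁ := h.G₂₁ hr (m₁ := m₁) ▸ hq.G₂₁

end Config.Matches

namespace BoundaryData

variable {D : BoundaryData} {r ν m₁ m₂ : ℝ}

/-- The boundary data in units of `r`. -/
def frame (D : BoundaryData) (r : ℝ) : Frame where
  g := r⁻¹
  T := r⁻¹ * D.span
  k :=
    { k₂ := fun τ => r⁻¹ • D.hist₂ (r * τ)
      w₂ := fun τ => deriv D.hist₂ (r * τ)
      b₂ := fun τ => r • deriv (deriv D.hist₂) (r * τ)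
      k₁ := fun τ => r⁻¹ • D.hist₁ (r * τ)
      w₁ := fun τ => deriv D.hist₁ (r * τ)
      b₁ := fun τ => r • deriv (deriv D.hist₁) (r * τ) }
  X := (r⁻¹ • D.xOA, r⁻¹ • D.seg₂ D.tOp)
  S := (r⁻¹ * D.tOm, r⁻¹ * D.tLm)

/-- The state of the rescaled equations along the trajectories `y` with delayed and advanced times
`s` and `σ`. -/
def state (D : BoundaryData) (r : ℝ) (y : Trajectory) (s σ : ℝ → ℝ) (u : ℝ) : State :=
  ((r⁻¹ • y.x₁ (D.time u), r⁻¹ • y.x₂ (D.time u)), (y.v₁ (D.time u), y.v₂ (D.time u)),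
    (r⁻¹ * s (D.time u), r⁻¹ * σ (D.time u)))

theorem matches_state (hr : 0 < r) (y : Trajectory) (s σ : ℝ → ℝ) (u : ℝ) :
    (D.config y (D.time u) (s (D.time u)) (σ (D.time u))).Matches r
      (vars (D.frame r).g (D.frame r).k (D.state r y s σ u)) := by
  have e : ∀ x : ℝ, r * (r⁻¹ * x) = x := fun x => mul_inv_cancel_left₀ hr.ne' x
  have e' : ∀ a b : E, r • (r⁻¹ • a - r⁻¹ • b) = a - b := fun a b => by
    rw [← smul_sub, smul_inv_smul₀ hr.ne']
  refine ⟨rfl, e' _ _, ?_, ?_, rfl, rfl, ?_, ?_⟩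
  · simp only [vars, Vars.d₂, Hist.pos, frame, state, config, e, e']
  · simp only [vars, Vars.d₁, Hist.pos, frame, state, config, e, e']
  · simp only [vars, Vars.w₂, Hist.vel, frame, state, config, e]
  · simp only [vars, Vars.w₁, Hist.vel, frame, state, config, e]

theorem IsTame.pos (h : D.IsTame r ν) : 0 < r := by linarith [h.one_le_r]

theorem IsTame.bounds (h : D.IsTame r ν) (hν : ν ≤ 1 / 8) : D.tOm < D.tOp ∧ D.tLm < D.tLp ∧
    r ≤ D.span ∧ D.span ≤ 3 * r := by
  have h1 := abs_le.1 h.Om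
  have h2 := abs_le.1 h.Op
  have h3 := abs_le.1 h.Lm
  have h4 := abs_le.1 h.LB
  have h5 := abs_le.1 h.Lp
  have hr := h.pos
  have : ν * r ≤ 1 / 8 * r := mul_le_mul_of_nonneg_right hν hr.le
  refine ⟨by linarith, by linarith, ?_, ?_⟩ <;> rw [span] <;> linarith

theorem hasDerivAt_hist₂ (hD : D.IsShortest) (h : D.tOm < D.tOp) (t : ℝ) :
    HasDerivAt D.hist₂ (c2ExtendVel D.seg₂ D.tOm D.tOp t) t :=
  hasDerivAt_c2Extend h hD.contDiff₂ t

theorem hasDerivAt_hist₁ (hD : D.IsShortest) (h : D.tLm < D.tLp) (t : ℝ) :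
    HasDerivAt D.hist₁ (c2ExtendVel D.seg₁ D.tLm D.tLp t) t :=
  hasDerivAt_c2Extend h hD.contDiff₁ t

theorem deriv_hist₂ (hD : D.IsShortest) (h : D.tOm < D.tOp) :
    deriv D.hist₂ = c2ExtendVel D.seg₂ D.tOm D.tOp := funext fun t =>
  (hasDerivAt_hist₂ hD h t).deriv

theorem deriv_hist₁ (hD : D.IsShortest) (h : D.tLm < D.tLp) :
    deriv D.hist₁ = c2ExtendVel D.seg₁ D.tLm D.tLp := funext fun t =>
  (hasDerivAt_hist₁ hD h t).deriv

theorem deriv_deriv_hist₂ (hD : D.IsShortest) (h : D.tOm < D.tOp) :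
    deriv (deriv D.hist₂) = c2ExtendAcc D.seg₂ D.tOm D.tOp := funext fun t => by
  rw [deriv_hist₂ hD h]; exact (hasDerivAt_c2ExtendVel h hD.contDiff₂ t).deriv

theorem deriv_deriv_hist₁ (hD : D.IsShortest) (h : D.tLm < D.tLp) :
    deriv (deriv D.hist₁) = c2ExtendAcc D.seg₁ D.tLm D.tLp := funext fun t => by
  rw [deriv_hist₁ hD h]; exact (hasDerivAt_c2ExtendVel h hD.contDiff₁ t).deriv

/-- In units of `r` the speeds are unchanged and the accelerations are multiplied by `r`. -/
theorem isBounded_frame (hD : D.IsShortest) (h : D.IsTame r ν) (hν : ν ≤ 1 / 8) :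
    (D.frame r).k.IsBounded ν := by
  have hr := h.pos
  obtain ⟨i2, i1, -, -⟩ := h.bounds hν
  have lin : ∀ τ : ℝ, HasDerivAt (fun τ => r * τ) r τ := fun τ => by
    simpa using (hasDerivAt_id τ).const_mul r
  refine ⟨fun τ => ?_, fun τ => ?_, ?_, fun τ => ?_, fun τ => ?_, ?_, fun τ => ?_, fun τ => ?_,
    fun τ => ?_, fun τ => ?_⟩
  · have h1 := ((hasDerivAt_hist₂ hD i2 (r * τ)).scomp τ (lin τ)).const_smul r⁻¹
    rw [inv_smul_smul₀ hr.ne', ← deriv_hist₂ hD i2] at h1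
    exact h1
  · have h1 := (hasDerivAt_c2ExtendVel i2 hD.contDiff₂ (r * τ)).scomp τ (lin τ)
    rw [← deriv_deriv_hist₂ hD i2, ← deriv_hist₂ hD i2] at h1
    exact h1
  · have h1 := (continuous_c2ExtendAcc i2 hD.contDiff₂).comp (continuous_const_mul r)
    rw [← deriv_deriv_hist₂ hD i2] at h1
    exact h1.const_smul r
  · have h1 := ((hasDerivAt_hist₁ hD i1 (r * τ)).scomp τ (lin τ)).const_smul r⁻¹
    rw [inv_smul_smul₀ hr.ne', ← deriv_hist₁ hD i1] at h1
    exact h1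
  · have h1 := (hasDerivAt_c2ExtendVel i1 hD.contDiff₁ (r * τ)).scomp τ (lin τ)
    rw [← deriv_deriv_hist₁ hD i1, ← deriv_hist₁ hD i1] at h1
    exact h1
  · have h1 := (continuous_c2ExtendAcc i1 hD.contDiff₁).comp (continuous_const_mul r)
    rw [← deriv_deriv_hist₁ hD i1] at h1
    exact h1.const_smul r
  · change ‖deriv D.hist₂ (r * τ)‖ ≤ ν
    rw [deriv_hist₂ hD i2]; exact h.vel₂ _
  · change ‖r • deriv (deriv D.hist₂) (r * τ)‖ ≤ ν
    rw [deriv_deriv_hist₂ hD i2, norm_smul, Real.norm_eq_abs, abs_of_pos hr]; exact h.acc₂ _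
  · change ‖deriv D.hist₁ (r * τ)‖ ≤ ν
    rw [deriv_hist₁ hD i1]; exact h.vel₁ _
  · change ‖r • deriv (deriv D.hist₁) (r * τ)‖ ≤ ν
    rw [deriv_deriv_hist₁ hD i1, norm_smul, Real.norm_eq_abs, abs_of_pos hr]; exact h.acc₁ _

theorem hist₂_Om (h : D.tOm < D.tOp) : D.hist₂ D.tOm = D.seg₂ D.tOm :=
  c2Extend_of_mem _ (left_mem_Icc.2 h.le)

theorem hist₂_Op (h : D.tOm < D.tOp) : D.hist₂ D.tOp = D.seg₂ D.tOp :=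
  c2Extend_of_mem _ (right_mem_Icc.2 h.le)

theorem hist₁_Lm (h : D.tLm < D.tLp) : D.hist₁ D.tLm = D.seg₁ D.tLm :=
  c2Extend_of_mem _ (left_mem_Icc.2 h.le)

theorem hist₁_Lp (h : D.tLm < D.tLp) : D.hist₁ D.tLp = D.seg₁ D.tLp :=
  c2Extend_of_mem _ (right_mem_Icc.2 h.le)

theorem norm_inv_smul_sub (hr : 0 < r) (a b : E) : ‖r⁻¹ • a - r⁻¹ • b‖ = r⁻¹ * ‖a - b‖ := by
  rw [← smul_sub, norm_smul, norm_inv, Real.norm_eq_abs, abs_of_pos hr]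

theorem abs_inv_mul_sub_one_le (hr : 0 < r) {x : ℝ} (h : |x - r| ≤ ν * r) : |r⁻¹ * x - 1| ≤ ν := by
  have e : r⁻¹ * x - 1 = r⁻¹ * (x - r) := by field_simp
  rw [e, abs_mul, abs_inv, abs_of_pos hr, inv_mul_le_iff₀ hr]
  linarith

/-- Tame boundary data give, in units of `r`, a small perturbation of free motion. -/
theorem isGood_frame (hD : D.IsShortest) (h : D.IsTame r ν) (hν : ν ≤ 1 / 8) (hg : r⁻¹ ≤ ν) :
    (D.frame r).IsGood ν := by
  have hr := h.pos
  obtain ⟨i2, i1, s1, s2⟩ := h.bounds hν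
  have e : ∀ x : ℝ, r * (r⁻¹ * x) = x := fun x => mul_inv_cancel_left₀ hr.ne' x
  refine ⟨(inv_pos.2 hr).le, hg, ?_, ?_, isBounded_frame hD h hν, ?_, ?_, ?_⟩
  · change 1 ≤ r⁻¹ * D.span
    rw [← div_eq_inv_mul, le_div_iff₀ hr]; linarith
  · change r⁻¹ * D.span ≤ 3
    rw [← div_eq_inv_mul, div_le_iff₀ hr]; linarith
  · change |‖r⁻¹ • D.xOA - r⁻¹ • D.seg₂ D.tOp‖ - 1| ≤ ν
    rw [norm_inv_smul_sub hr, ← hD.lightcone_Op]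
    exact abs_inv_mul_sub_one_le hr h.Op
  · change |‖r⁻¹ • D.xOA - r⁻¹ • D.hist₂ (r * (r⁻¹ * D.tOm))‖ - 1| ≤ ν
    rw [norm_inv_smul_sub hr, e, hist₂_Om i2, ← hD.lightcone_Om]
    exact abs_inv_mul_sub_one_le hr h.Om
  · change |‖r⁻¹ • D.seg₂ D.tOp - r⁻¹ • D.hist₁ (r * (r⁻¹ * D.tLm))‖ - 1| ≤ ν
    rw [norm_inv_smul_sub hr, e, hist₁_Lm i1, norm_sub_rev, ← hD.shortest]
    exact abs_inv_mul_sub_one_le hr h.Lm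

end BoundaryData

/-! ### Solutions of the reduced equations as rescaled flows -/

namespace IsFlow

variable {m₁ m₂ g T a : ℝ} {k : Hist} {Z : ℝ → State}

theorem hasDerivWithinAt_x₁ (hZ : IsFlow (Vars.coeff m₁ m₂) g T k a Z) {u : ℝ} (hu : u ∈ Icc 0 a) :
    HasDerivWithinAt (fun u => (Z u).1.1) (T • (Z u).2.1.1) (Icc 0 a) u :=
  hasDerivWithinAt_fst (hasDerivWithinAt_fst (hZ u hu))

theorem hasDerivWithinAt_x₂ (hZ : IsFlow (Vars.coeff m₁ m₂) g T k a Z) {u : ℝ} (hu : u ∈ Icc 0 a) :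
    HasDerivWithinAt (fun u => (Z u).1.2) (T • (vars g k (Z u)).lam • (Z u).2.1.2) (Icc 0 a) u :=
  hasDerivWithinAt_snd (hasDerivWithinAt_fst (hZ u hu))

theorem hasDerivWithinAt_V (hZ : IsFlow (Vars.coeff m₁ m₂) g T k a Z) {u : ℝ} (hu : u ∈ Icc 0 a) :
    HasDerivWithinAt (fun u => (Z u).2.1)
      (T • (vfield (Vars.coeff m₁ m₂) g k (Z u)).2.1) (Icc 0 a) u :=
  hasDerivWithinAt_fst (hasDerivWithinAt_snd (hZ u hu))

theorem hasDerivWithinAt_s (hZ : IsFlow (Vars.coeff m₁ m₂) g T k a Z) {u : ℝ} (hu : u ∈ Icc 0 a) :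
    HasDerivWithinAt (fun u => (Z u).2.2.1) (T * (vars g k (Z u)).psi.1) (Icc 0 a) u :=
  hasDerivWithinAt_fst (hasDerivWithinAt_snd (hasDerivWithinAt_snd (hZ u hu)))

theorem hasDerivWithinAt_σ (hZ : IsFlow (Vars.coeff m₁ m₂) g T k a Z) {u : ℝ} (hu : u ∈ Icc 0 a) :
    HasDerivWithinAt (fun u => (Z u).2.2.2) (T * (vars g k (Z u)).psi.2) (Icc 0 a) u :=
  hasDerivWithinAt_snd (hasDerivWithinAt_snd (hasDerivWithinAt_snd (hZ u hu)))

end IsFlow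

namespace Vars

variable {q : Vars} {m₁ m₂ : ℝ}

theorem one_add_inner_pos (d : E) {v : E} (h : ‖v‖ < 1) : 0 < 1 + inner ℝ (nv d) v := by
  linarith [(abs_le.1 (abs_inner_nv_le d v)).1]

theorem one_sub_inner_pos (d : E) {v : E} (h : ‖v‖ < 1) : 0 < 1 - inner ℝ (nv d) v := by
  linarith [(abs_le.1 (abs_inner_nv_le d v)).2]

/-- The time of particle 2 runs with the rate `λ`. -/
theorem one_add_inner_sub (hq : ‖q.v₂‖ < 1) :
    1 + inner ℝ (nv q.d) (q.v₁ - q.lam • q.v₂) = q.lam := by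
  have h := one_add_inner_pos q.d hq
  have e : q.lam * (1 + inner ℝ (nv q.d) q.v₂) = 1 + inner ℝ (nv q.d) q.v₁ := by
    rw [lam]; field_simp
  rw [inner_sub_right, real_inner_smul_right]
  linarith

end Vars

theorem eq_of_derivWithin_zero {φ : ℝ → ℝ} (h : ∀ u ∈ Icc (0 : ℝ) 1, HasDerivWithinAt φ 0 (Icc 0 1) u)
    {u : ℝ} (hu : u ∈ Icc (0 : ℝ) 1) : φ u = φ 0 := by
  have := (convex_Icc (0 : ℝ) 1).norm_image_sub_le_of_norm_hasDerivWithin_le (C := 0) h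
    (fun u _ => by simp) (left_mem_Icc.2 zero_le_one) hu
  rw [zero_mul] at this
  exact sub_eq_zero.1 (norm_le_zero_iff.1 this)

section Conservation

variable {m₁ m₂ g T ν : ℝ} {k : Hist} {Z : ℝ → State}

/-- The time of particle 2 along a flow. -/
theorem IsFlow.hasDerivWithinAt_t₂ (hZ : IsFlow (Vars.coeff m₁ m₂) g T k 1 Z)
    (hreg : ∀ u ∈ Icc (0 : ℝ) 1, (vars g k (Z u)).Regular m₁ m₂) (t₀ : ℝ) {u : ℝ}
    (hu : u ∈ Icc (0 : ℝ) 1) :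
    HasDerivWithinAt (fun u => t₀ + u * T + ‖(Z u).1.1 - (Z u).1.2‖)
      (T * (vars g k (Z u)).lam) (Icc 0 1) u := by
  have hq := hreg u hu
  have h1 := hasDerivWithinAt_norm_sub (hZ.hasDerivWithinAt_x₁ hu) (hZ.hasDerivWithinAt_x₂ hu)
    (sub_ne_zero.1 hq.d)
  have h2 := (((hasDerivWithinAt_id u (Icc (0 : ℝ) 1)).mul_const T).const_add t₀).add h1
  refine h2.congr_deriv ?_
  have h3 := Vars.one_add_inner_sub hq.v₂
  rw [← smul_sub, real_inner_smul_right]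
  change 1 * T + T * inner ℝ (nv (vars g k (Z u)).d) ((vars g k (Z u)).v₁ -
    (vars g k (Z u)).lam • (vars g k (Z u)).v₂) = _
  linear_combination T * h3

/-- Along a flow, particle 1 stays in light-cone with the past segment. -/
theorem IsFlow.lightcone_past (hk : k.IsBounded ν) (hZ : IsFlow (Vars.coeff m₁ m₂) g T k 1 Z)
    (hreg : ∀ u ∈ Icc (0 : ℝ) 1, (vars g k (Z u)).Regular m₁ m₂) {t₀ : ℝ}
    (h0 : t₀ - (Z 0).2.2.1 = ‖(Z 0).1.1 - k.k₂ (Z 0).2.2.1‖) {u : ℝ} (hu : u ∈ Icc (0 : ℝ) 1) :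
    t₀ + u * T - (Z u).2.2.1 = ‖(Z u).1.1 - k.k₂ (Z u).2.2.1‖ := by
  have key := eq_of_derivWithin_zero
    (φ := fun u => t₀ + u * T - (Z u).2.2.1 - ‖(Z u).1.1 - k.k₂ (Z u).2.2.1‖) (fun u hu => by
      have hq := hreg u hu
      have hs := hZ.hasDerivWithinAt_s hu
      have h1 := hasDerivWithinAt_norm_sub (hZ.hasDerivWithinAt_x₁ hu)
        ((hk.hk₂ (Z u).2.2.1).scomp_hasDerivWithinAt u hs) (sub_ne_zero.1 hq.d₂)
      have h2 := ((((hasDerivWithinAt_id u (Icc (0 : ℝ) 1)).mul_const T).const_add t₀).sub hs).sub h1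
      refine h2.congr_deriv ?_
      have h3 := Vars.one_sub_inner_pos (vars g k (Z u)).d₂ hq.w₂
      have e : (vars g k (Z u)).psi.1 *
          (1 - inner ℝ (nv (vars g k (Z u)).d₂) (vars g k (Z u)).w₂) =
          1 - inner ℝ (nv (vars g k (Z u)).d₂) (vars g k (Z u)).v₁ := by
        rw [Vars.psi]; field_simp
      change 1 * T - T * (vars g k (Z u)).psi.1 - inner ℝ (nv (vars g k (Z u)).d₂)
        (T • (vars g k (Z u)).v₁ - (T * (vars g k (Z u)).psi.1) • (vars g k (Z u)).w₂) = 0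
      rw [inner_sub_right, real_inner_smul_right, real_inner_smul_right]
      linear_combination -T * e) hu
  simp only [zero_mul, add_zero, h0, sub_self] at key
  linarith

/-- Along a flow, particle 2 stays in light-cone with the future segment. -/
theorem IsFlow.lightcone_future (hk : k.IsBounded ν) (hZ : IsFlow (Vars.coeff m₁ m₂) g T k 1 Z)
    (hreg : ∀ u ∈ Icc (0 : ℝ) 1, (vars g k (Z u)).Regular m₁ m₂) {t₀ : ℝ}
    (h0 : (Z 0).2.2.2 - (t₀ + ‖(Z 0).1.1 - (Z 0).1.2‖) = ‖(Z 0).1.2 - k.k₁ (Z 0).2.2.2‖) {u : ℝ}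
    (hu : u ∈ Icc (0 : ℝ) 1) :
    (Z u).2.2.2 - (t₀ + u * T + ‖(Z u).1.1 - (Z u).1.2‖) = ‖(Z u).1.2 - k.k₁ (Z u).2.2.2‖ := by
  have key := eq_of_derivWithin_zero
    (φ := fun u => (Z u).2.2.2 - (t₀ + u * T + ‖(Z u).1.1 - (Z u).1.2‖) -
      ‖(Z u).1.2 - k.k₁ (Z u).2.2.2‖) (fun u hu => by
      have hq := hreg u hu
      have hs := hZ.hasDerivWithinAt_σ hu
      have h1 := hasDerivWithinAt_norm_sub (hZ.hasDerivWithinAt_x₂ hu)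
        ((hk.hk₁ (Z u).2.2.2).scomp_hasDerivWithinAt u hs) (sub_ne_zero.1 hq.d₁)
      have h2 := (hs.sub (hZ.hasDerivWithinAt_t₂ hreg t₀ hu)).sub h1
      refine h2.congr_deriv ?_
      have h3 := Vars.one_add_inner_pos (vars g k (Z u)).d₁ hq.w₁
      have e : (vars g k (Z u)).psi.2 *
          (1 + inner ℝ (nv (vars g k (Z u)).d₁) (vars g k (Z u)).w₁) =
          (vars g k (Z u)).lam * (1 + inner ℝ (nv (vars g k (Z u)).d₁) (vars g k (Z u)).v₂) := by
        rw [Vars.psi]; field_simp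
      change T * (vars g k (Z u)).psi.2 - T * (vars g k (Z u)).lam -
        inner ℝ (nv (vars g k (Z u)).d₁) (T • (vars g k (Z u)).lam • (vars g k (Z u)).v₂ -
          (T * (vars g k (Z u)).psi.2) • (vars g k (Z u)).w₁) = 0
      rw [inner_sub_right, real_inner_smul_right, real_inner_smul_right, real_inner_smul_right]
      linear_combination T * e) hu
  simp only [zero_mul, add_zero, h0, sub_self] at key
  linarith

end Conservation

namespace BoundaryData

variable {D : BoundaryData} {r ν m₁ m₂ : ℝ}

theorem time_mem (hs : 0 ≤ D.span) {u : ℝ} (hu : u ∈ Icc (0 : ℝ) 1) : D.time u ∈ D.interval := by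
  have h : u * D.span ≤ D.span := mul_le_of_le_one_left hs hu.2
  have h2 : 0 ≤ u * D.span := mul_nonneg hu.1 hs
  refine ⟨?_, ?_⟩ <;> rw [time]
  · linarith
  · rw [span] at h ⊢; linarith

theorem time_zero : D.time 0 = D.tOA := by simp [time]

theorem time_one : D.time 1 = D.tLm := by simp [time, span]

theorem hasDerivWithinAt_time (u : ℝ) (I : Set ℝ) : HasDerivWithinAt D.time D.span I u := by
  have h := ((hasDerivAt_id u).mul_const D.span).const_add D.tOA
  rw [one_mul] at h
  exact h.hasDerivWithinAt

theorem lipschitz_hist₂ (hD : D.IsShortest) (h : D.IsTame r ν) (hν : ν ≤ 1 / 8) (a b : ℝ) :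
    ‖D.hist₂ a - D.hist₂ b‖ ≤ ν * |a - b| :=
  Hist.norm_sub_le_of_deriv (hasDerivAt_hist₂ hD (h.bounds hν).1) h.vel₂ a b

theorem lipschitz_hist₁ (hD : D.IsShortest) (h : D.IsTame r ν) (hν : ν ≤ 1 / 8) (a b : ℝ) :
    ‖D.hist₁ a - D.hist₁ b‖ ≤ ν * |a - b| :=
  Hist.norm_sub_le_of_deriv (hasDerivAt_hist₁ hD (h.bounds hν).2.1) h.vel₁ a b

theorem b₂_frame (hr : 0 < r) (x : ℝ) :
    (D.frame r).k.b₂ (r⁻¹ * x) = r • deriv (deriv D.hist₂) x := by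
  simp only [frame, mul_inv_cancel_left₀ hr.ne']

theorem b₁_frame (hr : 0 < r) (x : ℝ) :
    (D.frame r).k.b₁ (r⁻¹ * x) = r • deriv (deriv D.hist₁) x := by
  simp only [frame, mul_inv_cancel_left₀ hr.ne']

theorem vfield_velocity {c : Config} {z : State}
    (hm : c.Matches r (vars (D.frame r).g (D.frame r).k z))
    (h₂ : (D.frame r).k.b₂ z.2.2.1 = r • c.b₂) (h₁ : (D.frame r).k.b₁ z.2.2.2 = r • c.b₁)
    (hr : 0 < r) (hψ₁ : (vars (D.frame r).g (D.frame r).k z).psi.1 ≠ 0)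
    (hψ₂ : (vars (D.frame r).g (D.frame r).k z).psi.2 ≠ 0) :
    (vfield (Vars.coeff m₁ m₂) (D.frame r).g (D.frame r).k z).2.1 =
      r • (c.H₁₂ m₁ m₂, c.lam • c.H₂₁ m₁ m₂) := by
  rw [← hm.accelerations hr hψ₁ hψ₂, ← h₂, ← h₁]
  rfl

/-- Solutions of the reduced equations solve the rescaled equations. -/
theorem isFlow_state (hD : D.IsShortest) (h : D.IsTame r ν) (hν : ν ≤ 1 / 8) {y : Trajectory}
    {s σ : ℝ → ℝ} (hy : D.SolvesWith m₁ m₂ y s σ) :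
    IsFlow (Vars.coeff m₁ m₂) (D.frame r).g (D.frame r).T (D.frame r).k 1 (D.state r y s σ) := by
  have hr := h.pos
  obtain ⟨i2, i1, sp, -⟩ := h.bounds hν
  have hs : 0 ≤ D.span := by linarith
  have hk := isBounded_frame hD h hν
  intro u hu
  set t := D.time u with ht
  have htI : t ∈ D.interval := time_mem hs hu
  have hmaps : MapsTo D.time (Icc 0 1) D.interval := fun u hu => time_mem hs hu
  have htime := hasDerivWithinAt_time (D := D) u (Icc 0 1)
  have hm := matches_state (D := D) hr y s σ u
  set q := vars (D.frame r).g (D.frame r).k (D.state r y s σ u) with hq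
  set c := D.config y t (s t) (σ t) with hc
  have hreg : c.IsRegular m₁ m₂ := hy.regular t htI
  have hw₂ : ‖q.w₂‖ ≤ ν := hk.norm_w₂ _
  have hw₁ : ‖q.w₁‖ ≤ ν := hk.norm_w₁ _
  have hv₁ : ‖q.v₁‖ < 1 := hreg.subluminal₁
  have hv₂ : ‖q.v₂‖ < 1 := hreg.subluminal₂
  have hψ := Vars.psi_pos hv₁ hv₂ (by linarith) (by linarith)
  have hlam : c.lam = q.lam := hm.lam hr
  have d1 := hy.ode_x₁ t htI
  have d2 := hy.ode_x₂ t htI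
  have d3 := hy.ode_v₁ t htI
  have d4 := hy.ode_v₂ t htI
  -- the delayed and the advanced time
  have d5 := hasDerivWithinAt_lightcone (sg := -1) (θ := fun t => t) (s := s) (x := y.x₁)
    (k := D.hist₂) (w := deriv D.hist₂) (I := D.interval) (ν := ν) (by simp) (by linarith)
    (lipschitz_hist₂ hD h hν)
    (hasDerivAt_hist₂ hD i2 _).differentiableAt.hasDerivAt (by rw [deriv_hist₂ hD i2]; exact h.vel₂ _)
    (fun t ht => by rw [← hy.lightcone_past t ht]; ring) htI (hasDerivWithinAt_id _ _) d1
    hreg.noncollision_past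
  have d6 := (hasDerivWithinAt_id t D.interval).add
    (hasDerivWithinAt_norm_sub d1 d2 hreg.noncollision)
  have e6 : 1 + inner ℝ (nvec (y.x₁ t) (y.x₂ t)) (y.v₁ t - c.lam • y.v₂ t) = q.lam := by
    have h1 := Vars.one_add_inner_sub hv₂
    rw [← hm.nvec_eq hr, hm.v₁, hm.v₂, ← hlam] at h1
    rw [← hlam]
    exact h1
  rw [e6] at d6
  have d7 := hasDerivWithinAt_lightcone (sg := 1) (θ := fun t => t + ‖y.x₁ t - y.x₂ t‖) (s := σ)
    (x := y.x₂) (k := D.hist₁) (w := deriv D.hist₁) (I := D.interval) (ν := ν) (by simp)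
    (by linarith) (lipschitz_hist₁ hD h hν)
    (hasDerivAt_hist₁ hD i1 _).differentiableAt.hasDerivAt (by rw [deriv_hist₁ hD i1]; exact h.vel₁ _)
    (fun t ht => by rw [← hy.lightcone_future t ht]; ring) htI d6 d2
    hreg.noncollision_future
  have e5 : (1 + -1 * inner ℝ (nvec (y.x₁ t) (D.hist₂ (s t))) (y.v₁ t)) /
      (1 + -1 * inner ℝ (nvec (y.x₁ t) (D.hist₂ (s t))) (deriv D.hist₂ (s t))) = q.psi.1 := by
    have e1 : nvec (y.x₁ t) (D.hist₂ (s t)) = nv q.d₂ := hm.nvec_eq₂ hr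
    have e2 : deriv D.hist₂ (s t) = q.w₂ := hm.w₂.symm
    have e3 : y.v₁ t = q.v₁ := rfl
    rw [e1, e2, e3, Vars.psi, neg_one_mul, neg_one_mul, ← sub_eq_add_neg, ← sub_eq_add_neg]
  have e7 : (q.lam + 1 * inner ℝ (nvec (y.x₂ t) (D.hist₁ (σ t))) (c.lam • y.v₂ t)) /
      (1 + 1 * inner ℝ (nvec (y.x₂ t) (D.hist₁ (σ t))) (deriv D.hist₁ (σ t))) = q.psi.2 := by
    have e1 : nvec (y.x₂ t) (D.hist₁ (σ t)) = nv q.d₁ := hm.nvec_eq₁ hr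
    have e2 : deriv D.hist₁ (σ t) = q.w₁ := hm.w₁.symm
    have e3 : y.v₂ t = q.v₂ := rfl
    rw [e1, e2, e3, Vars.psi, hlam, real_inner_smul_right, one_mul, one_mul, mul_add, mul_one]
  rw [e5] at d5
  rw [e7] at d7
  have f1 := (d1.scomp u htime hmaps).const_smul r⁻¹
  have f2 := (d2.scomp u htime hmaps).const_smul r⁻¹
  have f3 := d3.scomp u htime hmaps
  have f4 := d4.scomp u htime hmaps
  have f5 := (d5.scomp u htime hmaps).const_mul r⁻¹
  have f6 := (d7.scomp u htime hmaps).const_mul r⁻¹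
  have hfin := HasDerivWithinAt.prodMk (HasDerivWithinAt.prodMk f1 f2) (HasDerivWithinAt.prodMk
    (HasDerivWithinAt.prodMk f3 f4) (HasDerivWithinAt.prodMk f5 f6))
  refine hfin.congr_deriv ?_
  have hT : (D.frame r).T = r⁻¹ * D.span := rfl
  have hTr : (D.frame r).T * r = D.span := by rw [hT]; field_simp
  refine Prod.ext (Prod.ext ?_ ?_) (Prod.ext ?_ (Prod.ext ?_ ?_))
  · change r⁻¹ • D.span • y.v₁ t = (D.frame r).T • y.v₁ t
    rw [smul_smul, hT]
  · change r⁻¹ • D.span • c.lam • y.v₂ t = (D.frame r).T • q.lam • y.v₂ t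
    rw [smul_smul, hT, hlam]
  · have e1 := vfield_velocity (D := D) (r := r) (m₁ := m₁) (m₂ := m₂) hm
      (b₂_frame hr (s t)) (b₁_frame hr (σ t)) hr hψ.1.ne' hψ.2.ne'
    change (D.span • c.H₁₂ m₁ m₂, D.span • c.lam • c.H₂₁ m₁ m₂) =
      (D.frame r).T • (vfield (Vars.coeff m₁ m₂) (D.frame r).g (D.frame r).k
        (D.state r y s σ u)).2.1
    rw [e1, smul_smul (D.frame r).T r, hTr]
    rfl
  · change r⁻¹ * (D.span • q.psi.1) = (D.frame r).T * q.psi.1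
    rw [smul_eq_mul, hT, mul_assoc]
  · change r⁻¹ * (D.span • q.psi.2) = (D.frame r).T * q.psi.2
    rw [smul_eq_mul, hT, mul_assoc]

/-- The trajectory that belongs to a solution of the rescaled equations. -/
def toTrajectory (D : BoundaryData) (r : ℝ) (Z : ℝ → State) : Trajectory where
  x₁ t := r • (Z ((t - D.tOA) / D.span)).1.1
  v₁ t := (Z ((t - D.tOA) / D.span)).2.1.1
  x₂ t := r • (Z ((t - D.tOA) / D.span)).1.2
  v₂ t := (Z ((t - D.tOA) / D.span)).2.1.2

theorem time_sub_div (hs : D.span ≠ 0) (u : ℝ) : (D.time u - D.tOA) / D.span = u := by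
  rw [time, add_sub_cancel_left, mul_div_cancel_right₀ _ hs]

/-- Solutions of the rescaled equations that start in light-cone with the segments solve the reduced
equations. -/
theorem solvesWith_toTrajectory (hD : D.IsShortest) (h : D.IsTame r ν) (hν : ν ≤ 1 / 8)
    {Z : ℝ → State} {V : E × E} (hZ : (D.frame r).Solves m₁ m₂ V Z)
    (hreg : ∀ u ∈ Icc (0 : ℝ) 1, (vars (D.frame r).g (D.frame r).k (Z u)).Regular m₁ m₂) :
    D.SolvesWith m₁ m₂ (D.toTrajectory r Z) (fun t => r * (Z ((t - D.tOA) / D.span)).2.2.1)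
      (fun t => r * (Z ((t - D.tOA) / D.span)).2.2.2) := by
  have hr := h.pos
  obtain ⟨i2, i1, sp, -⟩ := h.bounds hν
  have hs : 0 < D.span := by linarith
  have hk := isBounded_frame hD h hν
  set y := D.toTrajectory r Z with hy
  set s : ℝ → ℝ := fun t => r * (Z ((t - D.tOA) / D.span)).2.2.1 with hsdef
  set σ : ℝ → ℝ := fun t => r * (Z ((t - D.tOA) / D.span)).2.2.2 with hσdef
  set T := (D.frame r).T with hT
  have hTr : r * T = D.span := mul_inv_cancel_left₀ hr.ne' _
  have hstate : ∀ u, D.state r y s σ u = Z u := fun u => by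
    simp only [state, hy, toTrajectory, hsdef, hσdef, time_sub_div hs.ne', inv_smul_smul₀ hr.ne',
      inv_mul_cancel_left₀ hr.ne']
  have hu : ∀ t ∈ D.interval, (t - D.tOA) / D.span ∈ Icc (0 : ℝ) 1 := fun t ht => by
    refine ⟨div_nonneg (by linarith [ht.1]) hs.le, ?_⟩
    rw [div_le_one hs, span]
    linarith [ht.2]
  have hut : ∀ t, D.time ((t - D.tOA) / D.span) = t := fun t => by
    rw [time, div_mul_cancel₀ _ hs.ne']; ring
  have hm : ∀ t, (D.config y t (s t) (σ t)).Matches r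
      (vars (D.frame r).g (D.frame r).k (Z ((t - D.tOA) / D.span))) := fun t => by
    have h1 := matches_state (D := D) hr y s σ ((t - D.tOA) / D.span)
    rwa [hut, hstate] at h1
  have hder : ∀ t, HasDerivWithinAt (fun t => (t - D.tOA) / D.span) D.span⁻¹ D.interval t :=
    fun t => by
      simpa using! (((hasDerivAt_id t).sub_const D.tOA).div_const D.span).hasDerivWithinAt
  have hscale : r * (D.span⁻¹ * T) = 1 := by
    rw [mul_left_comm, hTr, inv_mul_cancel₀ hs.ne']
  have hTs : D.span⁻¹ * T = r⁻¹ := by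
    rw [← inv_mul_cancel_left₀ hr.ne' (D.span⁻¹ * T), hscale, mul_one]
  have e : ∀ x : ℝ, r * (r⁻¹ * x) = x := fun x => mul_inv_cancel_left₀ hr.ne' x
  have hZ0 := hZ.1
  have hacc : ∀ t ∈ D.interval, HasDerivWithinAt
      (fun t => (Z ((t - D.tOA) / D.span)).2.1) ((D.config y t (s t) (σ t)).H₁₂ m₁ m₂,
        (D.config y t (s t) (σ t)).lam • (D.config y t (s t) (σ t)).H₂₁ m₁ m₂) D.interval t := by
    intro t ht
    have h1 := HasDerivWithinAt.scomp (h := fun t => (t - D.tOA) / D.span) t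
      (hZ.2.hasDerivWithinAt_V (hu t ht)) (hder t) hu
    refine h1.congr_deriv ?_
    have hq := hreg _ (hu t ht)
    have hψ := Vars.psi_pos hq.v₁ hq.v₂ hq.w₂ hq.w₁
    have ha := vfield_velocity (D := D) (m₁ := m₁) (m₂ := m₂) (hm t)
      ((congrArg (D.frame r).k.b₂ (inv_mul_cancel_left₀ hr.ne' _)).symm.trans (b₂_frame hr (s t)))
      ((congrArg (D.frame r).k.b₁ (inv_mul_cancel_left₀ hr.ne' _)).symm.trans (b₁_frame hr (σ t)))
      hr hψ.1.ne' hψ.2.ne'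
    rw [ha, smul_smul, smul_smul, hTs, inv_mul_cancel₀ hr.ne', one_smul]
  refine ⟨fun t ht => ?_, fun t ht => ?_, fun t ht => (hm t).isRegular hr (hreg _ (hu t ht)),
    fun t ht => hasDerivWithinAt_fst (hacc t ht), fun t ht => hasDerivWithinAt_snd (hacc t ht),
    fun t ht => ?_, fun t ht => ?_⟩
  · have h0 : r⁻¹ * D.tOA - (Z 0).2.2.1 = ‖(Z 0).1.1 - (D.frame r).k.k₂ (Z 0).2.2.1‖ := by
      rw [hZ0]
      change r⁻¹ * D.tOA - r⁻¹ * D.tOm = ‖r⁻¹ • D.xOA - r⁻¹ • D.hist₂ (r * (r⁻¹ * D.tOm))‖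
      rw [norm_inv_smul_sub hr, e, hist₂_Om i2, ← hD.lightcone_Om]
      ring
    have h1 := hZ.2.lightcone_past hk hreg h0 (hu t ht)
    set u := (t - D.tOA) / D.span with hud
    have h2 : ‖(Z u).1.1 - (D.frame r).k.k₂ (Z u).2.2.1‖ = r⁻¹ * ‖y.x₁ t - D.hist₂ (s t)‖ := by
      rw [← norm_inv_smul_sub hr]
      simp only [hy, toTrajectory, inv_smul_smul₀ hr.ne']
      rfl
    rw [h2] at h1
    have h3 : t = D.tOA + u * D.span := (hut t).symm
    calc t - s t = r * (r⁻¹ * D.tOA + u * T - (Z u).2.2.1) := by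
          rw [mul_sub, mul_add, e, mul_left_comm, hTr, ← h3]
      _ = _ := by rw [h1, e]
  · have h0 : (Z 0).2.2.2 - (r⁻¹ * D.tOA + ‖(Z 0).1.1 - (Z 0).1.2‖) =
        ‖(Z 0).1.2 - (D.frame r).k.k₁ (Z 0).2.2.2‖ := by
      rw [hZ0]
      change r⁻¹ * D.tLm - (r⁻¹ * D.tOA + ‖r⁻¹ • D.xOA - r⁻¹ • D.seg₂ D.tOp‖) =
        ‖r⁻¹ • D.seg₂ D.tOp - r⁻¹ • D.hist₁ (r * (r⁻¹ * D.tLm))‖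
      rw [norm_inv_smul_sub hr, norm_inv_smul_sub hr, e, hist₁_Lm i1, ← hD.lightcone_Op,
        norm_sub_rev, ← hD.shortest]
      ring
    have h1 := hZ.2.lightcone_future hk hreg h0 (hu t ht)
    set u := (t - D.tOA) / D.span with hud
    have h2 : ‖(Z u).1.2 - (D.frame r).k.k₁ (Z u).2.2.2‖ = r⁻¹ * ‖y.x₂ t - D.hist₁ (σ t)‖ := by
      rw [← norm_inv_smul_sub hr]
      simp only [hy, toTrajectory, inv_smul_smul₀ hr.ne']
      rfl
    have h2' : ‖(Z u).1.1 - (Z u).1.2‖ = r⁻¹ * ‖y.x₁ t - y.x₂ t‖ := by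
      rw [← norm_inv_smul_sub hr]
      simp only [hy, toTrajectory, inv_smul_smul₀ hr.ne']
      rfl
    rw [h2, h2'] at h1
    have h3 : t = D.tOA + u * D.span := (hut t).symm
    calc σ t - (t + ‖y.x₁ t - y.x₂ t‖) =
          r * ((Z u).2.2.2 - (r⁻¹ * D.tOA + u * T + r⁻¹ * ‖y.x₁ t - y.x₂ t‖)) := by
          rw [mul_sub, mul_add, mul_add, e, e, mul_left_comm, hTr, ← h3]
      _ = _ := by rw [h1, e]
  · have h1 := (HasDerivWithinAt.scomp (h := fun t => (t - D.tOA) / D.span) t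
      (hZ.2.hasDerivWithinAt_x₁ (hu t ht)) (hder t) hu).const_smul r
    refine h1.congr_deriv ?_
    rw [smul_smul, smul_smul, mul_assoc, hscale, one_smul]
    rfl
  · have h1 := (HasDerivWithinAt.scomp (h := fun t => (t - D.tOA) / D.span) t
      (hZ.2.hasDerivWithinAt_x₂ (hu t ht)) (hder t) hu).const_smul r
    refine h1.congr_deriv ?_
    rw [smul_smul, smul_smul, mul_assoc, hscale, one_smul, (hm t).lam hr]
    rfl

end BoundaryData

/-! ### Trial trajectories and solutions of the boundary problem -/

theorem norm_sub_le_sub_of_deriv {W : Type*} [NormedAddCommGroup W] [NormedSpace ℝ W]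
    {φ φ' : ℝ → W} {B B' : ℝ → ℝ} (hφ : ∀ u ∈ Icc (0 : ℝ) 1, HasDerivWithinAt φ (φ' u) (Icc 0 1) u)
    (hB : ∀ u ∈ Icc (0 : ℝ) 1, HasDerivWithinAt B (B' u) (Icc 0 1) u)
    (h : ∀ u ∈ Icc (0 : ℝ) 1, ‖φ' u‖ ≤ B' u) {a b : ℝ} (ha : 0 ≤ a) (hab : a ≤ b) (hb : b ≤ 1) :
    ‖φ b - φ a‖ ≤ B b - B a := by
  have hsub : ∀ {u}, u ∈ Icc a b → u ∈ Icc (0 : ℝ) 1 := fun hu => ⟨ha.trans hu.1, hu.2.trans hb⟩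
  have hs : Icc a b ⊆ Icc (0 : ℝ) 1 := fun u hu => hsub hu
  have hI : ∀ {u}, u ∈ Ico a b → u ∈ Ico (0 : ℝ) 1 := fun hu =>
    ⟨ha.trans hu.1, hu.2.trans_le hb⟩
  have key := image_norm_le_of_norm_deriv_right_le_deriv_boundary' (f := fun u => φ u - φ a)
    (f' := φ') (B := fun u => B u - B a) (B' := B') (a := a) (b := b)
    (fun u hu => ((hφ u (hsub hu)).continuousWithinAt.mono hs).sub continuousWithinAt_const)
    (fun u hu => Setting.hasDerivWithinAt_Ici ((hφ u (hsub ⟨hu.1, hu.2.le⟩)).sub_const _) (hI hu))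
    (by simp)
    (fun u hu => ((hB u (hsub hu)).continuousWithinAt.mono hs).sub continuousWithinAt_const)
    (fun u hu => Setting.hasDerivWithinAt_Ici ((hB u (hsub ⟨hu.1, hu.2.le⟩)).sub_const _) (hI hu))
    (fun u hu => h u (hsub ⟨hu.1, hu.2.le⟩))
  exact key ⟨hab, le_rfl⟩

theorem Frame.IsGood.mono {f : Frame} {ν μ : ℝ} (h : f.IsGood ν) (hνμ : ν ≤ μ) : f.IsGood μ where
  g_nonneg := h.g_nonneg
  g_le := h.g_le.trans hνμ
  one_le_T := h.one_le_T
  T_le := h.T_le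
  hk := h.hk.mono hνμ
  d := h.d.trans hνμ
  d₂ := h.d₂.trans hνμ
  d₁ := h.d₁.trans hνμ

namespace Setting

variable {m₁ m₂ κ g₀ C μ ν ε : ℝ} {f : Frame}

theorem mono (G : Setting m₁ m₂ κ g₀ C μ ε) (hν : 0 < ν) (h : ν ≤ μ) :
    Setting m₁ m₂ κ g₀ C ν ε :=
  { G with
    μ_pos := hν
    μ_le := h.trans G.μ_le
    small := by
      have h1 := stabConst_pos G.one_le
      have h2 := G.one_le
      exact (mul_le_mul_of_nonneg_left h (by positivity)).trans G.small }

theorem regular_of_solves (G : Setting m₁ m₂ κ g₀ C μ ε) (hf : f.IsGood μ) {Z : ℝ → State}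
    {V : E × E} (hV : ‖V‖ ≤ μ) (hZ : f.Solves m₁ m₂ V Z) {u : ℝ} (hu : u ∈ Icc (0 : ℝ) 1) :
    (vars f.g f.k (Z u)).Regular m₁ m₂ :=
  G.regular _ (G.mem_tube hf (G.near_of_solves hf hV hZ u hu))

theorem abs_lam_le {q : Vars} (h₁ : ‖q.v₁‖ ≤ 1 / 2) (h₂ : ‖q.v₂‖ ≤ 1 / 2) : |q.lam| ≤ 3 := by
  have h3 := abs_lam_sub_one_le (q := q) h₂
  have h5 := abs_sub_abs_le_abs_sub q.lam 1
  rw [abs_one] at h5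
  linarith

section Solution

variable {c : ℝ} {Z : ℝ → State} {V : E × E}

/-- A solution with speeds at most `c < 1 / 2` between end points close to each other stays in the
tube. The flight takes about the time `2`; as each particle comes back to where it started, it gets
no farther than about `c` from there. Hence the two particles, which start at distance about `1`,
keep the distance `1 - 2 c`. -/
theorem mem_tube_of_speed_le (hf : f.IsGood ν) (hνg : ν ≤ g₀) (hν : 6 * ν ≤ κ) (hc₀ : 0 ≤ c)
    (hκc : 2 * κ = 1 - 2 * c) (hκ : 0 < κ)
    (hZ : f.Solves m₁ m₂ V Z)
    (hreg : ∀ u ∈ Icc (0 : ℝ) 1, (vars f.g f.k (Z u)).Regular m₁ m₂)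
    (hspeed : ∀ u ∈ Icc (0 : ℝ) 1, ‖(Z u).2.1‖ ≤ c)
    (hS : ∀ u ∈ Icc (0 : ℝ) 1, ‖(Z u).2.2 - f.S‖ ≤ 3) (hmove : ‖(Z 1).1 - f.X‖ ≤ ν)
    (hend : |‖(Z 1).1.1 - (Z 1).1.2‖ - 1| ≤ ν) (hT : |f.T - 2| ≤ 2 * ν) {u : ℝ}
    (hu : u ∈ Icc (0 : ℝ) 1) : vars f.g f.k (Z u) ∈ Vars.tube g₀ κ := by
  have hν0 : 0 ≤ ν := (abs_nonneg _).trans hf.d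
  have hT0 : 0 ≤ f.T := by linarith [hf.one_le_T]
  have hT2 := abs_le.1 hT
  have he := abs_le.1 hend
  have hd0 := abs_le.1 hf.d
  have hd20 := abs_le.1 hf.d₂
  have hd10 := abs_le.1 hf.d₁
  have hX0 : (Z 0).1 = f.X := by rw [hZ.1]; rfl
  obtain ⟨mv₁, mv₂⟩ := norm_prod_le_iff.1 hmove
  have hcν : c * ν ≤ 1 / 2 * ν := mul_le_mul_of_nonneg_right (by linarith) hν0
  -- particle 1
  have sp₁ : ∀ {a b : ℝ}, 0 ≤ a → a ≤ b → b ≤ 1 →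
      ‖(Z b).1.1 - (Z a).1.1‖ ≤ c * (b * f.T) - c * (a * f.T) := fun h1 h2 h3 =>
    norm_sub_le_sub_of_deriv (φ := fun u => (Z u).1.1) (B := fun u => c * (u * f.T))
      (B' := fun _ => c * (1 * f.T))
      (fun u hu => hZ.2.hasDerivWithinAt_x₁ hu)
      (fun u _ => ((hasDerivWithinAt_id u _).mul_const f.T).const_mul c)
      (fun u hu => by
        rw [norm_smul, Real.norm_eq_abs, abs_of_nonneg hT0, one_mul, mul_comm]
        exact mul_le_mul_of_nonneg_right ((norm_fst_le _).trans (hspeed u hu)) hT0) h1 h2 h3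
  -- particle 2, whose time is `u T + ‖x₁ - x₂‖`
  have sp₂ : ∀ {a b : ℝ}, 0 ≤ a → a ≤ b → b ≤ 1 → ‖(Z b).1.2 - (Z a).1.2‖ ≤
      c * (0 + b * f.T + ‖(Z b).1.1 - (Z b).1.2‖) -
        c * (0 + a * f.T + ‖(Z a).1.1 - (Z a).1.2‖) := fun h1 h2 h3 =>
    norm_sub_le_sub_of_deriv (φ := fun u => (Z u).1.2)
      (B := fun u => c * (0 + u * f.T + ‖(Z u).1.1 - (Z u).1.2‖))
      (fun u hu => hZ.2.hasDerivWithinAt_x₂ hu)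
      (fun u hu => (hZ.2.hasDerivWithinAt_t₂ hreg 0 hu).const_mul c)
      (fun u hu => by
        have hq := hreg u hu
        have hl := Vars.lam_pos hq.v₁ hq.v₂
        rw [norm_smul, norm_smul, Real.norm_eq_abs, Real.norm_eq_abs, abs_of_nonneg hT0,
          abs_of_pos hl, ← mul_assoc, mul_comm]
        exact mul_le_mul_of_nonneg_right ((norm_snd_le _).trans (hspeed u hu))
          (mul_nonneg hT0 hl.le)) h1 h2 h3
  have a₁ := sp₁ le_rfl hu.1 hu.2
  have b₁ := sp₁ hu.1 hu.2 le_rfl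
  have a₂ := sp₂ le_rfl hu.1 hu.2
  have b₂ := sp₂ hu.1 hu.2 le_rfl
  rw [hX0] at a₁ a₂
  have half : ∀ {x y z : E}, 2 * ‖x - y‖ ≤ ‖x - y‖ + ‖z - x‖ + ‖z - y‖ := by
    intro x y z
    have := norm_sub_le (z - y) (z - x)
    rw [sub_sub_sub_cancel_left] at this
    linarith
  have p₁ : ‖(Z u).1.1 - f.X.1‖ ≤ c + 2 * ν := by
    have h1 := half (x := (Z u).1.1) (y := f.X.1) (z := (Z 1).1.1)
    have h2 : c * f.T ≤ c * (2 + 2 * ν) := mul_le_mul_of_nonneg_left (by linarith) hc₀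
    have h3 : ‖(Z 1).1.1 - f.X.1‖ ≤ ν := mv₁
    linarith
  have p₂ : ‖(Z u).1.2 - f.X.2‖ ≤ c + 2 * ν := by
    have h1 := half (x := (Z u).1.2) (y := f.X.2) (z := (Z 1).1.2)
    have h2 : c * (f.T + ‖(Z 1).1.1 - (Z 1).1.2‖ - ‖f.X.1 - f.X.2‖) ≤ c * (2 + 4 * ν) :=
      mul_le_mul_of_nonneg_left (by linarith) hc₀
    have h3 : ‖(Z 1).1.2 - f.X.2‖ ≤ ν := mv₂
    linarith
  have hk : ‖f.k.pos (Z u).2.2 - f.k.pos f.S‖ ≤ 3 * ν :=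
    (hf.hk.norm_pos_sub hν0 _ _).trans (by
      rw [mul_comm]; exact mul_le_mul_of_nonneg_right (hS u hu) hν0)
  obtain ⟨k₁, k₂⟩ := norm_prod_le_iff.1 hk
  have hd : ∀ {a b a' b' : E} {α β : ℝ}, ‖a' - a‖ ≤ α → ‖b' - b‖ ≤ β →
      |‖a' - b'‖ - ‖a - b‖| ≤ α + β := by
    intro a b a' b' α β h1 h2
    have e : a' - b' - (a - b) = (a' - a) - (b' - b) := by abel
    refine (abs_norm_sub_norm_le _ _).trans ?_
    rw [e]
    exact (norm_sub_le _ _).trans (add_le_add h1 h2)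
  have g1 := abs_le.1 (hd p₁ p₂)
  have g2 := abs_le.1 (hd p₁ k₁)
  have g3 := abs_le.1 (hd p₂ k₂)
  have hsp := norm_prod_le_iff.1 (hspeed u hu)
  simp only [Hist.pos] at g2 g3
  refine Vars.mem_tube.2 ⟨⟨hf.g_nonneg, hf.g_le.trans hνg⟩, ⟨⟨?_, ?_⟩, ⟨?_, ?_⟩, ?_, ?_⟩, ⟨?_, ?_⟩,
    ?_, ?_⟩
  · change ‖(Z u).1.1 - (Z u).1.2‖ ≤ 4; linarith
  · change κ ≤ ‖(Z u).1.1 - (Z u).1.2‖; linarith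
  · change ‖(Z u).1.1 - f.k.k₂ (Z u).2.2.1‖ ≤ 4; linarith
  · change κ ≤ ‖(Z u).1.1 - f.k.k₂ (Z u).2.2.1‖; linarith
  · change ‖(Z u).1.2 - f.k.k₁ (Z u).2.2.2‖ ≤ 4; linarith
  · change κ ≤ ‖(Z u).1.2 - f.k.k₁ (Z u).2.2.2‖; linarith
  · exact hsp.1.trans (by linarith)
  · exact hsp.2.trans (by linarith)
  · exact (hf.hk.norm_w₂ _).trans (by linarith)
  · exact (hf.hk.norm_w₁ _).trans (by linarith)

/-- The initial velocities of such a solution are small: the velocities are almost constant, and the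
displacements are small. -/
theorem norm_velocity_le_of_mem_tube (G : Setting m₁ m₂ κ g₀ C ν ε) (hf : f.IsGood ν)
    (hZ : f.Solves m₁ m₂ V Z)
    (htube : ∀ u ∈ Icc (0 : ℝ) 1, vars f.g f.k (Z u) ∈ Vars.tube g₀ κ)
    (hmove : ‖(Z 1).1 - f.X‖ ≤ ν)
    (hend : |‖(Z 1).1.1 - (Z 1).1.2‖ - 1| ≤ ν) (hT : |f.T - 2| ≤ 2 * ν) :
    ‖V‖ ≤ 55 * C ^ 2 * ν := by
  have hν0 := G.μ_pos
  have hC := G.one_le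
  have hν1 := G.small_μ
  have hε := G.ε_le
  have hT0 : 0 ≤ f.T := by linarith [hf.one_le_T]
  have hT2 := abs_le.1 hT
  have he := abs_le.1 hend
  have hd0 := abs_le.1 hf.d
  have hX0 : (Z 0).1 = f.X := by rw [hZ.1]; rfl
  have hV0 : (Z 0).2.1 = V := by rw [hZ.1]; rfl
  obtain ⟨mv₁, mv₂⟩ := norm_prod_le_iff.1 hmove
  have hνC : ν ≤ C ^ 2 * ν := le_mul_of_one_le_left hν0.le (one_le_pow₀ hC)
  have hreg := fun u hu => G.regular _ (htube u hu)
  have h01 : (1 : ℝ) ∈ Icc (0 : ℝ) 1 := ⟨zero_le_one, le_rfl⟩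
  have h00 : (0 : ℝ) ∈ Icc (0 : ℝ) 1 := ⟨le_rfl, zero_le_one⟩
  have hvel : ∀ u ∈ Icc (0 : ℝ) 1, ‖(Z u).2.1 - V‖ ≤ 6 * (C ^ 2 * ν) := by
    intro u hu
    have h := (convex_Icc (0 : ℝ) 1).norm_image_sub_le_of_norm_hasDerivWithin_le
      (C := 3 * (f.g * (2 * C ^ 2))) (fun u hu => hZ.2.hasDerivWithinAt_V hu)
      (fun u hu => by
        rw [norm_smul, Real.norm_eq_abs, abs_of_nonneg hT0]
        exact mul_le_mul hf.T_le (norm_vfield_velocity_le G.coeffBound hf.g_nonneg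
          (G.bounded_one hf) (htube u hu)) (norm_nonneg _) (by norm_num)) h00 hu
    rw [hV0, sub_zero, Real.norm_eq_abs, abs_of_nonneg hu.1] at h
    have h2 : f.g * (2 * C ^ 2) ≤ ν * (2 * C ^ 2) := mul_le_mul_of_nonneg_right hf.g_le
      (by positivity)
    have h3 : 0 ≤ f.g * (2 * C ^ 2) := mul_nonneg hf.g_nonneg (by positivity)
    have h4 : 3 * (f.g * (2 * C ^ 2)) * u ≤ 3 * (f.g * (2 * C ^ 2)) :=
      mul_le_of_le_one_right (by positivity) hu.2
    linarith
  refine norm_prod_le_iff.2 ⟨?_, ?_⟩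
  · have h := (convex_Icc (0 : ℝ) 1).norm_image_sub_le_of_norm_hasDerivWithin_le
      (f := fun u => (Z u).1.1 - (u * f.T) • V.1)
      (f' := fun u => f.T • ((Z u).2.1.1 - V.1)) (C := 3 * (6 * (C ^ 2 * ν)))
      (fun u hu => by
        refine ((hZ.2.hasDerivWithinAt_x₁ hu).sub
          (((hasDerivWithinAt_id u _).mul_const f.T).smul_const V.1)).congr_deriv ?_
        rw [one_mul, smul_sub])
      (fun u hu => by
        rw [norm_smul, Real.norm_eq_abs, abs_of_nonneg hT0]
        exact mul_le_mul hf.T_le ((norm_fst_le ((Z u).2.1 - V)).trans (hvel u hu)) (norm_nonneg _)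
          (by norm_num)) h00 h01
    simp only [hX0, one_mul, zero_mul, zero_smul, sub_zero, norm_one, mul_one] at h
    have h2 := norm_sub_le ((Z 1).1.1 - f.X.1) ((Z 1).1.1 - f.T • V.1 - f.X.1)
    have e : (Z 1).1.1 - f.X.1 - ((Z 1).1.1 - f.T • V.1 - f.X.1) = f.T • V.1 := by abel
    rw [e, norm_smul, Real.norm_eq_abs, abs_of_nonneg hT0] at h2
    have h3 : ‖V.1‖ ≤ f.T * ‖V.1‖ := le_mul_of_one_le_left (norm_nonneg _) hf.one_le_T
    have h4 : ‖(Z 1).1.1 - f.X.1‖ ≤ ν := mv₁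
    linarith
  · have h := (convex_Icc (0 : ℝ) 1).norm_image_sub_le_of_norm_hasDerivWithin_le
      (f := fun u => (Z u).1.2 - (0 + u * f.T + ‖(Z u).1.1 - (Z u).1.2‖) • V.2)
      (f' := fun u => f.T • (vars f.g f.k (Z u)).lam • ((Z u).2.1.2 - V.2))
      (C := 3 * (3 * (6 * (C ^ 2 * ν))))
      (fun u hu => by
        refine ((hZ.2.hasDerivWithinAt_x₂ hu).sub
          ((hZ.2.hasDerivWithinAt_t₂ hreg 0 hu).smul_const V.2)).congr_deriv ?_
        rw [smul_sub, smul_sub, smul_smul f.T _ V.2])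
      (fun u hu => by
        obtain ⟨-, -, ⟨b1, b2⟩, -⟩ := Vars.mem_tube.1 (htube u hu)
        rw [norm_smul, norm_smul, Real.norm_eq_abs, Real.norm_eq_abs, abs_of_nonneg hT0]
        refine mul_le_mul hf.T_le (mul_le_mul (abs_lam_le b1 b2)
          ((norm_snd_le ((Z u).2.1 - V)).trans (hvel u hu)) (norm_nonneg _)
          (by norm_num)) (by positivity) (by norm_num)) h00 h01
    simp only [hX0, one_mul, zero_mul, zero_add, sub_zero, norm_one, mul_one] at h
    set τ := f.T + ‖(Z 1).1.1 - (Z 1).1.2‖ with hτ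
    set τ₀ := ‖f.X.1 - f.X.2‖ with hτ₀
    have h2 := norm_sub_le ((Z 1).1.2 - f.X.2) ((Z 1).1.2 - τ • V.2 - (f.X.2 - τ₀ • V.2))
    have e : (Z 1).1.2 - f.X.2 - ((Z 1).1.2 - τ • V.2 - (f.X.2 - τ₀ • V.2)) = (τ - τ₀) • V.2 := by
      rw [sub_smul]; abel
    have hττ : 1 ≤ τ - τ₀ := by linarith
    rw [e, norm_smul, Real.norm_eq_abs, abs_of_nonneg (by linarith)] at h2
    have h3 : ‖V.2‖ ≤ (τ - τ₀) * ‖V.2‖ := le_mul_of_one_le_left (norm_nonneg _) hττ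
    have h4 : ‖(Z 1).1.2 - f.X.2‖ ≤ ν := mv₂
    linarith

end Solution

end Setting

namespace BoundaryData

variable {D : BoundaryData} {r ν m₁ m₂ κ g₀ C μ ε : ℝ}

/-- Solutions of the reduced equations with the prescribed initial positions have the prescribed
initial delayed and advanced times. -/
theorem solves_state (hD : D.IsShortest) (h : D.IsTame r ν) (hν : ν ≤ 1 / 8) {y : Trajectory}
    {s σ : ℝ → ℝ} (hy : D.SolvesWith m₁ m₂ y s σ) (hpos : y.pos D.tOA = (D.xOA, D.seg₂ D.tOp)) :
    (D.frame r).Solves m₁ m₂ (y.vel D.tOA) (D.state r y s σ) := by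
  refine ⟨?_, isFlow_state hD h hν hy⟩
  obtain ⟨i2, i1, sp, -⟩ := h.bounds hν
  have hA : D.tOA ∈ D.interval := by
    have := time_mem (D := D) (by linarith [h.pos]) (left_mem_Icc.2 zero_le_one)
    rwa [time_zero] at this
  have p₁ : y.x₁ D.tOA = D.xOA := congrArg Prod.fst hpos
  have p₂ : y.x₂ D.tOA = D.seg₂ D.tOp := congrArg Prod.snd hpos
  have hs : s D.tOA = D.tOm := by
    refine lightcone_unique (sg := -1) (θ := D.tOA) (x := D.xOA) (k := D.hist₂) (ν := ν) (by simp)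
      (by linarith) (lipschitz_hist₂ hD h hν) ?_ ?_
    · rw [← p₁, ← hy.lightcone_past _ hA]; ring
    · rw [hist₂_Om i2, ← hD.lightcone_Om]; ring
  have hσ : σ D.tOA = D.tLm := by
    refine lightcone_unique (sg := 1) (θ := D.tOp) (x := D.seg₂ D.tOp) (k := D.hist₁) (ν := ν)
      (by simp) (by linarith) (lipschitz_hist₁ hD h hν) ?_ ?_
    · have := hy.lightcone_future _ hA
      rw [p₁, p₂, ← hD.lightcone_Op] at this
      rw [← this]; ring
    · rw [hist₁_Lm i1, norm_sub_rev, ← hD.shortest]; ring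
  simp only [state, time_zero, p₁, p₂, hs, hσ, Frame.start, frame]
  rfl

theorem isTrial_toTrajectory (G : Setting m₁ m₂ κ g₀ C μ ε) (hD : D.IsShortest)
    (h : D.IsTame r ν) (hν : ν ≤ 1 / 8) (hf : (D.frame r).IsGood μ) {V : E × E} (hV : ‖V‖ ≤ μ)
    {Z : ℝ → State} (hZ : (D.frame r).Solves m₁ m₂ V Z) :
    D.IsTrial m₁ m₂ V (D.toTrajectory r Z) := by
  have hr := h.pos
  refine ⟨⟨_, _, solvesWith_toTrajectory hD h hν hZ fun u hu =>
    G.regular_of_solves hf hV hZ hu⟩, ?_, ?_⟩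
  · simp only [Trajectory.pos, toTrajectory, sub_self, zero_div, hZ.1, Frame.start, frame,
      smul_inv_smul₀ hr.ne']
  · simp only [Trajectory.vel, toTrajectory, sub_self, zero_div, hZ.1, Frame.start]

theorem pos_time (hr : 0 < r) (y : Trajectory) (s σ : ℝ → ℝ) (u : ℝ) :
    y.pos (D.time u) = r • (D.state r y s σ u).1 := by
  simp only [state, Trajectory.pos, Prod.smul_mk, smul_inv_smul₀ hr.ne']

theorem pos_toTrajectory (hs : D.span ≠ 0) (Z : ℝ → State) (u : ℝ) :
    (D.toTrajectory r Z).pos (D.time u) = r • (Z u).1 := by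
  simp only [Trajectory.pos, toTrajectory, time_sub_div hs]
  rfl

theorem vel_toTrajectory (hs : D.span ≠ 0) (Z : ℝ → State) (u : ℝ) :
    (D.toTrajectory r Z).vel (D.time u) = (Z u).2.1 := by
  simp only [Trajectory.vel, toTrajectory, time_sub_div hs]

theorem agreeOn_of_time {y y' : Trajectory} (hs : 0 < D.span)
    (h : ∀ u ∈ Icc (0 : ℝ) 1, y.pos (D.time u) = y'.pos (D.time u) ∧
      y.vel (D.time u) = y'.vel (D.time u)) : y.AgreeOn y' D.interval := by
  have key : ∀ t ∈ D.interval, y.pos t = y'.pos t ∧ y.vel t = y'.vel t := by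
    intro t ht
    have hu : (t - D.tOA) / D.span ∈ Icc (0 : ℝ) 1 := by
      refine ⟨div_nonneg (by linarith [ht.1]) hs.le, ?_⟩
      rw [div_le_one hs, span]
      linarith [ht.2]
    have e : D.time ((t - D.tOA) / D.span) = t := by
      rw [time, div_mul_cancel₀ _ hs.ne']; ring
    simpa only [e] using h _ hu
  exact ⟨fun t ht => congrArg Prod.fst (key t ht).1, fun t ht => congrArg Prod.fst (key t ht).2,
    fun t ht => congrArg Prod.snd (key t ht).1, fun t ht => congrArg Prod.snd (key t ht).2⟩

/-- Trial trajectories are unique. -/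
theorem IsTrial.exists_state (hD : D.IsShortest) (h : D.IsTame r ν) (hν : ν ≤ 1 / 8) {V : E × E}
    {y : Trajectory} (hy : D.IsTrial m₁ m₂ V y) : ∃ Z, (D.frame r).Solves m₁ m₂ V Z ∧
      ∀ u, y.pos (D.time u) = r • (Z u).1 ∧ y.vel (D.time u) = (Z u).2.1 := by
  obtain ⟨⟨s, σ, hs⟩, hpos, hvel⟩ := hy
  exact ⟨D.state r y s σ, hvel ▸ solves_state hD h hν hs hpos,
    fun u => ⟨pos_time h.pos y s σ u, rfl⟩⟩

theorem IsTrial.agreeOn (G : Setting m₁ m₂ κ g₀ C μ ε) (hD : D.IsShortest) (h : D.IsTame r ν)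
    (hν : ν ≤ 1 / 8) (hf : (D.frame r).IsGood μ) {V : E × E} (hV : ‖V‖ ≤ μ) {Z : ℝ → State}
    (hZ : (D.frame r).Solves m₁ m₂ V Z) {y : Trajectory} (hy : D.IsTrial m₁ m₂ V y) :
    y.AgreeOn (D.toTrajectory r Z) D.interval := by
  have hs : 0 < D.span := by linarith [h.pos, (h.bounds hν).2.2.1]
  obtain ⟨Z', hZ', hy'⟩ := hy.exists_state hD h hν
  refine agreeOn_of_time hs fun u hu => ?_
  rw [pos_toTrajectory hs.ne', vel_toTrajectory hs.ne', (hy' u).1, (hy' u).2,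
    G.solves_unique hf hV hZ hZ' hu]
  exact ⟨rfl, rfl⟩

theorem IsSolution.isTrial {y : Trajectory} (hy : D.IsSolution m₁ m₂ y) :
    D.IsTrial m₁ m₂ (y.vel D.tOA) y := by
  obtain ⟨⟨s, σ, hs, -⟩, hpos, -⟩ := hy
  exact ⟨⟨s, σ, hs⟩, hpos, rfl⟩

theorem IsTame.abs_T_sub_two_le (h : D.IsTame r ν) : |(D.frame r).T - 2| ≤ 2 * ν := by
  have hr := h.pos
  have h1 := abs_le.1 (abs_inv_mul_sub_one_le hr h.Op)
  have h2 := abs_le.1 (abs_inv_mul_sub_one_le hr h.Lm)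
  have e : (D.frame r).T = r⁻¹ * (D.tOp - D.tOA) + r⁻¹ * (D.tLm - D.tOp) := by
    change r⁻¹ * (D.tLm - D.tOA) = _
    ring
  rw [e, abs_le]
  constructor <;> linarith

/-- The prescribed final positions, in units of `r`, are close to the initial ones. -/
theorem IsTame.norm_target_sub_le (h : D.IsTame r ν) : ‖r⁻¹ • D.target - (D.frame r).X‖ ≤ ν := by
  have hr := h.pos
  refine norm_prod_le_iff.2 ⟨?_, ?_⟩
  · change ‖r⁻¹ • D.seg₁ D.tLm - r⁻¹ • D.xOA‖ ≤ ν
    rw [norm_inv_smul_sub hr, inv_mul_le_iff₀ hr, mul_comm]; exact h.move₁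
  · change ‖r⁻¹ • D.xLB - r⁻¹ • D.seg₂ D.tOp‖ ≤ ν
    rw [norm_inv_smul_sub hr, inv_mul_le_iff₀ hr, mul_comm]; exact h.move₂

/-- Solutions with speeds at most `c < 1 / 2` have in fact small initial velocities. -/
theorem IsSolution.norm_vel_le (G : Setting m₁ m₂ κ g₀ C ν ε) (hD : D.IsShortest)
    (h : D.IsTame r ν) (hg : r⁻¹ ≤ ν) (hνκ : 6 * ν ≤ κ) {c : ℝ} (hc₀ : 0 ≤ c)
    (hκc : 2 * κ = 1 - 2 * c) {y : Trajectory} (hy : D.IsSolution m₁ m₂ y)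
    (hyc : y.SpeedLE c D.interval) : ‖y.vel D.tOA‖ ≤ 55 * C ^ 2 * ν := by
  have hr := h.pos
  have hν : ν ≤ 1 / 8 := by linarith [G.small_μ, G.ε_le, G.μ_pos]
  have hf := isGood_frame hD h hν hg
  obtain ⟨i2, i1, sp, -⟩ := h.bounds hν
  have hs0 : 0 ≤ D.span := by linarith
  obtain ⟨⟨s, σ, hs, hsI, hσI⟩, hpos, hfin⟩ := hy
  have hZ := solves_state hD h hν hs hpos
  set Z := D.state r y s σ with hZdef
  have hreg : ∀ u ∈ Icc (0 : ℝ) 1,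
      (vars (D.frame r).g (D.frame r).k (Z u)).Regular m₁ m₂ := by
    intro u hu
    have hm := matches_state (D := D) hr y s σ u
    have hc := hs.regular _ (time_mem hs0 hu)
    have ne : ∀ {d a b : E}, r • d = a - b → a ≠ b → d ≠ 0 := by
      rintro d a b h1 h2 rfl
      rw [smul_zero] at h1
      exact h2 (sub_eq_zero.1 h1.symm)
    exact ⟨ne hm.d hc.noncollision, ne hm.d₂ hc.noncollision_past, ne hm.d₁ hc.noncollision_future,
      hc.subluminal₁, hc.subluminal₂, (hf.hk.norm_w₂ _).trans_lt (by linarith),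
      (hf.hk.norm_w₁ _).trans_lt (by linarith), hm.G₁₂ hr ▸ hc.invertible₁₂,
      hm.G₂₁ hr ▸ hc.invertible₂₁⟩
  have hZ1 : (Z 1).1 = r⁻¹ • D.target := by
    have := pos_time (D := D) hr y s σ 1
    rw [time_one, hfin] at this
    rw [this, inv_smul_smul₀ hr.ne']
  have hmove : ‖(Z 1).1 - (D.frame r).X‖ ≤ ν := by rw [hZ1]; exact h.norm_target_sub_le
  have hend : |‖(Z 1).1.1 - (Z 1).1.2‖ - 1| ≤ ν := by
    rw [hZ1]
    change |‖r⁻¹ • D.seg₁ D.tLm - r⁻¹ • D.xLB‖ - 1| ≤ ν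
    rw [norm_inv_smul_sub hr, norm_sub_rev, ← hD.lightcone_Lm]
    exact abs_inv_mul_sub_one_le hr h.LB
  have hspeed : ∀ u ∈ Icc (0 : ℝ) 1, ‖(Z u).2.1‖ ≤ c := fun u hu =>
    norm_prod_le_iff.2 (hyc _ (time_mem hs0 hu))
  have hS : ∀ u ∈ Icc (0 : ℝ) 1, ‖(Z u).2.2 - (D.frame r).S‖ ≤ 3 := by
    intro u hu
    have a1 := hsI _ (time_mem hs0 hu)
    have a2 := hσI _ (time_mem hs0 hu)
    have o1 := abs_le.1 h.Om
    have o2 := abs_le.1 h.Op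
    have o3 := abs_le.1 h.LB
    have o4 := abs_le.1 h.Lp
    have hνr : ν * r ≤ 1 / 8 * r := mul_le_mul_of_nonneg_right hν hr.le
    refine norm_prod_le_iff.2 ⟨?_, ?_⟩
    · change |r⁻¹ * s (D.time u) - r⁻¹ * D.tOm| ≤ 3
      rw [← mul_sub, abs_mul, abs_inv, abs_of_pos hr, inv_mul_le_iff₀ hr,
        abs_of_nonneg (by linarith [a1.1])]
      linarith [a1.2]
    · change |r⁻¹ * σ (D.time u) - r⁻¹ * D.tLm| ≤ 3
      rw [← mul_sub, abs_mul, abs_inv, abs_of_pos hr, inv_mul_le_iff₀ hr,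
        abs_of_nonneg (by linarith [a2.1])]
      linarith [a2.2]
  exact G.norm_velocity_le_of_mem_tube hf hZ
    (fun u hu => Setting.mem_tube_of_speed_le hf G.μ_le hνκ hc₀ hκc G.κ_pos hZ hreg hspeed hS hmove
      hend h.abs_T_sub_two_le hu) hmove hend h.abs_T_sub_two_le

/-- A trial trajectory that hits the target solves the boundary problem. -/
theorem isSolution_of_target (G : Setting m₁ m₂ κ g₀ C μ ε) (hD : D.IsShortest)
    (h : D.IsTame r ν) (hν : ν ≤ 1 / 8) (hf : (D.frame r).IsGood μ) {V : E × E} (hV : ‖V‖ ≤ μ)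
    {Z : ℝ → State} (hZ : (D.frame r).Solves m₁ m₂ V Z) (hZ1 : r • (Z 1).1 = D.target) :
    D.IsSolution m₁ m₂ (D.toTrajectory r Z) := by
  have hr := h.pos
  obtain ⟨i2, i1, sp, -⟩ := h.bounds hν
  have hs : 0 < D.span := by linarith
  have hreg := fun u hu => G.regular_of_solves hf hV hZ (u := u) hu
  have hsol := solvesWith_toTrajectory hD h hν hZ hreg
  have htrial := isTrial_toTrajectory G hD h hν hf hV hZ
  set y := D.toTrajectory r Z with hy
  have hend : y.pos D.tLm = D.target := by
    rw [← time_one (D := D), pos_toTrajectory hs.ne', hZ1]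
  have p₁ : y.x₁ D.tLm = D.seg₁ D.tLm := congrArg Prod.fst hend
  have p₂ : y.x₂ D.tLm = D.xLB := congrArg Prod.snd hend
  have hL : D.tLm ∈ D.interval := by
    have := time_mem (D := D) hs.le (right_mem_Icc.2 zero_le_one)
    rwa [time_one] at this
  have hu1 : (D.tLm - D.tOA) / D.span = 1 := div_self hs.ne'
  have hu : ∀ t ∈ D.interval, (t - D.tOA) / D.span ∈ Icc (0 : ℝ) 1 := fun t ht => by
    refine ⟨div_nonneg (by linarith [ht.1]) hs.le, ?_⟩
    rw [div_le_one hs, span]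
    linarith [ht.2]
  have hT0 : 0 ≤ (D.frame r).T := by linarith [hf.one_le_T]
  have e : ∀ x : ℝ, r * (r⁻¹ * x) = x := fun x => mul_inv_cancel_left₀ hr.ne' x
  -- at the end the delayed and the advanced time reach the ends of the segments
  have es : r * (Z 1).2.2.1 = D.tOp := by
    refine lightcone_unique (sg := -1) (θ := D.tLm) (x := D.seg₁ D.tLm) (k := D.hist₂) (ν := ν)
      (by simp) (by linarith) (lipschitz_hist₂ hD h hν) ?_ ?_
    · have := hsol.lightcone_past _ hL
      simp only [hu1, p₁] at this
      rw [← this]; ring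
    · rw [hist₂_Op i2, ← hD.shortest]; ring
  have eσ : r * (Z 1).2.2.2 = D.tLp := by
    refine lightcone_unique (sg := 1) (θ := D.tLB) (x := D.xLB) (k := D.hist₁) (ν := ν)
      (by simp) (by linarith) (lipschitz_hist₁ hD h hν) ?_ ?_
    · have := hsol.lightcone_future _ hL
      simp only [hu1, p₁, p₂] at this
      rw [norm_sub_rev (D.seg₁ D.tLm), ← hD.lightcone_Lm] at this
      rw [← this]; ring
    · rw [hist₁_Lp i1, ← hD.lightcone_Lp]; ring
  have e0s : r * (Z 0).2.2.1 = D.tOm := by rw [hZ.1]; exact e _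
  have e0σ : r * (Z 0).2.2.2 = D.tLm := by rw [hZ.1]; exact e _
  have hψ := fun u hu => Vars.psi_pos (hreg u hu).v₁ (hreg u hu).v₂ (hreg u hu).w₂ (hreg u hu).w₁
  have mono : ∀ {φ φ' : ℝ → ℝ}, (∀ u ∈ Icc (0 : ℝ) 1, HasDerivWithinAt φ (φ' u) (Icc 0 1) u) →
      (∀ u ∈ Icc (0 : ℝ) 1, 0 ≤ φ' u) → ∀ u ∈ Icc (0 : ℝ) 1, r * φ u ∈ Icc (r * φ 0) (r * φ 1) := by
    intro φ φ' h1 h2 u hu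
    have hm := monotoneOn_of_hasDerivWithinAt_nonneg (f' := φ') (convex_Icc (0 : ℝ) 1)
      (fun u hu => (h1 u hu).continuousWithinAt)
      (fun u hu => (h1 u (interior_subset hu)).mono interior_subset)
      (fun u hu => h2 u (interior_subset hu))
    exact ⟨mul_le_mul_of_nonneg_left (hm (left_mem_Icc.2 zero_le_one) hu hu.1) hr.le,
      mul_le_mul_of_nonneg_left (hm hu (right_mem_Icc.2 zero_le_one) hu.2) hr.le⟩
  refine ⟨⟨_, _, hsol, fun t ht => ?_, fun t ht => ?_⟩, htrial.2.1, hend⟩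
  · have := mono (fun u hu => hZ.2.hasDerivWithinAt_s hu)
      (fun u hu => mul_nonneg hT0 (hψ u hu).1.le) _ (hu t ht)
    rwa [e0s, es] at this
  · have := mono (fun u hu => hZ.2.hasDerivWithinAt_σ hu)
      (fun u hu => mul_nonneg hT0 (hψ u hu).2.le) _ (hu t ht)
    rwa [e0σ, eσ] at this

theorem speedLE_toTrajectory (G : Setting m₁ m₂ κ g₀ C μ ε) (h : D.IsTame r ν) (hν : ν ≤ 1 / 8)
    (hf : (D.frame r).IsGood μ) {V : E × E} (hV : ‖V‖ ≤ μ) {Z : ℝ → State}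
    (hZ : (D.frame r).Solves m₁ m₂ V Z) {c : ℝ} (hc : 8 * C ^ 2 * μ ≤ c) :
    (D.toTrajectory r Z).SpeedLE c D.interval := by
  have hs : 0 < D.span := by linarith [h.pos, (h.bounds hν).2.2.1]
  intro t ht
  have hu : (t - D.tOA) / D.span ∈ Icc (0 : ℝ) 1 := by
    refine ⟨div_nonneg (by linarith [ht.1]) hs.le, ?_⟩
    rw [div_le_one hs, span]
    linarith [ht.2]
  exact norm_prod_le_iff.1 (((G.near_of_solves hf hV hZ _ hu).V).trans hc)

end BoundaryData

/-! ### The shooting method -/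

section Shooting

variable {F : Type*} [NormedAddCommGroup F] [NormedSpace ℝ F]

/-- The derivative of a map that is close to `Δ` times the identity is so, too. -/
theorem norm_sub_smul_id_le_of_approx {X : F → F} {A : F →L[ℝ] F} {V₀ V : F} {ρ Δ ε : ℝ}
    (hΔ : 0 ≤ Δ) (hε₀ : 0 ≤ ε)
    (hX : ∀ V ∈ ball V₀ ρ, ∀ V' ∈ ball V₀ ρ, ‖X V' - X V - Δ • (V' - V)‖ ≤ ε * Δ * ‖V' - V‖)
    (hV : V ∈ ball V₀ ρ) (hA : HasFDerivAt X A V) :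
    ‖A - Δ • ContinuousLinearMap.id ℝ F‖ ≤ ε * Δ := by
  have h : HasFDerivAt (fun W => X W - Δ • W) (A - Δ • ContinuousLinearMap.id ℝ F) V :=
    hA.sub ((hasFDerivAt_id V).const_smul Δ)
  refine h.le_of_lip' (by positivity) ?_
  filter_upwards [isOpen_ball.mem_nhds hV] with W hW
  have e : X W - Δ • W - (X V - Δ • V) = X W - X V - Δ • (W - V) := by rw [smul_sub]; abel
  rw [e]
  exact hX V hV W hW

/-- Shooting with a map that is differentiable and close to a multiple of the identity: there is a
zero near the starting point, the Jacobian is well conditioned, and Newton's iteration converges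
to the zero. -/
theorem exists_shooting [CompleteSpace F] {X : F → F} {V₀ Y : F} {ρ Δ ε : ℝ} (hρ : 0 < ρ)
    (hΔ : 0 < Δ) (hε₀ : 0 ≤ ε) (hε : ε ≤ 1 / 8)
    (hX : ∀ V ∈ ball V₀ ρ, ∀ V' ∈ ball V₀ ρ, ‖X V' - X V - Δ • (V' - V)‖ ≤ ε * Δ * ‖V' - V‖)
    (hd : ∀ V ∈ ball V₀ ρ, ∃ A : F →L[ℝ] F, HasFDerivAt X A V)
    (hY : ‖Y - X V₀‖ ≤ ρ / 8 * Δ) :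
    ∃ Vs ∈ ball V₀ ρ, X Vs = Y ∧ ∃ J : F → F ≃L[ℝ] F,
      (∀ V ∈ ball V₀ ρ, HasFDerivAt X (J V : F →L[ℝ] F) V ∧
        ‖(J V : F →L[ℝ] F) - Δ • ContinuousLinearMap.id ℝ F‖ ≤ ε * Δ ∧
        ‖(J V : F →L[ℝ] F)‖ * ‖((J V).symm : F →L[ℝ] F)‖ ≤ (1 + ε) / (1 - ε)) ∧
      ∀ V : ℕ → F, V 0 = V₀ → (∀ k, V (k + 1) = V k + (J (V k)).symm (Y - X (V k))) →
        (∀ k, V k ∈ ball V₀ ρ) ∧ Tendsto V atTop (𝓝 Vs) := by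
  obtain ⟨Vs, hVs, rfl⟩ := exists_zero_of_approx hρ hΔ hε₀ hε hX hY
  have hJ : ∀ V, ∃ J : F ≃L[ℝ] F, V ∈ ball V₀ ρ → HasFDerivAt X (J : F →L[ℝ] F) V ∧
      ‖(J.symm : F →L[ℝ] F)‖ ≤ 1 / ((1 - ε) * Δ) := by
    intro V
    by_cases hV : V ∈ ball V₀ ρ
    · obtain ⟨A, hA⟩ := hd V hV
      obtain ⟨J, rfl, hJ⟩ := exists_equiv_of_close hΔ (by linarith)
        (norm_sub_smul_id_le_of_approx hΔ.le hε₀ hX hV hA)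
      exact ⟨J, fun _ => ⟨hA, hJ⟩⟩
    -- outside the ball the value of `J` does not matter
    · exact ⟨ContinuousLinearEquiv.refl ℝ F, fun h => absurd h hV⟩
  choose J hJ using hJ
  have hclose := fun V hV => norm_sub_smul_id_le_of_approx hΔ.le hε₀ hX hV (hJ V hV).1
  refine ⟨Vs, closedBall_subset_ball (by linarith) hVs, rfl, J, fun V hV =>
    ⟨(hJ V hV).1, hclose V hV, ?_⟩, fun V h0 hV =>
      newton_iteration hρ hΔ hε hX hclose (fun V hV => (hJ V hV).2) hVs h0 hV⟩
  have h1 : ‖(J V : F →L[ℝ] F)‖ ≤ (1 + ε) * Δ := by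
    have h2 := norm_add_le ((J V : F →L[ℝ] F) - Δ • ContinuousLinearMap.id ℝ F)
      (Δ • ContinuousLinearMap.id ℝ F)
    rw [sub_add_cancel, norm_smul, Real.norm_eq_abs, abs_of_pos hΔ] at h2
    have h3 : Δ * ‖ContinuousLinearMap.id ℝ F‖ ≤ Δ * 1 :=
      mul_le_mul_of_nonneg_left ContinuousLinearMap.norm_id_le hΔ.le
    linarith [hclose V hV]
  have h4 : 0 < 1 - ε := by linarith
  calc _ ≤ (1 + ε) * Δ * (1 / ((1 - ε) * Δ)) :=
        mul_le_mul h1 (hJ V hV).2 (norm_nonneg _) (by positivity)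
    _ = (1 + ε) / (1 - ε) := by field_simp

end Shooting

variable {m₁ m₂ κ g₀ C μ ν ε r : ℝ}

/-- For any accuracy `ε` there are suitable constants. -/
theorem Setting.exists (hm₁ : 0 < m₁) (hm₂ : 0 < m₂) (hκ : 0 < κ) (hκ' : κ ≤ 1 / 2) (hε : 0 < ε)
    (hε' : ε ≤ 1 / 8) : ∃ g₀ C μ, Setting m₁ m₂ κ g₀ C μ ε := by
  obtain ⟨g₀, hg₀, hg₁, hreg⟩ := Vars.exists_regular_tube hm₁ hm₂ hκ
  obtain ⟨C₁, h₁, hC₁⟩ := exists_bound_of_contDiffAt (Vars.isCompact_tube g₀ κ)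
    fun q hq => Vars.contDiffAt_coeff (hreg q hq)
  obtain ⟨C₂, h₂, hC₂⟩ := exists_bound_of_contDiffAt (Vars.isCompact_tube g₀ κ)
    fun q hq => Vars.contDiffAt_lam (hreg q hq).d (hreg q hq).v₂
  set C := max C₁ C₂ with hC
  have l₁ : C₁ ≤ C := le_max_left _ _
  have l₂ : C₂ ≤ C := le_max_right _ _
  have hC1 : 1 ≤ C := h₁.trans l₁
  have hs := stabConst_pos hC1
  have hA : 0 < 1000 * (C ^ 3 * stabConst C) := by positivity
  refine ⟨g₀, C, min g₀ (ε / (1000 * (C ^ 3 * stabConst C))), ⟨hC1,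
    fun q hq => Vars.contDiffAt_coeff (hreg q hq), fun q hq => (hC₁ q hq).1.trans l₁,
    fun q hq => (hC₁ q hq).2.1.trans l₁, fun q hq q' hq' => ((hC₁ q hq).2.2 q' hq').trans
      (mul_le_mul_of_nonneg_right l₁ (norm_nonneg _))⟩, hreg,
    fun q hq q' hq' => ((hC₂ q hq).2.2 q' hq').trans
      (mul_le_mul_of_nonneg_right l₂ (norm_nonneg _)), hκ, hκ', hg₁, by positivity,
    min_le_left _ _, hε', ?_⟩
  calc _ ≤ 1000 * (C ^ 3 * stabConst C) * (ε / (1000 * (C ^ 3 * stabConst C))) :=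
        mul_le_mul_of_nonneg_left (min_le_right _ _) hA.le
    _ = ε := by field_simp

open Classical in
/-- The solution of the rescaled initial value problem with initial velocities `V`; it is `0` if
there is none. -/
def Frame.flow (m₁ m₂ : ℝ) (f : Frame) (V : E × E) : ℝ → State :=
  if h : ∃ Z, f.Solves m₁ m₂ V Z then h.choose else 0

namespace Setting

variable {f : Frame}

theorem solves_flow (G : Setting m₁ m₂ κ g₀ C μ ε) (hf : f.IsGood μ) {V : E × E}
    (hV : ‖V‖ ≤ μ) : f.Solves m₁ m₂ V (f.flow m₁ m₂ V) := by
  have h := G.exists_solves hf hV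
  rw [Frame.flow, dif_pos h]
  exact h.choose_spec

/-- The final positions are differentiable in the initial velocities. -/
theorem exists_hasFDerivAt_flow (G : Setting m₁ m₂ κ g₀ C μ ε) (hf : f.IsGood μ) {V : E × E}
    (hV : ‖V‖ < μ) :
    ∃ A : E × E →L[ℝ] E × E, HasFDerivAt (fun W => (f.flow m₁ m₂ W 1).1) A V := by
  have hV' : ∀ h : E × E, ‖h‖ < μ - ‖V‖ → ‖V + h‖ ≤ μ := fun h hh =>
    (norm_add_le _ _).trans (by linarith)
  have s := G.solves_flow hf hV.le
  obtain ⟨A, hA⟩ := flow_differentiable (Zh := fun h => f.flow m₁ m₂ (V + h)) G.coeffBound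
    (Vars.isCompact_tube g₀ κ) hf.g_nonneg (G.g_le_one hf) (by linarith [hf.one_le_T]) hf.T_le
    (G.bounded_one hf) s.2 (fun u hu => G.mem_tube hf (G.near_of_solves hf hV.le s u hu))
    (sub_pos.2 hV) (fun h hh => (G.solves_flow hf (hV' h hh)).2)
    (fun h hh u hu => G.mem_tube hf
      (G.near_of_solves hf (hV' h hh) (G.solves_flow hf (hV' h hh)) u hu))
    (fun h hh => by
      rw [(G.solves_flow hf (hV' h hh)).1, s.1]
      simp [Frame.start])
  refine ⟨A, ?_⟩
  have := (hasFDerivAt_comp_add_left (f := fun W => (f.flow m₁ m₂ W 1).1) (f' := A) (x := 0) V).1 hA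
  rwa [add_zero] at this

end Setting

namespace BoundaryData

variable {D : BoundaryData}

/-- The trial trajectories with initial velocities `V`. -/
def trial (m₁ m₂ : ℝ) (D : BoundaryData) (r : ℝ) (V : E × E) : Trajectory :=
  D.toTrajectory r ((D.frame r).flow m₁ m₂ V)

theorem span_eq (hr : 0 < r) : D.span = r * (D.frame r).T :=
  (mul_inv_cancel_left₀ hr.ne' D.span).symm

theorem pos_trial (hs : D.span ≠ 0) (V : E × E) :
    (D.trial m₁ m₂ r V).pos D.tLm = r • ((D.frame r).flow m₁ m₂ V 1).1 := by
  rw [← time_one (D := D), trial, pos_toTrajectory hs]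

theorem vel_trial (G : Setting m₁ m₂ κ g₀ C μ ε) (hs : D.span ≠ 0) (hf : (D.frame r).IsGood μ)
    {V : E × E} (hV : ‖V‖ ≤ μ) : (D.trial m₁ m₂ r V).vel D.tOA = V := by
  rw [← time_zero (D := D), trial, vel_toTrajectory hs, (G.solves_flow hf hV).1]
  rfl

theorem approx_trial (G : Setting m₁ m₂ κ g₀ C μ ε) (hr : 0 < r) (hf : (D.frame r).IsGood μ)
    {V V' : E × E} (hV : ‖V‖ ≤ μ) (hV' : ‖V'‖ ≤ μ) :
    ‖(D.trial m₁ m₂ r V').pos D.tLm - (D.trial m₁ m₂ r V).pos D.tLm - D.span • (V' - V)‖ ≤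
      ε * D.span * ‖V' - V‖ := by
  have hs : D.span ≠ 0 := by
    rw [span_eq hr]
    exact (mul_pos hr (by linarith [hf.one_le_T])).ne'
  have h := G.approx hf hV hV' (G.solves_flow hf hV) (G.solves_flow hf hV')
  rw [pos_trial hs, pos_trial hs, span_eq hr, mul_smul, ← smul_sub, ← smul_sub, norm_smul,
    Real.norm_eq_abs, abs_of_pos hr]
  exact (mul_le_mul_of_nonneg_left h hr.le).trans (le_of_eq (by ring))

/-- Existence, uniqueness and shooting for tame boundary data, with initial velocities near a small
`V₀`. -/
theorem IsTame.wellPosed {ρ c : ℝ} (G : Setting m₁ m₂ κ g₀ C (2 * ρ) ε) (hD : D.IsShortest)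
    (h : D.IsTame r ν) (hν₀ : 0 < ν) (hg : r⁻¹ ≤ ν) (hε₀ : 0 < ε) (hνρ : 600 * (C ^ 2 * ν) ≤ ρ)
    (hνκ : 6 * ν ≤ κ) (hc₀ : 0 ≤ c) (hκc : 2 * κ = 1 - 2 * c) (hεc : ε ≤ c) {V₀ : E × E}
    (hV₀ : ‖V₀‖ ≤ ν) :
    ∃ y : Trajectory, (D.IsSolution m₁ m₂ y ∧ y.SpeedLE c D.interval ∧
        ∀ y' : Trajectory, D.IsSolution m₁ m₂ y' → y'.SpeedLE c D.interval →
          y'.AgreeOn y D.interval) ∧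
      y.vel D.tOA ∈ ball V₀ ρ ∧
      ∃ (Φ : E × E → Trajectory) (J : E × E → ((E × E) ≃L[ℝ] (E × E))),
        (∀ V ∈ ball V₀ ρ, D.IsTrial m₁ m₂ V (Φ V) ∧
          (∀ y' : Trajectory, D.IsTrial m₁ m₂ V y' → y'.AgreeOn (Φ V) D.interval) ∧
          HasFDerivAt (fun U => (Φ U).pos D.tLm) (J V : (E × E) →L[ℝ] (E × E)) V ∧
          ‖(J V : (E × E) →L[ℝ] (E × E)) - D.span • ContinuousLinearMap.id ℝ (E × E)‖ ≤
            ε * D.span ∧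
          ‖(J V : (E × E) →L[ℝ] (E × E))‖ * ‖((J V).symm : (E × E) →L[ℝ] (E × E))‖ ≤
            (1 + ε) / (1 - ε)) ∧
        ∀ V : ℕ → E × E, V 0 = V₀ →
          (∀ k, V (k + 1) = V k + (J (V k)).symm (D.target - (Φ (V k)).pos D.tLm)) →
          (∀ k, V k ∈ ball V₀ ρ) ∧ Tendsto V atTop (𝓝 (y.vel D.tOA)) := by
  have hr := h.pos
  have hC := G.one_le
  have hCν : ν ≤ C ^ 2 * ν := le_mul_of_one_le_left hν₀.le (one_le_pow₀ hC)
  have hρ : 0 < ρ := by linarith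
  have hν8 : ν ≤ 1 / 8 := by linarith [G.small_μ, G.ε_le]
  have hf := isGood_frame hD h hν8 hg
  have hf' := hf.mono (show ν ≤ 2 * ρ by linarith)
  have G' := G.mono hν₀ (show ν ≤ 2 * ρ by linarith)
  have hs : 0 < D.span := by linarith [(h.bounds hν8).2.2.1]
  have hb : ∀ {V}, V ∈ ball V₀ ρ → ‖V‖ < 2 * ρ := by
    intro V hV
    rw [mem_ball, dist_eq_norm] at hV
    have := norm_add_le (V - V₀) V₀
    rw [sub_add_cancel] at this
    linarith
  have hX : ∀ V ∈ ball V₀ ρ, ∀ V' ∈ ball V₀ ρ,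
      ‖(D.trial m₁ m₂ r V').pos D.tLm - (D.trial m₁ m₂ r V).pos D.tLm - D.span • (V' - V)‖ ≤
        ε * D.span * ‖V' - V‖ := fun V hV V' hV' => approx_trial G hr hf' (hb hV).le (hb hV').le
  have hd : ∀ V ∈ ball V₀ ρ, ∃ A : E × E →L[ℝ] E × E,
      HasFDerivAt (fun U => (D.trial m₁ m₂ r U).pos D.tLm) A V := by
    intro V hV
    obtain ⟨A, hA⟩ := G.exists_hasFDerivAt_flow hf' (hb hV)
    refine ⟨r • A, ?_⟩
    simp only [pos_trial hs.ne']
    exact hA.const_smul r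
  have hY : ‖D.target - (D.trial m₁ m₂ r V₀).pos D.tLm‖ ≤ ρ / 8 * D.span := by
    have h1 := G'.displacement_le hf hV₀ (G.solves_flow hf' (hb (mem_ball_self hρ)).le)
    have h2 := h.norm_target_sub_le
    have h3 := norm_sub_le (r⁻¹ • D.target - (D.frame r).X)
      (((D.frame r).flow m₁ m₂ V₀ 1).1 - (D.frame r).X)
    rw [sub_sub_sub_cancel_right] at h3
    have e : D.target - (D.trial m₁ m₂ r V₀).pos D.tLm =
        r • (r⁻¹ • D.target - ((D.frame r).flow m₁ m₂ V₀ 1).1) := by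
      rw [pos_trial hs.ne', smul_sub, smul_inv_smul₀ hr.ne']
    have h4 : ‖r⁻¹ • D.target - ((D.frame r).flow m₁ m₂ V₀ 1).1‖ ≤ ρ / 8 := by linarith
    rw [e, norm_smul, Real.norm_eq_abs, abs_of_pos hr, mul_comm]
    exact mul_le_mul h4 (h.bounds hν8).2.2.1 hr.le (by positivity)
  obtain ⟨Vs, hVs, hhit, J, hJ, hN⟩ := exists_shooting hρ hs hε₀.le G.ε_le hX hd hY
  have hvel := vel_trial G hs.ne' hf' (hb hVs).le
  refine ⟨D.trial m₁ m₂ r Vs, ⟨?_, ?_, ?_⟩, hvel.symm ▸ hVs, D.trial m₁ m₂ r, J, ?_, ?_⟩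
  · refine isSolution_of_target G hD h hν8 hf' (hb hVs).le (G.solves_flow hf' (hb hVs).le) ?_
    rw [← pos_trial hs.ne', hhit]
  · exact speedLE_toTrajectory G h hν8 hf' (hb hVs).le (G.solves_flow hf' (hb hVs).le)
      (by linarith [G.small_sq])
  -- any solution with speeds at most `c` is a trial trajectory in the domain of injectivity
  · intro y' hy' hc'
    have hsmall := hy'.norm_vel_le G' hD h hg hνκ hc₀ hκc hc'
    have hV' : y'.vel D.tOA ∈ ball V₀ ρ := by
      rw [mem_ball, dist_eq_norm]
      exact (norm_sub_le _ _).trans_lt (by linarith)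
    have hagree := hy'.isTrial.agreeOn G hD h hν8 hf' (hb hV').le
      (G.solves_flow hf' (hb hV').le)
    have hL : D.tLm ∈ D.interval := right_mem_Icc.2 (by rw [span] at hs; linarith)
    have hend : (D.trial m₁ m₂ r (y'.vel D.tOA)).pos D.tLm = D.target := by
      rw [← hy'.2.2]
      exact Prod.ext (hagree.1 hL).symm (hagree.2.2.1 hL).symm
    have hinj := injOn_of_approx hs hX hVs hV'
    rw [hend, hhit, sub_self, norm_zero] at hinj
    have h0 : ‖y'.vel D.tOA - Vs‖ ≤ 0 := by
      by_contra! hlt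
      have : 0 < (1 - ε) * D.span := mul_pos (by linarith [G.ε_le]) hs
      linarith [mul_pos this hlt]
    rw [sub_eq_zero.1 (norm_le_zero_iff.1 h0)] at hagree
    exact hagree
  · exact fun V hV => ⟨isTrial_toTrajectory G hD h hν8 hf' (hb hV).le
      (G.solves_flow hf' (hb hV).le), fun y' hy' => hy'.agreeOn G hD h hν8 hf' (hb hV).le
      (G.solves_flow hf' (hb hV).le), hJ V hV⟩
  · rw [hvel]
    exact hN

end BoundaryData

/-! ### Continuous dependence on the boundary data -/

namespace BoundaryData

variable {D D' : BoundaryData} {m₁ m₂ κ g₀ C μ ν ε r η : ℝ}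

theorem IsClose.mono {η' : ℝ} (h : D.IsClose D' η) (hη : η ≤ η') : D.IsClose D' η' where
  tOA := h.tOA.trans_le hη
  tOm := h.tOm.trans_le hη
  tOp := h.tOp.trans_le hη
  tLm := h.tLm.trans_le hη
  tLp := h.tLp.trans_le hη
  tLB := h.tLB.trans_le hη
  xOA := h.xOA.trans_le hη
  xLB := h.xLB.trans_le hη
  seg₂ := fun n hn t ht => (h.seg₂ n hn t ht).trans_le hη
  seg₁ := fun n hn t ht => (h.seg₁ n hn t ht).trans_le hη

theorem IsClose.norm_seg₂_sub_le (hc : D.IsClose D' η) (hD : D.IsShortest) (h : D.IsTame r ν)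
    (h' : D'.IsTame r ν) (hν : ν ≤ 1 / 8) : ‖D'.seg₂ D'.tOp - D.seg₂ D.tOp‖ ≤ 2 * η := by
  have h1 := (c2Close_apply hc.seg₂ (right_mem_Icc.2 (h'.bounds hν).1.le)).1
  have h2 := lipschitz_hist₂ hD h hν D'.tOp D.tOp
  rw [hist₂_Op (h.bounds hν).1] at h2
  have h3 := norm_add_le (D'.seg₂ D'.tOp - D.hist₂ D'.tOp) (D.hist₂ D'.tOp - D.seg₂ D.tOp)
  rw [sub_add_sub_cancel] at h3
  have h4 : ν * |D'.tOp - D.tOp| ≤ 1 * |D'.tOp - D.tOp| :=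
    mul_le_mul_of_nonneg_right (by linarith) (abs_nonneg _)
  linarith [hc.tOp]

theorem IsClose.norm_seg₁_sub_le (hc : D.IsClose D' η) (hD : D.IsShortest) (h : D.IsTame r ν)
    (h' : D'.IsTame r ν) (hν : ν ≤ 1 / 8) : ‖D'.seg₁ D'.tLm - D.seg₁ D.tLm‖ ≤ 2 * η := by
  have h1 := (c2Close_apply hc.seg₁ (left_mem_Icc.2 (h'.bounds hν).2.1.le)).1
  have h2 := lipschitz_hist₁ hD h hν D'.tLm D.tLm
  rw [hist₁_Lm (h.bounds hν).2.1] at h2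
  have h3 := norm_add_le (D'.seg₁ D'.tLm - D.hist₁ D'.tLm) (D.hist₁ D'.tLm - D.seg₁ D.tLm)
  rw [sub_add_sub_cancel] at h3
  have h4 : ν * |D'.tLm - D.tLm| ≤ 1 * |D'.tLm - D.tLm| :=
    mul_le_mul_of_nonneg_right (by linarith) (abs_nonneg _)
  linarith [hc.tLm]

theorem IsClose.norm_target_sub_le (hc : D.IsClose D' η) (hD : D.IsShortest) (h : D.IsTame r ν)
    (h' : D'.IsTame r ν) (hν : ν ≤ 1 / 8) : ‖D'.target - D.target‖ ≤ 2 * η :=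
  norm_prod_le_iff.2 ⟨hc.norm_seg₁_sub_le hD h h' hν,
    hc.xLB.le.trans (by linarith [(norm_nonneg _).trans_lt hc.xLB])⟩

/-- On bounded times the rescaled segments depend continuously, in `C¹`, on the boundary data. -/
theorem exists_hist_close (hD : D.IsShortest) (h : D.IsTame r ν) (hν : ν ≤ 1 / 8) (B : ℝ) {d : ℝ}
    (hd : 0 < d) : ∃ η > 0, ∀ D' : BoundaryData, D'.IsShortest → D'.IsTame r ν → D.IsClose D' η →
      ∀ S : ℝ × ℝ, ‖S - (D'.frame r).S‖ ≤ B →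
        ‖(D'.frame r).k.pos S - (D.frame r).k.pos S‖ ≤ d ∧
        ‖(D'.frame r).k.vel S - (D.frame r).k.vel S‖ ≤ d := by
  have hr := h.pos
  obtain ⟨i2, i1, -, -⟩ := h.bounds hν
  obtain ⟨η₂, hη₂, H₂⟩ := exists_c2Extend_close i2 hD.contDiff₂
    (isCompact_Icc (a := D.tOm - (r * B + 1)) (b := D.tOm + (r * B + 1))) hd
  obtain ⟨η₁, hη₁, H₁⟩ := exists_c2Extend_close i1 hD.contDiff₁
    (isCompact_Icc (a := D.tLm - (r * B + 1)) (b := D.tLm + (r * B + 1))) hd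
  refine ⟨min 1 (min η₂ η₁), by positivity, fun D' hD' h' hc S hS => ?_⟩
  obtain ⟨j2, j1, -, -⟩ := h'.bounds hν
  have c0 := hc.mono (min_le_left _ _)
  have c2 := hc.mono ((min_le_right _ _).trans (min_le_left _ _))
  have c1 := hc.mono ((min_le_right _ _).trans (min_le_right _ _))
  have mem : ∀ {s s₀ t t' : ℝ}, |s - s₀| ≤ B → r * s₀ = t' → |t' - t| < 1 →
      r * s ∈ Icc (t - (r * B + 1)) (t + (r * B + 1)) := by
    intro s s₀ t t' h1 h2 h3
    have h4 := abs_le.1 h1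
    have h5 := abs_le.1 h3.le
    have h6 := mul_le_mul_of_nonneg_left h4.1 hr.le
    have h7 := mul_le_mul_of_nonneg_left h4.2 hr.le
    rw [mul_sub, h2] at h6 h7
    constructor <;> linarith
  have e : ∀ x : ℝ, r * (r⁻¹ * x) = x := fun x => mul_inv_cancel_left₀ hr.ne' x
  have m2 := mem ((norm_fst_le _).trans hS) (e D'.tOm) c0.tOm
  have m1 := mem ((norm_snd_le _).trans hS) (e D'.tLm) c0.tLm
  have k2 := H₂ D'.seg₂ D'.tOm D'.tOp j2.le c2.tOm c2.tOp (fun t ht => by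
    have := c2Close_apply c2.seg₂ ht
    rw [deriv_deriv_hist₂ hD i2, deriv_hist₂ hD i2] at this
    exact ⟨this.1.le, this.2.1.le, this.2.2.le⟩) _ m2
  have k1 := H₁ D'.seg₁ D'.tLm D'.tLp j1.le c1.tLm c1.tLp (fun t ht => by
    have := c2Close_apply c1.seg₁ ht
    rw [deriv_deriv_hist₁ hD i1, deriv_hist₁ hD i1] at this
    exact ⟨this.1.le, this.2.1.le, this.2.2.le⟩) _ m1
  have hr1 : r⁻¹ ≤ 1 := inv_le_one_of_one_le₀ h.one_le_r
  have sc : ∀ {a b : E}, ‖a - b‖ ≤ d → ‖r⁻¹ • a - r⁻¹ • b‖ ≤ d := fun hab => by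
    rw [norm_inv_smul_sub hr]
    exact (mul_le_of_le_one_left (norm_nonneg _) hr1).trans hab
  refine ⟨norm_prod_le_iff.2 ⟨sc k2.1, sc k1.1⟩, norm_prod_le_iff.2 ⟨?_, ?_⟩⟩
  · change ‖deriv D'.hist₂ (r * S.1) - deriv D.hist₂ (r * S.1)‖ ≤ d
    rw [deriv_hist₂ hD i2, deriv_hist₂ hD' j2]
    exact k2.2
  · change ‖deriv D'.hist₁ (r * S.2) - deriv D.hist₁ (r * S.2)‖ ≤ d
    rw [deriv_hist₁ hD i1, deriv_hist₁ hD' j1]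
    exact k1.2

/-- The rescaled flow depends continuously on the boundary data and the initial velocities,
uniformly in the latter. -/
theorem exists_flow_close (G : Setting m₁ m₂ κ g₀ C μ ε) (hD : D.IsShortest) (h : D.IsTame r ν)
    (hg : r⁻¹ ≤ ν) (hνμ : ν ≤ μ) (hη : 0 < η) : ∃ η' > 0, ∀ D' : BoundaryData, D'.IsShortest →
      D'.IsTame r ν → D.IsClose D' η' → ∀ V V' : E × E, ‖V‖ ≤ μ → ‖V'‖ ≤ μ → ‖V' - V‖ < η' →
      ∀ Z Z' : ℝ → State, (D.frame r).Solves m₁ m₂ V Z → (D'.frame r).Solves m₁ m₂ V' Z' →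
        ∀ u ∈ Icc (0 : ℝ) 1, ‖Z' u - Z u‖ ≤ η := by
  have hr := h.pos
  have hν : ν ≤ 1 / 8 := by linarith [G.small_μ, G.ε_le, G.μ_pos]
  have hs := stabConst_pos G.one_le
  set d := η / stabConst C with hd
  have hd0 : 0 < d := by positivity
  obtain ⟨η₁, hη₁, H⟩ := exists_hist_close hD h hν (4 * C) hd0
  refine ⟨min (d / 2) η₁, by positivity, fun D' hD' h' hc V V' hV hV' hVV Z Z' hZ hZ' u hu => ?_⟩
  have hf := (isGood_frame hD h hν hg).mono hνμ
  have hf' := (isGood_frame hD' h' hν hg).mono hνμ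
  have c1 := hc.mono (min_le_left _ _)
  have c2 := hc.mono (min_le_right _ _)
  have hT0 : 0 ≤ (D.frame r).T := by linarith [hf.one_le_T]
  have hT0' : 0 ≤ (D'.frame r).T := by linarith [hf'.one_le_T]
  have hn := G.near_of_solves hf hV hZ
  have hn' := G.near_of_solves hf' hV' hZ'
  have hr1 : r⁻¹ ≤ 1 := inv_le_one_of_one_le₀ h.one_le_r
  have sc : ∀ {a b : E}, ‖a - b‖ ≤ d → ‖r⁻¹ • a - r⁻¹ • b‖ ≤ d := fun hab => by
    rw [norm_inv_smul_sub hr]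
    exact (mul_le_of_le_one_left (norm_nonneg _) hr1).trans hab
  have sc' : ∀ {a b : ℝ}, |a - b| ≤ d → |r⁻¹ * a - r⁻¹ * b| ≤ d := fun {a b} hab => by
    rw [← mul_sub, abs_mul, abs_of_pos (inv_pos.2 hr)]
    exact (mul_le_of_le_one_left (abs_nonneg _) hr1).trans hab
  have hT : |(D'.frame r).T - (D.frame r).T| ≤ d := by
    refine sc' (a := D'.span) (b := D.span) ?_
    have h1 := abs_le.1 c1.tLm.le
    have h2 := abs_le.1 c1.tOA.le
    rw [span, span, abs_le]
    constructor <;> linarith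
  have h0 : ‖Z' 0 - Z 0‖ ≤ d := by
    rw [hZ.1, hZ'.1]
    refine norm_state_le.2 ⟨norm_prod_le_iff.2 ⟨?_, ?_⟩, ?_, norm_prod_le_iff.2 ⟨?_, ?_⟩⟩
    · exact sc (c1.xOA.le.trans (by linarith))
    · exact sc ((c1.norm_seg₂_sub_le hD h h' hν).trans (by linarith))
    · exact hVV.le.trans ((min_le_left _ _).trans (by linarith))
    · exact sc' (c1.tOm.le.trans (by linarith))
    · exact sc' (c1.tLm.le.trans (by linarith))
  have key := flow_stability (d := d) G.coeffBound hf.g_nonneg (G.g_le_one hf) hT0 hf.T_le hT0'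
    hf'.T_le zero_le_one le_rfl (G.bounded_one hf) (G.bounded_one hf') hZ.2 hZ'.2
    (fun u hu => G.mem_tube hf (hn u hu)) (fun u hu => G.mem_tube hf' (hn' u hu))
    (fun u hu => (H D' hD' h' c2 _ (hn' u hu).S).1)
    (fun u hu => (H D' hD' h' c2 _ (hn' u hu).S).2) hT h0 u hu
  refine key.1.trans (le_of_eq ?_)
  rw [hd]
  field_simp

/-- Trial trajectories depend continuously on the boundary data and on the initial velocities,
uniformly in the latter. -/
theorem exists_trajClose (G : Setting m₁ m₂ κ g₀ C μ ε) (hD : D.IsShortest) (h : D.IsTame r ν)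
    (hg : r⁻¹ ≤ ν) (hνμ : ν ≤ μ) (hη : 0 < η) : ∃ η' > 0, ∀ D' : BoundaryData, D'.IsShortest →
      D'.IsTame r ν → D.IsClose D' η' → ∀ V V' : E × E, ‖V‖ ≤ μ → ‖V'‖ ≤ μ → ‖V' - V‖ < η' →
      ∀ y y' : Trajectory, D.IsTrial m₁ m₂ V y → D'.IsTrial m₁ m₂ V' y' →
        D.TrajClose D' y y' η := by
  have hr := h.pos
  have hν : ν ≤ 1 / 8 := by linarith [G.small_μ, G.ε_le, G.μ_pos]
  obtain ⟨η', hη', H⟩ := exists_flow_close G hD h hg hνμ (show 0 < η / (2 * r) by positivity)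
  refine ⟨η', hη', fun D' hD' h' hc V V' hV hV' hVV y y' hy hy' u hu => ?_⟩
  obtain ⟨Z, hZ, e⟩ := hy.exists_state hD h hν
  obtain ⟨Z', hZ', e'⟩ := hy'.exists_state hD' h' hν
  obtain ⟨k1, k2, -⟩ := norm_state_le.1 (H D' hD' h' hc V V' hV hV' hVV Z Z' hZ hZ' u hu)
  have k1 : ‖(Z' u).1 - (Z u).1‖ ≤ η / (2 * r) := k1
  have k2 : ‖(Z' u).2.1 - (Z u).2.1‖ ≤ η / (2 * r) := k2
  rw [(e u).1, (e u).2, (e' u).1, (e' u).2]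
  constructor
  · rw [← smul_sub, norm_smul, Real.norm_eq_abs, abs_of_pos hr]
    calc r * ‖(Z' u).1 - (Z u).1‖ ≤ r * (η / (2 * r)) := mul_le_mul_of_nonneg_left k1 hr.le
      _ = η / 2 := by field_simp
      _ < η := by linarith
  · refine k2.trans_lt ?_
    rw [div_lt_iff₀ (by positivity)]
    nlinarith [h.one_le_r]

/-- Solutions of the boundary problem depend continuously on the boundary data: nearby data make
the final positions, hence the initial velocities, close. -/
theorem exists_trajClose_of_isSolution (G : Setting m₁ m₂ κ g₀ C μ ε) (hD : D.IsShortest)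
    (h : D.IsTame r ν) (hg : r⁻¹ ≤ ν) (hνμ : ν ≤ μ) (hη : 0 < η) : ∃ η' > 0,
      ∀ D' : BoundaryData, D'.IsShortest → D'.IsTame r ν → D.IsClose D' η' → ∀ y y' : Trajectory,
        D.IsSolution m₁ m₂ y → ‖y.vel D.tOA‖ ≤ μ → D'.IsSolution m₁ m₂ y' →
        ‖y'.vel D'.tOA‖ ≤ μ → D.TrajClose D' y y' η := by
  have hr := h.pos
  have hν : ν ≤ 1 / 8 := by linarith [G.small_μ, G.ε_le, G.μ_pos]
  have hr1 : r⁻¹ ≤ 1 := inv_le_one_of_one_le₀ h.one_le_r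
  obtain ⟨η₁, hη₁, H₁⟩ := exists_trajClose G hD h hg hνμ hη
  obtain ⟨η₂, hη₂, H₂⟩ := exists_flow_close G hD h hg hνμ (show 0 < η₁ / 8 by positivity)
  refine ⟨min η₁ (min η₂ (η₁ / 16)), by positivity,
    fun D' hD' h' hc y y' hy hV hy' hV' => ?_⟩
  have c1 := hc.mono (min_le_left _ _)
  have c2 := hc.mono ((min_le_right _ _).trans (min_le_left _ _))
  have c3 := hc.mono ((min_le_right _ _).trans (min_le_right _ _))
  have hf' := (isGood_frame hD' h' hν hg).mono hνμ
  obtain ⟨Z, hZ, e⟩ := hy.isTrial.exists_state hD h hν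
  obtain ⟨Z', hZ', e'⟩ := hy'.isTrial.exists_state hD' h' hν
  refine H₁ D' hD' h' c1 _ _ hV hV' ?_ y y' hy.isTrial hy'.isTrial
  set V := y.vel D.tOA
  set V' := y'.vel D'.tOA
  have hW := G.solves_flow hf' hV
  have hclose := (norm_state_le.1 (H₂ D' hD' h' c2 V V hV hV (by simpa using hη₂) Z _ hZ hW 1
    (right_mem_Icc.2 zero_le_one))).1
  have hclose : ‖((D'.frame r).flow m₁ m₂ V 1).1 - (Z 1).1‖ ≤ η₁ / 8 := hclose
  have hend : r⁻¹ • D.target = (Z 1).1 := by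
    rw [← hy.2.2, ← time_one (D := D), (e 1).1, inv_smul_smul₀ hr.ne']
  have hend' : r⁻¹ • D'.target = (Z' 1).1 := by
    rw [← hy'.2.2, ← time_one (D := D'), (e' 1).1, inv_smul_smul₀ hr.ne']
  have htar : ‖(Z' 1).1 - (Z 1).1‖ ≤ η₁ / 8 := by
    rw [← hend, ← hend', ← smul_sub, norm_smul, norm_inv, Real.norm_eq_abs, abs_of_pos hr]
    have := c3.norm_target_sub_le hD h h' hν
    exact (mul_le_of_le_one_left (norm_nonneg _) hr1).trans (by linarith)
  -- both trial trajectories of `D'` end near its target, and the end determines the velocity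
  have h1 := G.approx hf' hV hV' hW hZ'
  have h2 := norm_sub_le ((Z' 1).1 - ((D'.frame r).flow m₁ m₂ V 1).1)
    ((Z' 1).1 - ((D'.frame r).flow m₁ m₂ V 1).1 - (D'.frame r).T • (V' - V))
  have hT0 : 0 ≤ (D'.frame r).T := by linarith [hf'.one_le_T]
  rw [sub_sub_cancel, norm_smul, Real.norm_eq_abs, abs_of_nonneg hT0] at h2
  have h3 := norm_sub_le ((Z' 1).1 - (Z 1).1) (((D'.frame r).flow m₁ m₂ V 1).1 - (Z 1).1)
  rw [sub_sub_sub_cancel_right] at h3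
  have h4 : ε * (D'.frame r).T * ‖V' - V‖ ≤ 1 / 8 * ((D'.frame r).T * ‖V' - V‖) := by
    rw [mul_assoc]
    exact mul_le_mul_of_nonneg_right G.ε_le (by positivity)
  have h5 : ‖V' - V‖ ≤ (D'.frame r).T * ‖V' - V‖ :=
    le_mul_of_one_le_left (norm_nonneg _) hf'.one_le_T
  linarith

end BoundaryData

end WF

end

theorem theorem1 (m₁ m₂ : ℝ) (hm₁ : 0 < m₁) (hm₂ : 0 < m₂)
    (ε : ℝ) (hε₀ : 0 < ε) (hε₁ : ε < 1) (c : ℝ) (hc₀ : 0 < c) (hc₁ : c < 1 / 2) :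
    ∃ R > 0, ∃ ρ > 0, ∀ S : WF.SchildOrbit m₁ m₂, R ≤ S.r₁₂ → ∃ δ > 0,
      -- well-posedness for each set of data
      (∀ D : WF.BoundaryData, D.IsShortest → D.IsNear S δ →
        ∃ y : WF.Trajectory,
          -- a solution, unique among those with speeds at most `c`
          (D.IsSolution m₁ m₂ y ∧ y.SpeedLE c D.interval ∧
            ∀ y' : WF.Trajectory, D.IsSolution m₁ m₂ y' → y'.SpeedLE c D.interval →
              y'.AgreeOn y D.interval) ∧
          y.vel D.tOA ∈ ball (D.circularVel S) ρ ∧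
          -- the trial trajectories `Φ V` and the Jacobian `J` of the shooting method
          ∃ (Φ : WF.E × WF.E → WF.Trajectory)
            (J : WF.E × WF.E → ((WF.E × WF.E) ≃L[ℝ] (WF.E × WF.E))),
            (∀ V ∈ ball (D.circularVel S) ρ,
              D.IsTrial m₁ m₂ V (Φ V) ∧
              (∀ y' : WF.Trajectory, D.IsTrial m₁ m₂ V y' → y'.AgreeOn (Φ V) D.interval) ∧
              HasFDerivAt (fun U => (Φ U).pos D.tLm)
                (J V : (WF.E × WF.E) →L[ℝ] (WF.E × WF.E)) V ∧
              ‖(J V : (WF.E × WF.E) →L[ℝ] (WF.E × WF.E)) -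
                D.span • ContinuousLinearMap.id ℝ (WF.E × WF.E)‖ ≤ ε * D.span ∧
              ‖(J V : (WF.E × WF.E) →L[ℝ] (WF.E × WF.E))‖ *
                ‖((J V).symm : (WF.E × WF.E) →L[ℝ] (WF.E × WF.E))‖ ≤ (1 + ε) / (1 - ε)) ∧
            -- the shooting iteration, started at the circular velocities, finds the solution
            ∀ V : ℕ → WF.E × WF.E, V 0 = D.circularVel S →
              (∀ k, V (k + 1) = V k + (J (V k)).symm (D.target - (Φ (V k)).pos D.tLm)) →
              (∀ k, V k ∈ ball (D.circularVel S) ρ) ∧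
                Tendsto V atTop (𝓝 (y.vel D.tOA))) ∧
      -- continuous dependence of the solution on the boundary data
      (∀ D : WF.BoundaryData, D.IsShortest → D.IsNear S δ → ∀ η > 0, ∃ η' > 0,
        ∀ D' : WF.BoundaryData, D'.IsShortest → D'.IsNear S δ → D.IsClose D' η' →
        ∀ y y' : WF.Trajectory, D.IsSolution m₁ m₂ y → y.SpeedLE c D.interval →
          D'.IsSolution m₁ m₂ y' → y'.SpeedLE c D'.interval → D.TrajClose D' y y' η) ∧
      -- continuous dependence of the trial trajectories on the data and the initial velocities
      (∀ D : WF.BoundaryData, D.IsShortest → D.IsNear S δ →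
        ∀ V ∈ ball (D.circularVel S) ρ, ∀ η > 0, ∃ η' > 0,
        ∀ D' : WF.BoundaryData, D'.IsShortest → D'.IsNear S δ → D.IsClose D' η' →
        ∀ V' ∈ ball (D'.circularVel S) ρ, ‖V' - V‖ < η' →
        ∀ y y' : WF.Trajectory, D.IsTrial m₁ m₂ V y → D'.IsTrial m₁ m₂ V' y' →
          D.TrajClose D' y y' η) := by
  set κ : ℝ := (1 - 2 * c) / 2 with hκ
  have hκ₀ : 0 < κ := by rw [hκ]; linarith
  have hκ₁ : κ ≤ 1 / 2 := by rw [hκ]; linarith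
  have hκc : 2 * κ = 1 - 2 * c := by rw [hκ]; ring
  obtain ⟨ε', hε'⟩ : ∃ ε', ε' = min ε (min c (1 / 8)) := ⟨_, rfl⟩
  have hε'₀ : 0 < ε' := by rw [hε']; positivity
  have hε'ε : ε' ≤ ε := hε' ▸ min_le_left _ _
  have hε'c : ε' ≤ c := hε' ▸ (min_le_right _ _).trans (min_le_left _ _)
  have hε'8 : ε' ≤ 1 / 8 := hε' ▸ (min_le_right _ _).trans (min_le_right _ _)
  obtain ⟨g₀, C, μ, G⟩ := WF.Setting.exists hm₁ hm₂ hκ₀ hκ₁ hε'₀ hε'8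
  have hμ := G.μ_pos
  have hC := G.one_le
  have hC2 : 1 ≤ C ^ 2 := one_le_pow₀ hC
  obtain ⟨ρ, hρ⟩ : ∃ ρ, 2 * ρ = μ := ⟨μ / 2, by ring⟩
  subst hρ
  have hρ : 0 < ρ := by linarith
  -- `ν` bounds the speeds and the rescaled accelerations on the boundary segments
  obtain ⟨ν, hν₀, hνρ, hνκ⟩ : ∃ ν > 0, 600 * (C ^ 2 * ν) ≤ ρ ∧ 6 * ν ≤ κ := by
    refine ⟨min (ρ / (600 * C ^ 2)) (κ / 6), by positivity, ?_, ?_⟩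
    · have h := mul_le_mul_of_nonneg_left (min_le_left (ρ / (600 * C ^ 2)) (κ / 6))
        (show 0 ≤ 600 * C ^ 2 by positivity)
      rw [mul_div_cancel₀ _ (by positivity)] at h
      linarith
    · linarith [min_le_right (ρ / (600 * C ^ 2)) (κ / 6)]
  have hCν : ν ≤ C ^ 2 * ν := le_mul_of_one_le_left hν₀.le hC2
  have hν8 : ν ≤ 1 / 8 := by linarith
  have hνμ : ν ≤ 2 * ρ := by linarith
  have G' := G.mono hν₀ hνμ
  obtain ⟨R, hR, hslow⟩ := WF.SchildOrbit.exists_isSlow hm₁ hm₂ (show 0 < ν / 8 by positivity)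
  refine ⟨max R (max 1 ν⁻¹), lt_max_of_lt_left hR, ρ, hρ, fun S hS => ?_⟩
  have hSR := (le_max_left _ _).trans hS
  have hS1 : 1 ≤ S.r₁₂ := (le_max_left _ _).trans ((le_max_right _ _).trans hS)
  have hSν : ν⁻¹ ≤ S.r₁₂ := (le_max_right _ _).trans ((le_max_right _ _).trans hS)
  have hg : S.r₁₂⁻¹ ≤ ν := inv_le_of_inv_le₀ hν₀ hSν
  have hsl := hslow S hSR
  obtain ⟨δ, hδ, htame⟩ := WF.SchildOrbit.exists_isTame hsl (by positivity)
    (show ν / 8 ≤ 1 / 8 by linarith) hS1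
  rw [mul_div_cancel₀ ν (by norm_num)] at htame
  have hV₀ : ∀ D : WF.BoundaryData, ‖D.circularVel S‖ ≤ ν := fun D =>
    (WF.SchildOrbit.norm_circularVel_le hsl D).trans (by linarith)
  have hball : ∀ (D : WF.BoundaryData) (V), V ∈ ball (D.circularVel S) ρ → ‖V‖ ≤ 2 * ρ := by
    intro D V hV
    rw [mem_ball, dist_eq_norm] at hV
    have h1 := norm_add_le (V - D.circularVel S) (D.circularVel S)
    rw [sub_add_cancel] at h1
    linarith [hV₀ D]
  have hsol : ∀ D : WF.BoundaryData, D.IsShortest → D.IsNear S δ → ∀ y, D.IsSolution m₁ m₂ y →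
      y.SpeedLE c D.interval → ‖y.vel D.tOA‖ ≤ 2 * ρ := fun D hD hn y hy hyc =>
    (hy.norm_vel_le G' hD (htame D hD hn) hg hνκ hc₀.le hκc hyc).trans (by linarith)
  refine ⟨δ, hδ, fun D hD hn => ?_, fun D hD hn η hη => ?_, fun D hD hn V hV η hη => ?_⟩
  · obtain ⟨y, hy, hyb, Φ, J, hJ, hN⟩ := (htame D hD hn).wellPosed G hD hν₀ hg hε'₀ hνρ hνκ hc₀.le
      hκc hε'c (hV₀ D)
    refine ⟨y, hy, hyb, Φ, J, fun V hV => ?_, hN⟩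
    obtain ⟨h1, h2, h3, h4, h5⟩ := hJ V hV
    have hs : 0 ≤ D.span := by
      linarith [((htame D hD hn).bounds hν8).2.2.1, (htame D hD hn).pos]
    refine ⟨h1, h2, h3, h4.trans (mul_le_mul_of_nonneg_right hε'ε hs), h5.trans ?_⟩
    exact div_le_div₀ (by linarith) (by linarith) (by linarith) (by linarith)
  · obtain ⟨η', hη', H⟩ := WF.BoundaryData.exists_trajClose_of_isSolution G hD (htame D hD hn) hg
      hνμ hη
    exact ⟨η', hη', fun D' hD' hn' hc y y' hy hyc hy' hyc' => H D' hD' (htame D' hD' hn') hc y y' hy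
      (hsol D hD hn y hy hyc) hy' (hsol D' hD' hn' y' hy' hyc')⟩
  · obtain ⟨η', hη', H⟩ := WF.BoundaryData.exists_trajClose G hD (htame D hD hn) hg hνμ hη
    exact ⟨η', hη', fun D' hD' hn' hc V' hV' hVV y y' hy hy' => H D' hD' (htame D' hD' hn') hc V V'
      (hball D V hV) (hball D' V' hV') hVV y y' hy hy'⟩
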